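/- **Notation.** Let $d\ge 1$. For a multi-index $k\in\mathbb N_0^d$ write $|k|=\sum_i k_i$, $k!=\prod_i k_i!$, $z^k=\prod_i z_i^{k_i}$, $\mathbb X^k_x(z)=(z-x)^k/k!$, and for $t\in\mathbb R$ let $\mathrm{poly}(t)=\{k\in\mathbb N_0^d: |k|<t\}$. For $\varphi\in C_c^\infty(\mathbb R^d)$ and $\lambda>0$ put $\varphi_x^\lambda(z)=\lambda^{-d}\varphi(\lambda^{-1}(z-x))$. For $r\in\mathbb N_0$, $\mathscr B^r$ is the set of $\varphi\in C_c^\infty(\mathbb R^d)$ supported in the closed unit ball with $|\partial^k\varphi|\le1$ for $|k|\le r$. A distribution has order $r$ if it extends to a continuous linear functional on the compactly supported $C^r$ functions; we use the same symbol for this (unique) extension. $K,K'$ denote compact subsets of $\mathbb R^d$. **Germs.** A *germ* is a family $F=(F_x)_{x\in\mathbb R^d}$ of distributions with $x\mapsto F_x(\varphi)$ measurable for every test function $\varphi$. A family $F$ is *$a$-homogeneous of order $r$* if for all $K$ and $\bar\lambda\ge1$, $|F_x(\varphi_x^\lambda)|\lesssim\lambda^{a}$ uniformly over $x\in K$, $\lambda\in(0,\bar\lambda]$,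 $\varphi\in\mathscr B^{r}$; *$(a,\gamma)$-coherent of order $r$* if for all $K$ and $\bar\lambda\ge1$, $|(F_y-F_x)(\varphi_x^\lambda)|\lesssim\lambda^{a}(|y-x|+\lambda)^{\gamma-a}$ uniformly over $x,y\in K$, $\lambda\in(0,\bar\lambda]$, $\varphi\in\mathscr B^{r}$. A distribution $R$ is a *$\gamma$-reconstruction* of $F$, relative to the lower coherence exponent $a$, if for all integers $r\ge0$ with $r>-a$ and all $K$, $|(F_x-R)(\varphi_x^\lambda)|\lesssim\lambda^{\gamma}$ uniformly over $x\in K$, $\lambda\in(0,1]$, $\varphi\in\mathscr B^{r}$. Put $$\|F\|_{\mathcal G^{a}_{\hom};K,\bar\lambda,r}=\sup_{x\in K,\ \lambda\in(0,\bar\lambda],\ \varphi\in\mathscr B^{r}}\frac{|F_x(\varphi_x^\lambda)|}{\lambda^{a}}\in[0,\infty].$$ **Models.** Let $J$ be a finite index set and $a=(a_i)_{i\in J}\subset\mathbb R$. A *model* with homogeneities $a$ and order $r_\Pi\in\mathbb N_0$ is a pair $(\Pi,\Gamma)$, where $\Pi=(\Pi^i)_{i\in J}$ are germs, $\Pi^i$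 is $a_i$-homogeneous of order $r_\Pi$, and $\Gamma_{xy}^{ji}\in\mathbb R$ satisfy $\Pi^i_y=\sum_j\Pi^j_x\Gamma^{ji}_{xy}$ for all $x,y\in\mathbb R^d$. Put $\|\Pi\|_{K,\bar\lambda}=\sup_i\|\Pi^i\|_{\mathcal G^{a_i}_{\hom};K,\bar\lambda,r_\Pi}$. A *$\gamma$-modelled distribution* is a measurable $f=(f^i)_{i\in J}:\mathbb R^d\to\mathbb R^J$, where $a_i<\gamma$ for all $i$, such that for every $K$, uniformly over $x,y\in K$ and $i\in J$, $|f^i(x)|\lesssim1$ and $|\sum_j\Gamma^{ij}_{xy}f^j(y)-f^i(x)|\lesssim|y-x|^{\gamma-a_i}$. Put $$\vvvert f\vvvert_{\gamma,K}=\sup_{x\in K,\,i}|f^i(x)|+\sup_{x,y\in K,\,i}\frac{|\sum_j\Gamma^{ij}_{xy}f^j(y)-f^i(x)|}{|y-x|^{\gamma-a_i}}$$ ($0/0=0$, $c/0=\infty$ for $c>0$), and $\langle f,\Pi\rangle_x=\sum_if^i(x)\Pi^i_x$. **Kernels.** Let $\beta>0$, $\rho>0$, $m,r\in\mathbb N_0$.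 A *$\beta$-regularising kernel of order $(m,r)$ with range $\rho$* is a function $\mathsf K:\mathbb R^d\times\mathbb R^d\to\mathbb R$ with functions $\mathsf K_n$, $n\in\mathbb N_0$, such that $\mathsf K=\sum_n\mathsf K_n$ almost everywhere; each $\mathsf K_n$ is of class $C^{m,r}$ (the derivatives $\partial_1^k\partial_2^l\mathsf K_n$, $|k|\le m$, $|l|\le r$, exist and are continuous); $\mathsf K_n(x,y)=0$ if $|x-y|>\rho2^{-n}$; and for every $K$ there is $c>0$ with, for all $n$, $|\partial_1^k\partial_2^l\mathsf K_n(x,y)|\le c\,2^{(d-\beta+|l|+|k|)n}$ for $|k|\le m$, $|l|\le r$, $x,y\in K$, and $|\int(y-x)^l\,\partial_2^k\mathsf K_n(x,y)\,dx|\le c\,2^{-\beta n}$ for $|k|,|l|\le r$, $y\in K$. For a distribution $g$ of order $r$, $\mathsf Kg$ is the distribution $\mathsf Kg(\psi)=\sum_n g(\mathsf K_n^*\psi)$, where $\mathsf K_n^*\psi(y)=\int\psi(x)\mathsf K_n(x,y)\,dx$; it is *well defined* if $g$ has order $r$, every $\mathsf K_n^*\psi$ is compactly supported of class $C^r$, and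 these series converge absolutely and define a distribution. **Pointwise derivatives.** For $\delta\in\mathbb R$ and $|k|<\delta$, the pointwise derivative $D^kg(x)$ at level $\delta$ is the limit of $\partial^kg(\eta_x^\lambda)$ as $\lambda\downarrow0$, if it exists and is the same for all $\eta\in C_c^\infty(\mathbb R^d)$ with $\int\eta=1$ and $\int\eta(z)z^l\,dz=0$ for $1\le|l|<\delta$. **Setting.** Let $I$ be a finite non-empty set, $\alpha=(\alpha_i)_{i\in I}\subset\mathbb R$, $\gamma>\max_i\alpha_i$ and $r_\Pi\in\mathbb N_0$; let $\mathsf K$ be a $\beta$-regularising kernel of order $(m,r)$ with range $\rho$, and suppose $$\gamma+\beta\notin\mathbb N_0,\qquad m>\gamma+\beta,\qquad r\ge r_\Pi .$$ A model $(\Pi,\Gamma)$ with homogeneities $\alpha$ and order $r_\Pi$ is *compatible* with $\mathsf K$ if for all $i\in I$ and all $k$ with $|k|=\alpha_i+\beta$ the family $(\partial^k(\mathsf K\Pi^i_x))_{x}$ is $0$-homogeneous of some order. Put $[\mathsf K\Pi]_{K,\bar\lambda}=\sum_{i\in I}\sum_{|k|=\alpha_i+\beta}\|\partial^k(\mathsf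 K\Pi^i)\|_{\mathcal G^0_{\hom};K,\bar\lambda,r_\Pi}$. Given such a model, write $D^k\mathsf K\Pi^i_x(x)$, $|k|<\alpha_i+\beta$, for the pointwise derivative at level $\alpha_i+\beta$. Define $\hat I=I\sqcup\mathrm{poly}(\gamma+\beta)$ and $$\hat\alpha_i=\alpha_i+\beta\ (i\in I),\quad \hat\alpha_k=|k|\ (k\in\mathrm{poly}(\gamma+\beta)),\qquad \underline{\hat\alpha}=\min_{a\in\hat I}\hat\alpha_a,\quad\underline\alpha=\min_{i\in I}\alpha_i,$$ $$\hat\Pi^i_x=\mathsf K\Pi^i_x-\sum_{|k|<\alpha_i+\beta}D^k\mathsf K\Pi^i_x(x)\,\mathbb X^k_x\quad(i\in I),\qquad \hat\Pi^k_x=\mathbb X^k_x\quad(k\in\mathrm{poly}(\gamma+\beta)),$$ and, for $i,j\in I$ and $k,l\in\mathrm{poly}(\gamma+\beta)$, $$\hat\Gamma^{ji}_{xy}=\Gamma^{ji}_{xy},\qquad \hat\Gamma^{jk}_{xy}=0,\qquad \hat\Gamma^{lk}_{xy}=\Gamma^{\mathrm{pol},lk}_{xy}:=\mathbf 1_{l\le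 k}\frac{(x-y)^{k-l}}{(k-l)!},$$ $$\hat\Gamma^{li}_{xy}=\sum_{j\in I:\ \alpha_j+\beta>|l|}D^l\mathsf K\Pi^j_x(x)\,\Gamma^{ji}_{xy}-\sum_{|k|<\alpha_i+\beta}\Gamma^{\mathrm{pol},lk}_{xy}\,D^k\mathsf K\Pi^i_y(y).$$ Given also a $\gamma$-modelled distribution $f$ and a $\gamma$-reconstruction $R=\mathcal R\langle f,\Pi\rangle$ of $\langle f,\Pi\rangle$ (relative to the exponent $\underline\alpha$), define $\hat f^i(x)=f^i(x)$ for $i\in I$ and, for $k\in\mathrm{poly}(\gamma+\beta)$, $$\hat f^k(x)=\sum_{i\in I:\ \alpha_i+\beta>|k|}f^i(x)\,D^k\mathsf K\Pi^i_x(x)-D^k\big(\mathsf K(\langle f,\Pi\rangle_x-R)\big)(x),$$ and put $$\big(\mathcal K\langle f,\Pi\rangle\big)_x=\mathsf K\langle f,\Pi\rangle_x-\sum_{|k|<\gamma+\beta}D^k\big(\mathsf K(\langle f,\Pi\rangle_x-R)\big)(x)\,\mathbb X^k_x,$$ with the last two pointwise derivatives taken at level $\gamma+\beta$. **Theorem 4.7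 (multilevel Schauder estimates).** In this setting the following hold. 1. For every model $(\Pi,\Gamma)$ compatible with $\mathsf K$, all $\mathsf K\Pi^i_x$ and all $D^k\mathsf K\Pi^i_x(x)$, $|k|<\alpha_i+\beta$, are well defined, and $(\hat\Pi,\hat\Gamma)$ is a model, indexed by $\hat I$, with homogeneities $\hat\alpha$ and order $r_\Pi$. 2. Let $(\Pi,\Gamma)$ be a compatible model, $f$ a $\gamma$-modelled distribution and $R$ a $\gamma$-reconstruction of $\langle f,\Pi\rangle$; if $\gamma\le0$, assume moreover $r>-\underline\alpha$. Then $\mathsf KR$, $\mathsf K\langle f,\Pi\rangle_x$, $\mathsf K(\langle f,\Pi\rangle_x-R)$ and $D^k(\mathsf K(\langle f,\Pi\rangle_x-R))(x)$, $|k|<\gamma+\beta$, are well defined; $\hat f$ is a $(\gamma+\beta)$-modelled distribution with respect to $(\hat\Pi,\hat\Gamma)$; $\langle\hat f,\hat\Pi\rangle$ is a germ, $\underline{\hat\alpha}$-homogeneous and $(\underline{\hat\alpha},\gamma+\beta)$-coherent of order $r_\Pi$; one has $$\langle\hat f,\hat\Pi\rangle=\mathcal K\langle f,\Pi\rangle ;$$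 and $\mathsf KR=\mathsf K\mathcal R\langle f,\Pi\rangle$ is a $(\gamma+\beta)$-reconstruction of $\langle\hat f,\hat\Pi\rangle$ (relative to the exponent $\underline{\hat\alpha}$), the only one if $\gamma+\beta>0$. 3. For all $K$ and $\bar\lambda\ge1$ there are $K'\supseteq K$, $\bar\lambda'\ge1$ and $C<\infty$ such that, for all compatible models, $$\|\hat\Pi\|_{K,\bar\lambda}\le C\big(1+\|\Pi\|_{K',\bar\lambda'}+[\mathsf K\Pi]_{K',\bar\lambda'}\big).$$ 4. For all $K$ there are $K'\supseteq K$, $\bar\lambda'\ge1$ and $C<\infty$ such that, for all $(\Pi,\Gamma)$, $f$, $R$ as in 2, $$\vvvert\hat f\vvvert_{\gamma+\beta,K}\le C\Big(\big(1+\|\Pi\|_{K',\bar\lambda'}+[\mathsf K\Pi]_{K',\bar\lambda'}\big)\vvvert f\vvvert_{\gamma,K'}+\|\langle f,\Pi\rangle-R\|_{\mathcal G^{\gamma}_{\hom};K',\bar\lambda',r}\Big).$$ 5. If $\gamma>0$ (so that $R$ is unique), the bound in 4 holds, for suitable $K'$, $\bar\lambda'$, $C$, without its last term. In 3, 4 and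 5, $K'$, $\bar\lambda'$ and $C$ do not depend on the model, on $f$ or on $R$. -/

import Mathlib

open MeasureTheory Set Filter TopologicalSpace
open scoped Distributions Topology ENNReal NNReal LineDeriv

noncomputable section

namespace Schauder

/-! ### Test functions and distributions on `ℝ^d` -/

abbrev Euc (d : ℕ) : Type := EuclideanSpace ℝ (Fin d)

/-- Smooth compactly supported real functions on `ℝ^d`. -/
abbrev Test (d : ℕ) : Type := 𝓓((⊤ : Opens (Euc d)), ℝ)

/-- Compactly supported real functions of class `C^r` on `ℝ^d`. -/
abbrev TestC (d r : ℕ) : Type := 𝓓^{(r : ℕ∞)}((⊤ : Opens (Euc d)), ℝ)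

/-- Distributions on `ℝ^d`. -/
abbrev Distr (d : ℕ) : Type := 𝓓'((⊤ : Opens (Euc d)), ℝ)

/-- Continuous linear functionals on compactly supported functions of class `C^r`. -/
abbrev DistrC (d r : ℕ) : Type := 𝓓'^{(r : ℕ∞)}((⊤ : Opens (Euc d)), ℝ)

/-- The standard basis vector `e_i`. -/
def basisVec {d : ℕ} (i : Fin d) : Euc d := EuclideanSpace.single i 1

/-! ### Multi-indices -/

/-- `|k| = k_1 + ... + k_d`. -/
def deg {d : ℕ} (k : Fin d → ℕ) : ℕ := ∑ i, k i

/-- `k! = k_1! ... k_d!`. -/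
def mfact {d : ℕ} (k : Fin d → ℕ) : ℕ := ∏ i, (k i).factorial

/-- `z^k = z_1^{k_1} ... z_d^{k_d}`. -/
def mpow {d : ℕ} (z : Euc d) (k : Fin d → ℕ) : ℝ := ∏ i, z i ^ k i

/-- The multi-indices `k` with `|k| < t`. -/
def poly (d : ℕ) (t : ℝ) : Finset (Fin d → ℕ) :=
  (Fintype.piFinset fun _ : Fin d => Finset.range ⌈t⌉₊).filter fun k => (deg k : ℝ) < t

theorem mem_poly {d : ℕ} {t : ℝ} {k : Fin d → ℕ} : k ∈ poly d t ↔ (deg k : ℝ) < t := by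
  simp only [poly, Finset.mem_filter, Fintype.mem_piFinset, Finset.mem_range,
    and_iff_right_iff_imp]
  intro h i
  refine Nat.lt_ceil.2 (lt_of_le_of_lt ?_ h)
  exact_mod_cast Finset.single_le_sum (f := k) (fun _ _ => Nat.zero_le _) (Finset.mem_univ i)

/-- `∂^k` on test functions and (in the sense of duality) on distributions. -/
def multiDeriv {d : ℕ} {V : Type} [LineDeriv (Euc d) V V] (k : Fin d → ℕ) (f : V) : V :=
  (List.finRange d).foldr (fun i g => (fun h : V => ∂_{basisVec i} h)^[k i] g) f

/-- `∂^k` on functions `ℝ^d → ℝ`. -/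
def partialDeriv {d : ℕ} (k : Fin d → ℕ) (f : Euc d → ℝ) : Euc d → ℝ :=
  (List.finRange d).foldr
    (fun i g => (fun (h : Euc d → ℝ) x => lineDeriv ℝ h x (basisVec i))^[k i] g) f

/-! ### Scaled test functions, classes of test functions -/

/-- The scaled and centred test function `z ↦ s^{-d} φ (s^{-1} (z - x))`, for `s > 0`. -/
def rescale {d : ℕ} (φ : Test d) (x : Euc d) (s : ℝ) : Test d :=
  if hs : 0 < s then
    { toFun := fun z => (s ^ d)⁻¹ * φ (s⁻¹ • (z - x))
      contDiff' := contDiff_const.mul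
        (φ.contDiff.comp ((contDiff_id.sub contDiff_const).const_smul s⁻¹))
      hasCompactSupport' := by
        have h : HasCompactSupport fun z : Euc d => φ (s⁻¹ • (z - x)) :=
          φ.hasCompactSupport.comp_homeomorph
            ((Homeomorph.subRight x).trans (Homeomorph.smulOfNeZero s⁻¹ (inv_ne_zero hs.ne')))
        exact h.mul_left
      tsupport_subset' := fun _ _ => trivial }
  else 0

/-- The class `ℬ^r`: test functions supported in the closed unit ball, with
`|∂^k φ| ≤ 1` for all `|k| ≤ r`. -/
def unitTests (d r : ℕ) : Set (Test d) :=
  {φ | tsupport φ ⊆ Metric.closedBall 0 1 ∧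
    ∀ k : Fin d → ℕ, deg k ≤ r → ∀ x, |multiDeriv k φ x| ≤ 1}

/-! ### Regularising kernels -/

/-- `∂_1^k ∂_2^l G (x, y)`. -/
def mixedDeriv {d : ℕ} (k l : Fin d → ℕ) (G : Euc d → Euc d → ℝ) (x y : Euc d) : ℝ :=
  partialDeriv l (fun y' => partialDeriv k (fun x' => G x' y') x) y

/-- The class `C^{m,r}`: the partial derivatives of order `(k, l)`, with `|k| ≤ m` and `|l| ≤ r`,
exist and are continuous. -/
structure IsCmr {d : ℕ} (m r : ℕ) (G : Euc d → Euc d → ℝ) : Prop where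
  contDiff_left : ∀ y, ContDiff ℝ m fun x => G x y
  contDiff_right : ∀ k : Fin d → ℕ, deg k ≤ m → ∀ x,
    ContDiff ℝ r fun y => partialDeriv k (fun x' => G x' y) x
  continuous_mixed : ∀ k l : Fin d → ℕ, deg k ≤ m → deg l ≤ r →
    Continuous fun p : Euc d × Euc d => mixedDeriv k l G p.1 p.2

/-- `𝖪 = ∑ 𝖪_n` (`Ker` and `Kn` below) is a `β`-regularising kernel of order `(m, r)` with
range `ρ`. -/
structure IsRegularisingKernel {d : ℕ} (β : ℝ) (m r : ℕ) (ρ : ℝ)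
    (Ker : Euc d → Euc d → ℝ) (Kn : ℕ → Euc d → Euc d → ℝ) : Prop where
  beta_pos : 0 < β
  range_pos : 0 < ρ
  decomposition : ∀ᵐ p : Euc d × Euc d, HasSum (fun n => Kn n p.1 p.2) (Ker p.1 p.2)
  regular : ∀ n, IsCmr m r (Kn n)
  support : ∀ n x y, ρ * ((2 : ℝ) ^ n)⁻¹ < ‖x - y‖ → Kn n x y = 0
  bounds : ∀ K : Set (Euc d), IsCompact K → ∃ c : ℝ, 0 < c ∧
    (∀ (n : ℕ) (k l : Fin d → ℕ), deg k ≤ m → deg l ≤ r → ∀ x ∈ K, ∀ y ∈ K,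
      |mixedDeriv k l (Kn n) x y| ≤ c * (2 : ℝ) ^ ((d - β + deg l + deg k) * n)) ∧
    (∀ (n : ℕ) (k l : Fin d → ℕ), deg k ≤ r → deg l ≤ r → ∀ y ∈ K,
      |∫ x, mpow (y - x) l * partialDeriv k (fun y' => Kn n x y') y|
        ≤ c * (2 : ℝ) ^ (-β * n))

/-! ### Integration of distributions with a kernel -/

/-- `T` extends `f` from smooth test functions to test functions of class `C^r`. -/
def IsExtension {d : ℕ} (r : ℕ) (f : Distr d) (T : DistrC d r) : Prop :=
  ∀ φ : Test d, T (TestFunction.monoCLM ℝ φ) = f φ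

open Classical in
/-- The (unique) extension to test functions of class `C^r` of a distribution of order `r`. -/
def extend {d : ℕ} (r : ℕ) (f : Distr d) : DistrC d r :=
  if h : ∃ T : DistrC d r, IsExtension r f T then h.choose else 0

/-- `(G^* ψ)(y) = ∫ ψ(x) G(x, y) dx`. -/
def dualAct {d : ℕ} (G : Euc d → Euc d → ℝ) (ψ : Test d) (y : Euc d) : ℝ :=
  ∫ x, ψ x * G x y

open Classical in
/-- A compactly supported function of class `C^r`, seen as an element of `TestC d r`. -/
def toTestC {d : ℕ} (r : ℕ) (g : Euc d → ℝ) : TestC d r :=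
  if h : ContDiff ℝ r g ∧ HasCompactSupport g then
    { toFun := g
      contDiff' := h.1
      hasCompactSupport' := h.2
      tsupport_subset' := fun _ _ => trivial }
  else 0

/-- The distribution `g` is the integration `𝖪 f` of `f` with the kernel `𝖪 = ∑ 𝖪_n`, that is
`g(ψ) = ∑_n f(𝖪_n^* ψ)`; all the objects in this formula are required to be well defined. -/
structure IsKernelInt {d : ℕ} (r : ℕ) (Kn : ℕ → Euc d → Euc d → ℝ) (f g : Distr d) : Prop where
  order : ∃ T : DistrC d r, IsExtension r f T
  regular : ∀ n ψ, ContDiff ℝ r (dualAct (Kn n) ψ) ∧ HasCompactSupport (dualAct (Kn n) ψ)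
  hasSum : ∀ ψ, HasSum (fun n => extend r f (toTestC r (dualAct (Kn n) ψ))) (g ψ)

open Classical in
/-- The integration `𝖪 f`. -/
def kernelInt {d : ℕ} (r : ℕ) (Kn : ℕ → Euc d → Euc d → ℝ) (f : Distr d) : Distr d :=
  if h : ∃ g, IsKernelInt r Kn f g then h.choose else 0

/-! ### Pointwise derivatives -/

/-- The pointwise derivative `D^k f (x)` (relative to a regularity level `δ`) exists and equals `a`:
`D^k f (η_x^s) → a` as `s ↓ 0` for every test function `η` with `∫ η = 1` and
`∫ η(z) z^l dz = 0` for `1 ≤ |l| < δ`. -/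
def HasPointDeriv {d : ℕ} (δ : ℝ) (k : Fin d → ℕ) (f : Distr d) (x : Euc d) (a : ℝ) : Prop :=
  ∀ η : Test d, ∫ z, η z = 1 →
    (∀ l : Fin d → ℕ, 1 ≤ deg l → (deg l : ℝ) < δ → ∫ z, η z * mpow z l = 0) →
    Tendsto (fun s : ℝ => multiDeriv k f (rescale η x s)) (𝓝[>] 0) (𝓝 a)

open Classical in
/-- The pointwise derivative `D^k f (x)`. -/
def pointDeriv {d : ℕ} (δ : ℝ) (k : Fin d → ℕ) (f : Distr d) (x : Euc d) : ℝ :=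
  if h : ∃ a, HasPointDeriv δ k f x a then h.choose else 0

/-! ### Germs -/

/-- A family of distributions indexed by `ℝ^d` is a germ if `x ↦ F_x(φ)` is measurable for all
test functions `φ`. -/
def IsGerm {d : ℕ} (F : Euc d → Distr d) : Prop := ∀ φ : Test d, Measurable fun x => F x φ

/-- `a`-homogeneity of order `r`. -/
def IsHomogeneous {d : ℕ} (a : ℝ) (r : ℕ) (F : Euc d → Distr d) : Prop :=
  ∀ K : Set (Euc d), IsCompact K → ∀ S : ℝ, 1 ≤ S → ∃ C : ℝ,
    ∀ x ∈ K, ∀ s ∈ Ioc 0 S, ∀ φ ∈ unitTests d r, |F x (rescale φ x s)| ≤ C * s ^ a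

/-- `(a, γ)`-coherence of order `r`. -/
def IsCoherent {d : ℕ} (a γ : ℝ) (r : ℕ) (F : Euc d → Distr d) : Prop :=
  ∀ K : Set (Euc d), IsCompact K → ∀ S : ℝ, 1 ≤ S → ∃ C : ℝ,
    ∀ x ∈ K, ∀ y ∈ K, ∀ s ∈ Ioc 0 S, ∀ φ ∈ unitTests d r,
      |(F y - F x) (rescale φ x s)| ≤ C * (s ^ a * (‖y - x‖ + s) ^ (γ - a))

/-- `R` is a `γ`-reconstruction of the germ `F`, whose lower coherence exponent is `a`. -/
def IsReconstruction {d : ℕ} (a γ : ℝ) (F : Euc d → Distr d) (R : Distr d) : Prop :=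
  ∀ r : ℕ, -a < r → ∀ K : Set (Euc d), IsCompact K → ∃ C : ℝ,
    ∀ x ∈ K, ∀ s ∈ Ioc (0 : ℝ) 1, ∀ φ ∈ unitTests d r,
      |(F x - R) (rescale φ x s)| ≤ C * s ^ γ

/-- The homogeneity semi-norm `sup |F_x(φ_x^s)| / s^a` over `x ∈ K`, `s ∈ (0, S]`, `φ ∈ ℬ^r`. -/
def homNorm {d : ℕ} (a : ℝ) (K : Set (Euc d)) (S : ℝ) (r : ℕ) (F : Euc d → Distr d) : ℝ≥0∞ :=
  ⨆ x ∈ K, ⨆ s ∈ Ioc 0 S, ⨆ φ ∈ unitTests d r,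
    ENNReal.ofReal (|F x (rescale φ x s)| / s ^ a)

/-! ### Models and modelled distributions -/

/-- `(P, Γ)` is a model with homogeneities `α` and order `r`. Here `Γ x y j i` stands for
`Γ^{ji}_{xy}`. -/
structure IsModel {d : ℕ} {J : Type*} [Fintype J] (α : J → ℝ) (r : ℕ)
    (P : J → Euc d → Distr d) (Γ : Euc d → Euc d → J → J → ℝ) : Prop where
  germ : ∀ i, IsGerm (P i)
  homogeneous : ∀ i, IsHomogeneous (α i) r (P i)
  reexpansion : ∀ i x y, P i y = ∑ j, Γ x y j i • P j x

/-- The semi-norm of a model. -/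
def modelNorm {d : ℕ} {J : Type*} (α : J → ℝ) (r : ℕ) (K : Set (Euc d)) (S : ℝ)
    (P : J → Euc d → Distr d) : ℝ≥0∞ :=
  ⨆ i, homNorm (α i) K S r (P i)

/-- The increment `∑_j Γ^{ij}_{xy} f^j(y) - f^i(x)`. -/
def increment {d : ℕ} {J : Type*} [Fintype J] (Γ : Euc d → Euc d → J → J → ℝ)
    (f : Euc d → J → ℝ) (x y : Euc d) (i : J) : ℝ :=
  ∑ j, Γ x y i j * f y j - f x i

/-- `f` is a modelled distribution of order `γ`, relative to a model with homogeneities `α` and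
re-expansion coefficients `Γ`. -/
structure IsModelled {d : ℕ} {J : Type*} [Fintype J] (α : J → ℝ)
    (Γ : Euc d → Euc d → J → J → ℝ) (γ : ℝ) (f : Euc d → J → ℝ) : Prop where
  lt : ∀ i, α i < γ
  measurable : Measurable f
  bounds : ∀ K : Set (Euc d), IsCompact K → ∃ C : ℝ, ∀ i, ∀ x ∈ K, ∀ y ∈ K,
    |f x i| ≤ C ∧ |increment Γ f x y i| ≤ C * ‖y - x‖ ^ (γ - α i)

/-- The semi-norm of a modelled distribution (in the quotient, `0 / 0 = 0` and `c / 0 = ∞` for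
`c > 0`). -/
def modelledNorm {d : ℕ} {J : Type*} [Fintype J] (α : J → ℝ)
    (Γ : Euc d → Euc d → J → J → ℝ) (γ : ℝ) (K : Set (Euc d)) (f : Euc d → J → ℝ) : ℝ≥0∞ :=
  (⨆ x ∈ K, ⨆ i, ENNReal.ofReal |f x i|) +
    ⨆ x ∈ K, ⨆ y ∈ K, ⨆ i,
      ENNReal.ofReal |increment Γ f x y i| / ENNReal.ofReal (‖y - x‖ ^ (γ - α i))

/-- The germ `⟨f, P⟩_x = ∑_i f^i(x) P^i_x`. -/
def germOf {d : ℕ} {J : Type*} [Fintype J] (f : Euc d → J → ℝ) (P : J → Euc d → Distr d) :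
    Euc d → Distr d :=
  fun x => ∑ i, f x i • P i x

/-- The normalised monomial `(z - x)^k / k!`, as a distribution in `z`. -/
def monomial {d : ℕ} (k : Fin d → ℕ) (x : Euc d) : Distr d where
  toFun φ := (TestFunction.integralAgainstBilinCLM (ContinuousLinearMap.mul ℝ ℝ) volume
    fun z : Euc d => mpow (z - x) k / mfact k) φ
  map_add' _ _ := map_add _ _ _
  map_smul' _ _ := map_smul _ _ _
  cont := ContinuousLinearMap.continuous _

open Classical in
/-- The coefficients `(x - y)^{k-l} / (k-l)!`, for `l ≤ k`, of the polynomial model. -/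
def polyΓ {d : ℕ} (x y : Euc d) (l k : Fin d → ℕ) : ℝ :=
  if l ≤ k then mpow (x - y) (k - l) / mfact (k - l) else 0

/-! ### Compatibility of a model and a kernel -/

/-- `(D^k (𝖪 P^i_x))_x` is a `0`-homogeneous germ (of some order) whenever `|k| = α_i + β`. -/
def IsCompatible {d : ℕ} {I : Type*} (r : ℕ) (Kn : ℕ → Euc d → Euc d → ℝ) (α : I → ℝ) (β : ℝ)
    (P : I → Euc d → Distr d) : Prop :=
  ∀ i, ∀ k : Fin d → ℕ, (deg k : ℝ) = α i + β →
    ∃ r₀ : ℕ, IsHomogeneous 0 r₀ fun x => multiDeriv k (kernelInt r Kn (P i x))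

/-- The quantity `[𝖪 P]_{K, S} = ∑_i ∑_{|k| = α_i + β} ‖D^k (𝖪 P^i)‖`, where the norm is the
`0`-homogeneity semi-norm of order `rP`. -/
def compatNorm {d : ℕ} {I : Type*} [Fintype I] (r : ℕ) (Kn : ℕ → Euc d → Euc d → ℝ)
    (α : I → ℝ) (β : ℝ) (rP : ℕ) (K : Set (Euc d)) (S : ℝ) (P : I → Euc d → Distr d) : ℝ≥0∞ :=
  ∑ i, ∑' k : {k : Fin d → ℕ // (deg k : ℝ) = α i + β},
    homNorm 0 K S rP fun x => multiDeriv k.1 (kernelInt r Kn (P i x))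

/-! ### The new model and the new modelled distribution -/

/-- The index set `I ⊔ poly(γ + β)`, where `t = γ + β`. -/
abbrev HatIndex (I : Type*) (d : ℕ) (t : ℝ) := I ⊕ {k : Fin d → ℕ // k ∈ poly d t}

/-- The new homogeneities. -/
def hatα {I : Type*} (d : ℕ) (α : I → ℝ) (β γ : ℝ) : HatIndex I d (γ + β) → ℝ
  | .inl i => α i + β
  | .inr k => deg k.1

/-- The coefficient `D^k (𝖪 P^i_x)(x)`, for `|k| < α_i + β`. -/
def coefK {d : ℕ} {I : Type*} (r : ℕ) (Kn : ℕ → Euc d → Euc d → ℝ) (α : I → ℝ) (β : ℝ)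
    (P : I → Euc d → Distr d) (i : I) (k : Fin d → ℕ) (x : Euc d) : ℝ :=
  pointDeriv (α i + β) k (kernelInt r Kn (P i x)) x

/-- The new germs. -/
def hatP {d : ℕ} {I : Type*} (r : ℕ) (Kn : ℕ → Euc d → Euc d → ℝ) (α : I → ℝ) (β γ : ℝ)
    (P : I → Euc d → Distr d) : HatIndex I d (γ + β) → Euc d → Distr d
  | .inl i => fun x => kernelInt r Kn (P i x) -
      ∑ k ∈ poly d (α i + β), coefK r Kn α β P i k x • monomial k x
  | .inr k => fun x => monomial k.1 x

/-- The new re-expansion coefficients. -/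
def hatΓ {d : ℕ} {I : Type*} [Fintype I] (r : ℕ) (Kn : ℕ → Euc d → Euc d → ℝ) (α : I → ℝ)
    (β γ : ℝ) (P : I → Euc d → Distr d) (Γ : Euc d → Euc d → I → I → ℝ) (x y : Euc d) :
    HatIndex I d (γ + β) → HatIndex I d (γ + β) → ℝ
  | .inl j, .inl i => Γ x y j i
  | .inl _, .inr _ => 0
  | .inr l, .inl i =>
      (∑ j, if (deg l.1 : ℝ) < α j + β then coefK r Kn α β P j l.1 x * Γ x y j i else 0) -
        ∑ k ∈ poly d (α i + β), polyΓ x y l.1 k * coefK r Kn α β P i k y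
  | .inr l, .inr k => polyΓ x y l.1 k.1

/-- The new modelled distribution, built from `f` and a reconstruction `R` of `⟨f, P⟩`. -/
def hatf {d : ℕ} {I : Type*} [Fintype I] (r : ℕ) (Kn : ℕ → Euc d → Euc d → ℝ) (α : I → ℝ)
    (β γ : ℝ) (P : I → Euc d → Distr d) (f : Euc d → I → ℝ) (R : Distr d) (x : Euc d) :
    HatIndex I d (γ + β) → ℝ
  | .inl i => f x i
  | .inr k =>
      (∑ j, if (deg k.1 : ℝ) < α j + β then f x j * coefK r Kn α β P j k.1 x else 0) -
        pointDeriv (γ + β) k.1 (kernelInt r Kn (germOf f P x - R)) x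

/-- The germ `𝒦^{γ,β} F`, built from `F` and a `γ`-reconstruction `R` of `F`: from `𝖪 F_x` one
subtracts the Taylor polynomial at `x`, up to degrees `< γ + β`, of `𝖪 (F_x - R)`. -/
def liftK {d : ℕ} (r : ℕ) (Kn : ℕ → Euc d → Euc d → ℝ) (β γ : ℝ) (F : Euc d → Distr d)
    (R : Distr d) (x : Euc d) : Distr d :=
  kernelInt r Kn (F x) -
    ∑ k ∈ poly d (γ + β), pointDeriv (γ + β) k (kernelInt r Kn (F x - R)) x • monomial k x

end Schauder

end

open Schauder

noncomputable section

namespace Schauder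


/-! ### Multi-indices -/

/-! Write ε_n = 2^{-n}. If F is a-homogeneous at x, then 𝖪_n F is the C^m function z ↦ F(𝖪_n(z, ·)),
called `pot` below, and it obeys two bounds, collected in `PotBd` and proved in
`IsRegularisingKernel.exists_potBd`. Within distance ε_n of x, its derivative of index k is of size
ε_n^{a+β-|k|}, because 𝖪_n(z, ·) is ε_n^β times a test function at scale ε_n. Tested against a
function ψ at a larger scale s, it is of size ε_n^β s^a, because the moment bounds make 𝖪_n^*ψ equal
to ε_n^β times a test function at scale s.

A Schauder estimate at scale s is a cut of the series ∑ 𝖪_n F at ε_n ≈ s. The scales below s are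
summed with the second bound. At the scales above s, 𝖪_n F is replaced by its Taylor polynomial of
order m at x; the error ε_n^{a+β-m} s^m is summable because m > a + β. In the Taylor terms three
regimes appear. If |k| < a + β, the series of the coefficients converges to D^k 𝖪F(x), which is
subtracted, and its tail is an error of the right size. If |k| > a + β, the sum over the scales
above s is geometric and already of the right size. If |k| = a + β, nothing decays and bounded
partial sums are needed. This is what compatibility supplies: `exists_partialSum_const` recovers the
partial sums by testing ∂^k 𝖪F against a bump at scale ε_N. The common bookkeeping is
`abs_series_sub_le`. Its first use, `PotBd.abs_remainder_le`, gives the homogeneity of the new model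
and the reconstruction bound for 𝖪R.

The second use, `PotBd.abs_increment_le`, controls the new modelled distribution. Put F = ⟨f, Π⟩.
Algebra turns the increment of the k-th coefficient into a Taylor remainder for D^k 𝖪(F_x - R), plus
the increments of f paired with the coefficients of the model (`increment_hatf_inr`). Since F_x - R
is F_y - R minus ∑_j (increment of f^j) Π^j_x, the same cut at ε_n ≈ |y - x| applies: the part of
F_y - R is expanded at y and the parts of Π^j_x are kept as they are. No monomial is critical
because γ + β is not an integer, and the critical Π^j_x are covered by compatibility.

Two multiscale iterations deal with the order of the test functions. In `exists_sewing_const`, for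
positive exponents, a test function is cut into smaller pieces and F_x is replaced by F_p at the
position p of each piece; a reconstruction bound of any order thereby becomes one of the order of
the germ, with a constant that depends only on coherence. This yields the estimate without R and
uniqueness. In `exists_orderReduction_const` the test function is moreover mollified before it is
cut, and the order drops to any r' with r' + a > 0. This turns one reconstruction bound for 𝖪R into
bounds of all admissible orders (`isReconstruction_of_order`). -/

theorem deg_add {d : ℕ} (k l : Fin d → ℕ) : deg (k + l) = deg k + deg l := by
  simp [deg, Finset.sum_add_distrib]

theorem deg_single {d : ℕ} (i : Fin d) (n : ℕ) : deg (Pi.single i n : Fin d → ℕ) = n := by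
  simp [deg]

theorem deg_zero {d : ℕ} : deg (0 : Fin d → ℕ) = 0 := by simp [deg]

theorem deg_eq_zero {d : ℕ} {k : Fin d → ℕ} : deg k = 0 ↔ k = 0 := by
  simp [deg, Finset.sum_eq_zero_iff, funext_iff]

theorem deg_add_single {d : ℕ} (k : Fin d → ℕ) (i : Fin d) :
    deg (k + Pi.single i 1) = deg k + 1 := by rw [deg_add, deg_single]

theorem exists_eq_add_single {d n : ℕ} {k : Fin d → ℕ} (hk : deg k = n + 1) :
    ∃ (l : Fin d → ℕ) (i : Fin d), k = l + Pi.single i 1 ∧ deg l = n := by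
  have h0 : k ≠ 0 := fun h => by simp [h, deg_zero] at hk
  obtain ⟨i, hi⟩ := Function.ne_iff.1 h0
  have hle : Pi.single i 1 ≤ k := by
    intro j
    by_cases hj : j = i
    · subst hj; simpa using Nat.one_le_iff_ne_zero.2 hi
    · simp [hj]
  refine ⟨k - Pi.single i 1, i, (tsub_add_cancel_of_le hle).symm, ?_⟩
  have := deg_add_single (k - Pi.single i 1) i
  rw [tsub_add_cancel_of_le hle] at this
  omega

/-! ### Partial derivatives along the coordinate axes -/

/-- The partial derivative in the direction `i`. -/
def axisDeriv {d : ℕ} (i : Fin d) (f : Euc d → ℝ) : Euc d → ℝ :=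
  fun z => lineDeriv ℝ f z (basisVec i)

theorem axisDeriv_eq_fderiv {d : ℕ} {i : Fin d} {f : Euc d → ℝ} (hf : ContDiff ℝ 1 f) :
    axisDeriv i f = fun z => fderiv ℝ f z (basisVec i) := by
  ext z
  exact (hf.differentiable one_ne_zero z).lineDeriv_eq_fderiv

theorem contDiff_axisDeriv {d n : ℕ} {i : Fin d} {f : Euc d → ℝ}
    (hf : ContDiff ℝ (n + 1 : ℕ) f) : ContDiff ℝ n (axisDeriv i f) := by
  rw [axisDeriv_eq_fderiv (hf.of_le (by norm_cast; omega))]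
  exact (hf.fderiv_right (m := n) (by norm_cast)).clm_apply contDiff_const

/-- Symmetry of the second derivative: both sides are entries of the Hessian. -/
theorem axisDeriv_comm {d : ℕ} {i j : Fin d} {f : Euc d → ℝ} (hf : ContDiff ℝ (2 : ℕ) f) :
    axisDeriv i (axisDeriv j f) = axisDeriv j (axisDeriv i f) := by
  have h1 : ContDiff ℝ 1 f := hf.of_le (by norm_cast)
  have hD : ∀ a : Fin d, ContDiff ℝ 1 (axisDeriv a f) := fun a =>
    contDiff_axisDeriv (n := 1) hf
  have hdd : Differentiable ℝ (fderiv ℝ f) :=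
    (hf.fderiv_right (m := 1) (by norm_cast)).differentiable one_ne_zero
  have key : ∀ a b : Fin d, axisDeriv a (axisDeriv b f) =
      fun z => fderiv ℝ (fderiv ℝ f) z (basisVec a) (basisVec b) := by
    intro a b
    rw [axisDeriv_eq_fderiv (hD b)]
    ext z
    rw [axisDeriv_eq_fderiv h1]
    rw [fderiv_clm_apply (hdd z) (differentiableAt_const _)]
    simp
  rw [key, key]
  ext z
  have : IsSymmSndFDerivAt ℝ f z := by
    apply hf.contDiffAt.isSymmSndFDerivAt
    simp
  exact this _ _

theorem contDiff_iterate_axisDeriv {d n : ℕ} {i : Fin d} (a : ℕ) {f : Euc d → ℝ}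
    (hf : ContDiff ℝ (n + a : ℕ) f) : ContDiff ℝ n ((axisDeriv i)^[a] f) := by
  induction a generalizing f with
  | zero => simpa using hf
  | succ a ih =>
    rw [Function.iterate_succ_apply]
    exact ih (contDiff_axisDeriv hf)

theorem axisDeriv_iterate_comm {d : ℕ} {i j : Fin d} (a : ℕ) {f : Euc d → ℝ}
    (hf : ContDiff ℝ (a + 1 : ℕ) f) :
    axisDeriv i ((axisDeriv j)^[a] f) = (axisDeriv j)^[a] (axisDeriv i f) := by
  induction a generalizing f with
  | zero => rfl
  | succ a ih =>
    rw [Function.iterate_succ_apply, Function.iterate_succ_apply,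
      ih (contDiff_axisDeriv hf), axisDeriv_comm (hf.of_le (by norm_cast; omega))]

/-- The iterated partial derivative along the axes of a list. -/
def listDeriv {d : ℕ} (L : List (Fin d)) (k : Fin d → ℕ) (f : Euc d → ℝ) : Euc d → ℝ :=
  L.foldr (fun i g => (axisDeriv i)^[k i] g) f

theorem partialDeriv_eq_listDeriv {d : ℕ} (k : Fin d → ℕ) (f : Euc d → ℝ) :
    partialDeriv k f = listDeriv (List.finRange d) k f := rfl

theorem contDiff_listDeriv {d n : ℕ} {k : Fin d → ℕ} {f : Euc d → ℝ} (L : List (Fin d))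
    (hf : ContDiff ℝ (n + (L.map k).sum : ℕ) f) : ContDiff ℝ n (listDeriv L k f) := by
  induction L generalizing n with
  | nil => simpa [listDeriv] using hf
  | cons j L ih =>
    refine contDiff_iterate_axisDeriv (k j) (ih ?_)
    simpa [List.sum_cons, add_assoc] using hf

theorem listDeriv_congr {d : ℕ} {k k' : Fin d → ℕ} {f : Euc d → ℝ} (L : List (Fin d))
    (h : ∀ j ∈ L, k j = k' j) : listDeriv L k f = listDeriv L k' f := by
  induction L with
  | nil => rfl
  | cons j L ih =>
    have := ih fun j' hj' => h j' (List.mem_cons_of_mem _ hj')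
    simp only [listDeriv, List.foldr_cons] at this ⊢
    rw [this, h j List.mem_cons_self]

/-- The new derivative is commuted past the directions that precede `i` in the list. As `i` occurs
only once, the exponent is raised at a single place. -/
theorem axisDeriv_listDeriv {d : ℕ} {i : Fin d} {k : Fin d → ℕ} {f : Euc d → ℝ}
    (L : List (Fin d)) (hL : L.Nodup) (hi : i ∈ L)
    (hf : ContDiff ℝ ((L.map k).sum + 1 : ℕ) f) :
    axisDeriv i (listDeriv L k f) = listDeriv L (k + Pi.single i 1) f := by
  induction L with
  | nil => simp at hi
  | cons j L ih =>
    change axisDeriv i ((axisDeriv j)^[k j] (listDeriv L k f)) =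
      (axisDeriv j)^[(k + Pi.single i 1 : Fin d → ℕ) j] (listDeriv L (k + Pi.single i 1) f)
    rw [List.nodup_cons] at hL
    rw [List.map_cons, List.sum_cons] at hf
    by_cases hij : i = j
    · subst hij
      have h1 : listDeriv L (k + Pi.single i 1) f = listDeriv L k f := by
        refine listDeriv_congr L fun j' hj' => ?_
        have : j' ≠ i := fun h => hL.1 (h ▸ hj')
        simp [this]
      have h2 : (k + Pi.single i 1 : Fin d → ℕ) i = k i + 1 := by simp
      rw [h1, h2, Function.iterate_succ_apply']
    · have hiL : i ∈ L := (List.mem_cons.1 hi).resolve_left hij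
      rw [axisDeriv_iterate_comm, ih hL.2 hiL (hf.of_le (by norm_cast; omega))]
      · have : (k + Pi.single i 1 : Fin d → ℕ) j = k j := by simp [Ne.symm hij]
        rw [this]
      · apply contDiff_listDeriv
        exact hf.of_le (by norm_cast; omega)

theorem sum_map_finRange {d : ℕ} (k : Fin d → ℕ) : ((List.finRange d).map k).sum = deg k := by
  rw [deg, ← List.sum_ofFn, List.ofFn_eq_map]

theorem contDiff_partialDeriv {d n : ℕ} {k : Fin d → ℕ} {f : Euc d → ℝ}
    (hf : ContDiff ℝ (n + deg k : ℕ) f) : ContDiff ℝ n (partialDeriv k f) := by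
  rw [partialDeriv_eq_listDeriv]
  apply contDiff_listDeriv
  rwa [sum_map_finRange]

theorem axisDeriv_partialDeriv {d : ℕ} {i : Fin d} {k : Fin d → ℕ} {f : Euc d → ℝ}
    (hf : ContDiff ℝ (deg k + 1 : ℕ) f) :
    axisDeriv i (partialDeriv k f) = partialDeriv (k + Pi.single i 1) f := by
  rw [partialDeriv_eq_listDeriv, partialDeriv_eq_listDeriv]
  apply axisDeriv_listDeriv _ (List.nodup_finRange d) (List.mem_finRange i)
  rwa [sum_map_finRange]

/-! ### Jets: families of functions that are the partial derivatives of the first one -/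

/-- The coordinate functional. -/
abbrev coord {d : ℕ} (i : Fin d) : Euc d →L[ℝ] ℝ := EuclideanSpace.proj i

/-- `(u k)_k` are the partial derivatives, up to order `r`, of the function `u 0` of class `C^r`. -/
structure IsJet {d : ℕ} (r : ℕ) (u : (Fin d → ℕ) → Euc d → ℝ) : Prop where
  hasFDerivAt : ∀ k, deg k < r → ∀ z,
    HasFDerivAt (u k) (∑ i, u (k + Pi.single i 1) z • (coord i : Euc d →L[ℝ] ℝ)) z
  continuous : ∀ k, deg k ≤ r → Continuous (u k)

theorem sum_smul_coord_basisVec {d : ℕ} (c : Fin d → ℝ) (i : Fin d) :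
    (∑ j, c j • (coord j : Euc d →L[ℝ] ℝ)) (basisVec i) = c i := by
  simp [basisVec]

theorem clm_eq_sum_coord {d : ℕ} (A : Euc d →L[ℝ] ℝ) :
    A = ∑ i, A (basisVec i) • (coord i : Euc d →L[ℝ] ℝ) := by
  refine ContinuousLinearMap.coe_injective
    ((EuclideanSpace.basisFun (Fin d) ℝ).toBasis.ext fun i => ?_)
  have := sum_smul_coord_basisVec (fun j => A (basisVec j)) i
  simp only [basisVec] at this ⊢
  simp only [OrthonormalBasis.coe_toBasis, EuclideanSpace.basisFun_apply,
    ContinuousLinearMap.coe_coe]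
  exact this.symm

theorem isJet_of_contDiff {d r : ℕ} {f : Euc d → ℝ} (hf : ContDiff ℝ r f) :
    IsJet r fun k => partialDeriv k f where
  hasFDerivAt k hk z := by
    have h1 : ContDiff ℝ (1 : ℕ) (partialDeriv k f) :=
      contDiff_partialDeriv (hf.of_le (by norm_cast; omega))
    have h2 := ((h1.differentiable (by norm_num)) z).hasFDerivAt
    refine h2.congr_fderiv ?_
    rw [clm_eq_sum_coord (fderiv ℝ (partialDeriv k f) z)]
    refine Finset.sum_congr rfl fun i _ => ?_
    have h3 := axisDeriv_partialDeriv (i := i) (k := k) (f := f) (hf.of_le (by norm_cast))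
    rw [← h3, axisDeriv_eq_fderiv (by exact_mod_cast h1)]
  continuous k hk := by
    have h1 : ContDiff ℝ (0 : ℕ) (partialDeriv k f) :=
      contDiff_partialDeriv (hf.of_le (by norm_cast; omega))
    exact h1.continuous

namespace IsJet

variable {d r : ℕ} {u v : (Fin d → ℕ) → Euc d → ℝ}

theorem shift (hu : IsJet r u) (l : Fin d → ℕ) {n : ℕ} (h : n + deg l ≤ r) :
    IsJet n fun k => u (k + l) where
  hasFDerivAt k hk z := by
    have := hu.hasFDerivAt (k + l) (by rw [deg_add]; omega) z
    simpa only [add_right_comm k l] using this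
  continuous k hk := hu.continuous _ (by rw [deg_add]; omega)

theorem contDiff (hu : IsJet r u) : ContDiff ℝ r (u 0) := by
  induction r generalizing u with
  | zero => exact contDiff_zero.2 (hu.continuous 0 (by simp [deg_zero]))
  | succ r ih =>
    have h0 : deg (0 : Fin d → ℕ) < r + 1 := by simp [deg_zero]
    have hd : Differentiable ℝ (u 0) := fun z => (hu.hasFDerivAt 0 h0 z).differentiableAt
    push_cast
    refine contDiff_succ_iff_fderiv.2 ⟨hd, by simp, ?_⟩
    have : fderiv ℝ (u 0) = fun z => ∑ i, u (0 + Pi.single i 1) z • (coord i : Euc d →L[ℝ] ℝ) := by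
      ext1 z; exact (hu.hasFDerivAt 0 h0 z).fderiv
    rw [this]
    refine ContDiff.sum fun i _ => ?_
    have h1 : ContDiff ℝ r (u (0 + Pi.single i 1)) :=
      ih (hu.shift (Pi.single i 1) (by rw [deg_single]))
    exact h1.smul contDiff_const

theorem contDiff_of_deg_le (hu : IsJet r u) {k : Fin d → ℕ} {n : ℕ} (h : n + deg k ≤ r) :
    ContDiff ℝ n (u k) := by
  simpa using (hu.shift k h).contDiff

theorem axisDeriv_eq (hu : IsJet r u) {k : Fin d → ℕ} (hk : deg k < r) (i : Fin d) :
    axisDeriv i (u k) = u (k + Pi.single i 1) := by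
  ext z
  have h := hu.hasFDerivAt k hk z
  rw [axisDeriv, h.differentiableAt.lineDeriv_eq_fderiv, h.fderiv, sum_smul_coord_basisVec]

theorem iterate_axisDeriv_eq (hu : IsJet r u) (i : Fin d) (a : ℕ) {k : Fin d → ℕ}
    (hk : deg k + a ≤ r) : (axisDeriv i)^[a] (u k) = u (k + Pi.single i a) := by
  induction a with
  | zero => simp
  | succ a ih =>
    rw [Function.iterate_succ_apply', ih (by omega), hu.axisDeriv_eq
      (by rw [deg_add, deg_single]; omega), add_assoc, ← Pi.single_add]

theorem listDeriv_eq (hu : IsJet r u) (k : Fin d → ℕ) (L : List (Fin d))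
    (h : (L.map k).sum ≤ r) :
    listDeriv L k (u 0) = u (L.map fun i => Pi.single i (k i)).sum ∧
      deg (L.map fun i => (Pi.single i (k i) : Fin d → ℕ)).sum = (L.map k).sum := by
  induction L with
  | nil => simp [listDeriv, deg_zero]
  | cons j L ih =>
    rw [List.map_cons, List.sum_cons] at h
    obtain ⟨h1, h2⟩ := ih (by omega)
    simp only [List.map_cons, List.sum_cons, deg_add, deg_single, h2, and_true]
    change (axisDeriv j)^[k j] (listDeriv L k (u 0)) = _
    rw [h1, hu.iterate_axisDeriv_eq _ _ (by omega), add_comm]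

/-- The use of jets: once a family is seen to be closed under differentiation, all the iterated
partial derivatives of its first member are known without further computation. Sums, dilations,
averages and potentials below are treated in this way. -/
theorem partialDeriv_eq (hu : IsJet r u) {k : Fin d → ℕ} (hk : deg k ≤ r) :
    partialDeriv k (u 0) = u k := by
  have h := (hu.listDeriv_eq k (List.finRange d) (by rwa [sum_map_finRange])).1
  rw [partialDeriv_eq_listDeriv, h]
  congr 1
  rw [← List.ofFn_eq_map, List.sum_ofFn]
  exact Finset.univ_sum_single k

theorem add (hu : IsJet r u) (hv : IsJet r v) : IsJet r fun k z => u k z + v k z where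
  hasFDerivAt k hk z := by
    refine ((hu.hasFDerivAt k hk z).add (hv.hasFDerivAt k hk z)).congr_fderiv ?_
    simp [add_smul, Finset.sum_add_distrib]
  continuous k hk := (hu.continuous k hk).add (hv.continuous k hk)

theorem const_mul (hu : IsJet r u) (c : ℝ) : IsJet r fun k z => c * u k z where
  hasFDerivAt k hk z := by
    refine ((hu.hasFDerivAt k hk z).const_mul c).congr_fderiv ?_
    simp [mul_smul, Finset.smul_sum]
  continuous k hk := continuous_const.mul (hu.continuous k hk)

theorem neg (hu : IsJet r u) : IsJet r fun k z => -u k z := by simpa using hu.const_mul (-1)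

theorem sub (hu : IsJet r u) (hv : IsJet r v) : IsJet r fun k z => u k z - v k z := by
  simpa [sub_eq_add_neg] using hu.add hv.neg

theorem zero : IsJet r fun (_ : Fin d → ℕ) (_ : Euc d) => (0 : ℝ) where
  hasFDerivAt k hk z := by simpa using hasFDerivAt_const (0 : ℝ) z
  continuous _ _ := continuous_const

theorem sum {ι : Type*} (s : Finset ι) {w : ι → (Fin d → ℕ) → Euc d → ℝ}
    (hw : ∀ j ∈ s, IsJet r (w j)) : IsJet r fun k z => ∑ j ∈ s, w j k z := by
  classical
  induction s using Finset.induction_on with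
  | empty => simpa using zero
  | insert a s ha ih =>
    simp only [Finset.sum_insert ha]
    exact (hw a (Finset.mem_insert_self _ _)).add
      (ih fun j hj => hw j (Finset.mem_insert_of_mem hj))

/-- Dilations and translations. -/
theorem comp_affine (hu : IsJet r u) (c : ℝ) (x : Euc d) :
    IsJet r fun k z => c ^ deg k * u k (c • (z - x)) where
  hasFDerivAt k hk z := by
    have hA : HasFDerivAt (fun z : Euc d => c • (z - x)) (c • ContinuousLinearMap.id ℝ (Euc d)) z :=
      ((hasFDerivAt_id z).sub_const x).const_smul c
    refine (((hu.hasFDerivAt k hk (c • (z - x))).comp z hA).const_mul (c ^ deg k)).congr_fderiv ?_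
    ext w
    simp only [deg_add_single, sum_apply, smul_apply,
      ContinuousLinearMap.comp_apply, Finset.mul_sum, smul_eq_mul, map_smul,
      ContinuousLinearMap.id_apply]
    refine Finset.sum_congr rfl fun i _ => ?_
    ring
  continuous k hk := continuous_const.mul
    ((hu.continuous k hk).comp ((continuous_id.sub continuous_const).const_smul c))

end IsJet

theorem partialDeriv_zero {d : ℕ} (f : Euc d → ℝ) : partialDeriv 0 f = f := by
  rw [partialDeriv_eq_listDeriv]
  induction List.finRange d with
  | nil => rfl
  | cons a L ih => simpa [listDeriv] using ih

theorem partialDeriv_comp_affine {d : ℕ} {f : Euc d → ℝ} {k : Fin d → ℕ}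
    (hf : ContDiff ℝ (deg k : ℕ) f) (c : ℝ) (x z : Euc d) :
    partialDeriv k (fun z => f (c • (z - x))) z = c ^ deg k * partialDeriv k f (c • (z - x)) := by
  have h := ((isJet_of_contDiff hf).comp_affine c x).partialDeriv_eq le_rfl
  simp only [deg_zero, partialDeriv_zero, pow_zero, one_mul] at h
  exact congrFun h z


/-! ### Normalised monomials -/

/-- The normalised monomial `z^k / k!`. -/
def nmon {d : ℕ} (k : Fin d → ℕ) (z : Euc d) : ℝ := mpow z k / mfact k

theorem mfact_pos {d : ℕ} (k : Fin d → ℕ) : 0 < mfact k :=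
  Finset.prod_pos fun _ _ => Nat.factorial_pos _

theorem one_le_mfact {d : ℕ} (k : Fin d → ℕ) : (1 : ℝ) ≤ mfact k := by
  exact_mod_cast mfact_pos k

theorem nmon_zero_index {d : ℕ} (z : Euc d) : nmon 0 z = 1 := by simp [nmon, mpow, mfact]

theorem nmon_zero {d : ℕ} {k : Fin d → ℕ} (hk : k ≠ 0) : nmon k (0 : Euc d) = 0 := by
  obtain ⟨i, hi⟩ := Function.ne_iff.1 hk
  have : mpow (0 : Euc d) k = 0 :=
    Finset.prod_eq_zero (Finset.mem_univ i) (by simpa using hi)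
  simp [nmon, this]

theorem nmon_smul {d : ℕ} (k : Fin d → ℕ) (c : ℝ) (z : Euc d) :
    nmon k (c • z) = c ^ deg k * nmon k z := by
  simp [nmon, mpow, mul_pow, Finset.prod_mul_distrib, deg, Finset.prod_pow_eq_pow_sum, mul_div_assoc]

theorem abs_coord_le {d : ℕ} (z : Euc d) (i : Fin d) : |z i| ≤ ‖z‖ := by
  simpa using PiLp.norm_apply_le z i

theorem abs_mpow_le {d : ℕ} (k : Fin d → ℕ) (z : Euc d) : |mpow z k| ≤ ‖z‖ ^ deg k := by
  rw [mpow, Finset.abs_prod, deg, ← Finset.prod_pow_eq_pow_sum]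
  refine Finset.prod_le_prod (fun i _ => abs_nonneg _) fun i _ => ?_
  rw [abs_pow]
  exact pow_le_pow_left₀ (abs_nonneg _) (abs_coord_le z i) _

theorem abs_nmon_le {d : ℕ} (k : Fin d → ℕ) (z : Euc d) : |nmon k z| ≤ ‖z‖ ^ deg k := by
  have h1 := one_le_mfact k
  rw [nmon, abs_div, abs_of_pos (by linarith : (0 : ℝ) < mfact k)]
  exact (div_le_self (abs_nonneg _) h1).trans (abs_mpow_le k z)

theorem continuous_nmon {d : ℕ} (k : Fin d → ℕ) : Continuous (nmon k : Euc d → ℝ) := by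
  unfold nmon mpow; fun_prop

theorem nmon_eq_prod {d : ℕ} (k : Fin d → ℕ) (z : Euc d) :
    nmon k z = ∏ i, z i ^ k i / (k i).factorial := by
  simp [nmon, mpow, mfact, Finset.prod_div_distrib]

open Classical in
theorem hasFDerivAt_nmon {d : ℕ} (k : Fin d → ℕ) (z : Euc d) :
    HasFDerivAt (nmon k) (∑ i, (if Pi.single i 1 ≤ k then nmon (k - Pi.single i 1) z else 0) •
      (coord i : Euc d →L[ℝ] ℝ)) z := by
  have h1 : ∀ i : Fin d, HasFDerivAt (fun z : Euc d => z i ^ k i / (k i).factorial)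
      ((k i * z i ^ (k i - 1) / (k i).factorial) • (coord i : Euc d →L[ℝ] ℝ)) z := by
    intro i
    have h2 : HasFDerivAt (fun z : Euc d => z i) (coord i : Euc d →L[ℝ] ℝ) z :=
      (coord i : Euc d →L[ℝ] ℝ).hasFDerivAt
    have h3 := (h2.pow (k i)).mul_const (((k i).factorial : ℝ)⁻¹)
    simp only [div_eq_mul_inv]
    refine h3.congr_fderiv ?_
    ext w
    simp
    ring
  have h4 := HasFDerivAt.finsetProd (u := Finset.univ) fun i _ => h1 i
  have h5 : nmon k = fun z : Euc d => ∏ i, z i ^ k i / (k i).factorial := by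
    ext z; exact nmon_eq_prod k z
  rw [h5]
  refine h4.congr_fderiv (Finset.sum_congr rfl fun i _ => ?_)
  rw [smul_smul]
  congr 1
  split_ifs with hi
  · have hi' : 1 ≤ k i := by simpa using hi i
    rw [nmon_eq_prod, ← Finset.mul_prod_erase _ _ (Finset.mem_univ i), mul_comm]
    congr 1
    · simp only [Pi.sub_apply, Pi.single_eq_same]
      obtain ⟨n, hn⟩ : ∃ n, k i = n + 1 := ⟨k i - 1, by omega⟩
      rw [hn, Nat.add_sub_cancel, Nat.factorial_succ]
      have : (n.factorial : ℝ) ≠ 0 := by exact_mod_cast n.factorial_ne_zero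
      push_cast
      field_simp
    · refine Finset.prod_congr rfl fun j hj => ?_
      have : j ≠ i := Finset.ne_of_mem_erase hj
      simp [this]
  · have : k i = 0 := by
      by_contra h
      apply hi
      intro j
      by_cases hj : j = i
      · subst hj; simpa using Nat.one_le_iff_ne_zero.2 h
      · simp [hj]
    simp [this]

open Classical in
/-- The jet of a normalised monomial. -/
theorem isJet_nmon {d : ℕ} (r : ℕ) (k : Fin d → ℕ) :
    IsJet r fun l (z : Euc d) => if l ≤ k then nmon (k - l) z else 0 where
  hasFDerivAt l _ z := by
    by_cases hl : l ≤ k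
    · simp only [hl, if_true]
      refine (hasFDerivAt_nmon (k - l) z).congr_fderiv (Finset.sum_congr rfl fun i _ => ?_)
      have h1 : Pi.single i 1 ≤ k - l ↔ l + Pi.single i 1 ≤ k := by
        rw [le_tsub_iff_left hl]
      simp only [h1, tsub_add_eq_tsub_tsub]
    · have : ∀ i : Fin d, ¬ l + Pi.single i 1 ≤ k := fun i h => hl (le_self_add.trans h)
      simp only [hl, this, if_false, zero_smul, Finset.sum_const_zero]
      exact hasFDerivAt_const 0 z
  continuous l _ := by
    by_cases hl : l ≤ k
    · simp only [hl, if_true]; exact continuous_nmon _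
    · simp only [hl, if_false]; exact continuous_const

/-! ### Taylor's formula -/

/-- The multi-indices of degree less than `q`. -/
abbrev below (d q : ℕ) : Finset (Fin d → ℕ) := poly d (q : ℝ)

theorem mem_below {d q : ℕ} {k : Fin d → ℕ} : k ∈ below d q ↔ deg k < q := by
  rw [mem_poly]; exact Nat.cast_lt

open Classical in
theorem sum_below_succ_shift {d q : ℕ} (i : Fin d) (F : (Fin d → ℕ) → ℝ) :
    ∑ k ∈ below d (q + 1), (if Pi.single i 1 ≤ k then F k else 0) =
      ∑ k ∈ below d q, F (k + Pi.single i 1) := by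
  rw [← Finset.sum_filter]
  symm
  refine Finset.sum_bij (fun k _ => k + Pi.single i 1) ?_ ?_ ?_ ?_
  · intro k hk
    rw [mem_below] at hk
    simp only [Finset.mem_filter, mem_below, deg_add_single]
    exact ⟨by omega, le_add_self⟩
  · intro k _ l _ h
    exact add_right_cancel h
  · intro k hk
    simp only [Finset.mem_filter, mem_below] at hk
    refine ⟨k - Pi.single i 1, ?_, tsub_add_cancel_of_le hk.2⟩
    rw [mem_below]
    have := deg_add_single (k - Pi.single i 1) i
    rw [tsub_add_cancel_of_le hk.2] at this
    omega
  · intro k _; rfl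

open Classical in
/-- Taylor's formula for jets, on convex sets. -/
theorem IsJet.taylor {d q : ℕ} {u : (Fin d → ℕ) → Euc d → ℝ} (hu : IsJet q u) {s : Set (Euc d)}
    (hs : Convex ℝ s) {B : ℝ} (hB : ∀ k, deg k = q → ∀ z ∈ s, |u k z| ≤ B) {x : Euc d}
    (hx : x ∈ s) {y : Euc d} (hy : y ∈ s) :
    |u 0 y - ∑ k ∈ below d q, nmon k (y - x) * u k x| ≤ (d : ℝ) ^ q * B * ‖y - x‖ ^ q := by
  induction q generalizing u y with
  | zero =>
    have : below d 0 = ∅ := by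
      ext k; simp [mem_below]
    simpa [this] using hB 0 deg_zero y hy
  | succ q ih =>
    have hB0 : 0 ≤ (d : ℝ) ^ (q + 1) * B := by
      rcases Nat.eq_zero_or_pos d with rfl | hd
      · simp
      · have := hB (Pi.single ⟨0, hd⟩ (q + 1)) (deg_single _ _) x hx
        have := (abs_nonneg _).trans this
        positivity
    set g : Euc d → ℝ := fun y => u 0 y - ∑ k ∈ below d (q + 1), nmon k (y - x) * u k x with hg
    have hgd : ∀ y, HasFDerivAt g (∑ i, (u (0 + Pi.single i 1) y -
        ∑ k ∈ below d q, nmon k (y - x) * u (k + Pi.single i 1) x) •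
          (coord i : Euc d →L[ℝ] ℝ)) y := by
      intro y
      have h1 : ∀ k ∈ below d (q + 1), HasFDerivAt (fun y => nmon k (y - x) * u k x)
          (u k x • ∑ i, (if Pi.single i 1 ≤ k then nmon (k - Pi.single i 1) (y - x) else 0) •
            (coord i : Euc d →L[ℝ] ℝ)) y := by
        intro k _
        have := (hasFDerivAt_nmon k (y - x)).comp y ((hasFDerivAt_id y).sub_const x)
        exact this.mul_const (u k x)
      refine ((hu.hasFDerivAt 0 (by simp [deg_zero]) y).sub
        (HasFDerivAt.fun_sum h1)).congr_fderiv ?_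
      simp only [Finset.smul_sum]
      rw [Finset.sum_comm, ← Finset.sum_sub_distrib]
      refine Finset.sum_congr rfl fun i _ => ?_
      refine Eq.trans ?_ (sub_smul _ _ _).symm
      congr 1
      rw [← sum_below_succ_shift i (fun k => nmon (k - Pi.single i 1) (y - x) * u k x) |>.trans
        (Finset.sum_congr rfl fun k _ => by rw [add_tsub_cancel_right]), Finset.sum_smul]
      refine Finset.sum_congr rfl fun k _ => ?_
      rw [smul_smul]
      split_ifs <;> simp [mul_comm]
    -- The mean value inequality is applied on the part of the convex set within distance ‖y - x‖ of
    -- x. There the inductive bound on each partial derivative of the remainder is at most its value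
    -- at distance ‖y - x‖, and summing over the d directions gives one more factor d.
    have hbound : ∀ w ∈ s ∩ Metric.closedBall x ‖y - x‖,
        ‖(∑ i, (u (0 + Pi.single i 1) w -
        ∑ k ∈ below d q, nmon k (w - x) * u (k + Pi.single i 1) x) •
          (coord i : Euc d →L[ℝ] ℝ))‖ ≤ (d : ℝ) ^ (q + 1) * B * ‖y - x‖ ^ q := by
      intro w hw
      have h2 : ∀ i ∈ Finset.univ, ‖(u (0 + Pi.single i 1) w -
        ∑ k ∈ below d q, nmon k (w - x) * u (k + Pi.single i 1) x) •
          (coord i : Euc d →L[ℝ] ℝ)‖ ≤ (d : ℝ) ^ q * B * ‖y - x‖ ^ q := by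
        intro i _
        have h3 := ih (hu.shift (Pi.single i 1) (by rw [deg_single]))
          (fun k hk z hz => hB (k + Pi.single i 1) (by rw [deg_add_single, hk]) z hz) hw.1
        have h4 : ‖(coord i : Euc d →L[ℝ] ℝ)‖ ≤ 1 :=
          ContinuousLinearMap.opNorm_le_bound _ zero_le_one fun z => by
            simpa using abs_coord_le z i
        have hB1 : 0 ≤ B := (abs_nonneg _).trans (hB (Pi.single i (q + 1)) (deg_single _ _) x hx)
        have h5 : ‖w - x‖ ≤ ‖y - x‖ := by simpa [dist_eq_norm] using hw.2
        rw [norm_smul, Real.norm_eq_abs]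
        calc _ ≤ (d : ℝ) ^ q * B * ‖w - x‖ ^ q * 1 :=
              mul_le_mul h3 h4 (norm_nonneg _) (by positivity)
          _ ≤ _ := by rw [mul_one]; gcongr
      refine (norm_sum_le_of_le _ h2).trans (le_of_eq ?_)
      simp
      ring
    have hcv : Convex ℝ (s ∩ Metric.closedBall x ‖y - x‖) :=
      hs.inter (convex_closedBall _ _)
    have hxm : x ∈ s ∩ Metric.closedBall x ‖y - x‖ := ⟨hx, by simp⟩
    have hym : y ∈ s ∩ Metric.closedBall x ‖y - x‖ := ⟨hy, by simp [dist_eq_norm]⟩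
    have h6 := hcv.norm_image_sub_le_of_norm_hasFDerivWithin_le
      (fun w _ => (hgd w).hasFDerivWithinAt) hbound hxm hym
    have hg0 : g x = 0 := by
      have : ∑ k ∈ below d (q + 1), nmon k (x - x) * u k x = u 0 x := by
        rw [Finset.sum_eq_single 0]
        · simp [nmon_zero_index]
        · intro k _ hk; simp [nmon_zero hk]
        · intro h; simp [mem_below, deg_zero] at h
      simp only [hg]
      rw [this, sub_self]
    rw [hg0, sub_zero, Real.norm_eq_abs] at h6
    refine h6.trans (le_of_eq ?_)
    ring

/-! ### Products -/

theorem axisDeriv_mul {d : ℕ} {f g : Euc d → ℝ} (hf : ContDiff ℝ 1 f) (hg : ContDiff ℝ 1 g)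
    (i : Fin d) :
    axisDeriv i (fun z => f z * g z) = fun z => axisDeriv i f z * g z + f z * axisDeriv i g z := by
  rw [axisDeriv_eq_fderiv (hf.mul hg), axisDeriv_eq_fderiv hf, axisDeriv_eq_fderiv hg]
  ext z
  rw [fderiv_fun_mul (hf.differentiable one_ne_zero z) (hg.differentiable one_ne_zero z)]
  simp
  ring

theorem partialDeriv_add_single {d : ℕ} {k : Fin d → ℕ} {f : Euc d → ℝ}
    (hf : ContDiff ℝ (deg k + 1 : ℕ) f) (i : Fin d) :
    partialDeriv (k + Pi.single i 1) f = partialDeriv k (axisDeriv i f) := by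
  have h1 := isJet_of_contDiff hf
  have h2 := (h1.shift (Pi.single i 1) (n := deg k) (by rw [deg_single])).partialDeriv_eq le_rfl
  have h3 : partialDeriv (0 + Pi.single i 1) f = axisDeriv i f := by
    rw [← axisDeriv_partialDeriv (hf.of_le (by norm_cast; simp [deg_zero])), partialDeriv_zero]
  simp only [h3] at h2
  exact h2.symm

theorem partialDeriv_add {d : ℕ} {k : Fin d → ℕ} {f g : Euc d → ℝ}
    (hf : ContDiff ℝ (deg k) f) (hg : ContDiff ℝ (deg k) g) :
    partialDeriv k (fun z => f z + g z) = fun z => partialDeriv k f z + partialDeriv k g z := by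
  have := ((isJet_of_contDiff hf).add (isJet_of_contDiff hg)).partialDeriv_eq le_rfl
  simpa only [partialDeriv_zero] using this

theorem partialDeriv_sub {d : ℕ} {k : Fin d → ℕ} {f g : Euc d → ℝ}
    (hf : ContDiff ℝ (deg k) f) (hg : ContDiff ℝ (deg k) g) :
    partialDeriv k (fun z => f z - g z) = fun z => partialDeriv k f z - partialDeriv k g z := by
  have := ((isJet_of_contDiff hf).sub (isJet_of_contDiff hg)).partialDeriv_eq le_rfl
  simpa only [partialDeriv_zero] using this

theorem partialDeriv_const_mul {d : ℕ} {k : Fin d → ℕ} {f : Euc d → ℝ}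
    (hf : ContDiff ℝ (deg k) f) (c : ℝ) :
    partialDeriv k (fun z => c * f z) = fun z => c * partialDeriv k f z := by
  have := ((isJet_of_contDiff hf).const_mul c).partialDeriv_eq le_rfl
  simpa only [partialDeriv_zero] using this

/-- A bound on the partial derivatives of a product. -/
theorem abs_partialDeriv_mul_le {d n : ℕ} {f g : Euc d → ℝ} (hf : ContDiff ℝ n f)
    (hg : ContDiff ℝ n g) {A B c : ℝ} (z : Euc d)
    (hA : ∀ k, deg k ≤ n → |partialDeriv k f z| ≤ A * c ^ deg k)
    (hB : ∀ k, deg k ≤ n → |partialDeriv k g z| ≤ B * c ^ deg k)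
    {k : Fin d → ℕ} (hk : deg k ≤ n) :
    |partialDeriv k (fun z => f z * g z) z| ≤ (2 * c) ^ deg k * (A * B) := by
  induction n generalizing f g A B k with
  | zero =>
    have hk0 : k = 0 := deg_eq_zero.1 (by omega)
    subst hk0
    have h1 := hA 0 hk
    have h2 := hB 0 hk
    simp only [partialDeriv_zero, deg_zero, pow_zero, mul_one, one_mul] at h1 h2 ⊢
    rw [abs_mul]
    exact mul_le_mul h1 h2 (abs_nonneg _) ((abs_nonneg _).trans h1)
  | succ n ih =>
    by_cases hkn : deg k ≤ n
    · exact ih (hf.of_le (by norm_cast; omega)) (hg.of_le (by norm_cast; omega))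
        (fun k hk => hA k (by omega)) (fun k hk => hB k (by omega)) hkn
    obtain ⟨l, i, rfl, hl⟩ := exists_eq_add_single (k := k) (n := n) (by omega)
    have hf1 := contDiff_axisDeriv (i := i) hf
    have hg1 := contDiff_axisDeriv (i := i) hg
    have hf0 : ContDiff ℝ n f := hf.of_le (by norm_cast; omega)
    have hg0 : ContDiff ℝ n g := hg.of_le (by norm_cast; omega)
    -- Differentiating one factor multiplies its constant by c. The two terms of the product rule
    -- then account for the factor 2c per derivative, without binomial coefficients.
    have hsh : ∀ {h : Euc d → ℝ} {D : ℝ}, ContDiff ℝ (n + 1 : ℕ) h →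
        (∀ k, deg k ≤ n + 1 → |partialDeriv k h z| ≤ D * c ^ deg k) →
        ∀ k, deg k ≤ n → |partialDeriv k (axisDeriv i h) z| ≤ (D * c) * c ^ deg k := by
      intro h D hh hD k hk
      rw [← partialDeriv_add_single (hh.of_le (by norm_cast; omega))]
      refine (hD _ (by rw [deg_add_single]; omega)).trans (le_of_eq ?_)
      rw [deg_add_single, pow_succ]; ring
    have h1 := ih hf1 hg0 (hsh hf hA) (fun k hk => hB k (by omega)) hl.le
    have h2 := ih hf0 hg1 (fun k hk => hA k (by omega)) (hsh hg hB) hl.le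
    rw [partialDeriv_add_single ((hf.mul hg).of_le (by norm_cast; omega)),
      axisDeriv_mul (hf.of_le (by norm_cast; omega)) (hg.of_le (by norm_cast; omega)),
      partialDeriv_add (hl ▸ hf1.mul hg0) (hl ▸ hf0.mul hg1)]
    refine (abs_add_le _ _).trans ((add_le_add h1 h2).trans (le_of_eq ?_))
    rw [deg_add_single, pow_succ]
    ring


/-! ### Derivatives of test functions and of distributions -/

theorem partialDeriv_partialDeriv {d : ℕ} {k l : Fin d → ℕ} {f : Euc d → ℝ}
    (hf : ContDiff ℝ (deg k + deg l : ℕ) f) :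
    partialDeriv k (partialDeriv l f) = partialDeriv (k + l) f := by
  have h := ((isJet_of_contDiff hf).shift l le_rfl).partialDeriv_eq le_rfl
  simpa using h

theorem partialDeriv_single_eq {d : ℕ} {i : Fin d} {a : ℕ} {f : Euc d → ℝ}
    (hf : ContDiff ℝ a f) : partialDeriv (Pi.single i a) f = (axisDeriv i)^[a] f := by
  have h := (isJet_of_contDiff hf).iterate_axisDeriv_eq i a (k := 0) (by simp [deg_zero])
  rw [partialDeriv_zero, zero_add] at h
  exact h.symm

theorem contDiff_nat_of_test {d : ℕ} (φ : Test d) (n : ℕ) : ContDiff ℝ n φ :=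
  φ.contDiff.of_le (by exact_mod_cast le_top)

theorem coe_lineDerivOp_test {d : ℕ} (i : Fin d) (φ : Test d) :
    ⇑(∂_{basisVec i} φ : Test d) = axisDeriv i φ := by
  ext z
  rw [TestFunction.lineDerivOp_eq_lineDerivCLM ℝ]
  exact TestFunction.lineDerivCLM_apply_of_le (by simp)

theorem coe_iterate_lineDerivOp_test {d : ℕ} (i : Fin d) (a : ℕ) (φ : Test d) :
    ⇑((fun h : Test d => ∂_{basisVec i} h)^[a] φ) = (axisDeriv i)^[a] φ := by
  induction a generalizing φ with
  | zero => rfl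
  | succ a ih => rw [Function.iterate_succ_apply, ih, Function.iterate_succ_apply,
      coe_lineDerivOp_test]

theorem coe_multiDeriv_test {d : ℕ} (k : Fin d → ℕ) (φ : Test d) :
    ⇑(multiDeriv k φ) = partialDeriv k φ := by
  unfold multiDeriv partialDeriv
  induction List.finRange d with
  | nil => rfl
  | cons j L ih =>
    rw [List.foldr_cons, List.foldr_cons, coe_iterate_lineDerivOp_test, ih]
    rfl

theorem mem_unitTests {d r : ℕ} {φ : Test d} : φ ∈ unitTests d r ↔
    tsupport φ ⊆ Metric.closedBall 0 1 ∧
      ∀ k : Fin d → ℕ, deg k ≤ r → ∀ x, |partialDeriv k φ x| ≤ 1 := by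
  simp only [unitTests, mem_ofPred_eq, coe_multiDeriv_test]

theorem iterate_lineDerivOp_distr {d : ℕ} (i : Fin d) (a : ℕ) (F : Distr d) (φ : Test d) :
    ((fun h : Distr d => ∂_{basisVec i} h)^[a] F) φ =
      (-1) ^ a * F ((fun h : Test d => ∂_{basisVec i} h)^[a] φ) := by
  induction a generalizing φ with
  | zero => simp
  | succ a ih =>
    rw [Function.iterate_succ_apply', Distribution.lineDerivOp_apply_apply, map_neg, ih,
      ← Function.iterate_succ_apply, pow_succ]
    ring

theorem multiDeriv_distr {d : ℕ} (k : Fin d → ℕ) (F : Distr d) (φ : Test d) :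
    multiDeriv k F φ = (-1) ^ deg k * F (multiDeriv k φ) := by
  -- Duality moves the derivatives onto the test function in the reverse order, so only the total
  -- multi-index reached is recorded; derivatives of a smooth function are determined by it.
  have key : ∀ (L : List (Fin d)) (φ : Test d), ∃ ψ : Test d,
      (L.foldr (fun i g => (fun h : Distr d => ∂_{basisVec i} h)^[k i] g) F) φ =
        (-1) ^ (L.map k).sum * F ψ ∧
      ⇑ψ = partialDeriv (L.map fun i => Pi.single i (k i)).sum φ := by
    intro L
    induction L with
    | nil => intro φ; exact ⟨φ, by simp, by simp [partialDeriv_zero]⟩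
    | cons j L ih =>
      intro φ
      obtain ⟨ψ, h1, h2⟩ := ih ((fun h : Test d => ∂_{basisVec j} h)^[k j] φ)
      refine ⟨ψ, ?_, ?_⟩
      · rw [List.foldr_cons, iterate_lineDerivOp_distr, h1, List.map_cons, List.sum_cons, pow_add,
          mul_assoc]
      · rw [h2, coe_iterate_lineDerivOp_test, ← partialDeriv_single_eq (contDiff_nat_of_test _ _),
          partialDeriv_partialDeriv (contDiff_nat_of_test _ _), List.map_cons, List.sum_cons,
          add_comm]
  obtain ⟨ψ, h1, h2⟩ := key (List.finRange d) φ
  have h3 : ((List.finRange d).map fun i => (Pi.single i (k i) : Fin d → ℕ)).sum = k := by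
    rw [← List.ofFn_eq_map, List.sum_ofFn]
    exact Finset.univ_sum_single k
  rw [h3, ← coe_multiDeriv_test] at h2
  rw [show ψ = multiDeriv k φ from DFunLike.coe_injective h2, sum_map_finRange] at h1
  exact h1

/-- A smooth compactly supported function, as a test function. -/
def mkTest {d : ℕ} (g : Euc d → ℝ) (h1 : ContDiff ℝ ((⊤ : ℕ∞) : WithTop ℕ∞) g)
    (h2 : HasCompactSupport g) : Test d where
  toFun := g
  contDiff' := h1
  hasCompactSupport' := h2
  tsupport_subset' := fun _ _ => trivial

theorem coe_toTestC {d r : ℕ} {g : Euc d → ℝ} (h1 : ContDiff ℝ r g) (h2 : HasCompactSupport g) :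
    ⇑(toTestC r g) = g := by
  rw [toTestC, dif_pos ⟨h1, h2⟩]; rfl

/-! ### Iterated derivatives and partial derivatives -/

theorem iteratedFDeriv_basisVec {d j : ℕ} {f : Euc d → ℝ} (hf : ContDiff ℝ j f)
    (σ : Fin j → Fin d) (z : Euc d) :
    iteratedFDeriv ℝ j f z (fun a => basisVec (σ a)) =
      partialDeriv (∑ a, Pi.single (σ a) 1) f z := by
  induction j generalizing z with
  | zero => simp [partialDeriv_zero]
  | succ j ih =>
    have hdiff : DifferentiableAt ℝ (iteratedFDeriv ℝ j f) z :=
      (hf.differentiable_iteratedFDeriv (by norm_cast; omega)) z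
    rw [iteratedFDeriv_succ_apply_left, Fin.sum_univ_succ, add_comm (Pi.single (σ 0) 1)]
    have hf' : ContDiff ℝ j f := hf.of_le (by norm_cast; omega)
    have hs : deg (∑ a : Fin j, (Pi.single (σ a.succ) 1 : Fin d → ℕ)) = j := by
      simp [deg, Finset.sum_apply, Finset.sum_comm (s := (Finset.univ : Finset (Fin d)))]
    rw [← axisDeriv_partialDeriv (by rwa [hs])]
    have h1 : (fun y => iteratedFDeriv ℝ j f y (Fin.tail fun a => basisVec (σ a))) =
        partialDeriv (∑ a : Fin j, Pi.single (σ a.succ) 1) f := by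
      ext y; exact ih hf' (fun a => σ a.succ) y
    rw [← fderiv_continuousMultilinear_apply_const_apply hdiff, h1,
      axisDeriv_eq_fderiv (contDiff_partialDeriv (n := 1) (hf.of_le (by rw [hs, add_comm])))]

theorem abs_partialDeriv_le_norm_iteratedFDeriv {d : ℕ} {f : Euc d → ℝ} {k : Fin d → ℕ}
    (hf : ContDiff ℝ (deg k) f) (z : Euc d) :
    |partialDeriv k f z| ≤ ‖iteratedFDeriv ℝ (deg k) f z‖ := by
  obtain ⟨σ, hσ⟩ : ∃ σ : Fin (deg k) → Fin d, k = ∑ a, Pi.single (σ a) 1 := by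
    clear hf
    generalize hn : deg k = n
    induction n generalizing k with
    | zero => exact ⟨Fin.elim0, by simpa using deg_eq_zero.1 hn⟩
    | succ n ih =>
      obtain ⟨l, i, rfl, hl⟩ := exists_eq_add_single hn
      obtain ⟨σ, hσ⟩ := ih hl
      exact ⟨Fin.cons i σ, by rw [Fin.sum_univ_succ]; simp [← hσ, add_comm]⟩
  have h := iteratedFDeriv_basisVec hf σ z
  rw [← hσ] at h
  rw [← h, ← Real.norm_eq_abs]
  refine (ContinuousMultilinearMap.le_opNorm _ _).trans ?_
  simp [basisVec]

/-- Expanding each of the j arguments in the basis produces d^j terms, each a partial derivative of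
total order j. -/
theorem norm_iteratedFDeriv_le_of_partialDeriv {d j : ℕ} {f : Euc d → ℝ} (hf : ContDiff ℝ j f)
    {z : Euc d} {M : ℝ} (hM : 0 ≤ M) (h : ∀ k, deg k = j → |partialDeriv k f z| ≤ M) :
    ‖iteratedFDeriv ℝ j f z‖ ≤ (d : ℝ) ^ j * M := by
  refine ContinuousMultilinearMap.opNorm_le_bound (by positivity) fun v => ?_
  have hv : v = fun a => ∑ i, v a i • (basisVec i : Euc d) := by
    ext a i
    simp [basisVec, Finset.sum_apply, Pi.single_apply]
  conv_lhs => rw [hv]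
  rw [ContinuousMultilinearMap.map_sum]
  have hs : ∀ σ : Fin j → Fin d,
      deg (∑ a : Fin j, (Pi.single (σ a) 1 : Fin d → ℕ)) = j := fun σ => by
    simp [deg, Finset.sum_apply, Finset.sum_comm (s := (Finset.univ : Finset (Fin d)))]
  have h1 : ∀ σ ∈ (Finset.univ : Finset (Fin j → Fin d)),
      ‖iteratedFDeriv ℝ j f z fun a => v a (σ a) • (basisVec (σ a) : Euc d)‖ ≤
        M * ∏ a, ‖v a‖ := by
    intro σ _
    rw [ContinuousMultilinearMap.map_smul_univ, iteratedFDeriv_basisVec hf, norm_smul, mul_comm]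
    refine mul_le_mul (h _ (hs σ)) ?_ (norm_nonneg _) hM
    rw [Real.norm_eq_abs, Finset.abs_prod]
    exact Finset.prod_le_prod (fun _ _ => abs_nonneg _) fun a _ => abs_coord_le _ _
  refine (norm_sum_le_of_le _ h1).trans (le_of_eq ?_)
  simp [mul_assoc]

/-! ### Continuous linear functionals on test functions -/

/-- On functions supported in a fixed compact set the topology is given by the seminorms of the
iterated derivatives. A continuous functional is bounded by finitely many of them, which are here
expressed through partial derivatives. -/
theorem exists_bound_of_continuous {d : ℕ} {n : ℕ∞} (T : 𝓓'^{n}((⊤ : Opens (Euc d)), ℝ))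
    {L : Set (Euc d)} (hL : IsCompact L) :
    ∃ r : ℕ, (r : ℕ∞) ≤ n ∧ ∃ C : ℝ, 0 ≤ C ∧
      ∀ φ : 𝓓^{n}((⊤ : Opens (Euc d)), ℝ), (∀ z ∉ L, φ z = 0) → ∀ M : ℝ, 0 ≤ M →
        (∀ k, deg k ≤ r → ∀ z, |partialDeriv k φ z| ≤ M) → |T φ| ≤ C * M := by
  classical
  let LC : Compacts (Euc d) := ⟨L, hL⟩
  have hLt : (LC : Set (Euc d)) ⊆ ((⊤ : Opens (Euc d)) : Set (Euc d)) := fun _ _ => trivial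
  let A : 𝓓^{n}_{LC}(Euc d, ℝ) →ₗ[ℝ] ℝ :=
    { toFun := fun f => T (TestFunction.ofSupportedIn hLt f)
      map_add' := fun f g => map_add T (TestFunction.ofSupportedIn hLt f)
        (TestFunction.ofSupportedIn hLt g)
      map_smul' := fun c f => map_smul T c (TestFunction.ofSupportedIn hLt f) }
  have hA : Continuous A :=
    T.continuous.comp (TestFunction.continuous_ofSupportedIn hLt)
  obtain ⟨s, C, -, hC⟩ := Seminorm.bound_of_continuous
    (ContDiffMapSupportedIn.withSeminorms ℝ (Euc d) ℝ n LC)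
    ((normSeminorm ℝ ℝ).comp A) (continuous_norm.comp hA)
  -- Only the seminorms of order at most n contribute, so the order obtained does not exceed n.
  set s' := s.filter fun i : ℕ => (i : ℕ∞) ≤ n with hs'
  refine ⟨s'.sup id, ?_, C * ((d : ℝ) + 1) ^ (s'.sup id), by positivity, ?_⟩
  · rcases s'.eq_empty_or_nonempty with h | h
    · simp [h]
    · obtain ⟨i, hi, hi'⟩ := Finset.exists_mem_eq_sup s' h id
      rw [hi']
      exact (Finset.mem_filter.1 hi).2
  · intro φ hφ M hM hbd
    let f : 𝓓^{n}_{LC}(Euc d, ℝ) :=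
      ContDiffMapSupportedIn.of_support_subset φ.contDiff
        (fun z hz => by by_contra h; exact hz (hφ z h))
    have h1 := hC f
    have h2 : ((normSeminorm ℝ ℝ).comp A) f = |T φ| := rfl
    rw [h2] at h1
    refine h1.trans ?_
    rw [smul_apply, NNReal.smul_def, smul_eq_mul, mul_assoc]
    refine mul_le_mul_of_nonneg_left ?_ C.2
    refine Seminorm.finset_sup_apply_le (by positivity) fun i hi => ?_
    rw [ContDiffMapSupportedIn.seminorm_le_iff ℝ (by positivity)]
    intro hin z _
    have hi' : i ≤ s'.sup id :=
      Finset.le_sup (f := id) (Finset.mem_filter.2 ⟨hi, hin⟩)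
    have h3 : ContDiff ℝ i φ := φ.contDiff.of_le (by exact_mod_cast hin)
    refine (norm_iteratedFDeriv_le_of_partialDeriv h3 hM fun k hk => hbd k (hk ▸ hi') z).trans ?_
    gcongr
    calc (d : ℝ) ^ i ≤ ((d : ℝ) + 1) ^ i := by gcongr; linarith
      _ ≤ _ := pow_le_pow_right₀ (by linarith [Nat.cast_nonneg (α := ℝ) d]) hi'

/-- The converse of the preceding bound: the test function space carries the inductive limit
topology, so continuity is checked on each compact set separately. -/
theorem exists_clm_of_bound {d : ℕ} {n : ℕ∞} (A : 𝓓^{n}((⊤ : Opens (Euc d)), ℝ) → ℝ)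
    (hadd : ∀ f g, A (f + g) = A f + A g) (hsmul : ∀ (c : ℝ) f, A (c • f) = c * A f)
    (hbd : ∀ L : Set (Euc d), IsCompact L → ∃ r : ℕ, (r : ℕ∞) ≤ n ∧ ∃ C : ℝ, 0 ≤ C ∧
      ∀ φ : 𝓓^{n}((⊤ : Opens (Euc d)), ℝ), (∀ z ∉ L, φ z = 0) → ∀ M : ℝ, 0 ≤ M →
        (∀ k, deg k ≤ r → ∀ z, |partialDeriv k φ z| ≤ M) → |A φ| ≤ C * M) :
    ∃ T : 𝓓'^{n}((⊤ : Opens (Euc d)), ℝ), ∀ φ, T φ = A φ := by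
  have hcont : ∀ (K : Compacts (Euc d)) (hK : (K : Set (Euc d)) ⊆ (⊤ : Opens (Euc d))),
      Continuous (A ∘ TestFunction.ofSupportedIn (n := n) hK) := by
    intro K hK
    obtain ⟨r, hr, C, hC, h⟩ := hbd K K.isCompact
    let B : 𝓓^{n}_{K}(Euc d, ℝ) →L[ℝ] ℝ :=
      ContDiffMapSupportedIn.mkCLMtoNormedSpace ℝ
        (fun f => A (TestFunction.ofSupportedIn hK f))
        (fun f g => hadd (TestFunction.ofSupportedIn hK f) (TestFunction.ofSupportedIn hK g))
        (fun c f => hsmul c (TestFunction.ofSupportedIn hK f))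
        ⟨Finset.range (r + 1), C, hC, fun f => by
          refine h _ (fun z hz => f.zero_on_compl hz) _ (apply_nonneg _ _) fun k hk z => ?_
          have hkn : (deg k : ℕ∞) ≤ n := le_trans (by exact_mod_cast hk) hr
          have h1 : ContDiff ℝ (deg k) f := f.contDiff.of_le (by exact_mod_cast hkn)
          refine (abs_partialDeriv_le_norm_iteratedFDeriv h1 z).trans ?_
          refine (ContDiffMapSupportedIn.norm_iteratedFDeriv_apply_le_seminorm ℝ hkn).trans ?_
          exact Seminorm.le_finset_sup_apply (Finset.mem_range.2 (by omega))⟩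
    exact B.continuous
  let T0 := TestFunction.mkCLM ℝ A hadd hsmul hcont
  exact ⟨{ T0 with }, fun φ => rfl⟩


/-! ### Integrals of functions depending on a parameter -/

section ParameterIntegral

variable {d r : ℕ} {X : Type*} [TopologicalSpace X] {H : (Fin d → ℕ) → X → Euc d → ℝ}

/-- The bound forces `A` to vanish on the kernel of `J`, hence `A` factors through a bounded
functional on the range of `J`, which Hahn–Banach extends to the whole space. -/
theorem exists_clm_comp_eq {V E : Type*} [AddCommGroup V] [Module ℝ V] [NormedAddCommGroup E]
    [NormedSpace ℝ E] (J : V →ₗ[ℝ] E) (A : V →ₗ[ℝ] ℝ) {C : ℝ} (h : ∀ v, |A v| ≤ C * ‖J v‖) :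
    ∃ Φ : E →L[ℝ] ℝ, ∀ v, Φ (J v) = A v := by
  have hker : LinearMap.ker J ≤ LinearMap.ker A := by
    intro v hv
    have := h v
    rw [LinearMap.mem_ker.1 hv, norm_zero, mul_zero] at this
    exact abs_nonpos_iff.1 this
  set f : LinearMap.range J →ₗ[ℝ] ℝ :=
    (LinearMap.ker J).liftQ A hker ∘ₗ J.quotKerEquivRange.symm.toLinearMap with hf
  have hfJ : ∀ v, f ⟨J v, LinearMap.mem_range_self J v⟩ = A v := by
    intro v
    simp only [hf, LinearMap.comp_apply, LinearEquiv.coe_coe]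
    rw [LinearMap.quotKerEquivRange_symm_apply_image]
    simp
  have hfb : ∀ w, ‖f w‖ ≤ C * ‖w‖ := by
    rintro ⟨w, v, rfl⟩
    rw [hfJ]
    exact h v
  obtain ⟨Φ, hΦ, -⟩ := exists_extension_norm_eq (LinearMap.range J) (f.mkContinuous C hfb)
  refine ⟨Φ, fun v => ?_⟩
  rw [← hfJ]
  exact hΦ ⟨J v, LinearMap.mem_range_self J v⟩

/-- A functional on compactly supported functions of class `C^r` is a continuous functional of the
restriction of the jet to a compact set containing the support. -/
theorem exists_clm_jet (T : DistrC d r) {L : Set (Euc d)} (hL : IsCompact L) :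
    letI : CompactSpace L := isCompact_iff_compactSpace.1 hL
    ∃ Φ : ({k : Fin d → ℕ // k ∈ below d (r + 1)} → C(L, ℝ)) →L[ℝ] ℝ,
      ∀ u : (Fin d → ℕ) → Euc d → ℝ, IsJet r u → (∀ y ∉ L, u 0 y = 0) →
        ∀ c : {k : Fin d → ℕ // k ∈ below d (r + 1)} → C(L, ℝ), (∀ k y, c k y = u k.1 y) →
          T (toTestC r (u 0)) = Φ c := by
  have : CompactSpace L := isCompact_iff_compactSpace.1 hL
  obtain ⟨r', hr', C, hC0, hC⟩ := exists_bound_of_continuous T hL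
  have hr'' : r' ≤ r := by exact_mod_cast hr'
  let V : Submodule ℝ (Euc d → ℝ) :=
    { carrier := {g | ContDiff ℝ r g ∧ ∀ y ∉ L, g y = 0}
      add_mem' := fun {f g} hf hg => ⟨hf.1.add hg.1, fun y hy => by
        simp [hf.2 y hy, hg.2 y hy]⟩
      zero_mem' := ⟨contDiff_const, fun _ _ => rfl⟩
      smul_mem' := fun c f hf => ⟨hf.1.const_smul c, fun y hy => by simp [hf.2 y hy]⟩ }
  have hcs : ∀ g : V, HasCompactSupport g.1 := fun g =>
    HasCompactSupport.intro hL fun y hy => g.2.2 y hy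
  have hcoe : ∀ g : V, ⇑(toTestC r g.1) = g.1 := fun g => coe_toTestC g.2.1 (hcs g)
  let A : V →ₗ[ℝ] ℝ :=
    { toFun := fun g => T (toTestC r g.1)
      map_add' := fun f g => by
        rw [← map_add]
        congr 1
        apply DFunLike.coe_injective
        rw [hcoe (f + g), FunLike.coe_add, hcoe, hcoe]; rfl
      map_smul' := fun c f => by
        rw [← map_smul]
        congr 1
        apply DFunLike.coe_injective
        rw [hcoe (c • f), RingHom.id_apply, FunLike.coe_smul, hcoe]; rfl }
  let E := {k : Fin d → ℕ // k ∈ below d (r + 1)} → C(L, ℝ)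
  have hjet : ∀ g : V, IsJet r fun k => partialDeriv k g.1 := fun g => isJet_of_contDiff g.2.1
  have hdeg : ∀ k : {k : Fin d → ℕ // k ∈ below d (r + 1)}, deg k.1 ≤ r := fun k => by
    have := mem_below.1 k.2; omega
  let J : V →ₗ[ℝ] E :=
    { toFun := fun g k => ⟨fun y => partialDeriv k.1 g.1 y,
        ((hjet g).continuous k.1 (hdeg k)).comp continuous_subtype_val⟩
      map_add' := fun f g => by
        ext k y
        exact congrFun (partialDeriv_add (k := k.1) (f.2.1.of_le (by exact_mod_cast hdeg k))
          (g.2.1.of_le (by exact_mod_cast hdeg k))) y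
      map_smul' := fun c f => by
        ext k y
        exact congrFun (partialDeriv_const_mul (k := k.1)
          (f.2.1.of_le (by exact_mod_cast hdeg k)) c) y }
  -- All derivatives vanish off `L`, so suprema over the whole space are suprema over `L`, that is,
  -- norms in `C(L, ℝ)`.
  have hzero : ∀ (g : V) (k : Fin d → ℕ), deg k ≤ r → ∀ y ∉ L, partialDeriv k g.1 y = 0 := by
    intro g k hk y hy
    have hev : g.1 =ᶠ[𝓝 y] fun _ => (0 : ℝ) := by
      filter_upwards [hL.isClosed.isOpen_compl.mem_nhds hy] with z hz using g.2.2 z hz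
    have h1 := abs_partialDeriv_le_norm_iteratedFDeriv (k := k)
      (g.2.1.of_le (by exact_mod_cast hk)) y
    rw [(Filter.EventuallyEq.iteratedFDeriv ℝ hev (deg k)).eq_of_nhds] at h1
    simpa using h1
  have hbd : ∀ g : V, |A g| ≤ C * ‖J g‖ := by
    intro g
    refine hC (toTestC r g.1) (fun z hz => by rw [hcoe]; exact g.2.2 z hz) _ (norm_nonneg _) ?_
    intro k hk z
    rw [hcoe]
    by_cases hz : z ∈ L
    · have h1 : ‖J g ⟨k, mem_below.2 (by omega)⟩ ⟨z, hz⟩‖ ≤ ‖J g‖ :=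
        (ContinuousMap.norm_coe_le_norm _ _).trans (norm_le_pi_norm (J g) _)
      exact h1
    · rw [hzero g k (by omega) z hz, abs_zero]; exact norm_nonneg _
  obtain ⟨Φ, hΦ⟩ := exists_clm_comp_eq J A hbd
  refine ⟨Φ, fun u hu hu0 c hc => ?_⟩
  have h1 := hΦ ⟨u 0, hu.contDiff, hu0⟩
  have h2 : J ⟨u 0, hu.contDiff, hu0⟩ = c := by
    ext k y
    rw [hc]
    exact congrFun (hu.partialDeriv_eq (hdeg k)) y
  rw [h2] at h1
  exact h1.symm

/-- The jet of a function depending on a parameter, restricted to a compact set. -/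
def jetCurry (L : Set (Euc d))
    (hc : ∀ k, deg k ≤ r → Continuous fun p : X × Euc d => H k p.1 p.2) (t : X)
    (k : {k : Fin d → ℕ // k ∈ below d (r + 1)}) : C(L, ℝ) :=
  (⟨fun p : X × L => H k.1 p.1 p.2, (hc k.1 (by have := mem_below.1 k.2; omega)).comp
      (continuous_fst.prodMk (continuous_subtype_val.comp continuous_snd))⟩ : C(X × L, ℝ)).curry t

/-- Through `exists_clm_jet` the claim becomes the continuity of a curve in a finite product of the
Banach spaces `C(L, ℝ)`, which is a matter of currying. -/
theorem continuous_distrC (T : DistrC d r)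
    (hc : ∀ k, deg k ≤ r → Continuous fun p : X × Euc d => H k p.1 p.2)
    (hj : ∀ t, IsJet r fun k => H k t) {L : Set (Euc d)} (hL : IsCompact L)
    (hs : ∀ t, ∀ y ∉ L, H 0 t y = 0) :
    Continuous fun t => T (toTestC r (H 0 t)) := by
  have : CompactSpace L := isCompact_iff_compactSpace.1 hL
  obtain ⟨Φ, hΦ⟩ := exists_clm_jet T hL
  have h1 : (fun t => T (toTestC r (H 0 t))) = fun t => Φ (jetCurry L hc t) := by
    ext t
    exact hΦ (fun k => H k t) (hj t) (hs t) _ fun k y => rfl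
  rw [h1]
  exact Φ.continuous.comp (continuous_pi fun k => (ContinuousMap.curry _).continuous)

variable [FirstCountableTopology X] [LocallyCompactSpace X] [SecondCountableTopology X] [T2Space X]
  [MeasurableSpace X] [BorelSpace X] {μ : Measure X} [IsLocallyFiniteMeasure μ] {Q : Set X}

theorem hasFDerivAt_integral_jet (hQ : IsCompact Q)
    (hc : ∀ k, deg k ≤ r → Continuous fun p : X × Euc d => H k p.1 p.2)
    (hj : ∀ t, IsJet r fun k => H k t) {k : Fin d → ℕ} (hk : deg k < r) (y : Euc d) :
    HasFDerivAt (fun y => ∫ t in Q, H k t y ∂μ)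
      (∑ i, (∫ t in Q, H (k + Pi.single i 1) t y ∂μ) • (coord i : Euc d →L[ℝ] ℝ)) y := by
  have hci : ∀ i : Fin d, Continuous fun p : X × Euc d => H (k + Pi.single i 1) p.1 p.2 :=
    fun i => hc _ (by rw [deg_add_single]; omega)
  have hck := hc k hk.le
  obtain ⟨F', hF'⟩ : ∃ F' : Euc d → X → (Euc d →L[ℝ] ℝ), ∀ y t, F' y t =
    ∑ i, H (k + Pi.single i 1) t y • (coord i : Euc d →L[ℝ] ℝ) := ⟨_, fun _ _ => rfl⟩
  have hF'c : Continuous fun p : X × Euc d => F' p.2 p.1 := by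
    simp only [hF']
    exact continuous_finsetSum _ fun i _ => (hci i).smul continuous_const
  have hKc : IsCompact (Q ×ˢ Metric.closedBall y 1) := hQ.prod (isCompact_closedBall y 1)
  obtain ⟨M, hM⟩ := hKc.exists_bound_of_continuousOn hF'c.continuousOn
  have hm1 : ∀ᶠ z in 𝓝 y, AEStronglyMeasurable (fun t => H k t z) (μ.restrict Q) :=
    Eventually.of_forall fun z => by
      have : Continuous fun t => H k t z := hck.comp (Continuous.prodMk_left z)
      exact this.aestronglyMeasurable
  have hm2 : Integrable (fun t => H k t y) (μ.restrict Q) := by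
    have : Continuous fun t => H k t y := hck.comp (Continuous.prodMk_left y)
    exact this.continuousOn.integrableOn_compact hQ
  have hm3 : AEStronglyMeasurable (F' y) (μ.restrict Q) := by
    have : Continuous fun t => F' y t := hF'c.comp (Continuous.prodMk_left y)
    exact this.aestronglyMeasurable
  have hm4 : ∀ᵐ t ∂(μ.restrict Q), ∀ z ∈ Metric.closedBall y 1, ‖F' z t‖ ≤ M := by
    refine (ae_restrict_iff' hQ.measurableSet).2 (Eventually.of_forall fun t ht z hz => ?_)
    exact hM (t, z) ⟨ht, hz⟩
  have hm5 : Integrable (fun _ : X => M) (μ.restrict Q) := by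
    have : IsFiniteMeasure (μ.restrict Q) := ⟨by
      rw [Measure.restrict_apply_univ]; exact hQ.measure_lt_top⟩
    exact integrable_const _
  have hm6 : ∀ᵐ t ∂(μ.restrict Q), ∀ z ∈ Metric.closedBall y 1,
      HasFDerivAt (fun z => H k t z) (F' z t) z :=
    Eventually.of_forall fun t z _ => by
      rw [hF']; exact (hj t).hasFDerivAt k hk z
  have h1 := hasFDerivAt_integral_of_dominated_of_fderiv_le
    (Metric.closedBall_mem_nhds y one_pos) hm1 hm2 hm3 hm4 hm5 hm6
  refine h1.congr_fderiv ?_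
  have hint : ∀ i ∈ Finset.univ, Integrable (fun t => H (k + Pi.single i 1) t y •
      (coord i : Euc d →L[ℝ] ℝ)) (μ.restrict Q) := by
    intro i _
    have : Continuous fun t => H (k + Pi.single i 1) t y • (coord i : Euc d →L[ℝ] ℝ) :=
      ((hci i).comp (Continuous.prodMk_left y)).smul continuous_const
    exact this.continuousOn.integrableOn_compact hQ
  simp only [hF']
  rw [integral_finsetSum _ hint]
  refine Finset.sum_congr rfl fun i _ => ?_
  rw [integral_smul_const]

theorem isJet_integral (hQ : IsCompact Q)
    (hc : ∀ k, deg k ≤ r → Continuous fun p : X × Euc d => H k p.1 p.2)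
    (hj : ∀ t, IsJet r fun k => H k t) :
    IsJet r fun k y => ∫ t in Q, H k t y ∂μ where
  hasFDerivAt k hk y := hasFDerivAt_integral_jet hQ hc hj hk y
  continuous k hk := by
    have h := continuous_parametric_integral_of_continuous (μ := μ) (f := fun y t => H k t y)
      ((hc k hk).comp continuous_swap) hQ
    exact h

/-- A Fubini theorem for functionals of order r. The jet of the integral is the Bochner integral of
the jets in a finite product of `C(L, ℝ)`, and the functional factors continuously through that
space. -/
theorem distrC_integral (T : DistrC d r) (hQ : IsCompact Q)
    (hc : ∀ k, deg k ≤ r → Continuous fun p : X × Euc d => H k p.1 p.2)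
    (hj : ∀ t, IsJet r fun k => H k t) {L : Set (Euc d)} (hL : IsCompact L)
    (hs : ∀ t, ∀ y ∉ L, H 0 t y = 0) :
    T (toTestC r fun y => ∫ t in Q, H 0 t y ∂μ) = ∫ t in Q, T (toTestC r (H 0 t)) ∂μ := by
  have : CompactSpace L := isCompact_iff_compactSpace.1 hL
  obtain ⟨Φ, hΦ⟩ := exists_clm_jet T hL
  have hI := isJet_integral (μ := μ) hQ hc hj
  have hJc : Continuous fun t => jetCurry L hc t :=
    continuous_pi fun k => (ContinuousMap.curry _).continuous
  have hJi : IntegrableOn (fun t => jetCurry L hc t) Q μ :=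
    hJc.continuousOn.integrableOn_compact hQ
  have hJI : T (toTestC r fun y => ∫ t in Q, H 0 t y ∂μ) =
      Φ (∫ t in Q, jetCurry L hc t ∂μ) := by
    refine hΦ _ hI (fun y hy => by simp [hs _ y hy]) _ fun k y => ?_
    let ev : ({k : Fin d → ℕ // k ∈ below d (r + 1)} → C(L, ℝ)) →L[ℝ] ℝ :=
      (ContinuousMap.evalCLM ℝ y).comp (ContinuousLinearMap.proj k)
    exact (ev.integral_comp_comm hJi).symm
  rw [hJI, ← Φ.integral_comp_comm hJi]
  refine integral_congr_ae (Eventually.of_forall fun t => ?_)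
  exact (hΦ (fun k => H k t) (hj t) (hs t) _ fun k y => rfl).symm

end ParameterIntegral


/-! ### Mollification -/

/-- The average of the translates `g (y - ε t)`, with weight `η t`. -/
def average {d : ℕ} (η g : Euc d → ℝ) (ε : ℝ) (y : Euc d) : ℝ := ∫ t, η t * g (y - ε • t)

theorem hasCompactSupport_of_zero {d : ℕ} {g : Euc d → ℝ} {x : Euc d} {s : ℝ}
    (h : ∀ z, s < ‖z - x‖ → g z = 0) : HasCompactSupport g :=
  HasCompactSupport.intro (isCompact_closedBall x s) fun z hz => h z (by
    simpa [dist_eq_norm] using hz)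

theorem exists_zero_of_hasCompactSupport {d : ℕ} {g : Euc d → ℝ} (h : HasCompactSupport g)
    (x : Euc d) : ∃ s, 0 < s ∧ ∀ z, s < ‖z - x‖ → g z = 0 := by
  obtain ⟨s, hs⟩ := h.isCompact.isBounded.subset_closedBall x
  refine ⟨max s 1, by positivity, fun z hz => image_eq_zero_of_notMem_tsupport fun hz' => ?_⟩
  have := hs hz'
  rw [Metric.mem_closedBall, dist_eq_norm] at this
  exact absurd (lt_of_le_of_lt (le_max_left s 1) hz) (not_lt.2 this)

theorem partialDeriv_eq_zero {d : ℕ} {g : Euc d → ℝ} {k : Fin d → ℕ} (hg : ContDiff ℝ (deg k) g)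
    {x : Euc d} {s : ℝ} (h : ∀ z, s < ‖z - x‖ → g z = 0) (z : Euc d) (hz : s < ‖z - x‖) :
    partialDeriv k g z = 0 := by
  have ho : IsOpen {z : Euc d | s < ‖z - x‖} :=
    isOpen_lt continuous_const (continuous_id.sub continuous_const).norm
  have hev : g =ᶠ[𝓝 z] fun _ => (0 : ℝ) := by
    filter_upwards [ho.mem_nhds hz] with w hw using h w hw
  have h1 := abs_partialDeriv_le_norm_iteratedFDeriv hg z
  rw [(Filter.EventuallyEq.iteratedFDeriv ℝ hev (deg k)).eq_of_nhds] at h1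
  simpa using h1

section Average

variable {d : ℕ} {η g : Euc d → ℝ}

theorem average_eq_setIntegral (hη0 : ∀ z, 1 < ‖z‖ → η z = 0) (ε : ℝ) (y : Euc d) :
    average η g ε y = ∫ t in Metric.closedBall 0 1, η t * g (y - ε • t) := by
  rw [average, setIntegral_eq_integral_of_forall_compl_eq_zero]
  intro t ht
  rw [hη0 t (by simpa using ht), zero_mul]

theorem average_eq_integral {ε : ℝ} (hε : 0 < ε) (y : Euc d) :
    average η g ε y = (ε ^ d)⁻¹ * ∫ w, η (ε⁻¹ • (y - w)) * g w := by
  have h1 : ∫ t, η t * g (y - ε • t) =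
      ∫ t, (fun v => η (ε⁻¹ • (y - (y - v))) * g (y - v)) (ε • t) := by
    refine integral_congr_ae (Eventually.of_forall fun t => ?_)
    simp only [sub_sub_cancel, smul_smul, inv_mul_cancel₀ hε.ne', one_smul]
  rw [average, h1, Measure.integral_comp_smul volume (fun v => η (ε⁻¹ • (y - (y - v))) * g (y - v)) ε]
  have h2 := integral_sub_left_eq_self (fun w => η (ε⁻¹ • (y - w)) * g w) volume y
  rw [h2]
  simp [abs_of_pos hε]

theorem integrable_average (hη : Continuous η) (hη0 : ∀ z, 1 < ‖z‖ → η z = 0) (hg : Continuous g)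
    (ε : ℝ) (y : Euc d) : Integrable fun t => η t * g (y - ε • t) := by
  refine Continuous.integrable_of_hasCompactSupport (by fun_prop) ?_
  exact (hasCompactSupport_of_zero (x := 0) (s := 1) (by simpa using hη0)).mul_right

theorem isJet_average_right {r : ℕ} (hη : Continuous η) (hη0 : ∀ z, 1 < ‖z‖ → η z = 0)
    (hg : ContDiff ℝ r g) (ε : ℝ) : IsJet r fun k => average η (partialDeriv k g) ε := by
  have hj := isJet_of_contDiff hg
  have h := isJet_integral (μ := volume) (isCompact_closedBall (0 : Euc d) 1)
    (H := fun k t y => η t * partialDeriv k g (y - ε • t)) (r := r)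
    (fun k hk => by have := hj.continuous k hk; fun_prop)
    (fun t => by
      have := (hj.comp_affine 1 (ε • t)).const_mul (η t)
      simpa using this)
  convert h using 3 with k
  exact average_eq_setIntegral hη0 ε _

/-- After the substitution w = y - ε t the derivatives fall on the weight, at the cost of a factor
ε⁻¹ each, and `g` need only be continuous. `isJet_average_right` puts them on `g` at no cost. -/
theorem isJet_average_left (n : ℕ) (hη : ContDiff ℝ n η)
    (hη0 : ∀ z, 1 < ‖z‖ → η z = 0) (hg : Continuous g) {x : Euc d} {s : ℝ}
    (hg0 : ∀ z, s < ‖z - x‖ → g z = 0) {ε : ℝ} (hε : 0 < ε) :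
    IsJet n fun k y => ε⁻¹ ^ deg k * average (partialDeriv k η) g ε y := by
  have hj := isJet_of_contDiff hη
  have h := isJet_integral (μ := volume) (isCompact_closedBall x s)
    (H := fun k w y => (ε ^ d)⁻¹ * g w * (ε⁻¹ ^ deg k * partialDeriv k η (ε⁻¹ • (y - w)))) (r := n)
    (fun k hk => by have := hj.continuous k hk; fun_prop)
    (fun w => (hj.comp_affine ε⁻¹ w).const_mul ((ε ^ d)⁻¹ * g w))
  convert h using 3 with k y
  rw [average_eq_integral hε, setIntegral_eq_integral_of_forall_compl_eq_zero,
    ← mul_assoc, ← integral_const_mul]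
  · refine integral_congr_ae (Eventually.of_forall fun w => ?_)
    ring
  · intro w hw
    rw [hg0 w (by simpa [dist_eq_norm] using hw)]
    ring

theorem average_eq_zero (hη0 : ∀ z, 1 < ‖z‖ → η z = 0) {x : Euc d} {s ε : ℝ} (hε : 0 ≤ ε)
    (hg0 : ∀ z, s < ‖z - x‖ → g z = 0) (y : Euc d) (hy : s + ε < ‖y - x‖) :
    average η g ε y = 0 := by
  rw [average, ← integral_zero (Euc d) ℝ]
  congr 1
  ext t
  by_cases ht : 1 < ‖t‖
  · rw [hη0 t ht, zero_mul]
  · rw [hg0 _ ?_, mul_zero]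
    have h1 : ‖ε • t‖ ≤ ε := by
      rw [norm_smul, Real.norm_of_nonneg hε]
      exact mul_le_of_le_one_right hε (not_lt.1 ht)
    have h2 : ‖y - x‖ ≤ ‖y - ε • t - x‖ + ‖ε • t‖ := by
      have := norm_add_le (y - ε • t - x) (ε • t)
      rwa [show y - ε • t - x + ε • t = y - x by abel] at this
    linarith

theorem abs_average_le (hη : Continuous η) (hη0 : ∀ z, 1 < ‖z‖ → η z = 0) {ε M : ℝ} {y : Euc d}
    (hM : ∀ t, ‖t‖ ≤ 1 → |g (y - ε • t)| ≤ M) :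
    |average η g ε y| ≤ (∫ t, |η t|) * M := by
  rw [average, ← integral_mul_const, ← Real.norm_eq_abs]
  refine norm_integral_le_of_norm_le ?_ (Eventually.of_forall fun t => ?_)
  · have h0 : HasCompactSupport η :=
      hasCompactSupport_of_zero (x := 0) (s := 1) (by simpa using hη0)
    exact (hη.integrable_of_hasCompactSupport h0).abs.mul_const M
  · rw [norm_mul, Real.norm_eq_abs, Real.norm_eq_abs]
    by_cases ht : 1 < ‖t‖
    · simp [hη0 t ht]
    · exact mul_le_mul_of_nonneg_left (hM t (not_lt.1 ht)) (abs_nonneg _)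

theorem average_sub_eq (hη : Continuous η) (hη0 : ∀ z, 1 < ‖z‖ → η z = 0) (hg : Continuous g)
    (ε : ℝ) (y : Euc d) (p : Euc d → ℝ) (hp : Continuous p) :
    average η g ε y - average η p ε y = average η (fun z => g z - p z) ε y := by
  rw [average, average, average, ← integral_sub (integrable_average hη hη0 hg ε y)
    (integrable_average hη hη0 hp ε y)]
  congr 1; ext t; ring

theorem average_const (c ε : ℝ) (y : Euc d) :
    average η (fun _ => c) ε y = (∫ t, η t) * c := by
  rw [average, integral_mul_const]

/-- Averages converge uniformly to the function. -/
theorem eventually_average_sub_le (hη : Continuous η) (hη0 : ∀ z, 1 < ‖z‖ → η z = 0)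
    (hη1 : ∫ t, η t = 1) (hg : Continuous g) (hgs : HasCompactSupport g) {δ : ℝ} (hδ : 0 < δ) :
    ∀ᶠ ε : ℝ in 𝓝[>] 0, ∀ y, |average η g ε y - g y| ≤ δ := by
  have hI : 0 < (∫ t, |η t|) + 1 := by
    have : 0 ≤ ∫ t, |η t| := integral_nonneg fun _ => abs_nonneg _
    linarith
  obtain ⟨τ, hτ, hu⟩ := Metric.uniformContinuous_iff.1
    (hgs.uniformContinuous_of_continuous hg) (δ / ((∫ t, |η t|) + 1)) (by positivity)
  filter_upwards [Ioo_mem_nhdsGT hτ] with ε hε y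
  have h1 : average η g ε y - g y = average η (fun z => g z - g y) ε y := by
    rw [← average_sub_eq hη hη0 hg ε y (fun _ => g y) continuous_const, average_const, hη1, one_mul]
  rw [h1]
  refine (abs_average_le hη hη0 (M := δ / ((∫ t, |η t|) + 1)) fun t ht => ?_).trans ?_
  · have h2 : dist (y - ε • t) y < τ := by
      rw [dist_eq_norm, sub_sub_cancel_left, norm_neg, norm_smul, Real.norm_of_nonneg hε.1.le]
      exact lt_of_le_of_lt (mul_le_of_le_one_right hε.1.le ht) hε.2
    exact (hu h2).le
  · rw [mul_div_assoc', div_le_iff₀ hI, mul_comm]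
    gcongr
    linarith

end Average

open Classical in
/-- The average of `g`, as a test function. -/
def averageTest {d : ℕ} (η : Test d) (g : Euc d → ℝ) (ε : ℝ) : Test d :=
  if h : ContDiff ℝ ((⊤ : ℕ∞) : WithTop ℕ∞) (average η g ε) ∧ HasCompactSupport (average η g ε)
  then mkTest _ h.1 h.2 else 0

theorem coe_averageTest {d : ℕ} {η : Test d} (hη0 : ∀ z, 1 < ‖z‖ → η z = 0) {g : Euc d → ℝ}
    (hg : Continuous g) (hgs : HasCompactSupport g) {ε : ℝ} (hε : 0 < ε) :
    ⇑(averageTest η g ε) = average η g ε := by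
  obtain ⟨s, -, hs⟩ := exists_zero_of_hasCompactSupport hgs 0
  have h1 : ContDiff ℝ ((⊤ : ℕ∞) : WithTop ℕ∞) (average η g ε) := by
    refine contDiff_infty.2 fun n => ?_
    have := (isJet_average_left n (contDiff_nat_of_test η n) hη0 hg hs hε).contDiff
    simpa [deg_zero, partialDeriv_zero] using this
  have h2 : HasCompactSupport (average η g ε) :=
    hasCompactSupport_of_zero (average_eq_zero hη0 hε.le hs)
  rw [averageTest, dif_pos ⟨h1, h2⟩]
  rfl

theorem partialDeriv_average {d r : ℕ} {η : Euc d → ℝ} (hη : Continuous η)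
    (hη0 : ∀ z, 1 < ‖z‖ → η z = 0) {g : Euc d → ℝ} (hg : ContDiff ℝ r g) (ε : ℝ)
    {k : Fin d → ℕ} (hk : deg k ≤ r) :
    partialDeriv k (average η g ε) = average η (partialDeriv k g) ε := by
  have := (isJet_average_right hη hη0 hg ε).partialDeriv_eq hk
  simpa only [partialDeriv_zero] using this

/-- A nonnegative test function of integral one, supported in the unit ball. -/
def stdBump (d : ℕ) : Test d :=
  let b : ContDiffBump (0 : Euc d) := ⟨1 / 2, 1, by norm_num, by norm_num⟩
  mkTest (b.normed volume) b.contDiff_normed b.hasCompactSupport_normed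

theorem stdBump_zero {d : ℕ} (z : Euc d) (hz : 1 < ‖z‖) : stdBump d z = 0 := by
  let b : ContDiffBump (0 : Euc d) := ⟨1 / 2, 1, by norm_num, by norm_num⟩
  apply image_eq_zero_of_notMem_tsupport
  change z ∉ tsupport (b.normed volume)
  rw [b.tsupport_normed_eq]
  simpa [b] using hz

theorem integral_stdBump (d : ℕ) : ∫ z, stdBump d z = 1 := by
  let b : ContDiffBump (0 : Euc d) := ⟨1 / 2, 1, by norm_num, by norm_num⟩
  exact b.integral_normed

theorem integral_abs_stdBump (d : ℕ) : ∫ z, |stdBump d z| = 1 := by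
  let b : ContDiffBump (0 : Euc d) := ⟨1 / 2, 1, by norm_num, by norm_num⟩
  have : ∀ z, |stdBump d z| = stdBump d z := fun z => abs_of_nonneg (b.nonneg_normed z)
  simp only [this, integral_stdBump]

/-! ### Extension of a distribution to functions of class `C^r` -/

theorem tendsto_of_uniform {d : ℕ} {n : ℕ∞} {ι : Type*} {l : Filter ι}
    (T : 𝓓'^{n}((⊤ : Opens (Euc d)), ℝ))
    {φ : ι → 𝓓^{n}((⊤ : Opens (Euc d)), ℝ)} {ψ : 𝓓^{n}((⊤ : Opens (Euc d)), ℝ)}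
    {L : Set (Euc d)} (hL : IsCompact L) (hφ : ∀ᶠ j in l, ∀ z ∉ L, φ j z = 0)
    (hψ : ∀ z ∉ L, ψ z = 0)
    (h : ∀ k : Fin d → ℕ, (deg k : ℕ∞) ≤ n → ∀ δ > 0, ∀ᶠ j in l, ∀ z,
      |partialDeriv k (φ j) z - partialDeriv k ψ z| ≤ δ) :
    Tendsto (fun j => T (φ j)) l (𝓝 (T ψ)) := by
  obtain ⟨r, hr, C, hC0, hC⟩ := exists_bound_of_continuous T hL
  rw [Metric.tendsto_nhds]
  intro δ hδ
  have hall : ∀ᶠ j in l, ∀ k ∈ below d (r + 1), ∀ z,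
      |partialDeriv k (φ j) z - partialDeriv k ψ z| ≤ δ / (2 * (C + 1)) := by
    rw [eventually_all_finset]
    intro k hk
    rw [mem_below] at hk
    exact h k (le_trans (by exact_mod_cast Nat.lt_succ_iff.1 hk) hr) _ (by positivity)
  filter_upwards [hall, hφ] with j hj hφj
  rw [Real.dist_eq, ← map_sub]
  have h1 := hC (φ j - ψ) (fun z hz => by rw [sub_apply, hφj z hz, hψ z hz, sub_zero])
    (δ / (2 * (C + 1))) (by positivity) (fun k hk z => by
      have hkn : (deg k : ℕ∞) ≤ n := le_trans (by exact_mod_cast hk) hr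
      have h2 : ∀ f : 𝓓^{n}((⊤ : Opens (Euc d)), ℝ), ContDiff ℝ (deg k) f := fun f =>
        f.contDiff.of_le (by exact_mod_cast hkn)
      have h3 := congrFun (partialDeriv_sub (k := k) (h2 (φ j)) (h2 ψ)) z
      have h4 : ⇑(φ j - ψ) = fun z => φ j z - ψ z := rfl
      rw [h4, h3]
      exact hj k (mem_below.2 (by omega)) z)
  refine h1.trans_lt ?_
  rw [mul_div_assoc', div_lt_iff₀ (by positivity)]
  nlinarith

/-- `F` is locally bounded by the first `r` derivatives of the test functions. -/
def LocBdd {d : ℕ} (r : ℕ) (F : Distr d) : Prop :=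
  ∀ R : ℝ, ∃ C : ℝ, 0 ≤ C ∧ ∀ φ : Test d, (∀ z, R < ‖z‖ → φ z = 0) → ∀ M : ℝ, 0 ≤ M →
    (∀ k, deg k ≤ r → ∀ z, |partialDeriv k φ z| ≤ M) → |F φ| ≤ C * M

theorem coe_monoCLM_test {d r : ℕ} (φ : Test d) :
    ⇑(TestFunction.monoCLM ℝ φ : TestC d r) = φ := by
  rw [TestFunction.monoCLM_apply, if_pos ⟨le_top, le_rfl⟩]

theorem tendsto_inv_nat_nhdsGT :
    Tendsto (fun j : ℕ => ((j : ℝ) + 1)⁻¹) atTop (𝓝[>] 0) := by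
  refine tendsto_nhdsWithin_iff.2 ⟨?_, Eventually.of_forall fun j => ?_⟩
  · simpa only [one_div] using tendsto_one_div_add_atTop_nhds_zero_nat (𝕜 := ℝ)
  · exact mem_Ioi.2 (by positivity)

section Extension

variable {d r : ℕ}

theorem eventually_partialDeriv_averageTest {η : Test d} (hη0 : ∀ z, 1 < ‖z‖ → η z = 0)
    (hη1 : ∫ t, η t = 1) {g : Euc d → ℝ} (hg : ContDiff ℝ r g) (hgs : HasCompactSupport g)
    {k : Fin d → ℕ} (hk : deg k ≤ r) {δ : ℝ} (hδ : 0 < δ) :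
    ∀ᶠ ε : ℝ in 𝓝[>] 0, ∀ z, |partialDeriv k (averageTest η g ε) z - partialDeriv k g z| ≤ δ := by
  obtain ⟨s, -, hs⟩ := exists_zero_of_hasCompactSupport hgs 0
  have h1 : HasCompactSupport (partialDeriv k g) :=
    hasCompactSupport_of_zero (partialDeriv_eq_zero (hg.of_le (by exact_mod_cast hk)) hs)
  filter_upwards [eventually_average_sub_le η.continuous hη0 hη1
    ((isJet_of_contDiff hg).continuous k hk) h1 hδ, self_mem_nhdsWithin] with ε hε hε0 z
  rw [coe_averageTest hη0 hg.continuous hgs hε0, partialDeriv_average η.continuous hη0 hg ε hk]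
  exact hε z

theorem averageTest_zero_of_notMem {η : Test d} (hη0 : ∀ z, 1 < ‖z‖ → η z = 0)
    {g : Euc d → ℝ} (hg : Continuous g) {x : Euc d} {s : ℝ} (hgs : ∀ z, s < ‖z - x‖ → g z = 0)
    {ε : ℝ} (hε0 : 0 < ε) (z : Euc d) (hz : s + ε < ‖z - x‖) : averageTest η g ε z = 0 := by
  rw [coe_averageTest hη0 hg (hasCompactSupport_of_zero hgs) hε0]
  exact average_eq_zero hη0 hε0.le hgs z hz

/-- The averages of a `C^r` function converge to it, when tested against a functional of order
`r`. -/
theorem IsExtension.tendsto_average {F : Distr d} {T : DistrC d r} (hT : IsExtension r F T)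
    {η : Test d} (hη0 : ∀ z, 1 < ‖z‖ → η z = 0) (hη1 : ∫ t, η t = 1) {g : Euc d → ℝ}
    (hg : ContDiff ℝ r g) (hgs : HasCompactSupport g) :
    Tendsto (fun ε => F (averageTest η g ε)) (𝓝[>] 0) (𝓝 (T (toTestC r g))) := by
  obtain ⟨s, -, hs⟩ := exists_zero_of_hasCompactSupport hgs 0
  have hmem : Ioo (0 : ℝ) 1 ∈ 𝓝[>] (0 : ℝ) := Ioo_mem_nhdsGT one_pos
  have h := tendsto_of_uniform (l := 𝓝[>] (0 : ℝ)) T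
    (φ := fun ε => TestFunction.monoCLM ℝ (averageTest η g ε)) (ψ := toTestC r g)
    (isCompact_closedBall (0 : Euc d) (s + 1))
    (by
      filter_upwards [hmem] with ε hε z hz
      rw [coe_monoCLM_test]
      refine averageTest_zero_of_notMem hη0 hg.continuous hs hε.1 z ?_
      have : s + 1 < ‖z - 0‖ := by simpa using hz
      linarith [hε.2])
    (by
      intro z hz
      rw [coe_toTestC hg hgs]
      refine hs z ?_
      have : s + 1 < ‖z - 0‖ := by simpa using hz
      linarith)
    (by
      intro k hk δ hδ
      simp only [coe_monoCLM_test, coe_toTestC hg hgs]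
      exact eventually_partialDeriv_averageTest hη0 hη1 hg hgs (by exact_mod_cast hk) hδ)
  exact h.congr fun ε => hT _

/-- The averages of a smooth function converge to it, when tested against a distribution. -/
theorem tendsto_average_distr (F : Distr d) {η : Test d} (hη0 : ∀ z, 1 < ‖z‖ → η z = 0)
    (hη1 : ∫ t, η t = 1) (φ : Test d) :
    Tendsto (fun ε => F (averageTest η φ ε)) (𝓝[>] 0) (𝓝 (F φ)) := by
  obtain ⟨s, -, hs⟩ := exists_zero_of_hasCompactSupport φ.hasCompactSupport 0
  have hmem : Ioo (0 : ℝ) 1 ∈ 𝓝[>] (0 : ℝ) := Ioo_mem_nhdsGT one_pos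
  refine tendsto_of_uniform (l := 𝓝[>] (0 : ℝ)) F (ψ := φ)
    (isCompact_closedBall (0 : Euc d) (s + 1)) ?_ ?_ ?_
  · filter_upwards [hmem] with ε hε z hz
    refine averageTest_zero_of_notMem hη0 φ.continuous hs hε.1 z ?_
    have : s + 1 < ‖z - 0‖ := by simpa using hz
    linarith [hε.2]
  · intro z hz
    refine hs z ?_
    have : s + 1 < ‖z - 0‖ := by simpa using hz
    linarith
  · intro k _ δ hδ
    exact eventually_partialDeriv_averageTest hη0 hη1 (contDiff_nat_of_test φ (deg k))
      φ.hasCompactSupport le_rfl hδ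

theorem abs_partialDeriv_averageTest_le {g : Euc d → ℝ} (hg : ContDiff ℝ r g)
    (hgs : HasCompactSupport g) {k : Fin d → ℕ} (hk : deg k ≤ r) {M : ℝ}
    (hM : ∀ z, |partialDeriv k g z| ≤ M) {ε : ℝ} (hε : 0 < ε) (z : Euc d) :
    |partialDeriv k (averageTest (stdBump d) g ε) z| ≤ M := by
  rw [coe_averageTest stdBump_zero hg.continuous hgs hε,
    partialDeriv_average (stdBump d).continuous stdBump_zero hg ε hk]
  have := abs_average_le (η := stdBump d) (g := partialDeriv k g) (ε := ε) (y := z)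
    (stdBump d).continuous stdBump_zero (fun t _ => hM _)
  rwa [integral_abs_stdBump, one_mul] at this

theorem averageTest_add {η : Test d} (hη0 : ∀ z, 1 < ‖z‖ → η z = 0) {f g : Euc d → ℝ}
    (hf : Continuous f) (hfs : HasCompactSupport f) (hg : Continuous g) (hgs : HasCompactSupport g)
    {ε : ℝ} (hε : 0 < ε) :
    averageTest η (fun z => f z + g z) ε = averageTest η f ε + averageTest η g ε := by
  ext z
  rw [add_apply, coe_averageTest (g := fun z => f z + g z) hη0 (hf.add hg) (hfs.add hgs) hε, coe_averageTest hη0 hf hfs hε,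
    coe_averageTest hη0 hg hgs hε, average, average, average,
    ← integral_add (integrable_average η.continuous hη0 hf ε z)
      (integrable_average η.continuous hη0 hg ε z)]
  congr 1; ext t; ring

theorem averageTest_smul {η : Test d} (hη0 : ∀ z, 1 < ‖z‖ → η z = 0) {f : Euc d → ℝ}
    (hf : Continuous f) (hfs : HasCompactSupport f) (c : ℝ) {ε : ℝ} (hε : 0 < ε) :
    averageTest η (fun z => c * f z) ε = c • averageTest η f ε := by
  ext z
  rw [smul_apply, coe_averageTest (g := fun z => c * f z) hη0 (by fun_prop) hfs.mul_left hε,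
    coe_averageTest hη0 hf hfs hε, average, average, smul_eq_mul, ← integral_const_mul]
  congr 1; ext t; ring

/-- The mollifications of a C^r function are Cauchy in C^r with supports in a fixed ball, and
`LocBdd` transfers this to their images under F. -/
theorem exists_tendsto_of_locBdd {F : Distr d} (hF : LocBdd r F) {g : Euc d → ℝ}
    (hg : ContDiff ℝ r g) (hgs : HasCompactSupport g) :
    ∃ a, Tendsto (fun ε => F (averageTest (stdBump d) g ε)) (𝓝[>] 0) (𝓝 a) := by
  obtain ⟨s, -, hs⟩ := exists_zero_of_hasCompactSupport hgs 0
  obtain ⟨C, hC0, hC⟩ := hF (s + 1)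
  apply cauchy_map_iff_exists_tendsto.1
  rw [Metric.cauchy_iff]
  refine ⟨inferInstance, fun δ hδ => ?_⟩
  have hall : ∀ᶠ ε : ℝ in 𝓝[>] 0, ∀ k ∈ below d (r + 1), ∀ z,
      |partialDeriv k (averageTest (stdBump d) g ε) z - partialDeriv k g z| ≤
        δ / (4 * (C + 1)) := by
    rw [eventually_all_finset]
    intro k hk
    rw [mem_below] at hk
    exact eventually_partialDeriv_averageTest stdBump_zero (integral_stdBump d) hg hgs
      (by omega) (by positivity)
  have hmem : Ioo (0 : ℝ) 1 ∈ 𝓝[>] (0 : ℝ) := Ioo_mem_nhdsGT one_pos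
  refine ⟨_, image_mem_map (Filter.inter_mem hall hmem), ?_⟩
  rintro _ ⟨ε, ⟨hε, hε1⟩, rfl⟩ _ ⟨ε', ⟨hε', hε1'⟩, rfl⟩
  rw [Real.dist_eq, ← map_sub]
  have hz : ∀ {e : ℝ}, e ∈ Ioo (0 : ℝ) 1 → ∀ z, s + 1 < ‖z‖ → averageTest (stdBump d) g e z = 0 :=
    fun he z hz => averageTest_zero_of_notMem stdBump_zero hg.continuous hs he.1 z (by
      rw [sub_zero]; linarith [he.2])
  refine (hC (_ - _) (fun z hz' => by rw [sub_apply, hz hε1 z hz', hz hε1' z hz', sub_zero])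
    (δ / (2 * (C + 1))) (by positivity) fun k hk z => ?_).trans_lt ?_
  · have h4 : ⇑(averageTest (stdBump d) g ε - averageTest (stdBump d) g ε') =
        fun z => averageTest (stdBump d) g ε z - averageTest (stdBump d) g ε' z := rfl
    rw [h4, partialDeriv_sub (contDiff_nat_of_test _ _) (contDiff_nat_of_test _ _)]
    have h5 := hε k (mem_below.2 (by omega)) z
    have h6 := hε' k (mem_below.2 (by omega)) z
    have h7 : δ / (2 * (C + 1)) = δ / (4 * (C + 1)) + δ / (4 * (C + 1)) := by
      field_simp; norm_num
    rw [h7]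
    refine le_trans ?_ (add_le_add h5 h6)
    rw [← abs_neg (_ - partialDeriv k g z : ℝ)]
    nth_rw 2 [abs_sub_comm]
    rw [abs_neg]
    exact abs_sub_le _ _ _
  · rw [mul_div_assoc', div_lt_iff₀ (by positivity)]
    nlinarith

/-- The extension is the limit along mollifications. Linearity and the bound pass to the limit,
because averaging with a nonnegative weight of integral one does not increase the suprema of the
derivatives. -/
theorem LocBdd.exists_isExtension {F : Distr d} (hF : LocBdd r F) :
    ∃ T : DistrC d r, IsExtension r F T := by
  have hcd : ∀ g : TestC d r, ContDiff ℝ r g := fun g => g.contDiff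
  choose A hA using fun g : TestC d r =>
    exists_tendsto_of_locBdd hF (hcd g) g.hasCompactSupport
  have hpos : ∀ᶠ ε : ℝ in 𝓝[>] 0, 0 < ε := self_mem_nhdsWithin
  obtain ⟨T, hT⟩ := exists_clm_of_bound (n := r) A
    (fun f g => by
      refine tendsto_nhds_unique (hA (f + g)) (((hA f).add (hA g)).congr' ?_)
      filter_upwards [hpos] with ε hε
      have := averageTest_add stdBump_zero f.continuous f.hasCompactSupport g.continuous
        g.hasCompactSupport hε
      rw [← map_add, ← this]; rfl)
    (fun c f => by
      refine tendsto_nhds_unique (hA (c • f)) (((hA f).const_mul c).congr' ?_)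
      filter_upwards [hpos] with ε hε
      have := averageTest_smul stdBump_zero f.continuous f.hasCompactSupport c hε
      have h2 : averageTest (stdBump d) (⇑(c • f)) ε = c • averageTest (stdBump d) f ε := by
        rw [← this]; rfl
      rw [h2, map_smul, smul_eq_mul])
    (fun L hL => by
      obtain ⟨R, hR⟩ := hL.isBounded.subset_closedBall 0
      obtain ⟨C, hC0, hC⟩ := hF (R + 1)
      refine ⟨r, le_rfl, C, hC0, fun φ hφ M hM hb => ?_⟩
      have hs : ∀ z, R < ‖z - 0‖ → φ z = 0 := fun z hz => hφ z fun hz' => by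
        have := hR hz'
        rw [Metric.mem_closedBall, dist_eq_norm] at this
        linarith
      refine le_of_tendsto (hA φ).abs ?_
      filter_upwards [Ioo_mem_nhdsGT (one_pos : (0 : ℝ) < 1)] with ε hε
      refine hC _ (fun z hz => averageTest_zero_of_notMem stdBump_zero φ.continuous hs hε.1 z
        (by rw [sub_zero]; linarith [hε.2])) M hM fun k hk z => ?_
      exact abs_partialDeriv_averageTest_le (hcd φ) φ.hasCompactSupport hk (hb k hk) hε.1 z)
  refine ⟨T, fun φ => ?_⟩
  rw [hT]
  refine tendsto_nhds_unique (hA _) ?_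
  rw [coe_monoCLM_test]
  exact tendsto_average_distr F stdBump_zero (integral_stdBump d) φ

theorem isExtension_extend {F : Distr d} (h : ∃ T : DistrC d r, IsExtension r F T) :
    IsExtension r F (extend r F) := by
  rw [extend, dif_pos h]
  exact h.choose_spec

end Extension


/-! ### Bounds at a given scale -/

/-- `F` is bounded by `B` on the test functions of class `ℬ^r`, scaled by `s` and centred at `x`. -/
def ScaleBd {d : ℕ} (r : ℕ) (F : Distr d) (x : Euc d) (s B : ℝ) : Prop :=
  ∀ φ ∈ unitTests d r, |F (rescale φ x s)| ≤ B

/-- `g` is of class `C^r`, vanishes off the ball of radius `s` centred at `x`, and its derivatives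
are bounded as those of `M` times a test function at scale `s`. -/
structure CrBd {d : ℕ} (r : ℕ) (g : Euc d → ℝ) (x : Euc d) (s M : ℝ) : Prop where
  contDiff : ContDiff ℝ r g
  zero : ∀ z, s < ‖z - x‖ → g z = 0
  bound : ∀ k, deg k ≤ r → ∀ z, |partialDeriv k g z| ≤ M * ((s ^ d)⁻¹ * (s ^ deg k)⁻¹)

theorem zero_mem_unitTests {d r : ℕ} : (0 : Test d) ∈ unitTests d r := by
  rw [mem_unitTests]
  refine ⟨by simp [tsupport], fun k _ z => ?_⟩
  have : partialDeriv k (0 : Euc d → ℝ) = 0 := by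
    have := partialDeriv_const_mul (k := k) (f := (0 : Euc d → ℝ)) contDiff_const 0
    simpa [Pi.zero_def] using this
  have h0 : ⇑(0 : Test d) = 0 := rfl
  rw [h0, this]; simp

theorem coe_rescale {d : ℕ} (φ : Test d) (x : Euc d) {s : ℝ} (hs : 0 < s) :
    ⇑(rescale φ x s) = fun z => (s ^ d)⁻¹ * φ (s⁻¹ • (z - x)) := by
  rw [rescale, dif_pos hs]; rfl

theorem partialDeriv_rescale {d : ℕ} (φ : Test d) (x : Euc d) {s : ℝ} (hs : 0 < s)
    (k : Fin d → ℕ) : partialDeriv k (rescale φ x s) =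
      fun z => (s ^ d)⁻¹ * ((s ^ deg k)⁻¹ * partialDeriv k φ (s⁻¹ • (z - x))) := by
  have hφ := contDiff_nat_of_test φ (deg k)
  have h : ContDiff ℝ (deg k) fun z => φ (s⁻¹ • (z - x)) := hφ.comp (by fun_prop)
  rw [coe_rescale φ x hs, partialDeriv_const_mul h]
  ext z
  rw [partialDeriv_comp_affine hφ, inv_pow]

theorem unitTests_zero {d r : ℕ} {φ : Test d} (hφ : φ ∈ unitTests d r) (z : Euc d) (hz : 1 < ‖z‖) :
    φ z = 0 := by
  by_contra h
  have := hφ.1 (subset_tsupport _ h)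
  rw [mem_closedBall_zero_iff] at this
  linarith

theorem unitTests_mono {d r r' : ℕ} (h : r' ≤ r) : unitTests d r ⊆ unitTests d r' :=
  fun _ hφ => ⟨hφ.1, fun k hk => hφ.2 k (hk.trans h)⟩

theorem crBd_rescale {d r : ℕ} {φ : Test d} (hφ : φ ∈ unitTests d r) (x : Euc d) {s : ℝ}
    (hs : 0 < s) : CrBd r (rescale φ x s) x s 1 where
  contDiff := contDiff_nat_of_test _ _
  zero z hz := by
    rw [coe_rescale φ x hs]
    dsimp only
    rw [unitTests_zero hφ, mul_zero]
    rw [norm_smul, norm_inv, Real.norm_of_nonneg hs.le, inv_mul_eq_div, one_lt_div hs]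
    exact hz
  bound k hk z := by
    rw [partialDeriv_rescale φ x hs, one_mul, abs_mul, abs_mul, abs_of_nonneg (by positivity),
      abs_of_nonneg (by positivity : 0 ≤ (s ^ deg k)⁻¹), ← mul_assoc]
    exact mul_le_of_le_one_right (by positivity) ((mem_unitTests.1 hφ).2 k hk _)

namespace CrBd

variable {d r : ℕ} {g h : Euc d → ℝ} {x : Euc d} {s M N : ℝ}

theorem hasCompactSupport (hg : CrBd r g x s M) : HasCompactSupport g :=
  hasCompactSupport_of_zero hg.zero

theorem mono (hg : CrBd r g x s M) (hs : 0 < s) (hMN : M ≤ N) {r' : ℕ} (hr : r' ≤ r) :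
    CrBd r' g x s N where
  contDiff := hg.contDiff.of_le (by exact_mod_cast hr)
  zero := hg.zero
  bound k hk z := (hg.bound k (hk.trans hr) z).trans (by gcongr)

/-- Enlarging the radius from s to s' costs at most one factor s'/s for each of the d powers of the
normalisation and each of the at most r derivatives. -/
theorem recenter (hg : CrBd r g x s M) (hs : 0 < s) (hM : 0 ≤ M) {y : Euc d} {s' : ℝ}
    (h : s + ‖x - y‖ ≤ s') : CrBd r g y s' (M * (s' / s) ^ (d + r)) where
  contDiff := hg.contDiff
  zero z hz := hg.zero z (by
    have := norm_add_le (z - x) (x - y)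
    rw [sub_add_sub_cancel] at this
    linarith)
  bound k hk z := by
    refine (hg.bound k hk z).trans ?_
    have hss : s ≤ s' := by linarith [norm_nonneg (x - y)]
    have hs' : 0 < s' := by linarith
    rw [mul_assoc]
    refine mul_le_mul_of_nonneg_left ?_ hM
    have h1 : (s' / s) ^ (d + deg k) ≤ (s' / s) ^ (d + r) :=
      pow_le_pow_right₀ ((one_le_div hs).2 hss) (by omega)
    calc (s ^ d)⁻¹ * (s ^ deg k)⁻¹
        = (s' / s) ^ (d + deg k) * ((s' ^ d)⁻¹ * (s' ^ deg k)⁻¹) := by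
          rw [pow_add, div_pow, div_pow]; field_simp
      _ ≤ _ := by gcongr

theorem of_bound (hg : ContDiff ℝ r g) (h0 : ∀ z, s < ‖z - x‖ → g z = 0) (hs : 1 ≤ s) (hM : 0 ≤ M)
    (hb : ∀ k, deg k ≤ r → ∀ z, |partialDeriv k g z| ≤ M) :
    CrBd r g x s (M * s ^ (d + r)) where
  contDiff := hg
  zero := h0
  bound k hk z := by
    refine (hb k hk z).trans ?_
    rw [mul_assoc]
    refine le_mul_of_one_le_right hM ?_
    rw [← mul_inv, ← pow_add, ← div_eq_mul_inv, one_le_div (by positivity)]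
    exact pow_le_pow_right₀ hs (by omega)

theorem averageTest (hg : CrBd r g x s M) (hs : 0 < s) (hM : 0 ≤ M) {n : ℕ}
    (hn : ContDiff ℝ n g) {ε : ℝ} (hε : 0 < ε) (hεs : ε ≤ s) :
    CrBd r (averageTest (stdBump d) g ε) x (2 * s) (2 ^ (d + r) * M) where
  contDiff := contDiff_nat_of_test _ _
  zero z hz := averageTest_zero_of_notMem stdBump_zero hn.continuous hg.zero hε z (by linarith)
  bound k hk z := by
    refine (abs_partialDeriv_averageTest_le hg.contDiff hg.hasCompactSupport hk (hg.bound k hk)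
      hε z).trans ?_
    rw [mul_comm _ M, mul_assoc]
    refine mul_le_mul_of_nonneg_left ?_ hM
    rw [mul_pow, mul_pow, mul_inv, mul_inv, pow_add]
    have h1 : (1 : ℝ) ≤ 2 ^ r * (2 ^ deg k)⁻¹ := by
      rw [← div_eq_mul_inv, one_le_div (by positivity)]
      exact pow_le_pow_right₀ one_le_two hk
    calc (s ^ d)⁻¹ * (s ^ deg k)⁻¹ ≤ (s ^ d)⁻¹ * (s ^ deg k)⁻¹ * (2 ^ r * (2 ^ deg k)⁻¹) :=
          le_mul_of_one_le_right (by positivity) h1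
      _ = _ := by field_simp

end CrBd

namespace ScaleBd

variable {d r : ℕ} {F G : Distr d} {x : Euc d} {s B B' : ℝ}

theorem nonneg (h : ScaleBd r F x s B) : 0 ≤ B := (abs_nonneg _).trans (h 0 zero_mem_unitTests)

theorem mono (h : ScaleBd r F x s B) (hB : B ≤ B') {r' : ℕ} (hr : r ≤ r') : ScaleBd r' F x s B' :=
  fun φ hφ => (h φ (unitTests_mono hr hφ)).trans hB

theorem add (h : ScaleBd r F x s B) (h' : ScaleBd r G x s B') : ScaleBd r (F + G) x s (B + B') :=
  fun φ hφ => by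
    rw [add_apply]
    exact (abs_add_le _ _).trans (add_le_add (h φ hφ) (h' φ hφ))

theorem smul (h : ScaleBd r F x s B) (c : ℝ) : ScaleBd r (c • F) x s (|c| * B) :=
  fun φ hφ => by
    rw [smul_apply, smul_eq_mul, abs_mul]
    exact mul_le_mul_of_nonneg_left (h φ hφ) (abs_nonneg c)

theorem sub (h : ScaleBd r F x s B) (h' : ScaleBd r G x s B') : ScaleBd r (F - G) x s (B + B') :=
  fun φ hφ => by
    rw [sub_apply]
    exact (abs_sub _ _).trans (add_le_add (h φ hφ) (h' φ hφ))

theorem sum {ι : Type*} (t : Finset ι) {F : ι → Distr d} {B : ι → ℝ}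
    (h : ∀ i ∈ t, ScaleBd r (F i) x s (B i)) : ScaleBd r (∑ i ∈ t, F i) x s (∑ i ∈ t, B i) := by
  classical
  induction t using Finset.induction_on with
  | empty => intro φ _; simp
  | insert a t ha ih =>
    rw [Finset.sum_insert ha, Finset.sum_insert ha]
    exact (h a (Finset.mem_insert_self a t)).add
      (ih fun i hi => h i (Finset.mem_insert_of_mem hi))

/-- By scaling, such a ψ is M times a rescaled element of the unit class. The case M = 0 is separate
because this needs a division by M. -/
theorem test_le (h : ScaleBd r F x s B) (hs : 0 < s) {ψ : Test d} {M : ℝ} (hM : 0 ≤ M)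
    (hψ : CrBd r ψ x s M) : |F ψ| ≤ M * B := by
  rcases hM.eq_or_lt with rfl | hM
  · have : ψ = 0 := by
      ext z
      have := hψ.bound 0 (by simp [deg_zero]) z
      rw [partialDeriv_zero, zero_mul] at this
      simpa using abs_nonpos_iff.1 this
    rw [this]; simp
  have hsd : (0 : ℝ) < s ^ d := by positivity
  have hC : ContDiff ℝ ((⊤ : ℕ∞) : WithTop ℕ∞) fun w => M⁻¹ * s ^ d * ψ (s • (w - -(s⁻¹ • x))) :=
    contDiff_const.mul (ψ.contDiff.comp (by fun_prop))
  have harg : ∀ w : Euc d, s • (w - -(s⁻¹ • x)) - x = s • w := fun w => by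
    rw [sub_neg_eq_add, smul_add, smul_smul, mul_inv_cancel₀ hs.ne', one_smul, add_sub_cancel_right]
  have h0 : ∀ w : Euc d, 1 < ‖w - 0‖ → M⁻¹ * s ^ d * ψ (s • (w - -(s⁻¹ • x))) = 0 := fun w hw => by
    rw [hψ.zero, mul_zero]
    rw [harg, norm_smul, Real.norm_of_nonneg hs.le]
    rw [sub_zero] at hw
    nlinarith
  set φ : Test d := mkTest _ hC (hasCompactSupport_of_zero h0) with hφ
  have hcoe : ⇑φ = fun w => M⁻¹ * s ^ d * ψ (s • (w - -(s⁻¹ • x))) := rfl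
  have hmem : φ ∈ unitTests d r := by
    rw [mem_unitTests]
    refine ⟨closure_minimal (fun w hw => ?_) Metric.isClosed_closedBall, fun k hk w => ?_⟩
    · by_contra hw'
      rw [mem_closedBall_zero_iff, not_le] at hw'
      exact hw (h0 w (by rwa [sub_zero]))
    · have h2 := contDiff_nat_of_test ψ (deg k)
      have h3 : ContDiff ℝ (deg k) fun w => ψ (s • (w - -(s⁻¹ • x))) := h2.comp (by fun_prop)
      rw [hcoe, partialDeriv_const_mul h3]
      dsimp only
      rw [partialDeriv_comp_affine h2]
      rw [abs_mul, abs_of_nonneg (by positivity : 0 ≤ M⁻¹ * s ^ d), abs_mul,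
        abs_of_nonneg (by positivity : 0 ≤ s ^ deg k)]
      have := hψ.bound k hk (s • (w - -(s⁻¹ • x)))
      calc _ ≤ M⁻¹ * s ^ d * (s ^ deg k * (M * ((s ^ d)⁻¹ * (s ^ deg k)⁻¹))) := by gcongr
        _ = 1 := by field_simp
  have hψφ : ψ = M • rescale φ x s := by
    ext z
    rw [smul_apply, coe_rescale φ x hs, hcoe, smul_eq_mul]
    have : s • (s⁻¹ • (z - x) - -(s⁻¹ • x)) = z := by
      rw [sub_neg_eq_add, ← smul_add, smul_smul, mul_inv_cancel₀ hs.ne', one_smul, sub_add_cancel]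
    dsimp only
    rw [this]
    field_simp
  rw [hψφ, map_smul, smul_eq_mul, abs_mul, abs_of_pos hM]
  exact mul_le_mul_of_nonneg_left (h φ hmem) hM.le

end ScaleBd

/-! ### Locally bounded distributions and their extensions -/

/-- The value of (the extension of) a distribution at a function of class `C^r`. -/
def ext {d : ℕ} (r : ℕ) (F : Distr d) (g : Euc d → ℝ) : ℝ := extend r F (toTestC r g)

theorem locBdd_of_scaleBd {d r : ℕ} {F : Distr d} (x : Euc d)
    (h : ∀ s, 1 ≤ s → ∃ s', s ≤ s' ∧ ∃ B, ScaleBd r F x s' B) : LocBdd r F := by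
  intro s
  obtain ⟨s', hs', B, hB⟩ := h (max 1 (s + ‖x‖)) (le_max_left _ _)
  have h1 : 1 ≤ s' := (le_max_left _ _).trans hs'
  have h2 : s + ‖x‖ ≤ s' := (le_max_right _ _).trans hs'
  have hB0 := hB.nonneg
  refine ⟨s' ^ (d + r) * B, by positivity, fun φ hφ M hM hb => ?_⟩
  have := hB.test_le (by linarith) (ψ := φ) (M := M * s' ^ (d + r)) (by positivity)
    (CrBd.of_bound (contDiff_nat_of_test _ _) (fun z hz => hφ z (by
      have := norm_sub_le z x
      linarith)) h1 hM hb)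
  linarith

namespace LocBdd

variable {d r : ℕ} {F G : Distr d}

theorem mono (h : LocBdd r F) {r' : ℕ} (hr : r ≤ r') : LocBdd r' F := fun s => by
  obtain ⟨C, hC0, hC⟩ := h s
  exact ⟨C, hC0, fun φ hφ M hM hb => hC φ hφ M hM fun k hk => hb k (hk.trans hr)⟩

theorem add (h : LocBdd r F) (h' : LocBdd r G) : LocBdd r (F + G) := fun s => by
  obtain ⟨C, hC0, hC⟩ := h s
  obtain ⟨C', hC0', hC'⟩ := h' s
  refine ⟨C + C', by positivity, fun φ hφ M hM hb => ?_⟩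
  rw [add_apply, add_mul]
  exact (abs_add_le _ _).trans (add_le_add (hC φ hφ M hM hb) (hC' φ hφ M hM hb))

theorem smul (h : LocBdd r F) (c : ℝ) : LocBdd r (c • F) := fun s => by
  obtain ⟨C, hC0, hC⟩ := h s
  refine ⟨|c| * C, by positivity, fun φ hφ M hM hb => ?_⟩
  rw [smul_apply, smul_eq_mul, abs_mul, mul_assoc]
  exact mul_le_mul_of_nonneg_left (hC φ hφ M hM hb) (abs_nonneg c)

theorem sub (h : LocBdd r F) (h' : LocBdd r G) : LocBdd r (F - G) := by
  have := h.add (h'.smul (-1))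
  rwa [neg_one_smul, ← sub_eq_add_neg] at this

theorem zero : LocBdd r (0 : Distr d) := fun s => ⟨0, le_rfl, fun φ _ M _ _ => by simp⟩

theorem sum {ι : Type*} (t : Finset ι) {F : ι → Distr d} (h : ∀ i ∈ t, LocBdd r (F i)) :
    LocBdd r (∑ i ∈ t, F i) := by
  classical
  induction t using Finset.induction_on with
  | empty => simpa using zero
  | insert a t ha ih =>
    rw [Finset.sum_insert ha]
    exact (h a (Finset.mem_insert_self a t)).add
      (ih fun i hi => h i (Finset.mem_insert_of_mem hi))

theorem isExtension (h : LocBdd r F) : IsExtension r F (extend r F) :=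
  isExtension_extend h.exists_isExtension

theorem tendsto_ext (h : LocBdd r F) {g : Euc d → ℝ} (hg : ContDiff ℝ r g)
    (hgs : HasCompactSupport g) :
    Tendsto (fun ε => F (averageTest (stdBump d) g ε)) (𝓝[>] 0) (𝓝 (ext r F g)) :=
  h.isExtension.tendsto_average stdBump_zero (integral_stdBump d) hg hgs

theorem ext_add_left (h : LocBdd r F) (h' : LocBdd r G) {g : Euc d → ℝ} (hg : ContDiff ℝ r g)
    (hgs : HasCompactSupport g) : ext r (F + G) g = ext r F g + ext r G g :=
  tendsto_nhds_unique ((h.add h').tendsto_ext hg hgs)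
    ((h.tendsto_ext hg hgs).add (h'.tendsto_ext hg hgs))

theorem ext_smul_left (h : LocBdd r F) (c : ℝ) {g : Euc d → ℝ} (hg : ContDiff ℝ r g)
    (hgs : HasCompactSupport g) : ext r (c • F) g = c * ext r F g :=
  tendsto_nhds_unique ((h.smul c).tendsto_ext hg hgs) ((h.tendsto_ext hg hgs).const_mul c)

theorem ext_sub_left (h : LocBdd r F) (h' : LocBdd r G) {g : Euc d → ℝ} (hg : ContDiff ℝ r g)
    (hgs : HasCompactSupport g) : ext r (F - G) g = ext r F g - ext r G g :=
  tendsto_nhds_unique ((h.sub h').tendsto_ext hg hgs)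
    ((h.tendsto_ext hg hgs).sub (h'.tendsto_ext hg hgs))

theorem ext_sum_left {ι : Type*} (t : Finset ι) {F : ι → Distr d} (h : ∀ i ∈ t, LocBdd r (F i))
    {g : Euc d → ℝ} (hg : ContDiff ℝ r g) (hgs : HasCompactSupport g) :
    ext r (∑ i ∈ t, F i) g = ∑ i ∈ t, ext r (F i) g := by
  refine tendsto_nhds_unique ((LocBdd.sum t h).tendsto_ext hg hgs)
    ((tendsto_finsetSum t fun i hi => (h i hi).tendsto_ext hg hgs).congr fun ε => ?_)
  rw [sum_apply]

/-- The order r', in which the function and F are measured, may differ from the order r for which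
the extension is defined. The estimate is made on mollifications, which are smooth and live at scale
2s, and then passed to the limit. -/
theorem abs_ext_le (h : LocBdd r F) {x : Euc d} {s M B : ℝ} (hs : 0 < s) (hM : 0 ≤ M)
    {r' : ℕ} {g : Euc d → ℝ} (hg : ContDiff ℝ r g) (hb : CrBd r' g x s M)
    (hB : ScaleBd r' F x (2 * s) B) : |ext r F g| ≤ 2 ^ (d + r') * M * B := by
  refine le_of_tendsto (h.tendsto_ext hg hb.hasCompactSupport).abs ?_
  filter_upwards [Ioo_mem_nhdsGT hs] with ε hε
  exact hB.test_le (by positivity) (by positivity) (hb.averageTest hs hM hg hε.1 hε.2.le)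

theorem scaleBd (h : LocBdd r F) {K : Set (Euc d)} (hK : IsCompact K) (S : ℝ) :
    ∃ C, 0 ≤ C ∧ ∀ x ∈ K, ∀ s, 1 ≤ s → s ≤ S → ScaleBd r F x s C := by
  obtain ⟨R, hR⟩ := hK.isBounded.subset_closedBall 0
  obtain ⟨C, hC0, hC⟩ := h (R + S)
  refine ⟨C, hC0, fun x hx s hs hsS φ hφ => ?_⟩
  have hs0 : 0 < s := by linarith
  have hb := crBd_rescale hφ x hs0
  have := hC (rescale φ x s) (fun z hz => hb.zero z (by
    have h1 := mem_closedBall_zero_iff.1 (hR hx)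
    have h2 := norm_sub_norm_le z x
    linarith)) 1 zero_le_one (fun k hk z => (hb.bound k hk z).trans (by
      rw [one_mul, ← mul_inv, ← pow_add]
      exact inv_le_one_of_one_le₀ (one_le_pow₀ hs)))
  simpa using this

end LocBdd

theorem ext_add_right {d r : ℕ} (F : Distr d) {f g : Euc d → ℝ} (hf : ContDiff ℝ r f)
    (hfs : HasCompactSupport f) (hg : ContDiff ℝ r g) (hgs : HasCompactSupport g) :
    ext r F (fun z => f z + g z) = ext r F f + ext r F g := by
  rw [ext, ext, ext, ← map_add]
  congr 1
  ext z
  rw [add_apply, coe_toTestC (hf.add hg) (hfs.add hgs), coe_toTestC hf hfs, coe_toTestC hg hgs]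

theorem ext_const_mul_right {d r : ℕ} (F : Distr d) {f : Euc d → ℝ} (hf : ContDiff ℝ r f)
    (hfs : HasCompactSupport f) (c : ℝ) :
    ext r F (fun z => c * f z) = c * ext r F f := by
  rw [ext, ext, ← smul_eq_mul, ← map_smul]
  congr 1
  ext z
  rw [smul_apply, coe_toTestC (contDiff_const.mul hf) (HasCompactSupport.mul_left hfs), coe_toTestC hf hfs, smul_eq_mul]

theorem ext_sub_right {d r : ℕ} (F : Distr d) {f g : Euc d → ℝ} (hf : ContDiff ℝ r f)
    (hfs : HasCompactSupport f) (hg : ContDiff ℝ r g) (hgs : HasCompactSupport g) :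
    ext r F (fun z => f z - g z) = ext r F f - ext r F g := by
  have := ext_add_right F hf hfs (f := f) (g := fun z => -1 * g z) (contDiff_const.mul hg)
    hgs.mul_left
  rw [ext_const_mul_right F hg hgs] at this
  simpa [sub_eq_add_neg] using this

theorem ext_zero_right {d r : ℕ} (F : Distr d) : ext r F (fun _ => 0) = 0 := by
  have := ext_const_mul_right (r := r) F (f := fun _ => 0) contDiff_const HasCompactSupport.zero 0
  simpa using this

theorem ext_sum_right {d r : ℕ} (F : Distr d) {ι : Type*} (t : Finset ι) {f : ι → Euc d → ℝ}
    (hf : ∀ i ∈ t, ContDiff ℝ r (f i)) (hfs : ∀ i ∈ t, HasCompactSupport (f i)) :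
    ext r F (fun z => ∑ i ∈ t, f i z) = ∑ i ∈ t, ext r F (f i) := by
  classical
  suffices h : HasCompactSupport (fun z => ∑ i ∈ t, f i z) ∧
    ext r F (fun z => ∑ i ∈ t, f i z) = ∑ i ∈ t, ext r F (f i) from h.2
  induction t using Finset.induction_on with
  | empty => simpa using ⟨HasCompactSupport.zero, ext_zero_right F⟩
  | insert a t ha ih =>
    obtain ⟨h1, h2⟩ := ih (fun i hi => hf i (Finset.mem_insert_of_mem hi))
      (fun i hi => hfs i (Finset.mem_insert_of_mem hi))
    have ha' := Finset.mem_insert_self a t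
    simp only [Finset.sum_insert ha]
    refine ⟨(hfs a ha').add h1, ?_⟩
    rw [ext_add_right F (hf a ha') (hfs a ha')
      (ContDiff.sum fun i hi => hf i (Finset.mem_insert_of_mem hi)) h1, h2]


/-! ### Fundamental theorem of calculus and integration by parts for jets -/

/-- The segment parameter, clamped to the unit interval. -/
def clamp (t : ℝ) : ℝ := max 0 (min t 1)

theorem continuous_clamp : Continuous clamp := by unfold clamp; fun_prop

theorem clamp_mem (t : ℝ) : clamp t ∈ Icc (0 : ℝ) 1 :=
  ⟨le_max_left _ _, max_le zero_le_one (min_le_right _ _)⟩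

theorem clamp_of_mem {t : ℝ} (ht : t ∈ Icc (0 : ℝ) 1) : clamp t = t := by
  rw [clamp, min_eq_left ht.2, max_eq_right ht.1]

theorem IsJet.sub_eq_integral {d r : ℕ} {u : (Fin d → ℕ) → Euc d → ℝ} (hu : IsJet r u)
    {k : Fin d → ℕ} (hk : deg k < r) (z v : Euc d) :
    u k (z + v) - u k z =
      ∫ t in Icc (0 : ℝ) 1, ∑ i, v i * u (k + Pi.single i 1) (z + clamp t • v) := by
  have hd : ∀ t : ℝ, HasDerivAt (fun t : ℝ => u k (z + t • v))
      (∑ i, v i * u (k + Pi.single i 1) (z + t • v)) t := fun t => by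
    have h1 : HasDerivAt (fun t : ℝ => z + t • v) v t := by
      simpa using ((hasDerivAt_id t).smul_const v).const_add z
    have h2 := (hu.hasFDerivAt k hk (z + t • v)).comp_hasDerivAt t h1
    refine h2.congr_deriv ?_
    rw [sum_apply]
    refine Finset.sum_congr rfl fun i _ => ?_
    rw [smul_apply, smul_eq_mul, mul_comm]
    rfl
  have hc : Continuous fun t : ℝ => ∑ i, v i * u (k + Pi.single i 1) (z + t • v) :=
    continuous_finsetSum _ fun i _ => continuous_const.mul
      ((hu.continuous _ (by rw [deg_add_single]; omega)).comp (by fun_prop))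
  have h := intervalIntegral.integral_eq_sub_of_hasDerivAt (a := 0) (b := 1)
    (fun t _ => hd t) (hc.intervalIntegrable 0 1)
  simp only [one_smul, zero_smul, add_zero] at h
  rw [← h, intervalIntegral.integral_of_le zero_le_one, ← integral_Icc_eq_integral_Ioc]
  refine setIntegral_congr_fun measurableSet_Icc fun t ht => ?_
  simp only [clamp_of_mem ht]

/-- A converse of the fundamental theorem of calculus on segments. An integral identity can be
pushed through a functional of order r more easily than a limit of difference quotients, and this
lemma recovers the derivative from it. -/
theorem hasFDerivAt_of_sub_eq_integral {d : ℕ} {u : Euc d → ℝ} {w : Fin d → Euc d → ℝ}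
    (hw : ∀ i, Continuous (w i))
    (h : ∀ z v, u (z + v) - u z = ∫ t in Icc (0 : ℝ) 1, ∑ i, v i * w i (z + clamp t • v))
    (z : Euc d) : HasFDerivAt u (∑ i, w i z • (coord i : Euc d →L[ℝ] ℝ)) z := by
  rw [hasFDerivAt_iff_isLittleO_nhds_zero, Asymptotics.isLittleO_iff]
  intro c hc
  have hev : ∀ᶠ v in 𝓝 (0 : Euc d), ∀ i, |w i (z + v) - w i z| ≤ c / (d + 1) := by
    rw [eventually_all]
    intro i
    have h1 : Tendsto (fun v => w i (z + v)) (𝓝 0) (𝓝 (w i z)) := by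
      have : Continuous fun v => w i (z + v) := (hw i).comp (by fun_prop)
      simpa using this.tendsto 0
    have := Metric.tendsto_nhds.1 h1 (c / (d + 1)) (by positivity)
    filter_upwards [this] with v hv
    rw [← Real.dist_eq]; exact hv.le
  obtain ⟨δ, hδ, hδ'⟩ := Metric.eventually_nhds_iff_ball.1 hev
  filter_upwards [Metric.ball_mem_nhds (0 : Euc d) hδ] with v hv
  have hc2 : Continuous fun t : ℝ => ∑ i, v i * w i (z + clamp t • v) :=
    continuous_finsetSum _ fun i _ => continuous_const.mul
      ((hw i).comp (continuous_const.add (continuous_clamp.smul continuous_const)))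
  have h2 : u (z + v) - u z - (∑ i, w i z • (coord i : Euc d →L[ℝ] ℝ)) v =
      ∫ t in Icc (0 : ℝ) 1, ∑ i, v i * (w i (z + clamp t • v) - w i z) := by
    rw [h z v, sum_apply]
    have h3 : ∑ i, (w i z • (coord i : Euc d →L[ℝ] ℝ)) v =
        ∫ t in Icc (0 : ℝ) 1, ∑ i, v i * w i z := by
      simp [mul_comm]
    rw [h3, ← integral_sub (hc2.continuousOn.integrableOn_compact isCompact_Icc)
      (by simp)]
    simp only [← Finset.sum_sub_distrib, mul_sub]
  rw [h2]
  have h4 := norm_setIntegral_le_of_norm_le_const (μ := volume) (s := Icc (0 : ℝ) 1)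
    (f := fun t => ∑ i, v i * (w i (z + clamp t • v) - w i z)) (C := c * ‖v‖) (by simp)
    (fun t _ => by
      refine (norm_sum_le _ _).trans ?_
      have h5 : ∀ i ∈ Finset.univ, ‖v i * (w i (z + clamp t • v) - w i z)‖ ≤
          ‖v‖ * (c / (d + 1)) := fun i _ => by
        rw [norm_mul]
        refine mul_le_mul (abs_coord_le v i) (hδ' _ ?_ i) (abs_nonneg _) (norm_nonneg _)
        rw [mem_ball_zero_iff] at hv ⊢
        rw [norm_smul, Real.norm_of_nonneg (clamp_mem t).1]
        exact (mul_le_of_le_one_left (norm_nonneg _) (clamp_mem t).2).trans_lt hv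
      refine (Finset.sum_le_card_nsmul _ _ _ h5).trans ?_
      rw [Finset.card_univ, Fintype.card_fin, nsmul_eq_mul]
      have : (d : ℝ) * (c / (d + 1)) ≤ c := by
        rw [mul_div_assoc', div_le_iff₀ (by positivity)]; nlinarith
      nlinarith [norm_nonneg v])
  simpa using h4

theorem integrable_test_mul {d : ℕ} (φ : Test d) {u : Euc d → ℝ} (hu : Continuous u) :
    Integrable fun z => φ z * u z :=
  (φ.continuous.mul hu).integrable_of_hasCompactSupport φ.hasCompactSupport.mul_right

theorem integral_axisDeriv_mul {d : ℕ} (φ : Test d) {u : Euc d → ℝ} (hu : ContDiff ℝ 1 u)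
    (i : Fin d) : ∫ z, axisDeriv i φ z * u z = -∫ z, φ z * axisDeriv i u z := by
  have hφ : ContDiff ℝ 1 φ := contDiff_nat_of_test φ 1
  rw [axisDeriv_eq_fderiv hφ, axisDeriv_eq_fderiv hu]
  have h1 : Continuous fun z => fderiv ℝ u z (basisVec i) := (hu.continuous_fderiv one_ne_zero).clm_apply
    continuous_const
  rw [integral_mul_fderiv_eq_neg_fderiv_mul_of_integrable (f := φ) (g := u) (v := basisVec i) ?_
    (integrable_test_mul φ h1) (integrable_test_mul φ hu.continuous)
    (fun x _ => (hφ.differentiable one_ne_zero) x)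
    (fun x _ => (hu.differentiable one_ne_zero) x), neg_neg]
  have := integrable_test_mul (∂_{basisVec i} φ) hu.continuous
  rwa [coe_lineDerivOp_test, axisDeriv_eq_fderiv hφ] at this

theorem IsJet.integral_partialDeriv_mul {d r : ℕ} {u : (Fin d → ℕ) → Euc d → ℝ}
    (hu : IsJet r u) {k : Fin d → ℕ} (hk : deg k ≤ r) (φ : Test d) :
    ∫ z, partialDeriv k φ z * u 0 z = (-1) ^ deg k * ∫ z, φ z * u k z := by
  induction hn : deg k generalizing k φ with
  | zero =>
    rw [deg_eq_zero] at hn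
    subst hn
    simp [partialDeriv_zero]
  | succ n ih =>
    obtain ⟨l, i, rfl, hl⟩ := exists_eq_add_single hn
    have h1 : partialDeriv (l + Pi.single i 1) φ = partialDeriv l (∂_{basisVec i} φ : Test d) := by
      rw [coe_lineDerivOp_test, partialDeriv_add_single (contDiff_nat_of_test φ _)]
    rw [h1, ih (by omega) _ hl, coe_lineDerivOp_test, integral_axisDeriv_mul φ
      (by exact_mod_cast hu.contDiff_of_deg_le (k := l) (n := 1) (by omega)) i,
      hu.axisDeriv_eq (by omega) i, pow_succ]
    ring

/-! ### Potentials -/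

section Potential

variable {d m r : ℕ} {G : Euc d → Euc d → ℝ} {ρ : ℝ}

theorem IsCmr.left_eq_zero (hG : IsCmr m r G) (hρ : ∀ x y, ρ < ‖x - y‖ → G x y = 0)
    {k : Fin d → ℕ} (hk : deg k ≤ m) {x y : Euc d} (h : ρ < ‖x - y‖) :
    partialDeriv k (fun x' => G x' y) x = 0 :=
  partialDeriv_eq_zero ((hG.contDiff_left y).of_le (by exact_mod_cast hk))
    (fun z hz => hρ z y hz) x h

theorem IsCmr.left_hasCompactSupport (hG : IsCmr m r G) (hρ : ∀ x y, ρ < ‖x - y‖ → G x y = 0)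
    {k : Fin d → ℕ} (hk : deg k ≤ m) (x : Euc d) :
    HasCompactSupport fun y => partialDeriv k (fun x' => G x' y) x :=
  hasCompactSupport_of_zero (x := x) (s := ρ) fun y hy =>
    hG.left_eq_zero hρ hk (by rwa [norm_sub_rev])

theorem mixedDeriv_zero_right (k : Fin d → ℕ) (x y : Euc d) :
    mixedDeriv k 0 G x y = partialDeriv k (fun x' => G x' y) x := by
  rw [mixedDeriv, partialDeriv_zero]

theorem mixedDeriv_zero_left (l : Fin d → ℕ) (x y : Euc d) :
    mixedDeriv 0 l G x y = partialDeriv l (fun y' => G x y') y := by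
  simp only [mixedDeriv, partialDeriv_zero]

theorem IsCmr.isJet_right (hG : IsCmr m r G) {k : Fin d → ℕ} (hk : deg k ≤ m) (x : Euc d) :
    IsJet r fun l => mixedDeriv k l G x :=
  isJet_of_contDiff (hG.contDiff_right k hk x)

theorem IsCmr.isJet_left (hG : IsCmr m r G) (y : Euc d) :
    IsJet m fun k x => mixedDeriv k 0 G x y := by
  simp only [mixedDeriv_zero_right]
  exact isJet_of_contDiff (hG.contDiff_left y)

theorem ext_integral {X : Type*} [TopologicalSpace X] [FirstCountableTopology X]
    [LocallyCompactSpace X] [SecondCountableTopology X] [T2Space X]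
    [MeasurableSpace X] [BorelSpace X] {μ : Measure X} [IsLocallyFiniteMeasure μ] {Q : Set X}
    {H : (Fin d → ℕ) → X → Euc d → ℝ} (F : Distr d) (hQ : IsCompact Q)
    (hc : ∀ k, deg k ≤ r → Continuous fun p : X × Euc d => H k p.1 p.2)
    (hj : ∀ t, IsJet r fun k => H k t) {L : Set (Euc d)} (hL : IsCompact L)
    (hs : ∀ t, ∀ y ∉ L, H 0 t y = 0) :
    ext r F (fun y => ∫ t in Q, H 0 t y ∂μ) = ∫ t in Q, ext r F (H 0 t) ∂μ :=
  distrC_integral (extend r F) hQ hc hj hL hs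

/-- The derivatives of the function `z ↦ F (G (z, ·))`. -/
def pot (r : ℕ) (F : Distr d) (G : Euc d → Euc d → ℝ) (k : Fin d → ℕ) (z : Euc d) : ℝ :=
  ext r F fun y => partialDeriv k (fun x' => G x' y) z

theorem pot_eq (F : Distr d) (k : Fin d → ℕ) (z : Euc d) :
    pot r F G k z = ext r F (mixedDeriv k 0 G z) := by
  rw [pot]
  congr 1
  ext y
  rw [mixedDeriv_zero_right]

/-- Continuity is local, so z may be restricted to a unit ball, over which all the functions G(z, ·)
are supported in one compact set. -/
theorem IsCmr.continuous_pot (hG : IsCmr m r G) (hρ : ∀ x y, ρ < ‖x - y‖ → G x y = 0)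
    (F : Distr d) {k : Fin d → ℕ} (hk : deg k ≤ m) : Continuous (pot r F G k) := by
  rw [continuous_iff_continuousAt]
  intro z₀
  refine ContinuousOn.continuousAt (s := Metric.closedBall z₀ 1) ?_
    (Metric.closedBall_mem_nhds z₀ one_pos)
  rw [continuousOn_iff_continuous_domRestrict]
  have := continuous_distrC (extend r F) (X := Metric.closedBall z₀ 1)
    (H := fun l z y => mixedDeriv k l G z y)
    (fun l hl => (hG.continuous_mixed k l hk hl).comp
      ((continuous_subtype_val.comp continuous_fst).prodMk continuous_snd))
    (fun z => hG.isJet_right hk z) (isCompact_closedBall z₀ (1 + ρ)) (fun z y hy => by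
      rw [mixedDeriv_zero_right]
      refine hG.left_eq_zero hρ hk ?_
      have h1 := z.2
      rw [Metric.mem_closedBall, dist_eq_norm] at h1 hy
      have h2 := norm_sub_le_norm_sub_add_norm_sub y z.1 z₀
      rw [norm_sub_rev]
      linarith)
  refine this.congr fun z => ?_
  rw [Set.domRestrict_apply, pot_eq]
  rfl

theorem IsCmr.contDiff_mixedDeriv (hG : IsCmr m r G) {k : Fin d → ℕ} (hk : deg k ≤ m) (x : Euc d) :
    ContDiff ℝ r (mixedDeriv k 0 G x) := (hG.isJet_right hk x).contDiff

theorem IsCmr.hasCompactSupport_mixedDeriv (hG : IsCmr m r G)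
    (hρ : ∀ x y, ρ < ‖x - y‖ → G x y = 0) {k : Fin d → ℕ} (hk : deg k ≤ m) (x : Euc d) :
    HasCompactSupport (mixedDeriv k 0 G x) := by
  have := hG.left_hasCompactSupport hρ hk x
  simpa only [← mixedDeriv_zero_right] using this

/-- Clamping the parameter keeps the supports of the integrands in a single ball for all real t, as
the exchange of F with the integral requires. -/
theorem IsCmr.ext_integral_segment (hG : IsCmr m r G) (hρ : ∀ x y, ρ < ‖x - y‖ → G x y = 0)
    (F : Distr d) {k : Fin d → ℕ} (hk : deg k < m) (z v : Euc d) :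
    ext r F (fun y => ∫ t in Icc (0 : ℝ) 1,
        ∑ i, v i * mixedDeriv (k + Pi.single i 1) 0 G (z + clamp t • v) y) =
      ∫ t in Icc (0 : ℝ) 1,
        ext r F fun y => ∑ i, v i * mixedDeriv (k + Pi.single i 1) 0 G (z + clamp t • v) y := by
  have hk1 : ∀ i, deg (k + Pi.single i 1) ≤ m := fun i => by rw [deg_add_single]; omega
  have hc : ∀ l, deg l ≤ r → Continuous fun p : ℝ × Euc d =>
      ∑ i, v i * mixedDeriv (k + Pi.single i 1) l G (z + clamp p.1 • v) p.2 := fun l hl =>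
    continuous_finsetSum _ fun i _ => continuous_const.mul
      ((hG.continuous_mixed _ l (hk1 i) hl).comp (Continuous.prodMk (continuous_const.add
        ((continuous_clamp.comp continuous_fst).smul continuous_const)) continuous_snd))
  have hs : ∀ (t : ℝ), ∀ y ∉ Metric.closedBall z (‖v‖ + ρ),
      ∑ i, v i * mixedDeriv (k + Pi.single i 1) 0 G (z + clamp t • v) y = 0 := fun t y hy =>
    Finset.sum_eq_zero fun i _ => by
      rw [mixedDeriv_zero_right, hG.left_eq_zero hρ (hk1 i), mul_zero]
      rw [Metric.mem_closedBall, dist_eq_norm, not_le] at hy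
      have h2 := norm_sub_le_norm_sub_add_norm_sub y (z + clamp t • v) z
      have h3 : ‖z + clamp t • v - z‖ ≤ ‖v‖ := by
        rw [add_sub_cancel_left, norm_smul, Real.norm_of_nonneg (clamp_mem t).1]
        exact mul_le_of_le_one_left (norm_nonneg _) (clamp_mem t).2
      rw [norm_sub_rev]
      linarith
  have hj : ∀ t : ℝ, IsJet r fun l y =>
      ∑ i, v i * mixedDeriv (k + Pi.single i 1) l G (z + clamp t • v) y := fun t =>
    IsJet.sum _ fun i _ => (hG.isJet_right (hk1 i) _).const_mul (v i)
  obtain ⟨H, hH⟩ : ∃ H : (Fin d → ℕ) → ℝ → Euc d → ℝ, H = fun l t y =>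
    ∑ i, v i * mixedDeriv (k + Pi.single i 1) l G (z + clamp t • v) y := ⟨_, rfl⟩
  have hc' : ∀ l, deg l ≤ r → Continuous fun p : ℝ × Euc d => H l p.1 p.2 := by
    rw [hH]; exact hc
  have hj' : ∀ t : ℝ, IsJet r fun l => H l t := by rw [hH]; exact hj
  have hs' : ∀ (t : ℝ), ∀ y ∉ Metric.closedBall z (‖v‖ + ρ), H 0 t y = 0 := by rw [hH]; exact hs
  have key := ext_integral F (μ := volume) (isCompact_Icc (a := (0 : ℝ)) (b := 1)) hc' hj'
    (isCompact_closedBall z (‖v‖ + ρ)) hs'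
  rw [hH] at key
  exact key

/-- The identity holds for the kernel itself with y fixed; F is then applied in the variable y and
exchanged with the integral over the segment. -/
theorem IsCmr.pot_sub_eq_integral (hG : IsCmr m r G) (hρ : ∀ x y, ρ < ‖x - y‖ → G x y = 0)
    (F : Distr d) {k : Fin d → ℕ} (hk : deg k < m) (z v : Euc d) :
    pot r F G k (z + v) - pot r F G k z =
      ∫ t in Icc (0 : ℝ) 1, ∑ i, v i * pot r F G (k + Pi.single i 1) (z + clamp t • v) := by
  have hk1 : ∀ i, deg (k + Pi.single i 1) ≤ m := fun i => by rw [deg_add_single]; omega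
  rw [pot_eq, pot_eq, ← ext_sub_right F (hG.contDiff_mixedDeriv hk.le _)
    (hG.hasCompactSupport_mixedDeriv hρ hk.le _) (hG.contDiff_mixedDeriv hk.le _)
    (hG.hasCompactSupport_mixedDeriv hρ hk.le _)]
  have h1 : (fun y => mixedDeriv k 0 G (z + v) y - mixedDeriv k 0 G z y) = fun y =>
      ∫ t in Icc (0 : ℝ) 1,
        ∑ i, v i * mixedDeriv (k + Pi.single i 1) 0 G (z + clamp t • v) y := by
    ext y
    exact (hG.isJet_left y).sub_eq_integral hk z v
  rw [h1, hG.ext_integral_segment hρ F hk]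
  refine integral_congr_ae (Eventually.of_forall fun t => ?_)
  dsimp only
  rw [ext_sum_right F (f := fun i y => v i * mixedDeriv (k + Pi.single i 1) 0 G
    (z + clamp t • v) y) _ (fun i _ => contDiff_const.mul (hG.contDiff_mixedDeriv (hk1 i) _))
    (fun i _ => (hG.hasCompactSupport_mixedDeriv hρ (hk1 i) _).mul_left)]
  refine Finset.sum_congr rfl fun i _ => ?_
  rw [ext_const_mul_right F (hG.contDiff_mixedDeriv (hk1 i) _)
    (hG.hasCompactSupport_mixedDeriv hρ (hk1 i) _), pot_eq]

theorem IsCmr.isJet_pot (hG : IsCmr m r G) (hρ : ∀ x y, ρ < ‖x - y‖ → G x y = 0)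
    (F : Distr d) : IsJet m (pot r F G) where
  continuous k hk := hG.continuous_pot hρ F hk
  hasFDerivAt k hk z := hasFDerivAt_of_sub_eq_integral
    (fun i => hG.continuous_pot hρ F (by rw [deg_add_single]; omega))
    (hG.pot_sub_eq_integral hρ F hk) z

theorem dualAct_eq_setIntegral (ψ : Test d) {x : Euc d} {s : ℝ} (hψ : ∀ z, s < ‖z - x‖ → ψ z = 0)
    (g : Euc d → ℝ) : ∫ z, ψ z * g z = ∫ z in Metric.closedBall x s, ψ z * g z := by
  rw [setIntegral_eq_integral_of_forall_compl_eq_zero]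
  intro z hz
  rw [hψ z (by simpa [dist_eq_norm] using hz), zero_mul]

theorem IsCmr.isJet_dualAct (hG : IsCmr m r G) (ψ : Test d) :
    IsJet r fun l y => ∫ x, ψ x * mixedDeriv 0 l G x y := by
  obtain ⟨s, -, hs⟩ := exists_zero_of_hasCompactSupport ψ.hasCompactSupport 0
  have := isJet_integral (μ := volume) (isCompact_closedBall (0 : Euc d) s)
    (H := fun l x y => ψ x * mixedDeriv 0 l G x y)
    (fun l hl => (ψ.continuous.comp continuous_fst).mul
      (hG.continuous_mixed 0 l (by simp [deg_zero]) hl))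
    (fun x => (hG.isJet_right (by simp [deg_zero]) x).const_mul (ψ x))
  simpa only [dualAct_eq_setIntegral ψ hs] using this

theorem dualAct_eq_mixedDeriv (ψ : Test d) :
    dualAct G ψ = fun y => ∫ x, ψ x * mixedDeriv 0 0 G x y := by
  ext y
  simp only [dualAct, mixedDeriv_zero_left, partialDeriv_zero]

theorem IsCmr.contDiff_dualAct (hG : IsCmr m r G) (ψ : Test d) : ContDiff ℝ r (dualAct G ψ) := by
  rw [dualAct_eq_mixedDeriv]
  exact (hG.isJet_dualAct ψ).contDiff

theorem IsCmr.partialDeriv_dualAct (hG : IsCmr m r G) (ψ : Test d) {l : Fin d → ℕ}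
    (hl : deg l ≤ r) (y : Euc d) :
    partialDeriv l (dualAct G ψ) y = ∫ x, ψ x * mixedDeriv 0 l G x y := by
  rw [dualAct_eq_mixedDeriv]
  exact congrFun ((hG.isJet_dualAct ψ).partialDeriv_eq hl) y

theorem dualAct_eq_zero (hρ : ∀ x y, ρ < ‖x - y‖ → G x y = 0) {ψ : Test d} {x : Euc d} {s : ℝ}
    (hψ : ∀ z, s < ‖z - x‖ → ψ z = 0) (y : Euc d) (hy : s + ρ < ‖y - x‖) : dualAct G ψ y = 0 := by
  refine integral_eq_zero_of_ae (Eventually.of_forall fun z => ?_)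
  by_cases h : s < ‖z - x‖
  · simp [hψ z h]
  · have h2 := norm_sub_le_norm_sub_add_norm_sub y z x
    simp only [Pi.zero_apply]
    rw [hρ z y (by rw [norm_sub_rev]; linarith), mul_zero]

theorem hasCompactSupport_dualAct (hρ : ∀ x y, ρ < ‖x - y‖ → G x y = 0) (ψ : Test d) :
    HasCompactSupport (dualAct G ψ) := by
  obtain ⟨s, -, hs⟩ := exists_zero_of_hasCompactSupport ψ.hasCompactSupport 0
  exact hasCompactSupport_of_zero (x := 0) (s := s + ρ) (dualAct_eq_zero hρ hs)

/-- Exchanging F with the integral against ψ identifies the action of the kernel on F with a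
function. Each term of 𝖪F is therefore an honest integral, to which Taylor expansion applies. -/
theorem IsCmr.ext_dualAct (hG : IsCmr m r G) (hρ : ∀ x y, ρ < ‖x - y‖ → G x y = 0)
    (F : Distr d) (ψ : Test d) : ext r F (dualAct G ψ) = ∫ z, ψ z * pot r F G 0 z := by
  obtain ⟨s, -, hs⟩ := exists_zero_of_hasCompactSupport ψ.hasCompactSupport 0
  have h0 : deg (0 : Fin d → ℕ) ≤ m := by simp [deg_zero]
  have key := distrC_integral (extend r F) (μ := volume) (isCompact_closedBall (0 : Euc d) s)
    (H := fun l x y => ψ x * mixedDeriv 0 l G x y)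
    (fun l hl => (ψ.continuous.comp continuous_fst).mul
      (hG.continuous_mixed 0 l h0 hl))
    (fun x => (hG.isJet_right h0 x).const_mul (ψ x)) (isCompact_closedBall (0 : Euc d) (s + ρ))
    (fun z y hy => by
      by_cases h : s < ‖z - 0‖
      · rw [hs z h, zero_mul]
      · have h2 := norm_sub_le_norm_sub_add_norm_sub y z 0
        rw [Metric.mem_closedBall, dist_eq_norm, not_le] at hy
        rw [mixedDeriv_zero_right, hG.left_eq_zero hρ h0 (by rw [norm_sub_rev]; linarith),
          mul_zero])
  rw [dualAct_eq_mixedDeriv, dualAct_eq_setIntegral ψ hs]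
  simp only [dualAct_eq_setIntegral ψ hs]
  refine key.trans (integral_congr_ae (Eventually.of_forall fun z => ?_))
  change ext r F (fun y => ψ z * mixedDeriv 0 0 G z y) = _
  rw [ext_const_mul_right F (hG.isJet_right h0 z).contDiff]
  · simp only [pot_eq]
  · have := hG.left_hasCompactSupport hρ h0 z
    simpa only [← mixedDeriv_zero_right] using this

end Potential


/-! ### Dyadic scales -/

/-- The dyadic scale `2^{-n}`. -/
def eps (n : ℕ) : ℝ := ((2 : ℝ) ^ n)⁻¹

theorem eps_pos (n : ℕ) : 0 < eps n := by unfold eps; positivity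

theorem eps_le_one (n : ℕ) : eps n ≤ 1 := inv_le_one_of_one_le₀ (one_le_pow₀ one_le_two)

theorem eps_zero : eps 0 = 1 := by simp [eps]

theorem eps_add (n p : ℕ) : eps (n + p) = eps n * eps p := by
  rw [eps, eps, eps, pow_add, mul_inv]

theorem eps_anti {n p : ℕ} (h : n ≤ p) : eps p ≤ eps n := by
  obtain ⟨q, rfl⟩ := Nat.exists_eq_add_of_le h
  rw [eps_add]
  exact mul_le_of_le_one_right (eps_pos n).le (eps_le_one q)

theorem eps_rpow (n : ℕ) (t : ℝ) : eps n ^ t = ((2 : ℝ) ^ (-t)) ^ n := by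
  rw [eps, ← Real.rpow_natCast, ← Real.rpow_neg zero_le_two, ← Real.rpow_mul zero_le_two,
    ← Real.rpow_natCast, ← Real.rpow_mul zero_le_two]
  congr 1; ring

theorem summable_eps_rpow {t : ℝ} (ht : 0 < t) : Summable fun n => eps n ^ t := by
  simp only [eps_rpow]
  exact summable_geometric_of_lt_one (by positivity)
    (Real.rpow_lt_one_of_one_lt_of_neg one_lt_two (by linarith))

/-- The sum of the `2^{-tn}`. -/
def epsSum (t : ℝ) : ℝ := ∑' n, eps n ^ t

theorem epsSum_nonneg (t : ℝ) : 0 ≤ epsSum t :=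
  tsum_nonneg fun n => Real.rpow_nonneg (eps_pos n).le t

theorem exists_cut {s : ℝ} (hs : 0 < s) :
    ∃ N, (∀ n < N, s < eps n) ∧ ∀ n, N ≤ n → eps n ≤ s := by
  have h : ∃ n, eps n ≤ s := by
    obtain ⟨n, hn⟩ := exists_pow_lt_of_lt_one hs (by norm_num : (2 : ℝ)⁻¹ < 1)
    exact ⟨n, by rw [eps, ← inv_pow]; exact hn.le⟩
  classical
  refine ⟨Nat.find h, fun n hn => not_le.1 (Nat.find_min h hn), fun n hn => ?_⟩
  exact (eps_anti hn).trans (Nat.find_spec h)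

/-- Below the cut the terms decay geometrically from the scale ε_N ≤ s on, so the sum is comparable
with the value at s. -/
theorem sum_tail_le {f : ℕ → ℝ} {N : ℕ} {s t D : ℝ} (ht : 0 < t) (hs : 0 < s) (hN : eps N ≤ s)
    (hD : 0 ≤ D) (hf : ∀ n, N ≤ n → |f n| ≤ D * eps n ^ t) :
    Summable (fun n => f (n + N)) ∧ |∑' n, f (n + N)| ≤ epsSum t * (D * s ^ t) := by
  have h1 : ∀ n, ‖f (n + N)‖ ≤ D * s ^ t * eps n ^ t := fun n => by
    refine (hf _ (Nat.le_add_left N n)).trans ?_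
    rw [eps_add, Real.mul_rpow (eps_pos _).le (eps_pos _).le, mul_assoc, mul_comm (eps n ^ t)]
    have := Real.rpow_le_rpow (eps_pos N).le hN ht.le
    have := Real.rpow_nonneg (eps_pos n).le t
    gcongr
  have h2 := (summable_eps_rpow ht).mul_left (D * s ^ t)
  refine ⟨Summable.of_norm_bounded h2 h1, ?_⟩
  refine (tsum_of_norm_bounded h2.hasSum h1).trans ?_
  rw [tsum_mul_left, mul_comm, epsSum]

/-- Above the cut the terms grow geometrically with n. Read backwards from the last scale, which
still exceeds s, the sum is dominated by a convergent geometric series. -/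
theorem sum_head_le {f : ℕ → ℝ} {N : ℕ} {s t D : ℝ} (ht : 0 < t) (hs : 0 < s)
    (hN : ∀ n < N, s < eps n) (hD : 0 ≤ D) (hf : ∀ n < N, |f n| ≤ D * eps n ^ (-t)) :
    |∑ n ∈ Finset.range N, f n| ≤ epsSum t * (D * s ^ (-t)) := by
  refine (Finset.abs_sum_le_sum_abs _ _).trans ?_
  rw [← Finset.sum_range_reflect]
  have h1 : ∀ n ∈ Finset.range N, |f (N - 1 - n)| ≤ eps n ^ t * (D * s ^ (-t)) := by
    intro n hn
    rw [Finset.mem_range] at hn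
    refine (hf _ (by omega)).trans ?_
    have h2 : eps (N - 1) = eps (N - 1 - n) * eps n := by
      rw [← eps_add]; congr 1; omega
    have h3 : eps (N - 1 - n) ^ (-t) = eps n ^ t * eps (N - 1) ^ (-t) := by
      rw [h2, Real.mul_rpow (eps_pos _).le (eps_pos _).le, mul_left_comm,
        ← Real.rpow_add (eps_pos n)]
      simp
    rw [h3, mul_left_comm]
    have h4 : eps (N - 1) ^ (-t) ≤ s ^ (-t) :=
      Real.rpow_le_rpow_of_nonpos hs (hN _ (by omega)).le (by linarith)
    have := Real.rpow_nonneg (eps_pos n).le t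
    gcongr
  refine (Finset.sum_le_sum h1).trans ?_
  rw [← Finset.sum_mul]
  have h5 : ∑ n ∈ Finset.range N, eps n ^ t ≤ epsSum t :=
    (summable_eps_rpow ht).sum_le_tsum _ fun n _ => Real.rpow_nonneg (eps_pos n).le t
  have := Real.rpow_nonneg hs.le (-t)
  gcongr

/-! ### Kernels at a given scale -/

/-- The volume of the unit ball. -/
def ballVol (d : ℕ) : ℝ := (volume : Measure (Euc d)).real (Metric.closedBall 0 1)

theorem ballVol_nonneg (d : ℕ) : 0 ≤ ballVol d := measureReal_nonneg

theorem volume_closedBall {d : ℕ} (x : Euc d) {s : ℝ} (hs : 0 ≤ s) :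
    (volume : Measure (Euc d)).real (Metric.closedBall x s) = s ^ d * ballVol d := by
  rw [ballVol, Measure.real, Measure.addHaar_closedBall' _ _ hs, ENNReal.toReal_mul,
    ENNReal.toReal_ofReal (by positivity), Measure.real]
  simp

theorem CrBd.abs_integral_mul_le {d r : ℕ} {ψ g : Euc d → ℝ} {x : Euc d} {s M D : ℝ}
    (hψ : CrBd r ψ x s M) (hs : 0 < s) (hg : ∀ z, ‖z - x‖ ≤ s → |g z| ≤ D) :
    |∫ z, ψ z * g z| ≤ ballVol d * (M * D) := by
  have h1 : ∫ z, ψ z * g z = ∫ z in Metric.closedBall x s, ψ z * g z := by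
    rw [setIntegral_eq_integral_of_forall_compl_eq_zero]
    intro z hz
    rw [hψ.zero z (by simpa [dist_eq_norm] using hz), zero_mul]
  rw [h1, ← Real.norm_eq_abs]
  refine (norm_setIntegral_le_of_norm_le_const (C := M * (s ^ d)⁻¹ * D)
    measure_closedBall_lt_top fun z hz => ?_).trans (le_of_eq ?_)
  · rw [norm_mul]
    have h2 := hψ.bound 0 (by simp [deg_zero]) z
    rw [partialDeriv_zero, deg_zero, pow_zero, inv_one, mul_one] at h2
    rw [Metric.mem_closedBall, dist_eq_norm] at hz
    exact mul_le_mul h2 (hg z hz) (abs_nonneg _) ((abs_nonneg _).trans h2)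
  · rw [volume_closedBall x hs.le]
    field_simp

/-- A kernel of size `b` at scale `ε`: the blocks of which regularising kernels are made. -/
structure IsBlock {d : ℕ} (m r : ℕ) (ρ ε b : ℝ) (L : Set (Euc d)) (G : Euc d → Euc d → ℝ) :
    Prop where
  cmr : IsCmr m r G
  support : ∀ x y, ρ * ε < ‖x - y‖ → G x y = 0
  deriv : ∀ k l : Fin d → ℕ, deg k ≤ m → deg l ≤ r → ∀ x ∈ L, ∀ y ∈ L,
    |mixedDeriv k l G x y| ≤ b * ((ε ^ d)⁻¹ * (ε ^ deg l)⁻¹ * (ε ^ deg k)⁻¹)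
  moment : ∀ k l : Fin d → ℕ, deg k ≤ r → deg l ≤ r → ∀ y ∈ L,
    |∫ x, mpow (y - x) l * partialDeriv k (fun y' => G x y') y| ≤ b

theorem IsRegularisingKernel.exists_isBlock {d m r : ℕ} {β ρ : ℝ} {Ker : Euc d → Euc d → ℝ}
    {Kn : ℕ → Euc d → Euc d → ℝ} (h : IsRegularisingKernel β m r ρ Ker Kn) {L : Set (Euc d)}
    (hL : IsCompact L) :
    ∃ c, 0 < c ∧ ∀ n, IsBlock m r ρ (eps n) (c * eps n ^ β) L (Kn n) := by
  obtain ⟨c, hc, h1, h2⟩ := h.bounds L hL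
  refine ⟨c, hc, fun n => ⟨h.regular n, fun x y hxy => h.support n x y hxy,
    fun k l hk hl x hx y hy => (h1 n k l hk hl x hx y hy).trans (le_of_eq ?_),
    fun k l hk hl y hy => (h2 n k l hk hl y hy).trans (le_of_eq ?_)⟩⟩
  · rw [mul_assoc]
    congr 1
    have e : ∀ j : ℕ, (eps n ^ j)⁻¹ = eps n ^ (-(j : ℝ)) := fun j => by
      rw [Real.rpow_neg (eps_pos n).le, Real.rpow_natCast]
    rw [e, e, e, ← Real.rpow_add (eps_pos n), ← Real.rpow_add (eps_pos n),
      ← Real.rpow_add (eps_pos n), eps_rpow, ← Real.rpow_natCast, ← Real.rpow_mul zero_le_two]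
    congr 1; ring
  · congr 1
    rw [eps_rpow, ← Real.rpow_natCast, ← Real.rpow_mul zero_le_two]

/-! ### Action of one block on distributions, at its own scale and on test functions at larger
scales. -/

namespace IsBlock

variable {d m r : ℕ} {ρ ε b : ℝ} {L : Set (Euc d)} {G : Euc d → Euc d → ℝ}

theorem nonneg (hG : IsBlock m r ρ ε b L G) (hL : L.Nonempty) : 0 ≤ b := by
  obtain ⟨x, hx⟩ := hL
  exact (abs_nonneg _).trans (hG.moment 0 0 (by simp [deg_zero]) (by simp [deg_zero]) x hx)

/-- For z within ε of x, the function ∂_1^k G(z, ·) is b ε^{-|k|} times a test function centred at x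
at scale (1 + ρ)ε. The factor 2 in the scale leaves room for the mollification by which F is
extended. -/
theorem abs_pot_le (hG : IsBlock m r ρ ε b L G) (hρ : 0 < ρ) (hε : 0 < ε) {r' : ℕ} (hr : r' ≤ r)
    {F : Distr d} (hF : LocBdd r F) {x : Euc d} {B : ℝ}
    (hB : ScaleBd r' F x (2 * ((1 + ρ) * ε)) B) (hL : Metric.closedBall x ((1 + ρ) * ε) ⊆ L)
    {k : Fin d → ℕ} (hk : deg k ≤ m) {z : Euc d} (hz : ‖z - x‖ ≤ ε) :
    |pot r F G k z| ≤ (2 * (1 + ρ)) ^ (d + r') * (b * (ε ^ deg k)⁻¹ * B) := by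
  have hρε : 0 < ρ * ε := by positivity
  have hxL : x ∈ L := hL (Metric.mem_closedBall_self (by positivity))
  have hb := hG.nonneg ⟨x, hxL⟩
  have hzL : z ∈ L := hL (by rw [Metric.mem_closedBall, dist_eq_norm]; nlinarith)
  have hcr : CrBd r' (mixedDeriv k 0 G z) x ((1 + ρ) * ε)
      (b * (ε ^ deg k)⁻¹ * (1 + ρ) ^ (d + r')) := by
    have h0 : ∀ y, (1 + ρ) * ε < ‖y - x‖ → mixedDeriv k 0 G z y = 0 := fun y hy => by
      rw [mixedDeriv_zero_right]
      refine hG.cmr.left_eq_zero hG.support hk ?_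
      have := norm_sub_le_norm_sub_add_norm_sub y z x
      rw [norm_sub_rev]
      linarith
    have hcd := (hG.cmr.contDiff_mixedDeriv hk z).of_le
      (show (r' : WithTop ℕ∞) ≤ r by exact_mod_cast hr)
    refine ⟨hcd, h0, fun l hl y => ?_⟩
    have hld : ContDiff ℝ (deg l) (mixedDeriv k 0 G z) := hcd.of_le (by exact_mod_cast hl)
    by_cases hy : (1 + ρ) * ε < ‖y - x‖
    · rw [partialDeriv_eq_zero hld h0 y hy, abs_zero]
      positivity
    · have hyL : y ∈ L := hL (by rw [Metric.mem_closedBall, dist_eq_norm]; linarith)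
      rw [(hG.cmr.isJet_right hk z).partialDeriv_eq (hl.trans hr)]
      refine (hG.deriv k l hk (hl.trans hr) z hzL y hyL).trans ?_
      have h1 : (1 : ℝ) ≤ (1 + ρ) ^ (d + r') * ((1 + ρ) ^ (d + deg l))⁻¹ := by
        rw [← div_eq_mul_inv, one_le_div (by positivity)]
        exact pow_le_pow_right₀ (by linarith) (by omega)
      calc b * ((ε ^ d)⁻¹ * (ε ^ deg l)⁻¹ * (ε ^ deg k)⁻¹)
          ≤ b * ((ε ^ d)⁻¹ * (ε ^ deg l)⁻¹ * (ε ^ deg k)⁻¹) *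
            ((1 + ρ) ^ (d + r') * ((1 + ρ) ^ (d + deg l))⁻¹) :=
            le_mul_of_one_le_right (by positivity) h1
        _ = _ := by rw [mul_pow, mul_pow, mul_inv, mul_inv, pow_add _ d (deg l), mul_inv]; ring
  rw [pot_eq]
  refine (hF.abs_ext_le (by positivity) (by positivity) (hG.cmr.contDiff_mixedDeriv hk z) hcr
    hB).trans (le_of_eq ?_)
  rw [mul_pow]; ring

theorem continuous_mixedDeriv_left (hG : IsBlock m r ρ ε b L G) {l : Fin d → ℕ} (hl : deg l ≤ r)
    (y : Euc d) : Continuous fun w => mixedDeriv 0 l G w y :=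
  (hG.cmr.continuous_mixed 0 l (by simp [deg_zero]) hl).comp
    (continuous_id.prodMk continuous_const)

theorem mixedDeriv_eq_zero (hG : IsBlock m r ρ ε b L G) {l : Fin d → ℕ} (hl : deg l ≤ r)
    {w y : Euc d} (h : ρ * ε < ‖w - y‖) : mixedDeriv 0 l G w y = 0 := by
  rw [mixedDeriv_zero_left]
  have hc : ContDiff ℝ (deg l) fun y' => G w y' := by
    have := (hG.cmr.contDiff_mixedDeriv (k := 0) (by simp [deg_zero]) w).of_le
      (show ((deg l : ℕ) : WithTop ℕ∞) ≤ r by exact_mod_cast hl)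
    have e : (fun y' => G w y') = mixedDeriv 0 0 G w := by
      ext; rw [mixedDeriv_zero_left, partialDeriv_zero]
    rwa [e]
  exact partialDeriv_eq_zero hc (fun z hz => hG.support w z (by rwa [norm_sub_rev])) y
    (by rwa [norm_sub_rev])

theorem abs_moment_le (hG : IsBlock m r ρ ε b L G) {l j : Fin d → ℕ} (hl : deg l ≤ r)
    (hj : deg j ≤ r) {y : Euc d} (hy : y ∈ L) :
    |∫ w, nmon j (w - y) * mixedDeriv 0 l G w y| ≤ b := by
  have h1 : ∀ w, nmon j (w - y) * mixedDeriv 0 l G w y =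
      ((-1) ^ deg j / mfact j) * (mpow (y - w) j * partialDeriv l (fun y' => G w y') y) :=
    fun w => by
      have : w - y = (-1 : ℝ) • (y - w) := by rw [neg_one_smul, neg_sub]
      rw [this, nmon_smul, mixedDeriv_zero_left, nmon]
      ring
  simp only [h1]
  rw [integral_const_mul, abs_mul, abs_div, abs_pow, abs_neg, abs_one, one_pow,
    abs_of_pos (by exact_mod_cast mfact_pos j : (0 : ℝ) < mfact j)]
  refine le_trans (mul_le_of_le_one_left (abs_nonneg _) ?_) (hG.moment l j hl hj y hy)
  exact div_le_one_of_le₀ (one_le_mfact j) (zero_le_one.trans (one_le_mfact j))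

/-- Each derivative of G costs ε⁻¹, which is worse than the desired s⁻¹. To repair this, ψ is
expanded at y to the order |l|: the remainder gains (ε/s)^{|l|}, which compensates, while the
monomials are paired with ∂_2^l G and bounded by the moment condition. -/
theorem abs_partialDeriv_dualAct_le (hG : IsBlock m r ρ ε b L G) (hρ : 0 < ρ) (hε : 0 < ε)
    {l : Fin d → ℕ} (hl : deg l ≤ r) {ψ : Test d} {x y : Euc d} {s M S : ℝ} (hs : 0 < s)
    (hεs : ε ≤ s) (hS : 1 ≤ S) (hsS : s ≤ S) (hM : 0 ≤ M) (hψ : CrBd (deg l) ψ x s M)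
    (hL : Metric.closedBall y (ρ * ε) ⊆ L) :
    |partialDeriv l (dualAct G ψ) y| ≤ ((d : ℝ) ^ deg l * ρ ^ (d + deg l) * ballVol d +
      (below d (deg l)).card * S ^ deg l) * (b * M * ((s ^ d)⁻¹ * (s ^ deg l)⁻¹)) := by
  have hρε : 0 < ρ * ε := by positivity
  have hyL : y ∈ L := hL (Metric.mem_closedBall_self hρε.le)
  have hb := hG.nonneg ⟨y, hyL⟩
  set q := deg l with hq
  have hgc := hG.continuous_mixedDeriv_left hl y
  have hg0 : ∀ w, ρ * ε < ‖w - y‖ → mixedDeriv 0 l G w y = 0 := fun w hw =>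
    hG.mixedDeriv_eq_zero hl hw
  have hint : ∀ u : Euc d → ℝ, Continuous u →
      Integrable fun w => u w * mixedDeriv 0 l G w y := fun u hu =>
    (hu.mul hgc).integrable_of_hasCompactSupport (hasCompactSupport_of_zero hg0).mul_left
  rw [hG.cmr.partialDeriv_dualAct ψ hl]
  have hp : Continuous fun w => ∑ j ∈ below d q, nmon j (w - y) * partialDeriv j ψ y :=
    continuous_finsetSum _ fun j _ =>
      ((continuous_nmon j).comp (continuous_id.sub continuous_const)).mul continuous_const
  have h1 : ∫ w, ψ w * mixedDeriv 0 l G w y =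
      (∫ w, (ψ w - ∑ j ∈ below d q, nmon j (w - y) * partialDeriv j ψ y) *
        mixedDeriv 0 l G w y) +
      ∑ j ∈ below d q, partialDeriv j ψ y * ∫ w, nmon j (w - y) * mixedDeriv 0 l G w y := by
    simp only [← integral_const_mul]
    have hmon : ∀ j ∈ below d q, Integrable fun w =>
        partialDeriv j ψ y * (nmon j (w - y) * mixedDeriv 0 l G w y) := fun j _ =>
      (hint (fun w => nmon j (w - y)) ((continuous_nmon j).comp
        (continuous_id.sub continuous_const))).const_mul _
    rw [← integral_finsetSum _ hmon, ← integral_add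
        (hint (fun w => ψ w - ∑ j ∈ below d q, nmon j (w - y) * partialDeriv j ψ y)
          (ψ.continuous.sub hp)) (integrable_finsetSum _ hmon)]
    congr 1
    ext w
    rw [sub_mul, Finset.sum_mul]
    have : ∀ j ∈ below d q, nmon j (w - y) * partialDeriv j ψ y * mixedDeriv 0 l G w y =
      partialDeriv j ψ y * (nmon j (w - y) * mixedDeriv 0 l G w y) := fun j _ => by ring
    rw [Finset.sum_congr rfl this]
    ring
  have h2 : |∫ w, (ψ w - ∑ j ∈ below d q, nmon j (w - y) * partialDeriv j ψ y) *
      mixedDeriv 0 l G w y| ≤ (d : ℝ) ^ q * ρ ^ (d + q) * ballVol d *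
        (b * M * ((s ^ d)⁻¹ * (s ^ q)⁻¹)) := by
    have h3 : ∫ w, (ψ w - ∑ j ∈ below d q, nmon j (w - y) * partialDeriv j ψ y) *
        mixedDeriv 0 l G w y = ∫ w in Metric.closedBall y (ρ * ε),
          (ψ w - ∑ j ∈ below d q, nmon j (w - y) * partialDeriv j ψ y) *
            mixedDeriv 0 l G w y := by
      rw [setIntegral_eq_integral_of_forall_compl_eq_zero]
      intro w hw
      rw [hg0 w (by simpa [dist_eq_norm] using hw), mul_zero]
    rw [h3, ← Real.norm_eq_abs]
    refine (norm_setIntegral_le_of_norm_le_const (C := (d : ℝ) ^ q *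
      (M * ((s ^ d)⁻¹ * (s ^ q)⁻¹)) * (ρ * ε) ^ q * (b * ((ε ^ d)⁻¹ * (ε ^ q)⁻¹)))
      measure_closedBall_lt_top fun w hw => ?_).trans (le_of_eq ?_)
    · have hwL := hL hw
      rw [Metric.mem_closedBall, dist_eq_norm] at hw
      rw [norm_mul]
      have h4 := (isJet_of_contDiff hψ.contDiff).taylor convex_univ
        (B := M * ((s ^ d)⁻¹ * (s ^ q)⁻¹))
        (fun k hk z _ => by have := hψ.bound k hk.le z; rwa [hk] at this)
        (mem_univ y) (mem_univ w)
      rw [partialDeriv_zero] at h4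
      have h5 := hG.deriv 0 l (by simp [deg_zero]) hl w hwL y hyL
      rw [deg_zero, pow_zero, inv_one, mul_one] at h5
      refine mul_le_mul (h4.trans ?_) h5 (abs_nonneg _) (by positivity)
      gcongr
    · rw [volume_closedBall y hρε.le]
      rw [pow_add, mul_pow, mul_pow]
      field_simp
  have h6 : |∑ j ∈ below d q, partialDeriv j ψ y * ∫ w, nmon j (w - y) * mixedDeriv 0 l G w y| ≤
      (below d q).card * S ^ q * (b * M * ((s ^ d)⁻¹ * (s ^ q)⁻¹)) := by
    refine (Finset.abs_sum_le_sum_abs _ _).trans ?_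
    rw [mul_assoc, ← nsmul_eq_mul]
    refine Finset.sum_le_card_nsmul _ _ _ fun j hj => ?_
    rw [mem_below] at hj
    rw [abs_mul]
    have h7 := hψ.bound j hj.le y
    have h8 := hG.abs_moment_le hl (hj.le.trans hl) (j := j) hyL
    -- The Taylor terms carry fewer than |l| powers of s⁻¹. The missing powers are supplied by the
    -- bound s ≤ S, which is why the constant depends on the largest scale.
    have h9 : (s ^ deg j)⁻¹ ≤ S ^ q * (s ^ q)⁻¹ := by
      rw [inv_le_iff_one_le_mul₀ (by positivity)]
      have h10 : s ^ q ≤ S ^ q * s ^ deg j := by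
        rw [← Nat.sub_add_cancel hj.le, pow_add, pow_add, mul_assoc]
        have : s ^ (q - deg j) ≤ S ^ (q - deg j) := pow_le_pow_left₀ hs.le hsS _
        have h11 : s ^ deg j ≤ S ^ deg j * s ^ deg j :=
          le_mul_of_one_le_left (by positivity) (one_le_pow₀ hS)
        gcongr
      rw [mul_right_comm, ← div_eq_mul_inv, one_le_div (by positivity)]
      exact h10
    calc |partialDeriv j ψ y| * |∫ w, nmon j (w - y) * mixedDeriv 0 l G w y|
        ≤ (M * ((s ^ d)⁻¹ * (S ^ q * (s ^ q)⁻¹))) * b := by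
          refine mul_le_mul (h7.trans ?_) h8 (abs_nonneg _) (by positivity)
          gcongr
      _ = _ := by ring
  rw [h1, add_mul]
  exact (abs_add_le _ _).trans (add_le_add h2 h6)

/-- The constant in the bound on the action of a block on test functions at larger scales. -/
def _root_.Schauder.dualConst (d r : ℕ) (ρ S : ℝ) : ℝ :=
  (2 * (1 + ρ)) ^ (d + r) * (((d : ℝ) + 1) ^ r * (1 + ρ) ^ (d + r) * ballVol d +
    (below d r).card * S ^ r)

theorem _root_.Schauder.dualConst_nonneg {d r : ℕ} {ρ S : ℝ} (hρ : 0 < ρ) (hS : 1 ≤ S) :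
    0 ≤ dualConst d r ρ S := by
  have := ballVol_nonneg d
  unfold dualConst; positivity

/-- As ε ≤ s, the function G^*ψ is b times a function at scale (1 + ρ)s, by the preceding bound, and
F is tested at twice that scale. Evaluating its derivatives involves G up to a further distance ρε,
whence the radius (1 + 2ρ)s. -/
theorem abs_ext_dualAct_le (hG : IsBlock m r ρ ε b L G) (hρ : 0 < ρ) (hε : 0 < ε) {r' : ℕ}
    (hr : r' ≤ r) {F : Distr d} (hF : LocBdd r F) {x : Euc d} {s B M S : ℝ} (hs : 0 < s)
    (hεs : ε ≤ s) (hS : 1 ≤ S) (hsS : s ≤ S)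
    (hB : ScaleBd r' F x (2 * ((1 + ρ) * s)) B) (hL : Metric.closedBall x ((1 + 2 * ρ) * s) ⊆ L)
    (hM : 0 ≤ M) {ψ : Test d} (hψ : CrBd r' ψ x s M) :
    |ext r F (dualAct G ψ)| ≤ dualConst d r' ρ S * (b * M * B) := by
  have hv := ballVol_nonneg d
  have hxL : x ∈ L := hL (Metric.mem_closedBall_self (by positivity))
  have hb := hG.nonneg ⟨x, hxL⟩
  have hB0 := hB.nonneg
  have hcd := hG.cmr.contDiff_dualAct ψ
  have h0 : ∀ y, (1 + ρ) * s < ‖y - x‖ → dualAct G ψ y = 0 := fun y hy =>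
    dualAct_eq_zero hG.support hψ.zero y (by nlinarith)
  set D := ((d : ℝ) + 1) ^ r' * (1 + ρ) ^ (d + r') * ballVol d + (below d r').card * S ^ r' with hD
  have hD0 : 0 ≤ D := by positivity
  have hcr : CrBd r' (dualAct G ψ) x ((1 + ρ) * s) (D * (b * M) * (1 + ρ) ^ (d + r')) := by
    refine ⟨hcd.of_le (by exact_mod_cast hr), h0, fun l hl y => ?_⟩
    by_cases hy : (1 + ρ) * s < ‖y - x‖
    · rw [partialDeriv_eq_zero (hcd.of_le (by exact_mod_cast hl.trans hr)) h0 y hy, abs_zero]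
      positivity
    refine (hG.abs_partialDeriv_dualAct_le hρ hε (hl.trans hr) hs hεs hS hsS hM
      (hψ.mono hs le_rfl hl) (fun w hw => hL ?_)).trans ?_
    · rw [Metric.mem_closedBall, dist_eq_norm] at hw ⊢
      have := norm_sub_le_norm_sub_add_norm_sub w y x
      nlinarith
    have h1 : (d : ℝ) ^ deg l * ρ ^ (d + deg l) * ballVol d + (below d (deg l)).card * S ^ deg l
        ≤ D := by
      have e1 : (d : ℝ) ^ deg l ≤ ((d : ℝ) + 1) ^ r' :=
        (pow_le_pow_left₀ (by positivity) (by linarith) _).trans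
          (pow_le_pow_right₀ (by linarith [(Nat.cast_nonneg d : (0 : ℝ) ≤ d)]) hl)
      have e2 : ρ ^ (d + deg l) ≤ (1 + ρ) ^ (d + r') :=
        (pow_le_pow_left₀ hρ.le (by linarith) _).trans
          (pow_le_pow_right₀ (by linarith) (by omega))
      have e3 : ((below d (deg l)).card : ℝ) ≤ (below d r').card := by
        exact_mod_cast Finset.card_le_card fun j hj => mem_below.2
          ((mem_below.1 hj).trans_le hl)
      have e4 : S ^ deg l ≤ S ^ r' := pow_le_pow_right₀ hS hl
      rw [hD]; gcongr
    have h2 : (1 : ℝ) ≤ (1 + ρ) ^ (d + r') * ((1 + ρ) ^ (d + deg l))⁻¹ := by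
      rw [← div_eq_mul_inv, one_le_div (by positivity)]
      exact pow_le_pow_right₀ (by linarith) (by omega)
    calc _ ≤ D * (b * M * ((s ^ d)⁻¹ * (s ^ deg l)⁻¹)) :=
          mul_le_mul_of_nonneg_right h1 (by positivity)
      _ ≤ D * (b * M * ((s ^ d)⁻¹ * (s ^ deg l)⁻¹)) *
          ((1 + ρ) ^ (d + r') * ((1 + ρ) ^ (d + deg l))⁻¹) :=
          le_mul_of_one_le_right (by positivity) h2
      _ = _ := by rw [mul_pow, mul_pow, mul_inv, mul_inv, pow_add _ d (deg l), mul_inv]; ring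
  refine (hF.abs_ext_le (by positivity) (by positivity) hcd hcr hB).trans (le_of_eq ?_)
  rw [dualConst, mul_pow, hD]; ring

end IsBlock


/-! ### Integration of a distribution with a regularising kernel -/

section KernelInt

variable {d m r : ℕ} {β ρ : ℝ} {Ker : Euc d → Euc d → ℝ} {Kn : ℕ → Euc d → Euc d → ℝ}
  {F F' : Distr d}

theorem pot_add (hK : IsRegularisingKernel β m r ρ Ker Kn) (hF : LocBdd r F) (hF' : LocBdd r F')
    (n : ℕ) {k : Fin d → ℕ} (hk : deg k ≤ m) (z : Euc d) :
    pot r (F + F') (Kn n) k z = pot r F (Kn n) k z + pot r F' (Kn n) k z := by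
  rw [pot_eq, pot_eq, pot_eq]
  exact hF.ext_add_left hF' ((hK.regular n).contDiff_mixedDeriv hk z)
    ((hK.regular n).hasCompactSupport_mixedDeriv (hK.support n) hk z)

theorem pot_smul (hK : IsRegularisingKernel β m r ρ Ker Kn) (hF : LocBdd r F) (c : ℝ)
    (n : ℕ) {k : Fin d → ℕ} (hk : deg k ≤ m) (z : Euc d) :
    pot r (c • F) (Kn n) k z = c * pot r F (Kn n) k z := by
  rw [pot_eq, pot_eq]
  exact hF.ext_smul_left c ((hK.regular n).contDiff_mixedDeriv hk z)
    ((hK.regular n).hasCompactSupport_mixedDeriv (hK.support n) hk z)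

theorem IsRegularisingKernel.isJet_pot (hK : IsRegularisingKernel β m r ρ Ker Kn) (F : Distr d)
    (n : ℕ) : IsJet m (pot r F (Kn n)) := (hK.regular n).isJet_pot (hK.support n) F

theorem IsRegularisingKernel.continuous_pot_zero (hK : IsRegularisingKernel β m r ρ Ker Kn)
    (F : Distr d) (n : ℕ) : Continuous (pot r F (Kn n) 0) :=
  (hK.isJet_pot F n).continuous 0 (by simp [deg_zero])

/-- A test function on a fixed ball is regarded as one at a fixed scale s ≥ 1, larger than all the
ε_n. Each term then keeps the factor ε_n^β, which makes the series defining 𝖪F converge. -/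
theorem IsRegularisingKernel.exists_term_bound (hK : IsRegularisingKernel β m r ρ Ker Kn)
    (hF : LocBdd r F) (R : ℝ) :
    ∃ C, 0 ≤ C ∧ ∀ ψ : Test d, (∀ z, R < ‖z‖ → ψ z = 0) → ∀ M, 0 ≤ M →
      (∀ k, deg k ≤ r → ∀ z, |partialDeriv k ψ z| ≤ M) →
        ∀ n, |∫ z, ψ z * pot r F (Kn n) 0 z| ≤ C * M * eps n ^ β := by
  have hρ := hK.range_pos
  set s := max 1 R with hs
  have hs1 : 1 ≤ s := le_max_left _ _
  have hs0 : 0 < s := by linarith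
  obtain ⟨c, hc, hbl⟩ := hK.exists_isBlock (isCompact_closedBall (0 : Euc d) ((1 + 2 * ρ) * s))
  obtain ⟨B, hB0, hB⟩ := hF.scaleBd (isCompact_singleton (x := (0 : Euc d))) (2 * ((1 + ρ) * s))
  have hD := dualConst_nonneg (d := d) (r := r) hρ hs1
  refine ⟨dualConst d r ρ s * (c * s ^ (d + r) * B), by positivity, fun ψ hψ M hM hb n => ?_⟩
  rw [← (hK.regular n).ext_dualAct (hK.support n) F ψ]
  refine ((hbl n).abs_ext_dualAct_le hρ (eps_pos n) le_rfl hF (x := 0) (s := s) (S := s)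
    (M := M * s ^ (d + r)) hs0 ((eps_le_one n).trans hs1) hs1 le_rfl
    (hB 0 rfl _ (by nlinarith) le_rfl) subset_rfl (by positivity)
    (CrBd.of_bound (contDiff_nat_of_test _ _) (fun z hz => hψ z ?_) hs1 hM hb)).trans
    (le_of_eq (by ring))
  rw [sub_zero] at hz
  exact (le_max_right _ _).trans_lt hz

theorem IsRegularisingKernel.exists_isKernelInt (hK : IsRegularisingKernel β m r ρ Ker Kn)
    (hF : LocBdd r F) : ∃ g, IsKernelInt r Kn F g := by
  have hsum : ∀ ψ : Test d, Summable fun n => ∫ z, ψ z * pot r F (Kn n) 0 z := fun ψ => by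
    obtain ⟨R, -, hR⟩ := exists_zero_of_hasCompactSupport ψ.hasCompactSupport 0
    simp only [sub_zero] at hR
    obtain ⟨C, hC0, hC⟩ := hK.exists_term_bound hF R
    have hbd : ∃ M, 0 ≤ M ∧ ∀ k, deg k ≤ r → ∀ z, |partialDeriv k ψ z| ≤ M := by
      have h1 : ∀ k : Fin d → ℕ, ∃ M, ∀ z, |partialDeriv k ψ z| ≤ M := fun k => by
        have := (multiDeriv k ψ).continuous.bounded_above_of_compact_support
          (multiDeriv k ψ).hasCompactSupport
        simpa [coe_multiDeriv_test] using this
      choose M hM using h1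
      refine ⟨∑ k ∈ below d (r + 1), |M k|, by positivity, fun k hk z => ?_⟩
      exact ((hM k z).trans (le_abs_self _)).trans (Finset.single_le_sum (f := fun k => |M k|)
        (fun _ _ => abs_nonneg _) (mem_below.2 (by omega)))
    obtain ⟨M, hM0, hM⟩ := hbd
    exact Summable.of_norm_bounded ((summable_eps_rpow hK.beta_pos).mul_left (C * M))
      (hC ψ hR M hM0 hM)
  have hc := hK.continuous_pot_zero F
  obtain ⟨g, hg⟩ := exists_clm_of_bound (n := ⊤)
    (fun ψ : Test d => ∑' n, ∫ z, ψ z * pot r F (Kn n) 0 z)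
    (fun f g => by
      rw [← (hsum f).tsum_add (hsum g)]
      refine tsum_congr fun n => ?_
      rw [← integral_add (integrable_test_mul f (hc n)) (integrable_test_mul g (hc n))]
      refine integral_congr_ae (Eventually.of_forall fun z => ?_)
      exact add_mul (f z) (g z) _)
    (fun c f => by
      rw [← tsum_mul_left]
      refine tsum_congr fun n => ?_
      rw [← integral_const_mul]
      refine integral_congr_ae (Eventually.of_forall fun z => ?_)
      exact mul_assoc c (f z) _)
    (fun L hL => by
      obtain ⟨R, hR⟩ := hL.isBounded.subset_closedBall 0
      obtain ⟨C, hC0, hC⟩ := hK.exists_term_bound hF R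
      refine ⟨r, le_top, C * epsSum β, mul_nonneg hC0 (epsSum_nonneg _), fun φ hφ M hM hb => ?_⟩
      have h1 := hC φ (fun z hz => hφ z fun hz' => by
        have := mem_closedBall_zero_iff.1 (hR hz')
        linarith) M hM hb
      refine (tsum_of_norm_bounded (f := fun n => ∫ z, φ z * pot r F (Kn n) 0 z)
        ((summable_eps_rpow hK.beta_pos).mul_left (C * M)).hasSum h1).trans (le_of_eq ?_)
      rw [tsum_mul_left, epsSum]; ring)
  refine ⟨g, hF.exists_isExtension, fun n ψ => ⟨(hK.regular n).contDiff_dualAct ψ,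
    hasCompactSupport_dualAct (hK.support n) ψ⟩, fun ψ => ?_⟩
  rw [hg]
  have h2 : (fun n => extend r F (toTestC r (dualAct (Kn n) ψ))) =
      fun n => ∫ z, ψ z * pot r F (Kn n) 0 z :=
    funext fun n => (hK.regular n).ext_dualAct (hK.support n) F ψ
  rw [h2]
  exact (hsum ψ).hasSum

theorem hasSum_kernelInt (hK : IsRegularisingKernel β m r ρ Ker Kn) (hF : LocBdd r F)
    (ψ : Test d) : HasSum (fun n => ∫ z, ψ z * pot r F (Kn n) 0 z) (kernelInt r Kn F ψ) := by
  have h := hK.exists_isKernelInt hF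
  have h1 : IsKernelInt r Kn F (kernelInt r Kn F) := by
    rw [kernelInt, dif_pos h]; exact h.choose_spec
  have h2 := h1.hasSum ψ
  have h3 : (fun n => extend r F (toTestC r (dualAct (Kn n) ψ))) =
      fun n => ∫ z, ψ z * pot r F (Kn n) 0 z :=
    funext fun n => (hK.regular n).ext_dualAct (hK.support n) F ψ
  rwa [h3] at h2

theorem kernelInt_add (hK : IsRegularisingKernel β m r ρ Ker Kn) (hF : LocBdd r F)
    (hF' : LocBdd r F') :
    kernelInt r Kn (F + F') = kernelInt r Kn F + kernelInt r Kn F' := by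
  ext ψ
  rw [add_apply]
  refine (hasSum_kernelInt hK (hF.add hF') ψ).unique
    (((hasSum_kernelInt hK hF ψ).add (hasSum_kernelInt hK hF' ψ)).congr_fun fun n => ?_)
  rw [← integral_add (integrable_test_mul ψ (hK.continuous_pot_zero F n))
    (integrable_test_mul ψ (hK.continuous_pot_zero F' n))]
  simp only [pot_add hK hF hF' n (k := 0) (by simp [deg_zero]), mul_add]

theorem kernelInt_smul (hK : IsRegularisingKernel β m r ρ Ker Kn) (hF : LocBdd r F) (c : ℝ) :
    kernelInt r Kn (c • F) = c • kernelInt r Kn F := by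
  ext ψ
  rw [smul_apply]
  refine (hasSum_kernelInt hK (hF.smul c) ψ).unique
    (((hasSum_kernelInt hK hF ψ).mul_left c).congr_fun fun n => ?_)
  simp only [pot_smul hK hF c n (k := 0) (by simp [deg_zero])]
  rw [← integral_const_mul]
  simp only [mul_left_comm]

theorem kernelInt_sub (hK : IsRegularisingKernel β m r ρ Ker Kn) (hF : LocBdd r F)
    (hF' : LocBdd r F') :
    kernelInt r Kn (F - F') = kernelInt r Kn F - kernelInt r Kn F' := by
  have h := kernelInt_add hK hF (hF'.smul (-1))
  rwa [kernelInt_smul hK hF' (-1), neg_one_smul, neg_one_smul, ← sub_eq_add_neg,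
    ← sub_eq_add_neg] at h

theorem kernelInt_zero (hK : IsRegularisingKernel β m r ρ Ker Kn) :
    kernelInt r Kn (0 : Distr d) = 0 := by
  simpa using kernelInt_smul hK (LocBdd.zero (r := r) (d := d)) 0

theorem kernelInt_sum (hK : IsRegularisingKernel β m r ρ Ker Kn) {ι : Type*} (t : Finset ι)
    {F : ι → Distr d} (hF : ∀ i ∈ t, LocBdd r (F i)) :
    kernelInt r Kn (∑ i ∈ t, F i) = ∑ i ∈ t, kernelInt r Kn (F i) := by
  classical
  induction t using Finset.induction_on with
  | empty => simpa using kernelInt_zero hK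
  | insert a t ha ih =>
    have h1 := fun i hi => hF i (Finset.mem_insert_of_mem (b := a) hi)
    rw [Finset.sum_insert ha, Finset.sum_insert ha,
      kernelInt_add hK (hF a (Finset.mem_insert_self a t)) (LocBdd.sum t h1), ih h1]

end KernelInt

/-! ### Rescaled integrals and vanishing moments -/

theorem integral_rescale_mul {d : ℕ} (η : Test d) (x : Euc d) {s : ℝ} (hs : 0 < s)
    (g : Euc d → ℝ) : ∫ z, rescale η x s z * g z = ∫ w, η w * g (x + s • w) := by
  have h1 : ∀ z, rescale η x s z * g z =
      (s ^ d)⁻¹ * (fun w => η (s⁻¹ • w) * g (x + w)) (z - x) := fun z => by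
    rw [coe_rescale η x hs]
    simp [mul_assoc]
  simp only [h1]
  rw [integral_const_mul, integral_sub_right_eq_self (fun w => η (s⁻¹ • w) * g (x + w))]
  have h2 := Measure.integral_comp_smul (volume : Measure (Euc d))
    (fun w => η (s⁻¹ • w) * g (x + w)) s
  simp only [smul_smul, inv_mul_cancel₀ hs.ne', one_smul, finrank_euclideanSpace,
    Fintype.card_fin, smul_eq_mul] at h2
  rw [h2, abs_of_pos (by positivity)]

theorem tendsto_integral_rescale_mul {d : ℕ} (η : Test d) (x : Euc d) {g : Euc d → ℝ}
    (hg : Continuous g) : Tendsto (fun s => ∫ z, rescale η x s z * g z) (𝓝[>] 0)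
      (𝓝 ((∫ z, η z) * g x)) := by
  obtain ⟨R, -, hR⟩ := exists_zero_of_hasCompactSupport η.hasCompactSupport 0
  have hc : Continuous fun s : ℝ => ∫ w in Metric.closedBall (0 : Euc d) R, η w * g (x + s • w) :=
    continuous_parametric_integral_of_continuous (f := fun s w => η w * g (x + s • w))
      ((η.continuous.comp continuous_snd).mul (hg.comp (by fun_prop))) (isCompact_closedBall _ _)
  have h0 := (hc.tendsto 0).mono_left (nhdsWithin_le_nhds (s := Ioi (0 : ℝ)))
  simp only [zero_smul, add_zero] at h0
  rw [← dualAct_eq_setIntegral η hR (fun _ => g x), integral_mul_const] at h0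
  refine h0.congr' ?_
  filter_upwards [self_mem_nhdsWithin] with s hs
  rw [integral_rescale_mul η x hs, dualAct_eq_setIntegral η hR (fun w => g (x + s • w))]

theorem mpow_smul {d : ℕ} (k : Fin d → ℕ) (c : ℝ) (z : Euc d) :
    mpow (c • z) k = c ^ deg k * mpow z k := by
  have h := nmon_smul k c z
  have h0 : (mfact k : ℝ) ≠ 0 := by exact_mod_cast (mfact_pos k).ne'
  rw [nmon, nmon, div_eq_iff h0] at h
  rw [h]; field_simp

theorem continuous_mpow {d : ℕ} (k : Fin d → ℕ) : Continuous fun z : Euc d => mpow z k := by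
  unfold mpow; fun_prop

/-- Richardson extrapolation. Contracting η by one half multiplies its moments of degree l by
2^{-l}, so a suitable combination of η and its contraction kills the degree q + 1. The integral
stays 1 and the lower moments stay 0. -/
theorem exists_vanishing_moments (d q : ℕ) :
    ∃ η : Test d, (∀ z, 1 < ‖z‖ → η z = 0) ∧ ∫ z, η z = 1 ∧
      ∀ l : Fin d → ℕ, 1 ≤ deg l → deg l ≤ q → ∫ z, η z * mpow z l = 0 := by
  induction q with
  | zero => exact ⟨stdBump d, stdBump_zero, integral_stdBump d, fun l h h' => by omega⟩
  | succ q ih =>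
    obtain ⟨η, h0, h1, h2⟩ := ih
    set a : ℝ := 2 ^ (q + 1) with ha
    have ha1 : a - 1 ≠ 0 := by
      have : (1 : ℝ) < a := one_lt_pow₀ one_lt_two (Nat.succ_ne_zero q)
      linarith
    have hint : ∀ l, ∫ z, ((a - 1)⁻¹ • (a • rescale η 0 2⁻¹ - η) : Test d) z * mpow z l =
        (a - 1)⁻¹ * (a * (2⁻¹ ^ deg l * ∫ z, η z * mpow z l) - ∫ z, η z * mpow z l) := fun l => by
      have e1 : ∫ z, rescale η 0 2⁻¹ z * mpow z l = 2⁻¹ ^ deg l * ∫ z, η z * mpow z l := by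
        rw [integral_rescale_mul η 0 (by norm_num), ← integral_const_mul]
        simp only [zero_add, mpow_smul]
        congr 1; ext z; ring
      rw [← e1, ← integral_const_mul, ← integral_sub
        ((integrable_test_mul _ (continuous_mpow l)).const_mul _)
        (integrable_test_mul _ (continuous_mpow l)), ← integral_const_mul]
      congr 1; ext z
      rw [smul_apply, sub_apply, smul_apply, smul_eq_mul, smul_eq_mul]; ring
    have hm0 : ∀ z : Euc d, mpow z 0 = 1 := fun z => by simp [mpow]
    refine ⟨(a - 1)⁻¹ • (a • rescale η 0 2⁻¹ - η), fun z hz => ?_, ?_, fun l hl hl' => ?_⟩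
    · rw [smul_apply, sub_apply, smul_apply, h0 z hz, coe_rescale η 0 (by norm_num)]
      simp only [sub_zero, inv_inv, smul_eq_mul]
      rw [h0]
      · simp
      · rw [norm_smul]; norm_num; linarith
    · have := hint 0
      simp only [hm0, mul_one, deg_zero, pow_zero, h1] at this
      rw [this]
      field_simp
    · rw [hint]
      rcases hl'.lt_or_eq with h | h
      · rw [h2 l hl (by omega)]; simp
      · rw [h, ha, ← mul_assoc, ← mul_pow]; norm_num

theorem HasPointDeriv.unique {d : ℕ} {δ : ℝ} {k : Fin d → ℕ} {f : Distr d} {x : Euc d} {a b : ℝ}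
    (ha : HasPointDeriv δ k f x a) (hb : HasPointDeriv δ k f x b) : a = b := by
  obtain ⟨η, -, h1, h2⟩ := exists_vanishing_moments d ⌈δ⌉₊
  have h3 : ∀ l : Fin d → ℕ, 1 ≤ deg l → (deg l : ℝ) < δ → ∫ z, η z * mpow z l = 0 :=
    fun l hl hl' => h2 l hl (by exact_mod_cast hl'.le.trans (Nat.le_ceil δ))
  exact tendsto_nhds_unique (ha η h1 h3) (hb η h1 h3)

theorem HasPointDeriv.pointDeriv_eq {d : ℕ} {δ : ℝ} {k : Fin d → ℕ} {f : Distr d} {x : Euc d}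
    {a : ℝ} (ha : HasPointDeriv δ k f x a) : pointDeriv δ k f x = a := by
  have h : ∃ a, HasPointDeriv δ k f x a := ⟨a, ha⟩
  rw [pointDeriv, dif_pos h]
  exact h.choose_spec.unique ha


/-! ### Homogeneity at a point and Schauder estimates -/

/-- `a`-homogeneity of order `r` at the point `x`, up to the scale `S`. -/
def HomAt {d : ℕ} (r : ℕ) (a S : ℝ) (F : Distr d) (x : Euc d) (A : ℝ) : Prop :=
  ∀ s, 0 < s → s ≤ S → ScaleBd r F x s (A * s ^ a)

/-- Bounds at the point `x` on the jets of the `𝖪_n F`, for `F` homogeneous at `x`. -/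
structure PotBd {d : ℕ} (m r : ℕ) (β a S A : ℝ) (u : ℕ → (Fin d → ℕ) → Euc d → ℝ) (x : Euc d) :
    Prop where
  jet : ∀ n, IsJet m (u n)
  small : ∀ n k z, deg k ≤ m → ‖z - x‖ ≤ eps n → |u n k z| ≤ A * eps n ^ (a + β - deg k)
  large : ∀ n s (ψ : Test d) M, 0 ≤ M → 0 < s → eps n ≤ s → s ≤ S → CrBd r ψ x s M →
    |∫ z, ψ z * u n 0 z| ≤ A * M * (eps n ^ β * s ^ a)

/-- Both bounds test F at 2(1 + ρ) times the relevant scale, so homogeneity is needed up to 2(1 +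
ρ)S. The constant depends on K and S but neither on x in K nor on F. -/
theorem IsRegularisingKernel.exists_potBd {d m r : ℕ} {β ρ : ℝ} {Ker : Euc d → Euc d → ℝ}
    {Kn : ℕ → Euc d → Euc d → ℝ} (hK : IsRegularisingKernel β m r ρ Ker Kn) {r' : ℕ} (hr : r' ≤ r)
    {K : Set (Euc d)} (hKc : IsCompact K) {S : ℝ} (hS : 1 ≤ S) (a : ℝ) :
    ∃ C, 0 < C ∧ ∀ x ∈ K, ∀ (F : Distr d) (A : ℝ), LocBdd r F → 0 ≤ A →
      HomAt r' a (2 * ((1 + ρ) * S)) F x A →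
        PotBd m r' β a S (C * A) (fun n => pot r F (Kn n)) x := by
  have hρ := hK.range_pos
  obtain ⟨R, hR⟩ := hKc.isBounded.subset_closedBall 0
  obtain ⟨c, hc, hbl⟩ := hK.exists_isBlock
    (isCompact_closedBall (0 : Euc d) (R + (1 + 2 * ρ) * S))
  have hL : ∀ x ∈ K, ∀ s, s ≤ S → Metric.closedBall x ((1 + 2 * ρ) * s) ⊆
      Metric.closedBall (0 : Euc d) (R + (1 + 2 * ρ) * S) := fun x hx s hs w hw => by
    have h1 := mem_closedBall_zero_iff.1 (hR hx)
    rw [Metric.mem_closedBall, dist_eq_norm] at hw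
    rw [mem_closedBall_zero_iff]
    have := norm_sub_norm_le w x
    nlinarith
  have hv := ballVol_nonneg d
  have hD := dualConst_nonneg (d := d) (r := r') hρ hS
  refine ⟨((2 * (1 + ρ)) ^ (d + r') + dualConst d r' ρ S) * c * (2 * (1 + ρ)) ^ a, by positivity,
    fun x hx F A hF hA hH => ⟨fun n => hK.isJet_pot F n, fun n k z hk hz => ?_,
      fun n s ψ M hM hs hns hsS hψ => ?_⟩⟩
  · have hn := eps_pos n
    have hn1 := eps_le_one n
    have h1 := (hbl n).abs_pot_le hρ hn hr hF
      (hH (2 * ((1 + ρ) * eps n)) (by positivity) (by gcongr; linarith))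
      (fun w hw => hL x hx (eps n) (by linarith) (Metric.closedBall_subset_closedBall (by
        nlinarith) hw)) hk hz
    refine h1.trans ?_
    have h2 : (2 * ((1 + ρ) * eps n)) ^ a = (2 * (1 + ρ)) ^ a * eps n ^ a := by
      rw [← mul_assoc, Real.mul_rpow (by positivity) hn.le]
    have h3 : eps n ^ (a + β - deg k) = eps n ^ a * eps n ^ β * (eps n ^ deg k)⁻¹ := by
      rw [Real.rpow_sub hn, Real.rpow_add hn, Real.rpow_natCast, div_eq_mul_inv]
    rw [h2, h3]
    have h4 : 0 ≤ dualConst d r' ρ S * (c * (2 * (1 + ρ)) ^ a * A *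
      (eps n ^ a * eps n ^ β * (eps n ^ deg k)⁻¹)) := by positivity
    linarith
  · have hn := eps_pos n
    have h1 := (hbl n).abs_ext_dualAct_le hρ hn hr hF hs hns hS hsS
      (hH (2 * ((1 + ρ) * s)) (by positivity) (by gcongr)) (hL x hx s hsS) hM hψ
    rw [(hK.regular n).ext_dualAct (hK.support n)] at h1
    refine h1.trans ?_
    have h2 : (2 * ((1 + ρ) * s)) ^ a = (2 * (1 + ρ)) ^ a * s ^ a := by
      rw [← mul_assoc, Real.mul_rpow (by positivity) hs.le]
    rw [h2]
    have h4 : 0 ≤ (2 * (1 + ρ)) ^ (d + r') * (c * (2 * (1 + ρ)) ^ a * A * M *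
      (eps n ^ β * s ^ a)) := by positivity
    linarith

theorem exists_crBd_partialDeriv_rescale {d : ℕ} (η : Test d) {R : ℝ} (hR : 1 ≤ R)
    (hη : ∀ z, R < ‖z‖ → η z = 0) (r : ℕ) (k : Fin d → ℕ) :
    ∃ C, 0 ≤ C ∧ ∀ x s, 0 < s → CrBd r (partialDeriv k (rescale η x s)) x (R * s)
      (C * (s ^ deg k)⁻¹) := by
  have h1 : ∀ l : Fin d → ℕ, ∃ M, ∀ z, |partialDeriv l η z| ≤ M := fun l => by
    have := (multiDeriv l η).continuous.bounded_above_of_compact_support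
      (multiDeriv l η).hasCompactSupport
    simpa [coe_multiDeriv_test] using this
  choose M hM using h1
  have hM' : ∀ l, deg l ≤ r → ∀ z,
      |partialDeriv (l + k) η z| ≤ ∑ l ∈ below d (r + 1), |M (l + k)| := fun l hl z =>
    ((hM _ z).trans (le_abs_self _)).trans (Finset.single_le_sum (f := fun l => |M (l + k)|)
      (fun _ _ => abs_nonneg _) (mem_below.2 (by omega)))
  have hs0 : 0 ≤ ∑ l ∈ below d (r + 1), |M (l + k)| := by positivity
  refine ⟨(∑ l ∈ below d (r + 1), |M (l + k)|) * R ^ (d + r), by positivity, fun x s hs => ?_⟩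
  have h0 : ∀ z, R * s < ‖z - x‖ → rescale η x s z = 0 := fun z hz => by
    rw [coe_rescale η x hs]
    dsimp only
    rw [hη, mul_zero]
    rw [norm_smul, norm_inv, Real.norm_of_nonneg hs.le, inv_mul_eq_div, lt_div_iff₀ hs]
    exact hz
  have hcd := contDiff_nat_of_test (rescale η x s)
  refine ⟨contDiff_partialDeriv (by exact_mod_cast hcd (r + deg k)),
    partialDeriv_eq_zero (hcd _) h0, fun l hl z => ?_⟩
  rw [partialDeriv_partialDeriv (by exact_mod_cast hcd (deg l + deg k)),
    partialDeriv_rescale η x hs, abs_mul, abs_mul, abs_of_nonneg (by positivity),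
    abs_of_nonneg (by positivity : 0 ≤ (s ^ deg (l + k))⁻¹)]
  have h2 : (1 : ℝ) ≤ R ^ (d + r) * (R ^ (d + deg l))⁻¹ := by
    rw [← div_eq_mul_inv, one_le_div (by positivity)]
    exact pow_le_pow_right₀ hR (by omega)
  calc _ ≤ (s ^ d)⁻¹ * ((s ^ deg (l + k))⁻¹ * ∑ l ∈ below d (r + 1), |M (l + k)|) *
        (R ^ (d + r) * (R ^ (d + deg l))⁻¹) := by
        refine (mul_le_mul_of_nonneg_left (mul_le_mul_of_nonneg_left (hM' l hl _)
          (by positivity)) (by positivity)).trans (le_mul_of_one_le_right (by positivity) h2)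
    _ = _ := by rw [deg_add, pow_add s, mul_pow, mul_pow, mul_inv, mul_inv, mul_inv,
                  pow_add R d (deg l), mul_inv]; ring

/-! ### Pointwise derivatives of the integrated distribution. -/

namespace PotBd

variable {d m r : ℕ} {β a S A : ℝ} {u : ℕ → (Fin d → ℕ) → Euc d → ℝ} {x : Euc d} {H : Distr d}

theorem continuous (hu : PotBd m r β a S A u x) (n : ℕ) {k : Fin d → ℕ} (hk : deg k ≤ m) :
    Continuous (u n k) := (hu.jet n).continuous k hk

theorem nonneg (hu : PotBd m r β a S A u x) : 0 ≤ A := by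
  have h := hu.small 0 0 x (by simp [deg_zero]) (by simp [eps_zero])
  rw [eps_zero, Real.one_rpow, mul_one] at h
  exact (abs_nonneg _).trans h

theorem summable (hu : PotBd m r β a S A u x) {k : Fin d → ℕ} (hk : deg k ≤ m)
    (hka : (deg k : ℝ) < a + β) : Summable fun n => u n k x :=
  Summable.of_norm_bounded ((summable_eps_rpow (sub_pos.2 hka)).mul_left A)
    fun n => hu.small n k x hk (by simpa using (eps_pos n).le)

theorem integral_partialDeriv (hu : PotBd m r β a S A u x) (n : ℕ) {k : Fin d → ℕ}
    (hk : deg k ≤ m) (ψ : Test d) :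
    (-1) ^ deg k * ∫ z, multiDeriv k ψ z * u n 0 z = ∫ z, ψ z * u n k z := by
  rw [coe_multiDeriv_test, (hu.jet n).integral_partialDeriv_mul hk, ← mul_assoc, ← pow_add,
    ← two_mul, pow_mul]
  norm_num

theorem hasSum_multiDeriv (hu : PotBd m r β a S A u x)
    (hH : ∀ ψ, HasSum (fun n => ∫ z, ψ z * u n 0 z) (H ψ)) {k : Fin d → ℕ} (hk : deg k ≤ m)
    (ψ : Test d) : HasSum (fun n => ∫ z, ψ z * u n k z) (multiDeriv k H ψ) := by
  rw [multiDeriv_distr]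
  have := (hH (multiDeriv k ψ)).mul_left ((-1) ^ deg k)
  simpa only [hu.integral_partialDeriv _ hk] using this

/-- Each ∂^k 𝖪_n F is continuous, so its average against η_x^s tends to its value at x. Dominated
convergence for series exchanges this limit with the sum over n. -/
theorem hasPointDeriv (hu : PotBd m r β a S A u x) (hβ : 0 < β) (hS : 0 < S)
    (hH : ∀ ψ, HasSum (fun n => ∫ z, ψ z * u n 0 z) (H ψ)) {k : Fin d → ℕ} (hk : deg k ≤ m)
    (hka : (deg k : ℝ) < a + β) (δ : ℝ) : HasPointDeriv δ k H x (∑' n, u n k x) := by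
  intro η hη1 _
  have hA := hu.nonneg
  obtain ⟨R₀, -, hR₀⟩ := exists_zero_of_hasCompactSupport η.hasCompactSupport 0
  set R := max 1 R₀ with hR
  have hR1 : 1 ≤ R := le_max_left _ _
  have hR' : ∀ z, R < ‖z‖ → η z = 0 := fun z hz => hR₀ z (by
    rw [sub_zero]; exact (le_max_right _ _).trans_lt hz)
  obtain ⟨C₀, hC₀, hcr₀⟩ := exists_crBd_partialDeriv_rescale η hR1 hR' r 0
  obtain ⟨C₁, hC₁, hcr₁⟩ := exists_crBd_partialDeriv_rescale η hR1 hR' r k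
  simp only [partialDeriv_zero, deg_zero, pow_zero, inv_one, mul_one] at hcr₀
  have hS' : 0 < S / R := div_pos hS (by linarith)
  have hv := ballVol_nonneg d
  have hSk := Real.rpow_nonneg hS.le (a - deg k)
  have key : Tendsto (fun s => ∑' n, ∫ z, rescale η x s z * u n k z) (𝓝[>] 0)
      (𝓝 (∑' n, u n k x)) := by
    -- The first part of the majorant serves the scales ε_n > Rs, where the pointwise bound applies.
    -- The second serves ε_n ≤ Rs, where the derivative is moved onto the test function. There
    -- (Rs)^{a-|k|} is at most S^{a-|k|} or ε_n^{a-|k|}, according to the sign of the exponent.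
    refine tendsto_tsum_of_dominated_convergence
      (bound := fun n => ballVol d * (C₀ * A) * eps n ^ (a + β - deg k) +
        A * (C₁ * R ^ deg k) * (S ^ (a - deg k) * eps n ^ β + eps n ^ (a + β - deg k)))
      ?_ (fun n => ?_) ?_
    · have h1 := summable_eps_rpow (sub_pos.2 hka)
      exact (h1.mul_left _).add ((((summable_eps_rpow hβ).mul_left _).add h1).mul_left _)
    · have := tendsto_integral_rescale_mul η x (hu.continuous n hk)
      rwa [hη1, one_mul] at this
    · filter_upwards [Ioo_mem_nhdsGT hS'] with s hs n
      have hs0 : 0 < s := hs.1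
      have hRs : 0 < R * s := by positivity
      have hsS : R * s ≤ S := by
        have := hs.2
        rw [lt_div_iff₀ (by linarith)] at this
        linarith
      have he := Real.rpow_nonneg (eps_pos n).le (a + β - deg k)
      have heβ := Real.rpow_nonneg (eps_pos n).le β
      rw [Real.norm_eq_abs]
      rcases le_or_gt (eps n) (R * s) with h | h
      · rw [← hu.integral_partialDeriv n hk, abs_mul, abs_pow, abs_neg, abs_one, one_pow, one_mul]
        have hcr := hcr₁ x s hs0
        rw [← coe_multiDeriv_test] at hcr
        have h2 := hu.large n (R * s) _ _ (by positivity) hRs h hsS hcr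
        refine h2.trans ?_
        have h3 : (R * s) ^ a = (R * s) ^ deg k * (R * s) ^ (a - deg k) := by
          rw [← Real.rpow_natCast, ← Real.rpow_add hRs]; congr 1; ring
        have h4 : eps n ^ β * (R * s) ^ (a - deg k) ≤
            S ^ (a - deg k) * eps n ^ β + eps n ^ (a + β - deg k) := by
          rcases le_or_gt (0 : ℝ) (a - deg k) with h5 | h5
          · have := Real.rpow_le_rpow hRs.le hsS h5
            nlinarith
          · have := Real.rpow_le_rpow_of_nonpos (eps_pos n) h h5.le
            have e1 : eps n ^ (a + β - deg k) = eps n ^ β * eps n ^ (a - deg k) := by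
              rw [← Real.rpow_add (eps_pos n)]; congr 1; ring
            rw [e1]
            nlinarith
        have h6 : A * (C₁ * (s ^ deg k)⁻¹) * (eps n ^ β * (R * s) ^ a) =
            A * (C₁ * R ^ deg k) * (eps n ^ β * (R * s) ^ (a - deg k)) := by
          rw [h3, mul_pow]; field_simp
        rw [h6]
        have h7 := mul_le_mul_of_nonneg_left h4 (by positivity : 0 ≤ A * (C₁ * R ^ deg k))
        have h8 : 0 ≤ ballVol d * (C₀ * A) * eps n ^ (a + β - deg k) := by positivity
        linarith
      · have h2 := (hcr₀ x s hs0).abs_integral_mul_le hRs (g := u n k)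
          (fun z hz => hu.small n k z hk (hz.trans h.le))
        have h8 : 0 ≤ A * (C₁ * R ^ deg k) *
          (S ^ (a - deg k) * eps n ^ β + eps n ^ (a + β - deg k)) := by positivity
        linarith
  exact key.congr fun s => (hu.hasSum_multiDeriv hH hk _).tsum_eq

/-- The expansion stays within the ball of radius ε_n, where the derivatives of order |k| + q are
bounded by the first half of `PotBd`. -/
theorem abs_taylor_le (hu : PotBd m r β a S A u x) (n : ℕ) {z : Euc d} {s : ℝ}
    (hs : s ≤ eps n) (hz : ‖z - x‖ ≤ s) {q : ℕ} {k : Fin d → ℕ} (hk : deg k + q ≤ m) :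
    |u n k z - ∑ l ∈ below d q, nmon l (z - x) * u n (l + k) x| ≤
      (d : ℝ) ^ q * (A * eps n ^ (a + β - (deg k + q : ℕ))) * s ^ q := by
  have hs0 : 0 ≤ s := (norm_nonneg _).trans hz
  have h := ((hu.jet n).shift k (n := q) (by omega)).taylor (convex_closedBall x s)
    (B := A * eps n ^ (a + β - (deg k + q : ℕ))) (fun l hl w hw => by
      rw [Metric.mem_closedBall, dist_eq_norm] at hw
      have hlk : deg (l + k) = deg k + q := by rw [deg_add, hl, add_comm]
      have := hu.small n (l + k) w (by omega) (hw.trans hs)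
      rwa [hlk] at this) (Metric.mem_closedBall_self hs0)
    (y := z) (by rwa [Metric.mem_closedBall, dist_eq_norm])
  rw [zero_add] at h
  have hA := hu.nonneg
  have he := Real.rpow_nonneg (eps_pos n).le (a + β - (deg k + q : ℕ))
  exact h.trans (by gcongr)

end PotBd


/-! ### Series with a Taylor-like expansion at large scales -/

/-- The constant in the comparison of a series with its expansion. -/
def seriesConst {ι : Type*} (T : Finset ι) (e : ι → ℝ) (θ t t' : ℝ) : ℝ :=
  epsSum t + epsSum t' + ∑ i ∈ T, (1 + epsSum |e i - θ|)

theorem seriesConst_nonneg {ι : Type*} (T : Finset ι) (e : ι → ℝ) (θ t t' : ℝ) :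
    0 ≤ seriesConst T e θ t t' :=
  add_nonneg (add_nonneg (epsSum_nonneg _) (epsSum_nonneg _))
    (Finset.sum_nonneg fun _ _ => add_nonneg zero_le_one (epsSum_nonneg _))

-- The index N is where ε_n passes below s, and θ is the target exponent. The w_n are small for n ≥
-- N, and for n < N they are close to ∑_i V_i(n), whose size ε_n^{θ-e_i} s^{e_i} is summable,
-- growing or critical as e_i is below, above or equal to θ. Only the terms with e_i < θ have a full
-- sum, which is subtracted.
open Classical in
theorem abs_series_sub_le {ι : Type*} (T : Finset ι) (e : ι → ℝ) {θ t t' : ℝ} (ht : 0 < t)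
    (ht' : 0 < t') {w : ℕ → ℝ} {V : ι → ℕ → ℝ} {s : ℝ} (hs : 0 < s) {N : ℕ}
    (hN : ∀ n < N, s < eps n) (hN' : ∀ n, N ≤ n → eps n ≤ s) {D w₀ : ℝ} (hD : 0 ≤ D)
    (hw : HasSum w w₀) (htail : ∀ n, N ≤ n → |w n| ≤ D * (eps n ^ t * s ^ (θ - t)))
    (hhead : ∀ n < N, |w n - ∑ i ∈ T, V i n| ≤ D * (eps n ^ (-t') * s ^ (θ + t')))
    (hV : ∀ i ∈ T, ∀ n, |V i n| ≤ D * (eps n ^ (θ - e i) * s ^ e i))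
    (hcrit : ∀ i ∈ T, e i = θ → |∑ n ∈ Finset.range N, V i n| ≤ D * s ^ θ) :
    |w₀ - ∑ i ∈ T with e i < θ, ∑' n, V i n| ≤ seriesConst T e θ t t' * (D * s ^ θ) := by
  have hp : ∀ p : ℝ, 0 ≤ s ^ p := fun p => Real.rpow_nonneg hs.le p
  have hadd : ∀ p q : ℝ, s ^ p * s ^ q = s ^ (p + q) := fun p q => (Real.rpow_add hs p q).symm
  have h1 := sum_tail_le (f := w) (t := t) (D := D * s ^ (θ - t)) ht hs (hN' N le_rfl)
    (by have := hp (θ - t); positivity) (fun n hn => (htail n hn).trans (le_of_eq (by ring)))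
  have h2 := sum_head_le (f := fun n => w n - ∑ i ∈ T, V i n) (t := t') (D := D * s ^ (θ + t'))
    ht' hs hN (by have := hp (θ + t'); positivity)
    (fun n hn => (hhead n hn).trans (le_of_eq (by ring)))
  rw [mul_assoc D, hadd, sub_add_cancel] at h1
  rw [mul_assoc D, hadd, add_neg_cancel_right] at h2
  have hsummable : ∀ i ∈ T, e i < θ → Summable (V i) := fun i hi hθ =>
    Summable.of_norm_bounded (((summable_eps_rpow (sub_pos.2 hθ)).mul_right (s ^ e i)).mul_left D)
      (hV i hi)
  -- The error caused by V_i is the tail that the full sum adds if e_i < θ, and the head itself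
  -- otherwise. The head is geometric if e_i > θ and is bounded by assumption if e_i = θ.
  have h3 : ∀ i ∈ T, |(if e i < θ then -∑' n, V i (n + N) else ∑ n ∈ Finset.range N, V i n)| ≤
      (1 + epsSum |e i - θ|) * (D * s ^ θ) := fun i hi => by
    have hE := epsSum_nonneg |e i - θ|
    have h0 : 0 ≤ D * s ^ θ := by have := hp θ; positivity
    have h4 : 0 ≤ D * s ^ e i := by have := hp (e i); positivity
    rcases lt_trichotomy (e i) θ with h | h | h
    · rw [if_pos h, abs_neg]
      have h5 := (sum_tail_le (f := V i) (t := θ - e i) (D := D * s ^ e i) (sub_pos.2 h) hs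
        (hN' N le_rfl) h4 fun n _ => (hV i hi n).trans (le_of_eq (by ring))).2
      rw [mul_assoc D, hadd, add_sub_cancel] at h5
      rw [abs_sub_comm, abs_of_pos (sub_pos.2 h)] at hE ⊢
      nlinarith
    · rw [if_neg h.not_lt]
      have := hcrit i hi h
      nlinarith
    · rw [if_neg h.le.not_gt]
      have h5 := sum_head_le (f := V i) (t := e i - θ) (D := D * s ^ e i) (sub_pos.2 h) hs
        hN h4 fun n _ => (hV i hi n).trans (le_of_eq (by rw [neg_sub]; ring))
      rw [mul_assoc D, hadd, neg_sub, add_sub_cancel] at h5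
      rw [abs_of_pos (sub_pos.2 h)] at hE ⊢
      nlinarith
  have hw0 : w₀ = ∑ n ∈ Finset.range N, w n + ∑' n, w (n + N) := by
    rw [hw.summable.sum_add_tsum_nat_add, hw.tsum_eq]
  have key : w₀ - ∑ i ∈ T with e i < θ, ∑' n, V i n = ∑' n, w (n + N) +
      ∑ n ∈ Finset.range N, (w n - ∑ i ∈ T, V i n) +
      ∑ i ∈ T, (if e i < θ then -∑' n, V i (n + N) else ∑ n ∈ Finset.range N, V i n) := by
    have h6 : ∑ i ∈ T with e i < θ, ∑' n, V i n = ∑ i ∈ T, ∑ n ∈ Finset.range N, V i n -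
        ∑ i ∈ T, (if e i < θ then -∑' n, V i (n + N) else ∑ n ∈ Finset.range N, V i n) := by
      rw [Finset.sum_filter, ← Finset.sum_sub_distrib]
      refine Finset.sum_congr rfl fun i hi => ?_
      split_ifs with h
      · rw [← (hsummable i hi h).sum_add_tsum_nat_add N]; ring
      · ring
    rw [hw0, h6, Finset.sum_sub_distrib, Finset.sum_comm]
    ring
  rw [key, seriesConst, add_mul, add_mul, Finset.sum_mul]
  refine (abs_add_le _ _).trans (add_le_add ((abs_add_le _ _).trans (add_le_add h1.2 h2)) ?_)
  exact (Finset.abs_sum_le_sum_abs _ _).trans (Finset.sum_le_sum h3)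

/-! ### Taylor remainders of the integrated distribution, and its critical derivatives. -/

namespace PotBd

variable {d m r : ℕ} {β a S A : ℝ} {u : ℕ → (Fin d → ℕ) → Euc d → ℝ} {x : Euc d} {H : Distr d}

/-- The constant in the bound on the Taylor remainder of the integration with a kernel. -/
def _root_.Schauder.remConst (d m : ℕ) (δ β : ℝ) : ℝ :=
  seriesConst (below d m) (fun k => (deg k : ℝ)) δ β (m - δ) *
    ((d : ℝ) ^ m * ballVol d + ballVol d + 1)

theorem _root_.Schauder.remConst_nonneg (d m : ℕ) (δ β : ℝ) : 0 ≤ remConst d m δ β := by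
  have := ballVol_nonneg d
  exact mul_nonneg (seriesConst_nonneg _ _ _ _ _) (by positivity)

/-- The cut is made with target exponent a + β. The terms w_n are the pairings of ψ with 𝖪_n F,
bounded below scale s by the large-scale half of `PotBd`, and the V_k are the pairings of ψ with the
monomials of the Taylor polynomial of order m at x, of exponent |k|. -/
theorem abs_remainder_le (hu : PotBd m r β a S A u x) (hβ : 0 < β)
    (hH : ∀ ψ, HasSum (fun n => ∫ z, ψ z * u n 0 z) (H ψ)) (hm : a + β < m) {B : ℝ} (hB : 0 ≤ B)
    (hcrit : ∀ k : Fin d → ℕ, (deg k : ℝ) = a + β → ∀ N, |∑ n ∈ Finset.range N, u n k x| ≤ B)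
    {ψ : Test d} {s M : ℝ} (hs : 0 < s) (hsS : s ≤ S) (hM : 0 ≤ M) (hψ : CrBd r ψ x s M) :
    |H ψ - ∑ k ∈ poly d (a + β), (∑' n, u n k x) * ∫ z, ψ z * nmon k (z - x)| ≤
      remConst d m (a + β) β * ((A + B) * M * s ^ (a + β)) := by
  have hA := hu.nonneg
  have hv := ballVol_nonneg d
  obtain ⟨N, hN, hN'⟩ := exists_cut hs
  set c := (d : ℝ) ^ m * ballVol d + ballVol d + 1 with hc
  have hc1 : ballVol d ≤ c := by
    have : 0 ≤ (d : ℝ) ^ m * ballVol d := by positivity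
    linarith
  have hc2 : 1 ≤ c := by
    have : 0 ≤ (d : ℝ) ^ m * ballVol d := by positivity
    linarith
  have hc3 : (d : ℝ) ^ m * ballVol d ≤ c := by linarith
  have hI : ∀ k : Fin d → ℕ, |∫ z, ψ z * nmon k (z - x)| ≤ ballVol d * (M * s ^ deg k) :=
    fun k => hψ.abs_integral_mul_le hs fun z hz => (abs_nmon_le k _).trans (by gcongr)
  have hmain := abs_series_sub_le (below d m) (fun k => (deg k : ℝ)) (θ := a + β) (t := β)
    (t' := m - (a + β)) hβ (sub_pos.2 hm) (w := fun n => ∫ z, ψ z * u n 0 z)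
    (V := fun k n => (∫ z, ψ z * nmon k (z - x)) * u n k x) hs hN hN' (D := c * ((A + B) * M))
    (by positivity) (hH ψ)
    (fun n hn => by
      have h := hu.large n s ψ M hM hs (hN' n hn) hsS hψ
      rw [add_sub_cancel_right]
      refine h.trans (mul_le_mul_of_nonneg_right ?_ ?_)
      · have : 0 ≤ (A + B) * M := by positivity
        nlinarith [mul_nonneg hB hM]
      · exact mul_nonneg (Real.rpow_nonneg (eps_pos n).le _) (Real.rpow_nonneg hs.le _))
    (fun n hn => by
      have h1 : (∫ z, ψ z * u n 0 z) - ∑ k ∈ below d m, (∫ z, ψ z * nmon k (z - x)) * u n k x =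
          ∫ z, ψ z * (u n 0 z - ∑ k ∈ below d m, nmon k (z - x) * u n k x) := by
        have hi : ∀ k ∈ below d m, Integrable fun z => ψ z * nmon k (z - x) * u n k x :=
          fun k _ => (integrable_test_mul ψ (u := fun z => nmon k (z - x))
            ((continuous_nmon k).comp (by fun_prop))).mul_const _
        simp only [← integral_mul_const]
        rw [← integral_finsetSum _ hi, ← integral_sub (integrable_test_mul ψ (hu.continuous n
          (by simp [deg_zero]))) (integrable_finsetSum _ hi)]
        congr 1; ext z
        rw [mul_sub, Finset.mul_sum]
        simp only [mul_assoc]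
      rw [h1]
      have h2 := hψ.abs_integral_mul_le hs (D := (d : ℝ) ^ m * (A * eps n ^ (a + β - m)) * s ^ m)
        (g := fun z => u n 0 z - ∑ k ∈ below d m, nmon k (z - x) * u n k x) fun z hz => by
          have := hu.abs_taylor_le n (hN n hn).le hz (q := m) (k := 0) (by simp [deg_zero])
          simpa only [add_zero, deg_zero, zero_add] using this
      refine h2.trans ?_
      rw [neg_sub, add_sub_cancel, Real.rpow_natCast]
      have he := Real.rpow_nonneg (eps_pos n).le (a + β - m)
      have h3 : A * M ≤ (A + B) * M := by nlinarith [mul_nonneg hB hM]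
      calc _ = (d : ℝ) ^ m * ballVol d * (A * M) * (eps n ^ (a + β - m) * s ^ m) := by ring
        _ ≤ _ := by gcongr)
    (fun k hk n => by
      rw [mem_below] at hk
      have h1 := hu.small n k x hk.le (by simpa using (eps_pos n).le)
      have he := Real.rpow_nonneg (eps_pos n).le (a + β - deg k)
      rw [abs_mul, Real.rpow_natCast]
      calc _ ≤ ballVol d * (M * s ^ deg k) * (A * eps n ^ (a + β - deg k)) :=
            mul_le_mul (hI k) h1 (abs_nonneg _) (by positivity)
        _ = ballVol d * (A * M) * (eps n ^ (a + β - deg k) * s ^ deg k) := by ring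
        _ ≤ _ := by
            have h3 : A * M ≤ (A + B) * M := by nlinarith [mul_nonneg hB hM]
            gcongr)
    (fun k _ hkθ => by
      rw [← Finset.mul_sum, abs_mul, ← hkθ, Real.rpow_natCast]
      calc _ ≤ ballVol d * (M * s ^ deg k) * B :=
            mul_le_mul (hI k) (hcrit k hkθ N) (abs_nonneg _) (by positivity)
        _ = ballVol d * (B * M) * s ^ deg k := by ring
        _ ≤ _ := by
            have h3 : B * M ≤ (A + B) * M := by nlinarith [mul_nonneg hA hM]
            gcongr)
  have hset : (below d m).filter (fun k => (deg k : ℝ) < a + β) = poly d (a + β) := by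
    ext k
    rw [Finset.mem_filter, mem_poly, mem_poly, Nat.cast_lt]
    refine ⟨fun h => h.2, fun h => ⟨?_, h⟩⟩
    exact_mod_cast h.trans hm
  rw [hset] at hmain
  have hsum : ∑ k ∈ poly d (a + β), ∑' n, (∫ z, ψ z * nmon k (z - x)) * u n k x =
      ∑ k ∈ poly d (a + β), (∑' n, u n k x) * ∫ z, ψ z * nmon k (z - x) :=
    Finset.sum_congr rfl fun k _ => by rw [tsum_mul_left, mul_comm]
  rw [hsum] at hmain
  refine hmain.trans (le_of_eq ?_)
  rw [remConst]; ring

theorem _root_.Schauder.sum_below_one {d : ℕ} (F : (Fin d → ℕ) → ℝ) :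
    ∑ k ∈ below d 1, F k = F 0 := by
  have : below d 1 = {0} := by
    ext k
    rw [mem_below, Finset.mem_singleton, Nat.lt_one_iff, deg_eq_zero]
  rw [this, Finset.sum_singleton]

/-- When |k| = a + β, the partial sum up to N is compared with ∂^k H tested on a bump at scale s =
ε_N. For n < N, replacing ∂^k 𝖪_n F by its value at x costs s/ε_n, by a first order expansion. For n
≥ N, moving the derivative onto the bump leaves (ε_n/s)^β. Both errors sum to constants uniform in
N. -/
theorem _root_.Schauder.exists_partialSum_const (d r : ℕ) (β : ℝ) (hβ : 0 < β) (k : Fin d → ℕ) :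
    ∃ C, 0 ≤ C ∧ ∀ (m : ℕ) (a S A : ℝ) (u : ℕ → (Fin d → ℕ) → Euc d → ℝ) (x : Euc d)
      (H : Distr d), 1 ≤ S → deg k + 1 ≤ m → (deg k : ℝ) = a + β → PotBd m r β a S A u x →
      (∀ ψ, HasSum (fun n => ∫ z, ψ z * u n 0 z) (H ψ)) → ∀ B,
      (∀ s ∈ Ioc (0 : ℝ) 1, |multiDeriv k H (rescale (stdBump d) x s)| ≤ B) →
      ∀ N, |∑ n ∈ Finset.range N, u n k x| ≤ C * A + B := by
  obtain ⟨C₀, hC₀, hcr₀⟩ := exists_crBd_partialDeriv_rescale (stdBump d) le_rfl stdBump_zero r 0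
  obtain ⟨C₁, hC₁, hcr₁⟩ := exists_crBd_partialDeriv_rescale (stdBump d) le_rfl stdBump_zero r k
  simp only [partialDeriv_zero, deg_zero, pow_zero, inv_one, mul_one, one_mul] at hcr₀ hcr₁
  have hv := ballVol_nonneg d
  have hE := epsSum_nonneg β
  have hE1 := epsSum_nonneg 1
  refine ⟨epsSum 1 * (ballVol d * C₀ * d) + epsSum β * C₁, by positivity,
    fun m a S A u x H hS hkm hka hu hH B hB N => ?_⟩
  have hA := hu.nonneg
  have hkm' : deg k ≤ m := by omega
  set s := eps N with hs
  have hs0 : 0 < s := eps_pos N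
  have hs1 : s ≤ 1 := eps_le_one N
  set ψ := rescale (stdBump d) x s with hψ
  have hsum := hu.hasSum_multiDeriv hH hkm' ψ
  have h1 := (sum_tail_le (f := fun n => ∫ z, ψ z * u n k z) (N := N) (t := β)
    (D := A * (C₁ * (s ^ deg k)⁻¹) * s ^ a) hβ hs0 le_rfl
    (by have := Real.rpow_nonneg hs0.le a; positivity) (fun n hn => by
      have hcr := hcr₁ x s hs0
      rw [← coe_multiDeriv_test] at hcr
      have h := hu.large n s _ _ (by positivity) hs0 (eps_anti hn) (hs1.trans hS) hcr
      rw [← hu.integral_partialDeriv n hkm', abs_mul, abs_pow, abs_neg, abs_one, one_pow, one_mul]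
      exact h.trans (le_of_eq (by ring)))).2
  have h2 : A * (C₁ * (s ^ deg k)⁻¹) * s ^ a * s ^ β = C₁ * A := by
    rw [mul_assoc, ← Real.rpow_add hs0, ← hka, Real.rpow_natCast]
    field_simp
  rw [h2] at h1
  -- Strict because consecutive scales differ by a factor 2.
  have hlt : ∀ n < N, s < eps n := fun n hn => by
    have h3 : eps N ≤ eps (n + 1) := eps_anti hn
    have h4 : eps (n + 1) = eps n * 2⁻¹ := by rw [eps_add]; simp [eps]
    have := eps_pos n
    rw [hs]; linarith
  have h5 := sum_head_le (f := fun n => (∫ z, ψ z * u n k z) - u n k x) (N := N) (s := s) (t := 1)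
    (D := ballVol d * C₀ * d * A * s) one_pos hs0 hlt (by positivity) (fun n hn => by
      have hψ1 : ∫ z, ψ z = 1 := by
        have := integral_rescale_mul (stdBump d) x hs0 (fun _ => 1)
        simpa [integral_stdBump] using this
      have hψi : Integrable ψ := ψ.continuous.integrable_of_hasCompactSupport ψ.hasCompactSupport
      have h6 : (∫ z, ψ z * u n k z) - u n k x = ∫ z, ψ z * (u n k z - u n k x) := by
        simp only [mul_sub]
        rw [integral_sub (integrable_test_mul ψ (hu.continuous n hkm')) (hψi.mul_const _),
          integral_mul_const, hψ1, one_mul]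
      rw [h6]
      refine ((hcr₀ x s hs0).abs_integral_mul_le hs0 (D := d * (A * eps n ^ (-1 : ℝ)) * s)
        fun z hz => ?_).trans (le_of_eq (by ring))
      have h7 := hu.abs_taylor_le n (hlt n hn).le hz (q := 1) (k := k) hkm
      rw [sum_below_one, nmon_zero_index, one_mul, zero_add, pow_one, pow_one, ← hka] at h7
      push_cast at h7
      rwa [sub_add_cancel_left] at h7)
  have h8 : ballVol d * C₀ * d * A * s * s ^ (-1 : ℝ) = ballVol d * C₀ * d * A := by
    rw [Real.rpow_neg_one]; field_simp
  rw [h8] at h5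
  have h9 : ∑ n ∈ Finset.range N, u n k x = multiDeriv k H ψ -
      ∑ n ∈ Finset.range N, ((∫ z, ψ z * u n k z) - u n k x) -
      ∑' n, ∫ z, ψ z * u (n + N) k z := by
    rw [← hsum.tsum_eq, ← hsum.summable.sum_add_tsum_nat_add N, Finset.sum_sub_distrib]
    ring
  rw [h9]
  have h10 := hB s ⟨hs0, hs1⟩
  refine (abs_sub _ _).trans ((add_le_add_left (abs_sub _ _) _).trans ?_)
  linarith

end PotBd


/-! ### Partitions of unity and localization -/

/-- A bump function on the line whose integer translates sum up to one. -/
def pulse (t : ℝ) : ℝ := Real.smoothTransition (t + 1) - Real.smoothTransition t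

theorem contDiff_pulse {n : WithTop ℕ∞} (hn : n ≤ ((⊤ : ℕ∞) : WithTop ℕ∞)) :
    ContDiff ℝ n pulse := by
  have h : ContDiff ℝ ((⊤ : ℕ∞) : WithTop ℕ∞) Real.smoothTransition :=
    Real.smoothTransition.contDiff
  exact ((h.comp (contDiff_id.add contDiff_const)).sub h).of_le hn

theorem pulse_zero {t : ℝ} (ht : 1 ≤ |t|) : pulse t = 0 := by
  rcases le_abs.1 ht with h | h
  · rw [pulse, Real.smoothTransition.one_of_one_le h,
      Real.smoothTransition.one_of_one_le (by linarith), sub_self]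
  · rw [pulse, Real.smoothTransition.zero_of_nonpos (by linarith),
      Real.smoothTransition.zero_of_nonpos (by linarith), sub_self]

/-- The translates telescope: each pulse is a difference of two consecutive translates of a smooth
step. -/
theorem sum_pulse {N : ℕ} {t : ℝ} (ht : |t| ≤ N) :
    ∑ j ∈ Finset.range (2 * N + 1), pulse (t - ((j : ℝ) - N)) = 1 := by
  have h := Finset.sum_range_sub' (fun j : ℕ => Real.smoothTransition (t + N + 1 - j)) (2 * N + 1)
  have h1 : ∀ j : ℕ, pulse (t - ((j : ℝ) - N)) = Real.smoothTransition (t + N + 1 - j) -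
      Real.smoothTransition (t + N + 1 - ((j + 1 : ℕ) : ℝ)) := fun j => by
    rw [pulse]; push_cast; congr 2 <;> ring
  simp only [h1, h]
  rw [abs_le] at ht
  rw [Real.smoothTransition.one_of_one_le (by push_cast; linarith),
    Real.smoothTransition.zero_of_nonpos (by push_cast; linarith), sub_zero]

theorem norm_le_of_coord_le {d : ℕ} {w : Euc d} {c : ℝ} (hc : 0 ≤ c) (h : ∀ i, |w i| ≤ c) :
    ‖w‖ ≤ (d + 1) * c := by
  rw [EuclideanSpace.norm_eq]
  refine Real.sqrt_le_iff.2 ⟨by positivity, ?_⟩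
  have h1 : ∀ i ∈ Finset.univ, ‖w i‖ ^ 2 ≤ c ^ 2 := fun i _ =>
    pow_le_pow_left₀ (norm_nonneg _) (h i) 2
  refine (Finset.sum_le_card_nsmul _ _ _ h1).trans ?_
  rw [Finset.card_univ, Fintype.card_fin, nsmul_eq_mul, mul_pow]
  have : (0 : ℝ) ≤ d := Nat.cast_nonneg d
  exact mul_le_mul_of_nonneg_right (by nlinarith) (sq_nonneg c)

theorem latticeBump_zero {d : ℕ} (w : Euc d) (hw : (d + 1 : ℝ) < ‖w‖) :
    ∏ i, pulse (w i) = 0 := by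
  by_contra h
  rw [← ne_eq, Finset.prod_ne_zero_iff] at h
  have : ‖w‖ ≤ (d + 1) * 1 := norm_le_of_coord_le zero_le_one fun i => by
    by_contra hi
    exact h i (Finset.mem_univ i) (pulse_zero (not_le.1 hi).le)
  linarith

/-- A bump function whose translates by the integer lattice sum up to one. -/
def latticeBump (d : ℕ) : Test d :=
  mkTest (fun w => ∏ i, pulse (w i))
    (contDiff_prod fun i _ => (contDiff_pulse le_rfl).comp (by fun_prop))
    (hasCompactSupport_of_zero (x := 0) (s := d + 1) fun z hz =>
      latticeBump_zero z (by rwa [sub_zero] at hz))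

theorem coe_latticeBump (d : ℕ) : ⇑(latticeBump d) = fun w => ∏ i, pulse (w i) := rfl

theorem exists_bound_partialDeriv {d : ℕ} (η : Test d) (r : ℕ) :
    ∃ M, 0 ≤ M ∧ ∀ k, deg k ≤ r → ∀ z, |partialDeriv k η z| ≤ M := by
  have h1 : ∀ k : Fin d → ℕ, ∃ M, ∀ z, |partialDeriv k η z| ≤ M := fun k => by
    have := (multiDeriv k η).continuous.bounded_above_of_compact_support
      (multiDeriv k η).hasCompactSupport
    simpa [coe_multiDeriv_test] using this
  choose M hM using h1
  refine ⟨∑ k ∈ below d (r + 1), |M k|, by positivity, fun k hk z => ?_⟩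
  exact ((hM k z).trans (le_abs_self _)).trans (Finset.single_le_sum (f := fun k => |M k|)
    (fun _ _ => abs_nonneg _) (mem_below.2 (by omega)))

/-- The product of two test functions. -/
def mulTest {d : ℕ} (φ ψ : Test d) : Test d :=
  mkTest (fun z => φ z * ψ z) (φ.contDiff.mul ψ.contDiff) φ.hasCompactSupport.mul_right

/-- The points of a lattice of mesh `ε` around `x`. -/
def latticePt {d : ℕ} (x : Euc d) (ε : ℝ) (N : ℕ) (p : Fin d → ℕ) : Euc d :=
  x + ε • WithLp.toLp 2 fun i => (p i : ℝ) - N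

/-- Test functions can be cut into pieces at a given scale, whose derivatives up to order `r` are
controlled with the constant `C r`. -/
def IsLocalizing (d : ℕ) (C : ℕ → ℝ) : Prop :=
  (∀ r, 0 ≤ C r) ∧ ∀ (ψ : Test d) (x : Euc d) (s ε : ℝ), 0 < ε → ε ≤ s →
    (∀ z, s < ‖z - x‖ → ψ z = 0) →
    ∃ (T : Finset (Fin d → ℕ)) (pt : (Fin d → ℕ) → Euc d) (piece : (Fin d → ℕ) → Test d),
      (T.card : ℝ) ≤ (5 * (s / ε)) ^ d ∧ ψ = ∑ p ∈ T, piece p ∧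
      (∀ p ∈ T, ‖pt p - x‖ ≤ 2 * (d + 1) * s) ∧
      ∀ r M, 0 ≤ M → (∀ k, deg k ≤ r → ∀ z, |partialDeriv k ψ z| ≤ M * (ε ^ deg k)⁻¹) →
        ∀ p, CrBd r (piece p) (pt p) ((d + 1) * ε) (C r * ε ^ d * M)

/-- The function is multiplied by a partition of unity over a lattice of mesh ε. With N = ⌈s/ε⌉ the
2N + 1 ≤ 5 s/ε positions along each axis cover the ball of radius s. The radius (d + 1)ε of the
pieces and the distance bound for their centres come from comparing the norm with the largest
coordinate. -/
theorem exists_localize (d : ℕ) : ∃ C, IsLocalizing d C := by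
  choose X hX0 hX using exists_bound_partialDeriv (latticeBump d)
  refine ⟨fun r => (2 * ((d : ℝ) + 1)) ^ (d + r) * X r, fun r => by have := hX0 r; positivity,
    fun ψ x s ε hε hεs hψ => ?_⟩
  have hs : 0 < s := hε.trans_le hεs
  set N := ⌈s / ε⌉₊ with hN
  have hN1 : s / ε ≤ N := Nat.le_ceil _
  have hse : 1 ≤ s / ε := (one_le_div hε).2 hεs
  have hN2 : (N : ℝ) ≤ 2 * (s / ε) := by
    have := Nat.ceil_lt_add_one (zero_le_one.trans hse)
    linarith
  refine ⟨Fintype.piFinset fun _ => Finset.range (2 * N + 1), latticePt x ε N,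
    -- The factor ε^d cancels the normalisation built into `rescale`.
    fun p => mulTest (rescale (ε ^ d • latticeBump d) (latticePt x ε N p) ε) ψ, ?_, ?_, ?_, ?_⟩
  · rw [Fintype.card_piFinset]
    simp only [Finset.card_range, Finset.prod_const, Finset.card_univ, Fintype.card_fin]
    push_cast
    gcongr
    linarith
  · ext z
    rw [sum_apply]
    have h1 : ∀ p, mulTest (rescale (ε ^ d • latticeBump d) (latticePt x ε N p) ε) ψ z =
        (∏ i, pulse ((ε⁻¹ • (z - x)) i - ((p i : ℝ) - N))) * ψ z := fun p => by
      change rescale (ε ^ d • latticeBump d) (latticePt x ε N p) ε z * ψ z = _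
      rw [coe_rescale _ _ hε]
      dsimp only
      rw [smul_apply, smul_eq_mul, ← mul_assoc, inv_mul_cancel₀ (by positivity), one_mul,
        coe_latticeBump]
      dsimp only
      congr 1
      refine Finset.prod_congr rfl fun i _ => ?_
      congr 1
      simp only [latticePt, PiLp.smul_apply, PiLp.sub_apply, PiLp.add_apply, smul_eq_mul]
      field_simp
      ring
    simp only [h1]
    rw [← Finset.sum_mul]
    by_cases hz : s < ‖z - x‖
    · rw [hψ z hz, mul_zero]
    · rw [← Finset.prod_univ_sum (fun _ => Finset.range (2 * N + 1))
        (fun i j => pulse ((ε⁻¹ • (z - x)) i - ((j : ℝ) - N))), Finset.prod_eq_one, one_mul]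
      intro i _
      refine sum_pulse (le_trans ?_ hN1)
      refine (abs_coord_le _ i).trans ?_
      rw [norm_smul, norm_inv, Real.norm_of_nonneg hε.le, inv_mul_eq_div]
      exact div_le_div_of_nonneg_right (not_lt.1 hz) hε.le
  · intro p hp
    rw [Fintype.mem_piFinset] at hp
    rw [latticePt, add_sub_cancel_left, norm_smul, Real.norm_of_nonneg hε.le]
    have h1 : ‖(WithLp.toLp 2 fun i => (p i : ℝ) - N : Euc d)‖ ≤ (d + 1) * N :=
      norm_le_of_coord_le (Nat.cast_nonneg N) fun i => by
        have h2 : p i < 2 * N + 1 := Finset.mem_range.1 (hp i)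
        have h3 : (p i : ℝ) ≤ 2 * N := by exact_mod_cast Nat.lt_succ_iff.1 h2
        have h4 : (0 : ℝ) ≤ p i := Nat.cast_nonneg _
        change |(p i : ℝ) - N| ≤ N
        rw [abs_le]; constructor <;> linarith
    calc ε * ‖(WithLp.toLp 2 fun i => (p i : ℝ) - N : Euc d)‖
        ≤ ε * ((d + 1) * (2 * (s / ε))) := by gcongr; exact h1.trans (by gcongr)
      _ = _ := by field_simp
  · intro r M hM hb p
    set χ := rescale (ε ^ d • latticeBump d) (latticePt x ε N p) ε with hχ
    have hX0r := hX0 r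
    have hε' : (0 : ℝ) < (d + 1) * ε := by positivity
    have hcoe : ⇑(mulTest χ ψ) = fun z => χ z * ψ z := rfl
    refine ⟨contDiff_nat_of_test _ _, fun z hz => ?_, fun k hk z => ?_⟩
    · rw [hcoe]
      dsimp only
      rw [hχ, coe_rescale _ _ hε]
      dsimp only
      rw [smul_apply, coe_latticeBump]
      dsimp only
      rw [latticeBump_zero, smul_zero, mul_zero, zero_mul]
      rw [norm_smul, norm_inv, Real.norm_of_nonneg hε.le, inv_mul_eq_div, lt_div_iff₀ hε]
      exact hz
    · rw [hcoe]
      refine (abs_partialDeriv_mul_le (contDiff_nat_of_test χ r) (contDiff_nat_of_test ψ r)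
        (A := X r) (B := M) (c := ε⁻¹) z (fun k hk => ?_) (fun k hk => ?_) hk).trans ?_
      · rw [hχ, partialDeriv_rescale _ _ hε]
        have h5 : partialDeriv k (⇑(ε ^ d • latticeBump d)) =
            fun w => ε ^ d * partialDeriv k (latticeBump d) w :=
          partialDeriv_const_mul (contDiff_nat_of_test _ _) (ε ^ d)
        rw [h5]
        dsimp only
        rw [mul_left_comm _ (ε ^ d), ← mul_assoc, inv_mul_cancel₀ (by positivity), one_mul,
          abs_mul, abs_of_nonneg (by positivity : 0 ≤ (ε ^ deg k)⁻¹), inv_pow, mul_comm]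
        exact mul_le_mul_of_nonneg_right (hX r k hk _) (by positivity)
      · rw [inv_pow]; exact hb k hk z
      · have h6 : (2 : ℝ) ^ deg k * (d + 1) ^ (d + deg k) ≤ (2 * ((d : ℝ) + 1)) ^ (d + r) := by
          rw [mul_pow]
          have h7 : (2 : ℝ) ^ deg k ≤ 2 ^ (d + r) := pow_le_pow_right₀ one_le_two (by omega)
          have h8 : ((d : ℝ) + 1) ^ (d + deg k) ≤ (d + 1) ^ (d + r) :=
            pow_le_pow_right₀ (by linarith [(Nat.cast_nonneg d : (0 : ℝ) ≤ d)]) (by omega)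
          gcongr
        calc (2 * ε⁻¹) ^ deg k * (X r * M)
            = (2 : ℝ) ^ deg k * (d + 1) ^ (d + deg k) * (X r * ε ^ d * M *
              ((((d + 1) * ε) ^ d)⁻¹ * (((d + 1) * ε) ^ deg k)⁻¹)) := by
              rw [mul_pow, mul_pow, mul_pow, pow_add ((d : ℝ) + 1), inv_pow]; field_simp
          _ ≤ (2 * ((d : ℝ) + 1)) ^ (d + r) * (X r * ε ^ d * M *
              ((((d + 1) * ε) ^ d)⁻¹ * (((d + 1) * ε) ^ deg k)⁻¹)) := by gcongr
          _ = _ := by ring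


/-! ### Reconstruction bounds and orders -/

/-- A function on a large ball is cut at the fixed mesh 1/(d + 1), so that every piece lives in a
ball of radius one, where the bound applies. -/
theorem locBdd_of_scaleBd_one {d r : ℕ} {R : Distr d}
    (h : ∀ K : Set (Euc d), IsCompact K → ∃ C, ∀ x ∈ K, ScaleBd r R x 1 C) : LocBdd r R := by
  obtain ⟨X, hX0, hX⟩ := exists_localize d
  intro R₀
  set s := max 1 R₀ with hs
  have hs1 : 1 ≤ s := le_max_left _ _
  have hd : (0 : ℝ) < d + 1 := by positivity
  have hε : (0 : ℝ) < ((d : ℝ) + 1)⁻¹ := by positivity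
  have hε1 : ((d : ℝ) + 1)⁻¹ ≤ 1 := inv_le_one_of_one_le₀ (by linarith [(Nat.cast_nonneg d : (0:ℝ) ≤ d)])
  obtain ⟨B, hB⟩ := h _ (isCompact_closedBall 0 (2 * (d + 1) * s))
  have hXr := hX0 r
  have hB0 := (hB 0 (Metric.mem_closedBall_self (by positivity))).nonneg
  refine ⟨(5 * (s / ((d : ℝ) + 1)⁻¹)) ^ d * (X r * ((d : ℝ) + 1)⁻¹ ^ d * B), by positivity,
    fun ψ hψ M hM hb => ?_⟩
  obtain ⟨T, pt, piece, hT, hsum, hpt, hpc⟩ := hX ψ 0 s ((d : ℝ) + 1)⁻¹ hε (hε1.trans hs1)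
    (fun z hz => hψ z (by rw [sub_zero] at hz; exact (le_max_right _ _).trans_lt hz))
  have h1 : ∀ p ∈ T, |R (piece p)| ≤ X r * ((d : ℝ) + 1)⁻¹ ^ d * M * B := fun p hp => by
    have hcr := hpc r M hM (fun k hk z => (hb k hk z).trans (le_mul_of_one_le_right hM
      ((one_le_inv₀ (by positivity)).2 (pow_le_one₀ hε.le hε1)))) p
    rw [mul_inv_cancel₀ hd.ne'] at hcr
    exact (hB (pt p) (by simpa using hpt p hp)).test_le one_pos (by positivity) hcr
  rw [hsum, map_sum]
  refine (Finset.abs_sum_le_sum_abs _ _).trans ((Finset.sum_le_card_nsmul _ _ _ h1).trans ?_)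
  rw [nsmul_eq_mul]
  calc _ ≤ (5 * (s / ((d : ℝ) + 1)⁻¹)) ^ d * (X r * ((d : ℝ) + 1)⁻¹ ^ d * M * B) := by gcongr
    _ = _ := by ring

theorem exists_crBd_rescale {d : ℕ} {φ : Test d} (hφ : ∀ z, 1 < ‖z‖ → φ z = 0) (r : ℕ) (x : Euc d)
    {s : ℝ} (hs : 0 < s) : ∃ M, 0 ≤ M ∧ CrBd r (rescale φ x s) x s M := by
  obtain ⟨C, hC, h⟩ := exists_crBd_partialDeriv_rescale φ le_rfl hφ r 0
  refine ⟨C, hC, ?_⟩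
  simpa [partialDeriv_zero, deg_zero] using h x s hs

theorem exists_small_rpow {t C : ℝ} (ht : 0 < t) {τ₀ : ℝ} (hτ₀ : 0 < τ₀) :
    ∃ τ, 0 < τ ∧ τ ≤ τ₀ ∧ C * τ ^ t ≤ 1 / 2 := by
  have h : Tendsto (fun τ : ℝ => C * τ ^ t) (𝓝[>] 0) (𝓝 0) := by
    have h1 := (Real.continuousAt_rpow_const 0 t (Or.inr ht.le)).tendsto.const_mul C
    rw [Real.zero_rpow ht.ne', mul_zero] at h1
    exact h1.mono_left nhdsWithin_le_nhds
  obtain ⟨τ, h1, h2⟩ := ((h.eventually_le_const (by norm_num : (0 : ℝ) < 1 / 2)).and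
    (Ioo_mem_nhdsGT hτ₀)).exists
  exact ⟨τ, h2.1, h2.2.le, h1⟩

theorem le_of_forall_add_pow {a b c : ℝ} (h : ∀ j : ℕ, a ≤ b + 2⁻¹ ^ j * c) : a ≤ b := by
  have h1 : Tendsto (fun j : ℕ => b + (2⁻¹ : ℝ) ^ j * c) atTop (𝓝 (b + 0 * c)) :=
    ((tendsto_pow_atTop_nhds_zero_of_lt_one (by norm_num) (by norm_num)).mul_const c).const_add b
  rw [zero_mul, add_zero] at h1
  exact ge_of_tendsto' h1 h

theorem CrBd.bound_smaller {d r : ℕ} {ψ : Euc d → ℝ} {x : Euc d} {s M ε : ℝ} (hψ : CrBd r ψ x s M)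
    (hε : 0 < ε) (hεs : ε ≤ s) (hM : 0 ≤ M) (k : Fin d → ℕ) (hk : deg k ≤ r) (z : Euc d) :
    |partialDeriv k ψ z| ≤ M * (s ^ d)⁻¹ * (ε ^ deg k)⁻¹ := by
  refine (hψ.bound k hk z).trans ?_
  rw [← mul_assoc]
  have hs : 0 < s := hε.trans_le hεs
  gcongr

/-- Reconstructions of coherent germs, of some order, satisfy a bound of the order of the germ which
only depends on the coherence. -/
theorem exists_sewing_const (d r r₁ : ℕ) {a γ : ℝ} (hγ : 0 < γ) (ha : a ≤ γ) :
    ∃ C, 0 ≤ C ∧ ∀ (F : Euc d → Distr d) (R : Distr d) (K : Set (Euc d)) (S D B : ℝ), 0 ≤ D →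
      0 ≤ B →
      (∀ x ∈ K, ∀ y ∈ K, ∀ s, 0 < s → s ≤ S →
        ScaleBd r (F y - F x) x s (D * (s ^ a * (‖y - x‖ + s) ^ (γ - a)))) →
      (∀ x ∈ K, ∀ s, 0 < s → s ≤ S → ScaleBd r₁ (F x - R) x s (B * s ^ γ)) →
      ∀ x s, 0 < s → s ≤ S → Metric.closedBall x (4 * (d + 1) * s) ⊆ K →
        ScaleBd r (F x - R) x s (C * D * s ^ γ) := by
  obtain ⟨X, hX0, hX⟩ := exists_localize d
  set σ : ℝ := d + 1 with hσ
  have hσ1 : 1 ≤ σ := by rw [hσ]; linarith [(Nat.cast_nonneg d : (0:ℝ) ≤ d)]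
  have hσ0 : 0 < σ := by linarith
  have hXr := hX0 r
  have hXr₁ := hX0 r₁
  -- One generation of cutting produces at most (5/κ)^d pieces of weight κ^d and gains τ^γ, so τ is
  -- chosen to make the product at most 1/2. The requirement τ ≤ 1/2 keeps the balls around the
  -- pieces inside the ball around x.
  obtain ⟨τ, hτ, hτ1, hτ2⟩ := exists_small_rpow (C := 5 ^ d * (X r + X r₁)) hγ
    (by norm_num : (0 : ℝ) < 1 / 2)
  -- Mesh κs makes the radius of the pieces exactly τs.
  set κ := τ / σ with hκ
  have hκ0 : 0 < κ := div_pos hτ hσ0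
  have hκσ : σ * κ = τ := by rw [hκ]; field_simp
  have hκ1 : κ ≤ 1 := by rw [hκ, div_le_one hσ0]; linarith
  set C₀ : ℝ := 5 ^ d * X r * (τ ^ a * (2 * σ + 1) ^ (γ - a)) with hC₀
  have hC₀0 : 0 ≤ C₀ := by rw [hC₀]; positivity
  refine ⟨2 * C₀, by positivity, fun F R K S D B hD hB hcoh hrec => ?_⟩
  -- The first term involves only coherence and r derivatives of ψ. The second, with the given
  -- reconstruction constant B and r₁ derivatives, is halved at each generation and disappears as j
  -- tends to infinity.
  have claim : ∀ (j : ℕ) (x : Euc d) (s M M₁ : ℝ) (ψ : Test d), 0 < s → s ≤ S → 0 ≤ M → 0 ≤ M₁ →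
      Metric.closedBall x (4 * σ * s) ⊆ K → CrBd r ψ x s M → CrBd r₁ ψ x s M₁ →
      |(F x - R) ψ| ≤ (2 * C₀ * D * M + 2⁻¹ ^ j * (B * M₁)) * s ^ γ := by
    intro j
    induction j with
    | zero =>
      intro x s M M₁ ψ hs hsS hM hM₁ hK hψ hψ₁
      have hp := Real.rpow_nonneg hs.le γ
      have h := (hrec x (hK (Metric.mem_closedBall_self (by positivity))) s hs hsS).test_le hs hM₁ hψ₁
      have h2 : 0 ≤ 2 * C₀ * D * M * s ^ γ := by positivity
      rw [pow_zero, one_mul]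
      linarith
    | succ j ih =>
      intro x s M M₁ ψ hs hsS hM hM₁ hK hψ hψ₁
      have hp := Real.rpow_nonneg hs.le γ
      have hε : 0 < κ * s := by positivity
      have hεs : κ * s ≤ s := mul_le_of_le_one_left hs.le hκ1
      have hσε : σ * (κ * s) = τ * s := by rw [← hκσ]; ring
      obtain ⟨T, pt, piece, hT, hsum, hpt, hpc⟩ := hX ψ x s (κ * s) hε hεs hψ.zero
      have hxK : x ∈ K := hK (Metric.mem_closedBall_self (by positivity))
      have hcrs : ∀ (q : ℕ) (M' : ℝ), 0 ≤ M' → CrBd q ψ x s M' → ∀ p,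
          CrBd q (piece p) (pt p) (τ * s) (X q * κ ^ d * M') := fun q M' hM' hq p => by
        have := hpc q (M' * (s ^ d)⁻¹) (by positivity) (hq.bound_smaller hε hεs hM') p
        rw [hσε] at this
        have e : X q * (κ * s) ^ d * (M' * (s ^ d)⁻¹) = X q * κ ^ d * M' := by
          rw [mul_pow]; field_simp
        rwa [e] at this
      have hτs : 0 < τ * s := by positivity
      have hτsS : τ * s ≤ S := by nlinarith
      have hone : ∀ p ∈ T, |(F x - R) (piece p)| ≤
          κ ^ d * (X r * D * M * (τ ^ a * (2 * σ + 1) ^ (γ - a)) +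
            (X r + X r₁) * τ ^ γ * (2 * C₀ * D * M + 2⁻¹ ^ j * (B * M₁))) * s ^ γ := fun p hp => by
        have hptx := hpt p hp
        have hball : Metric.closedBall (pt p) (4 * σ * (τ * s)) ⊆ K := fun w hw => hK (by
          rw [Metric.mem_closedBall, dist_eq_norm] at hw ⊢
          have := norm_sub_le_norm_sub_add_norm_sub w (pt p) x
          have h3 : σ * s * τ ≤ σ * s * (1 / 2) := by gcongr
          linarith)
        have hpK : pt p ∈ K := hball (Metric.mem_closedBall_self (by positivity))
        have h1 := (hcoh (pt p) hpK x hxK (τ * s) hτs hτsS).test_le hτs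
          (by have := hX0 r; positivity) (hcrs r M hM hψ p)
        have h2 := ih (pt p) (τ * s) _ _ (piece p) hτs hτsS (by positivity) (by positivity) hball
          (hcrs r M hM hψ p) (hcrs r₁ M₁ hM₁ hψ₁ p)
        -- The germ is rebased at the centre of the piece: coherence controls the change of base
        -- point, and the induction hypothesis applies at the smaller scale.
        have h3 : (F x - R) (piece p) = (F x - F (pt p)) (piece p) + (F (pt p) - R) (piece p) := by
          rw [← add_apply, sub_add_sub_cancel]
        rw [h3]
        refine (abs_add_le _ _).trans ((add_le_add h1 h2).trans ?_)
        have h4 : (τ * s) ^ a * (‖x - pt p‖ + τ * s) ^ (γ - a) ≤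
            τ ^ a * (2 * σ + 1) ^ (γ - a) * s ^ γ := by
          have h5 : ‖x - pt p‖ + τ * s ≤ (2 * σ + 1) * s := by
            rw [norm_sub_rev]; nlinarith
          have h6 := Real.rpow_le_rpow (by positivity) h5 (sub_nonneg.2 ha)
          rw [Real.mul_rpow hτ.le hs.le]
          rw [Real.mul_rpow (by positivity) hs.le] at h6
          have h7 : s ^ γ = s ^ a * s ^ (γ - a) := by
            rw [← Real.rpow_add hs]; congr 1; ring
          rw [h7]
          calc _ ≤ τ ^ a * s ^ a * ((2 * σ + 1) ^ (γ - a) * s ^ (γ - a)) := by gcongr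
            _ = _ := by ring
        have h8 : (2 * C₀ * D * (X r * κ ^ d * M) + 2⁻¹ ^ j * (B * (X r₁ * κ ^ d * M₁))) ≤
            κ ^ d * ((X r + X r₁) * (2 * C₀ * D * M + 2⁻¹ ^ j * (B * M₁))) := by
          have e1 : 0 ≤ κ ^ d * (X r₁ * (2 * C₀ * D * M)) := by positivity
          have e2 : 0 ≤ κ ^ d * (X r * (2⁻¹ ^ j * (B * M₁))) := by positivity
          linarith
        rw [Real.mul_rpow (z := γ) hτ.le hs.le]
        calc _ ≤ X r * κ ^ d * M * (D * (τ ^ a * (2 * σ + 1) ^ (γ - a) * s ^ γ)) +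
              κ ^ d * ((X r + X r₁) * (2 * C₀ * D * M + 2⁻¹ ^ j * (B * M₁))) * (τ ^ γ * s ^ γ) :=
              add_le_add (mul_le_mul_of_nonneg_left (mul_le_mul_of_nonneg_left h4 hD)
                (by positivity)) (mul_le_mul_of_nonneg_right h8 (by positivity))
          _ = _ := by ring
      rw [hsum, map_sum]
      refine (Finset.abs_sum_le_sum_abs _ _).trans
        ((Finset.sum_le_card_nsmul _ _ _ hone).trans ?_)
      rw [nsmul_eq_mul]
      have hT' : (T.card : ℝ) * κ ^ d ≤ 5 ^ d := by
        have e : (5 * (s / (κ * s))) ^ d * κ ^ d = 5 ^ d := by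
          rw [← mul_pow]; congr 1; field_simp
        rw [← e]
        gcongr
      rw [← mul_assoc, ← mul_assoc]
      refine mul_le_mul_of_nonneg_right ?_ hp
      calc _ ≤ 5 ^ d * (X r * D * M * (τ ^ a * (2 * σ + 1) ^ (γ - a)) +
            (X r + X r₁) * τ ^ γ * (2 * C₀ * D * M + 2⁻¹ ^ j * (B * M₁))) := by gcongr
        _ = C₀ * D * M + 5 ^ d * (X r + X r₁) * τ ^ γ *
            (2 * C₀ * D * M + 2⁻¹ ^ j * (B * M₁)) := by rw [hC₀]; ring
        _ ≤ C₀ * D * M + 1 / 2 * (2 * C₀ * D * M + 2⁻¹ ^ j * (B * M₁)) := by gcongr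
        _ = _ := by rw [pow_succ]; ring
  intro x s hs hsS hK φ hφ
  obtain ⟨M₁, hM₁, hcr⟩ := exists_crBd_rescale (unitTests_zero hφ) r₁ x hs
  refine le_of_forall_add_pow (c := B * M₁ * s ^ γ) fun j => ?_
  have := claim j x s 1 M₁ _ hs hsS zero_le_one hM₁ hK (crBd_rescale hφ x hs) hcr
  linarith


/-! ### Reduction of the order -/

/-- With vanishing moments, averaging reproduces the Taylor polynomial at y, so the difference is
governed by the Taylor remainder of order q. -/
theorem abs_partialDeriv_sub_average_le {d q : ℕ} {η : Test d} (hη0 : ∀ z, 1 < ‖z‖ → η z = 0)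
    (hη1 : ∫ z, η z = 1)
    (hη : ∀ l : Fin d → ℕ, 1 ≤ deg l → deg l ≤ q → ∫ z, η z * mpow z l = 0) {ψ : Euc d → ℝ}
    (hψ : ContDiff ℝ q ψ) {B : ℝ} (hB0 : 0 ≤ B)
    (hB : ∀ k, deg k = q → ∀ z, |partialDeriv k ψ z| ≤ B) {ε : ℝ} (hε : 0 < ε) {k : Fin d → ℕ}
    (hk : deg k ≤ q) (y : Euc d) :
    |partialDeriv k ψ y - average η (partialDeriv k ψ) ε y| ≤
      (1 + ∫ t, |η t|) * ((d + 1) ^ q * B * ε ^ (q - deg k)) := by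
  have hI : 0 ≤ ∫ t, |η t| := integral_nonneg fun t => abs_nonneg _
  have hj := isJet_of_contDiff hψ
  have hgc := hj.continuous k hk
  rcases hk.eq_or_lt with hkq | hkq
  · have h1 := abs_average_le (η := η) (g := partialDeriv k ψ) (ε := ε) (y := y) η.continuous hη0
      (fun t _ => hB k hkq _)
    rw [hkq, Nat.sub_self, pow_zero, mul_one]
    have h2 := hB k hkq y
    have h3 : (1 : ℝ) ≤ (d + 1) ^ q :=
      one_le_pow₀ (by linarith [(Nat.cast_nonneg d : (0 : ℝ) ≤ d)])
    have h4 : (1 + ∫ t, |η t|) * B ≤ (1 + ∫ t, |η t|) * ((d + 1) ^ q * B) := by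
      gcongr; exact le_mul_of_one_le_left hB0 h3
    refine (abs_sub _ _).trans (le_trans ?_ h4)
    linarith
  · set n := q - deg k with hn
    have hn0 : 0 < n := by omega
    set p : Euc d → ℝ := fun z => ∑ l ∈ below d n, nmon l (z - y) * partialDeriv (l + k) ψ y with hp
    have hterm : ∀ l : Fin d → ℕ, Continuous fun z => nmon l (z - y) * partialDeriv (l + k) ψ y :=
      fun l => ((continuous_nmon l).comp (continuous_id.sub continuous_const)).mul continuous_const
    have hpc : Continuous p := continuous_finsetSum _ fun l _ => hterm l
    have hap : average η p ε y = partialDeriv k ψ y := by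
      have h1 : average η p ε y = ∑ l ∈ below d n,
          ((-ε) ^ deg l / mfact l * partialDeriv (l + k) ψ y) * ∫ t, η t * mpow t l := by
        simp only [← integral_const_mul]
        rw [average, ← integral_finsetSum _ fun l _ =>
          (integrable_test_mul η (continuous_mpow l)).const_mul _]
        congr 1; ext t
        rw [hp, Finset.mul_sum]
        refine Finset.sum_congr rfl fun l _ => ?_
        have : y - ε • t - y = (-ε) • t := by rw [neg_smul]; abel
        rw [this, nmon_smul, nmon]; ring
      rw [h1, Finset.sum_eq_single 0]
      · have hm0 : ∀ z : Euc d, mpow z 0 = 1 := fun z => by simp [mpow]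
        simp [hm0, hη1, deg_zero, mfact]
      · intro l hl hl0
        rw [hη l (Nat.one_le_iff_ne_zero.2 fun h => hl0 (deg_eq_zero.1 h))
          (by have := mem_below.1 hl; omega), mul_zero]
      · intro h; exact absurd (mem_below.2 (by simpa [deg_zero] using hn0)) h
    have h2 : |average η (fun z => partialDeriv k ψ z - p z) ε y| ≤
        (∫ t, |η t|) * ((d : ℝ) ^ n * B * ε ^ n) := by
      refine abs_average_le η.continuous hη0 fun t ht => ?_
      have h3 := (hj.shift k (n := n) (by omega)).taylor convex_univ (B := B)
        (fun l hl z _ => hB (l + k) (by rw [deg_add]; omega) z) (mem_univ y)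
        (mem_univ (y - ε • t))
      rw [zero_add] at h3
      refine h3.trans ?_
      have : ‖y - ε • t - y‖ ≤ ε := by
        rw [sub_sub_cancel_left, norm_neg, norm_smul, Real.norm_of_nonneg hε.le]
        exact mul_le_of_le_one_right hε.le ht
      gcongr
    rw [← average_sub_eq η.continuous hη0 hgc ε y p hpc, hap, abs_sub_comm] at h2
    refine h2.trans ?_
    have h5 : (d : ℝ) ^ n ≤ (d + 1) ^ q :=
      (pow_le_pow_left₀ (by positivity) (by linarith) n).trans
        (pow_le_pow_right₀ (by linarith [(Nat.cast_nonneg d : (0 : ℝ) ≤ d)]) (by omega))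
    gcongr
    linarith

/-- All derivatives fall on the mollifier, so control to any order r costs only powers of τ⁻¹ and
uses only the supremum of ψ. -/
theorem CrBd.averageTest_of_left {d q r : ℕ} {η : Test d} (hη0 : ∀ z, 1 < ‖z‖ → η z = 0)
    {E : ℝ} (hE : ∀ k, deg k ≤ r → ∫ t, |partialDeriv k η t| ≤ E) {ψ : Test d} {x : Euc d}
    {s M τ : ℝ} (hψ : CrBd q ψ x s M) (hs : 0 < s) (hM : 0 ≤ M) (hτ : 0 < τ) (hτ1 : τ ≤ 1) :
    CrBd r (Schauder.averageTest η ψ (τ * s)) x (2 * s) (E * (2 / τ) ^ (d + r) * M) := by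
  have hε : 0 < τ * s := by positivity
  have hcoe := coe_averageTest hη0 ψ.continuous ψ.hasCompactSupport hε
  have hE0 : 0 ≤ E := (integral_nonneg fun t => abs_nonneg _).trans (hE 0 (by simp [deg_zero]))
  refine ⟨contDiff_nat_of_test _ _, fun z hz => ?_, fun k hk z => ?_⟩
  · refine averageTest_zero_of_notMem hη0 ψ.continuous hψ.zero hε z ?_
    have : τ * s ≤ s := mul_le_of_le_one_left hs.le hτ1
    linarith
  · have hj := isJet_average_left (deg k) (contDiff_nat_of_test η _) hη0 ψ.continuous hψ.zero hε
    have h1 := congrFun (hj.partialDeriv_eq le_rfl) z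
    simp only [deg_zero, pow_zero, one_mul, partialDeriv_zero] at h1
    rw [hcoe]
    change partialDeriv k (fun y => average η ψ (τ * s) y) z = _ at h1
    rw [show (average η ψ (τ * s)) = fun y => average η ψ (τ * s) y from rfl, h1, abs_mul,
      abs_of_nonneg (by positivity)]
    have h2 := abs_average_le (η := partialDeriv k η) (g := ψ) (ε := τ * s) (y := z)
      (M := M * (s ^ d)⁻¹)
      ((isJet_of_contDiff (contDiff_nat_of_test η (deg k))).continuous k le_rfl)
      (fun w hw => partialDeriv_eq_zero (x := 0) (s := 1) (contDiff_nat_of_test η _)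
        (fun v hv => hη0 v (by rwa [sub_zero] at hv)) w (by rwa [sub_zero]))
      (fun t _ => by
        have := hψ.bound 0 (by simp [deg_zero]) (z - (τ * s) • t)
        simpa [partialDeriv_zero, deg_zero] using this)
    have h3 := hE k hk
    have h4 : (2 : ℝ) ^ (d + deg k) * τ⁻¹ ^ deg k ≤ (2 / τ) ^ (d + r) := by
      rw [div_eq_mul_inv, mul_pow]
      have hτ' : 1 ≤ τ⁻¹ := (one_le_inv₀ hτ).2 hτ1
      have e1 : (2 : ℝ) ^ (d + deg k) ≤ 2 ^ (d + r) := pow_le_pow_right₀ one_le_two (by omega)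
      have e2 : τ⁻¹ ^ deg k ≤ τ⁻¹ ^ (d + r) := pow_le_pow_right₀ hτ' (by omega)
      gcongr
    calc (τ * s)⁻¹ ^ deg k * |average (partialDeriv k η) ψ (τ * s) z|
        ≤ (τ * s)⁻¹ ^ deg k * (E * (M * (s ^ d)⁻¹)) := by
          gcongr; exact h2.trans (by gcongr)
      _ = E * (2 ^ (d + deg k) * τ⁻¹ ^ deg k) * M *
          (((2 * s) ^ d)⁻¹ * ((2 * s) ^ deg k)⁻¹) := by
          rw [mul_inv, mul_pow, mul_pow, mul_pow, pow_add (2 : ℝ), inv_pow, inv_pow]; field_simp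
      _ ≤ _ := by gcongr

/-- If the elements of a family of distributions, bounded at order `r₀`, split at smaller scales
into elements with a small enough weight, then they are bounded at a smaller order. -/
theorem exists_orderReduction_const (d : ℕ) {r' r₀ : ℕ} (hr : r' ≤ r₀) {e C₁ : ℝ} (he : 0 < r' + e)
    (hC₁ : 0 ≤ C₁) : ∃ κ C, 0 < κ ∧ κ ≤ 1 / 2 ∧ 0 ≤ C ∧
      ∀ 𝒞 : Euc d → ℝ → Distr d → ℝ → Prop,
      (∀ x s H w, 𝒞 x s H w → 0 < s ∧ 0 ≤ w ∧ ScaleBd r₀ H x (2 * s) w) →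
      (∀ x s H w, 𝒞 x s H w → ∀ p, ‖p - x‖ ≤ 4 * (d + 1) * s → ∃ H₁ w₁ H₂ w₂, H = H₁ + H₂ ∧
        𝒞 p (κ * s) H₁ w₁ ∧ 𝒞 p (κ * s) H₂ w₂ ∧ w₁ + w₂ ≤ C₁ * κ ^ e * w) →
      ∀ x s H w, 𝒞 x s H w → ScaleBd r' H x s (C * w) := by
  obtain ⟨X, hX0, hX⟩ := exists_localize d
  obtain ⟨η, hη0, hη1, hη⟩ := exists_vanishing_moments d r₀
  set σ : ℝ := d + 1 with hσ
  have hσ1 : 1 ≤ σ := by rw [hσ]; linarith [(Nat.cast_nonneg d : (0:ℝ) ≤ d)]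
  have hσ0 : 0 < σ := by linarith
  have hXr := hX0 r'
  have hXr₀ := hX0 r₀
  set J := 1 + ∫ t, |η t| with hJ
  have hJ0 : 0 ≤ J := add_nonneg zero_le_one (integral_nonneg fun t => abs_nonneg _)
  set Y : ℝ := (X r' + X r₀) * (J * σ ^ r₀) with hY
  have hY0 : 0 ≤ Y := by positivity
  -- The remainder after mollification lives in a ball of radius 2s and is cut at mesh τs into at
  -- most (10/τ)^d pieces of weight τ^d. Each piece gains τ^{r'} from the mollification and (στ)^e
  -- from the splitting of H; as r' + e > 0, the total gain can be made at most 1/2.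
  obtain ⟨τ, hτ, hτ1, hτ2⟩ := exists_small_rpow (C := 10 ^ d * Y * C₁ * σ ^ e) he
    (by positivity : (0 : ℝ) < 1 / (2 * σ))
  have hτσ : σ * τ ≤ 1 / 2 := by
    rw [le_div_iff₀ (by positivity)] at hτ1
    linarith
  have hτ1' : τ ≤ 1 := by nlinarith
  set E : ℝ := ∑ k ∈ below d (r₀ + 1), ∫ t, |partialDeriv k η t| with hE
  have hEk : ∀ k, deg k ≤ r₀ → ∫ t, |partialDeriv k η t| ≤ E := fun k hk =>
    Finset.single_le_sum (f := fun k => ∫ t, |partialDeriv k η t|)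
      (fun k _ => integral_nonneg fun t => abs_nonneg _) (mem_below.2 (by omega))
  have hE0 : 0 ≤ E := (integral_nonneg fun t => abs_nonneg _).trans (hEk 0 (by simp [deg_zero]))
  set C₀ : ℝ := E * (2 / τ) ^ (d + r₀) with hC₀
  have hC₀0 : 0 ≤ C₀ := by positivity
  refine ⟨σ * τ, 2 * C₀, by positivity, hτσ, by positivity, fun 𝒞 h0 h1 => ?_⟩
  -- The term with M uses r' derivatives of ψ only. The term with M₁, where r₀ derivatives enter, is
  -- halved at each generation and vanishes in the limit.
  have claim : ∀ (j : ℕ) (x : Euc d) (s : ℝ) (H : Distr d) (w M M₁ : ℝ) (ψ : Test d), 𝒞 x s H w →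
      0 ≤ M → 0 ≤ M₁ → CrBd r' ψ x s M → CrBd r₀ ψ x s M₁ →
      |H ψ| ≤ (2 * C₀ * M + 2⁻¹ ^ j * (2 ^ (d + r₀) * M₁)) * w := by
    intro j
    induction j with
    | zero =>
      intro x s H w M M₁ ψ h𝒞 hM hM₁ hψ hψ₁
      obtain ⟨hs, hw, hB⟩ := h0 x s H w h𝒞
      have hcr := hψ₁.recenter hs hM₁ (y := x) (s' := 2 * s) (by simp; linarith)
      rw [mul_div_assoc, div_self hs.ne', mul_one] at hcr
      have := hB.test_le (by positivity) (by positivity) hcr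
      have h2 : 0 ≤ 2 * C₀ * M * w := by positivity
      rw [pow_zero, one_mul]
      linarith
    | succ j ih =>
      intro x s H w M M₁ ψ h𝒞 hM hM₁ hψ hψ₁
      obtain ⟨hs, hw, hB⟩ := h0 x s H w h𝒞
      have hε : 0 < τ * s := by positivity
      set A := averageTest η ψ (τ * s) with hA
      have hcoe : ⇑A = average η ψ (τ * s) := coe_averageTest hη0 ψ.continuous ψ.hasCompactSupport hε
      have hAb := CrBd.averageTest_of_left hη0 hEk hψ hs hM hτ hτ1'
      -- The mollified part is tested directly with the bound of order r₀, and costs no more than a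
      -- constant times M.
      have h2 : |H A| ≤ C₀ * M * w := hB.test_le (by positivity) (by positivity) hAb
      have hzero : ∀ z, 2 * s < ‖z - x‖ → (ψ - A) z = 0 := fun z hz => by
        rw [sub_apply, hAb.zero z hz, hψ.zero z (by linarith), sub_zero]
      have hdiff : ∀ q M', q ≤ r₀ → 0 ≤ M' → CrBd q ψ x s M' → ∀ k, deg k ≤ q → ∀ z,
          |partialDeriv k (ψ - A) z| ≤
            J * σ ^ r₀ * (M' * (s ^ d)⁻¹ * τ ^ q) * ((τ * s) ^ deg k)⁻¹ := by
        intro q M' hq hM' hψ' k hk z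
        have e1 : ⇑(ψ - A) = fun z => ψ z - A z := rfl
        rw [e1, partialDeriv_sub (contDiff_nat_of_test _ _) (contDiff_nat_of_test _ _), hcoe,
          partialDeriv_average η.continuous hη0 (contDiff_nat_of_test ψ q) _ hk]
        refine (abs_partialDeriv_sub_average_le hη0 hη1 (fun l hl hl' => hη l hl (hl'.trans hq))
          (contDiff_nat_of_test ψ q) (B := M' * ((s ^ d)⁻¹ * (s ^ q)⁻¹)) (by positivity)
          (fun k hk z => by have := hψ'.bound k hk.le z; rwa [hk] at this) hε hk z).trans ?_
        have e2 : (τ * s) ^ (q - deg k) = (τ * s) ^ q * ((τ * s) ^ deg k)⁻¹ :=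
          pow_sub₀ _ hε.ne' hk
        have e3 : σ ^ q ≤ σ ^ r₀ := pow_le_pow_right₀ hσ1 hq
        calc _ = J * σ ^ q * (M' * (s ^ d)⁻¹ * τ ^ q) * ((τ * s) ^ deg k)⁻¹ := by
              rw [e2, mul_pow τ s q, hJ, hσ]; field_simp
          _ ≤ _ := by gcongr
      obtain ⟨T, pt, piece, hT, hsum, hpt, hpc⟩ := hX (ψ - A) x (2 * s) (τ * s) hε
        (by nlinarith) hzero
      have hcrs : ∀ q M', q ≤ r₀ → X q ≤ X r' + X r₀ → 0 ≤ M' → CrBd q ψ x s M' → ∀ p,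
          CrBd q (piece p) (pt p) (σ * τ * s) (Y * τ ^ d * (M' * τ ^ q)) := by
        intro q M' hq hXq hM' hψ' p
        have h3 := (hpc q _ (by positivity) (hdiff q M' hq hM' hψ') p).mono (by positivity)
          (N := Y * τ ^ d * (M' * τ ^ q)) (by
            rw [hY]
            calc _ = X q * (J * σ ^ r₀) * τ ^ d * (M' * τ ^ q) := by rw [mul_pow]; field_simp
              _ ≤ _ := by gcongr) le_rfl
        rwa [← mul_assoc] at h3
      have hone : ∀ p ∈ T, |H (piece p)| ≤ Y * τ ^ d * (C₁ * (σ * τ) ^ e * w) * τ ^ r' *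
          (2 * C₀ * M + 2⁻¹ ^ j * (2 ^ (d + r₀) * M₁)) := fun p hp => by
        obtain ⟨H₁, w₁, H₂, w₂, hH, h𝒞₁, h𝒞₂, hww⟩ := h1 x s H w h𝒞 (pt p) (by
          have := hpt p hp; linarith)
        have b1 := ih (pt p) (σ * τ * s) H₁ w₁ _ _ (piece p) h𝒞₁ (by positivity) (by positivity)
          (hcrs r' M hr (by linarith) hM hψ p) (hcrs r₀ M₁ le_rfl (by linarith) hM₁ hψ₁ p)
        have b2 := ih (pt p) (σ * τ * s) H₂ w₂ _ _ (piece p) h𝒞₂ (by positivity) (by positivity)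
          (hcrs r' M hr (by linarith) hM hψ p) (hcrs r₀ M₁ le_rfl (by linarith) hM₁ hψ₁ p)
        have hw₁ := (h0 _ _ _ _ h𝒞₁).2.1
        have hw₂ := (h0 _ _ _ _ h𝒞₂).2.1
        -- The r₀-regular bound gains even more, since r' ≤ r₀ and τ ≤ 1; both terms can share the
        -- factor τ^{r'}.
        have e1 : τ ^ r₀ ≤ τ ^ r' := pow_le_pow_of_le_one hτ.le hτ1' hr
        have e2 : 2 * C₀ * (Y * τ ^ d * (M * τ ^ r')) +
            2⁻¹ ^ j * (2 ^ (d + r₀) * (Y * τ ^ d * (M₁ * τ ^ r₀))) ≤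
            Y * τ ^ d * τ ^ r' * (2 * C₀ * M + 2⁻¹ ^ j * (2 ^ (d + r₀) * M₁)) := by
          have : 2⁻¹ ^ j * (2 ^ (d + r₀) * (Y * τ ^ d * (M₁ * τ ^ r₀))) ≤
            2⁻¹ ^ j * (2 ^ (d + r₀) * (Y * τ ^ d * (M₁ * τ ^ r'))) := by gcongr
          linarith
        rw [hH, add_apply]
        refine (abs_add_le _ _).trans ((add_le_add b1 b2).trans ?_)
        rw [← mul_add]
        calc _ ≤ Y * τ ^ d * τ ^ r' * (2 * C₀ * M + 2⁻¹ ^ j * (2 ^ (d + r₀) * M₁)) *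
              (C₁ * (σ * τ) ^ e * w) := by gcongr
          _ = _ := by ring
      have h3 : H ψ = H A + ∑ p ∈ T, H (piece p) := by
        rw [← map_sum, ← hsum, ← map_add, add_sub_cancel]
      have hT' : (T.card : ℝ) * τ ^ d ≤ 10 ^ d := by
        have e : (5 * (2 * s / (τ * s))) ^ d * τ ^ d = 10 ^ d := by
          rw [← mul_pow]; congr 1; field_simp; norm_num
        rw [← e]
        gcongr
      have h4 : |∑ p ∈ T, H (piece p)| ≤
          1 / 2 * (2 * C₀ * M + 2⁻¹ ^ j * (2 ^ (d + r₀) * M₁)) * w := by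
        refine (Finset.abs_sum_le_sum_abs _ _).trans
          ((Finset.sum_le_card_nsmul _ _ _ hone).trans ?_)
        rw [nsmul_eq_mul]
        have e1 : (σ * τ) ^ e * τ ^ r' = σ ^ e * τ ^ (r' + e) := by
          rw [Real.mul_rpow hσ0.le hτ.le, Real.rpow_add hτ, Real.rpow_natCast]; ring
        have hpos := Real.rpow_nonneg hτ.le (r' + e)
        have hpos' := Real.rpow_nonneg hσ0.le e
        calc _ = (T.card : ℝ) * τ ^ d * (Y * C₁ * ((σ * τ) ^ e * τ ^ r') *
              ((2 * C₀ * M + 2⁻¹ ^ j * (2 ^ (d + r₀) * M₁)) * w)) := by ring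
          _ ≤ 10 ^ d * (Y * C₁ * ((σ * τ) ^ e * τ ^ r') *
              ((2 * C₀ * M + 2⁻¹ ^ j * (2 ^ (d + r₀) * M₁)) * w)) := by
              rw [e1]; gcongr
          _ = 10 ^ d * Y * C₁ * σ ^ e * τ ^ (r' + e) *
              ((2 * C₀ * M + 2⁻¹ ^ j * (2 ^ (d + r₀) * M₁)) * w) := by rw [e1]; ring
          _ ≤ 1 / 2 * ((2 * C₀ * M + 2⁻¹ ^ j * (2 ^ (d + r₀) * M₁)) * w) := by gcongr
          _ = _ := by ring
      rw [h3]
      refine (abs_add_le _ _).trans ((add_le_add h2 h4).trans (le_of_eq ?_))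
      rw [pow_succ]; ring
  intro x s H w h𝒞 φ hφ
  have hs := (h0 x s H w h𝒞).1
  obtain ⟨M₁, hM₁, hcr⟩ := exists_crBd_rescale (unitTests_zero hφ) r₀ x hs
  refine le_of_forall_add_pow (c := 2 ^ (d + r₀) * M₁ * w) fun j => ?_
  have := claim j x s H w 1 M₁ _ h𝒞 zero_le_one hM₁ (crBd_rescale hφ x hs) hcr
  linarith


/-! ### Normalised monomials, as distributions -/

theorem monomial_apply {d : ℕ} (k : Fin d → ℕ) (x : Euc d) (ψ : Test d) :
    monomial k x ψ = ∫ z, ψ z * nmon k (z - x) := by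
  have hc : Continuous fun z : Euc d => mpow (z - x) k / mfact k :=
    (continuous_nmon k).comp (continuous_id.sub continuous_const)
  change TestFunction.integralAgainstBilinCLM (ContinuousLinearMap.mul ℝ ℝ) volume _ ψ = _
  rw [TestFunction.integralAgainstBilinCLM_eq_integral
    (hc.locallyIntegrable.locallyIntegrableOn _)]
  rfl

theorem homAt_monomial {d : ℕ} (r : ℕ) (k : Fin d → ℕ) (S : ℝ) (x : Euc d) :
    HomAt r (deg k) S (monomial k x) x (ballVol d) := fun s hs _ φ hφ => by
  rw [monomial_apply, Real.rpow_natCast]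
  refine ((crBd_rescale hφ x hs).abs_integral_mul_le hs (D := s ^ deg k)
    fun z hz => (abs_nmon_le k _).trans (by gcongr)).trans_eq (by ring)

theorem HomAt.locBdd {d r : ℕ} {a : ℝ} {F : Distr d} {x : Euc d}
    (h : ∀ S, 1 ≤ S → ∃ A, HomAt r a S F x A) : LocBdd r F :=
  locBdd_of_scaleBd x fun s hs => ⟨s, le_rfl, let ⟨A, hA⟩ := h s hs; ⟨_, hA s (by linarith) le_rfl⟩⟩

open Classical in
theorem polyΓ_eq {d : ℕ} (x y : Euc d) (l k : Fin d → ℕ) :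
    polyΓ x y l k = if l ≤ k then nmon (k - l) (x - y) else 0 := rfl

theorem polyΓ_self_left {d : ℕ} (x : Euc d) (l k : Fin d → ℕ) :
    polyΓ x x l k = if l = k then 1 else 0 := by
  rw [polyΓ_eq, sub_self]
  by_cases h : l = k
  · subst h; simp [nmon_zero_index]
  · by_cases hl : l ≤ k
    · rw [if_pos hl, if_neg h, nmon_zero]
      intro h0
      exact h (le_antisymm hl (fun i => by
        have := congrFun h0 i
        exact Nat.le_of_sub_eq_zero this))
    · rw [if_neg hl, if_neg h]

theorem deg_mono {d : ℕ} {k l : Fin d → ℕ} (h : k ≤ l) : deg k ≤ deg l :=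
  Finset.sum_le_sum fun i _ => h i

/-- Taylor's formula for the monomial centred at y, expanded at x beyond its degree, where the
remainder vanishes. This avoids the multinomial theorem. -/
theorem nmon_sub_eq_sum {d : ℕ} (x y z : Euc d) (k : Fin d → ℕ) {T : Finset (Fin d → ℕ)}
    (hT : ∀ l ≤ k, l ∈ T) :
    nmon k (z - y) = ∑ l ∈ T, polyΓ x y l k * nmon l (z - x) := by
  have hj := (isJet_nmon (deg k + 1) k).comp_affine 1 y
  have h := hj.taylor convex_univ (B := 0) (fun l hl z _ => by
    rw [if_neg fun hlk => by have := deg_mono hlk; omega]; simp) (mem_univ x) (mem_univ z)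
  simp only [mul_zero, zero_mul, one_pow, one_smul, one_mul] at h
  have h := sub_eq_zero.1 (abs_nonpos_iff.1 h)
  simp only [zero_le, if_true, tsub_zero] at h
  rw [h]
  have e : ∀ U : Finset (Fin d → ℕ), (∀ l ≤ k, l ∈ U) →
      ∑ l ∈ U, polyΓ x y l k * nmon l (z - x) =
        ∑ l ∈ Finset.Iic k, polyΓ x y l k * nmon l (z - x) := fun U hU => by
    refine (Finset.sum_subset (fun l hl => hU l (Finset.mem_Iic.1 hl)) fun l _ hl => ?_).symm
    rw [polyΓ_eq, if_neg (fun h => hl (Finset.mem_Iic.2 h)), zero_mul]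
  rw [e T hT, ← e _ fun l hl => mem_below.2 (Nat.lt_succ_of_le (deg_mono hl))]
  exact Finset.sum_congr rfl fun l _ => mul_comm _ _

theorem monomial_eq_sum {d : ℕ} (x y : Euc d) (k : Fin d → ℕ) {T : Finset (Fin d → ℕ)}
    (hT : ∀ l ≤ k, l ∈ T) :
    monomial k y = ∑ l ∈ T, polyΓ x y l k • monomial l x := by
  ext ψ
  rw [sum_apply, monomial_apply]
  simp only [nmon_sub_eq_sum x y _ k hT, Finset.mul_sum, smul_apply, monomial_apply, smul_eq_mul]
  rw [integral_finsetSum _ fun l _ => integrable_test_mul ψ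
    (u := fun z => polyΓ x y l k * nmon l (z - x))
    (continuous_const.mul ((continuous_nmon l).comp (continuous_id.sub continuous_const)))]
  refine Finset.sum_congr rfl fun l _ => ?_
  rw [← integral_const_mul]
  exact integral_congr_ae (.of_forall fun z => by ring)

theorem mem_poly_of_le {d : ℕ} {t : ℝ} {k l : Fin d → ℕ} (hk : k ∈ poly d t) (h : l ≤ k) :
    l ∈ poly d t :=
  mem_poly.2 (lt_of_le_of_lt (by exact_mod_cast deg_mono h) (mem_poly.1 hk))

theorem measurable_polyΓ {d : ℕ} (x : Euc d) (l k : Fin d → ℕ) :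
    Measurable fun y => polyΓ x y l k := by
  simp only [polyΓ_eq]
  by_cases h : l ≤ k
  · simp only [if_pos h]
    exact ((continuous_nmon _).comp (continuous_const.sub continuous_id)).measurable
  · simp only [if_neg h, measurable_const]

/-- Re-expansion at the origin makes the pairing a polynomial in the base point. -/
theorem isGerm_monomial {d : ℕ} (k : Fin d → ℕ) : IsGerm (monomial k : Euc d → Distr d) := by
  intro ψ
  simp only [monomial_eq_sum 0 _ k (T := Finset.Iic k) fun l hl => Finset.mem_Iic.2 hl, sum_apply,
    smul_apply, smul_eq_mul]
  exact Finset.measurable_sum _ fun l _ => (measurable_polyΓ 0 l k).mul_const _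

/-! ### Homogeneity at a point -/

namespace HomAt

variable {d r : ℕ} {a S A A' : ℝ} {F G : Distr d} {x : Euc d}

theorem mono (h : HomAt r a S F x A) (hA : A ≤ A') {r' : ℕ} (hr : r ≤ r') {S' : ℝ} (hS : S' ≤ S) :
    HomAt r' a S' F x A' := fun s hs hsS =>
  (h s hs (hsS.trans hS)).mono (by gcongr) hr

theorem smul (h : HomAt r a S F x A) (c : ℝ) : HomAt r a S (c • F) x (|c| * A) :=
  fun s hs hsS => ((h s hs hsS).smul c).mono (by rw [mul_assoc]) le_rfl

theorem sum {ι : Type*} (t : Finset ι) {F : ι → Distr d} {A : ι → ℝ}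
    (h : ∀ i ∈ t, HomAt r a S (F i) x (A i)) : HomAt r a S (∑ i ∈ t, F i) x (∑ i ∈ t, A i) :=
  fun s hs hsS => (ScaleBd.sum t fun i hi => h i hi s hs hsS).mono (by rw [Finset.sum_mul]) le_rfl

theorem nonneg (h : HomAt r a S F x A) (hS : 0 < S) : 0 ≤ A := by
  have := (h S hS le_rfl).nonneg
  exact nonneg_of_mul_nonneg_left this (Real.rpow_pos_of_pos hS a)

/-- A smaller exponent. -/
theorem exponent (h : HomAt r a S F x A) (hS : 1 ≤ S) {b : ℝ} (hb : b ≤ a) :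
    HomAt r b S F x (S ^ (a - b) * A) := fun s hs hsS => by
  have hA := h.nonneg (by linarith)
  refine (h s hs hsS).mono ?_ le_rfl
  have : s ^ a = s ^ (a - b) * s ^ b := by rw [← Real.rpow_add hs]; congr 1; ring
  rw [this, mul_comm (S ^ (a - b)) A, mul_assoc]
  have h2 : s ^ (a - b) ≤ S ^ (a - b) := Real.rpow_le_rpow hs.le hsS (by linarith)
  exact mul_le_mul_of_nonneg_left (mul_le_mul_of_nonneg_right h2 (by positivity)) hA

end HomAt

theorem IsHomogeneous.exists_homAt {d r : ℕ} {a : ℝ} {F : Euc d → Distr d}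
    (h : IsHomogeneous a r F) {K : Set (Euc d)} (hK : IsCompact K) {S : ℝ} (hS : 1 ≤ S) :
    ∃ A, 0 ≤ A ∧ ∀ x ∈ K, HomAt r a S (F x) x A := by
  obtain ⟨C, hC⟩ := h K hK S hS
  refine ⟨max C 0, le_max_right _ _, fun x hx s hs hsS φ hφ => (hC x hx s ⟨hs, hsS⟩ φ hφ).trans ?_⟩
  gcongr
  exact le_max_left _ _

theorem IsHomogeneous.locBdd {d r : ℕ} {a : ℝ} {F : Euc d → Distr d} (h : IsHomogeneous a r F)
    (x : Euc d) : LocBdd r (F x) :=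
  HomAt.locBdd fun _ hS => let ⟨A, _, hA⟩ := h.exists_homAt isCompact_singleton hS
    ⟨A, hA x rfl⟩

theorem isHomogeneous_of_homAt {d r : ℕ} {a : ℝ} {F : Euc d → Distr d}
    (h : ∀ K : Set (Euc d), IsCompact K → ∀ S : ℝ, 1 ≤ S → ∃ A, ∀ x ∈ K, HomAt r a S (F x) x A) :
    IsHomogeneous a r F := fun K hK S hS =>
  let ⟨A, hA⟩ := h K hK S hS
  ⟨A, fun x hx s hs φ hφ => hA x hx s hs.1 hs.2 φ hφ⟩

theorem homNorm_le {d r : ℕ} {a : ℝ} {F : Euc d → Distr d} {K : Set (Euc d)} {S A : ℝ}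
    (h : ∀ x ∈ K, HomAt r a S (F x) x A) : homNorm a K S r F ≤ ENNReal.ofReal A := by
  refine iSup₂_le fun x hx => iSup₂_le fun s hs => iSup₂_le fun φ hφ =>
    ENNReal.ofReal_le_ofReal ?_
  rw [div_le_iff₀ (Real.rpow_pos_of_pos hs.1 a)]
  exact h x hx s hs.1 hs.2 φ hφ

theorem homAt_toReal_homNorm {d r : ℕ} {a : ℝ} {F : Euc d → Distr d} {K : Set (Euc d)} {S : ℝ}
    (h : homNorm a K S r F ≠ ⊤) {x : Euc d} (hx : x ∈ K) :
    HomAt r a S (F x) x (homNorm a K S r F).toReal := fun s hs hsS φ hφ => by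
  rw [← div_le_iff₀ (Real.rpow_pos_of_pos hs a), ← ENNReal.ofReal_le_iff_le_toReal h]
  exact (le_iSup₂ (f := fun φ (_ : φ ∈ unitTests d r) =>
    ENNReal.ofReal (|F x (rescale φ x s)| / s ^ a)) φ hφ).trans
    ((le_iSup₂ (f := fun s (_ : s ∈ Ioc 0 S) => ⨆ φ ∈ unitTests d r,
      ENNReal.ofReal (|F x (rescale φ x s)| / s ^ a)) s ⟨hs, hsS⟩).trans
    (le_iSup₂ (f := fun x (_ : x ∈ K) => ⨆ s ∈ Ioc 0 S, ⨆ φ ∈ unitTests d r,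
      ENNReal.ofReal (|F x (rescale φ x s)| / s ^ a)) x hx))

/-- Functionals bounded on unit test functions are bounded on the standard bump. -/
theorem exists_stdBump_const (d r : ℕ) : ∃ c, 0 < c ∧ ∀ (F : Distr d) (x : Euc d) (s B : ℝ),
    0 < s → ScaleBd r F x s B → |F (rescale (stdBump d) x s)| ≤ c * B := by
  obtain ⟨M, hM0, hM⟩ := exists_bound_partialDeriv (stdBump d) r
  refine ⟨M + 1, by linarith, fun F x s B hs hB => hB.test_le hs (by linarith)
    ⟨contDiff_nat_of_test _ _, fun z hz => ?_, fun k hk z => ?_⟩⟩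
  · rw [coe_rescale _ _ hs]
    simp only
    rw [stdBump_zero, mul_zero]
    rw [norm_smul, norm_inv, Real.norm_of_nonneg hs.le, inv_mul_eq_div, lt_div_iff₀ hs]
    linarith
  · rw [partialDeriv_rescale _ _ hs]
    simp only
    rw [abs_mul, abs_mul, abs_of_nonneg (by positivity : 0 ≤ (s ^ d)⁻¹),
      abs_of_nonneg (by positivity : 0 ≤ (s ^ deg k)⁻¹)]
    have := hM k hk (s⁻¹ • (z - x))
    calc _ ≤ (s ^ d)⁻¹ * ((s ^ deg k)⁻¹ * (M + 1)) := by gcongr; linarith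
      _ = _ := by ring


/-! ### Integration of a homogeneous distribution -/

/-- The pointwise derivatives at `x` of the integration of `F`, as a series. -/
def taylorCoef {d : ℕ} (r : ℕ) (Kn : ℕ → Euc d → Euc d → ℝ) (F : Distr d) (k : Fin d → ℕ)
    (x : Euc d) : ℝ := ∑' n, pot r F (Kn n) k x

section

variable {d m r : ℕ} {β ρ : ℝ} {Ker : Euc d → Euc d → ℝ} {Kn : ℕ → Euc d → Euc d → ℝ}

theorem HomAt.exists_potBd (hK : IsRegularisingKernel β m r ρ Ker Kn) {r' : ℕ} (hr : r' ≤ r)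
    {F : Distr d} (hF : LocBdd r F) {a A : ℝ} {x : Euc d}
    (hA : HomAt r' a (2 * ((1 + ρ) * 1)) F x A) :
    ∃ A', PotBd m r' β a 1 A' (fun n => pot r F (Kn n)) x := by
  obtain ⟨C, _, hC⟩ := hK.exists_potBd hr (isCompact_singleton (x := x)) le_rfl a
  have := hK.range_pos
  exact ⟨_, hC x rfl F A hF (hA.nonneg (by positivity)) hA⟩

theorem HomAt.summable_pot (hK : IsRegularisingKernel β m r ρ Ker Kn) {r' : ℕ} (hr : r' ≤ r)
    {F : Distr d} (hF : LocBdd r F) {a A : ℝ} {x : Euc d}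
    (hA : HomAt r' a (2 * ((1 + ρ) * 1)) F x A) {k : Fin d → ℕ} (hkm : deg k ≤ m)
    (hk : (deg k : ℝ) < a + β) : Summable fun n => pot r F (Kn n) k x :=
  let ⟨_, h⟩ := hA.exists_potBd hK hr hF
  h.summable hkm hk

theorem HomAt.hasPointDeriv_kernelInt (hK : IsRegularisingKernel β m r ρ Ker Kn) {r' : ℕ}
    (hr : r' ≤ r) {F : Distr d} (hF : LocBdd r F) {a A : ℝ} {x : Euc d}
    (hA : HomAt r' a (2 * ((1 + ρ) * 1)) F x A) {k : Fin d → ℕ} (hkm : deg k ≤ m)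
    (hk : (deg k : ℝ) < a + β) (δ : ℝ) :
    HasPointDeriv δ k (kernelInt r Kn F) x (taylorCoef r Kn F k x) :=
  let ⟨_, h⟩ := hA.exists_potBd hK hr hF
  h.hasPointDeriv hK.beta_pos one_pos (hasSum_kernelInt hK hF) hkm hk δ

/-- `B` bounds the critical derivatives, of degree `a + β`, of the integration of `F`. -/
def CritBd (r : ℕ) (Kn : ℕ → Euc d → Euc d → ℝ) (t : ℝ) (F : Distr d) (x : Euc d) (B : ℝ) : Prop :=
  0 ≤ B ∧ ∀ k : Fin d → ℕ, (deg k : ℝ) = t → ∀ s ∈ Ioc (0 : ℝ) 1,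
    |multiDeriv k (kernelInt r Kn F) (rescale (stdBump d) x s)| ≤ B

/-- The sum of the constants over the finitely many indices of degree below a + β + 1 makes the
bound uniform in the critical index k. -/
theorem IsRegularisingKernel.exists_critical_const (hK : IsRegularisingKernel β m r ρ Ker Kn)
    {r' : ℕ} (hr : r' ≤ r) {K : Set (Euc d)} (hKc : IsCompact K) {S : ℝ} (hS : 1 ≤ S) {a : ℝ}
    (hm : a + β < m) :
    ∃ C, 0 ≤ C ∧ ∀ x ∈ K, ∀ (F : Distr d) (A B : ℝ), LocBdd r F →
      HomAt r' a (2 * ((1 + ρ) * S)) F x A → CritBd r Kn (a + β) F x B →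
      ∀ k : Fin d → ℕ, (deg k : ℝ) = a + β → ∀ N,
        |∑ n ∈ Finset.range N, pot r F (Kn n) k x| ≤ C * (A + B) := by
  obtain ⟨C, hC, h⟩ := hK.exists_potBd hr hKc hS a
  choose C' hC'0 hC' using exists_partialSum_const d r' β hK.beta_pos
  set Q := ∑ k ∈ poly d (a + β + 1), C' k with hQ
  have hQ0 : 0 ≤ Q := Finset.sum_nonneg fun k _ => hC'0 k
  refine ⟨Q * C + 1, by positivity, fun x hx F A B hF hA hB k hk N => ?_⟩
  have hρ := hK.range_pos
  have hA0 := hA.nonneg (by positivity)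
  have hkm : deg k + 1 ≤ m := by
    have : (deg k : ℝ) < m := by rw [hk]; exact hm
    exact_mod_cast this
  refine (hC' k m a S (C * A) _ x _ hS hkm hk (h x hx F A hF hA0 hA) (hasSum_kernelInt hK hF) B
    (hB.2 k hk) N).trans ?_
  have h1 : C' k ≤ Q := Finset.single_le_sum (f := C') (fun k _ => hC'0 k)
    (mem_poly.2 (by rw [hk]; linarith))
  have h2 : C' k * (C * A) ≤ Q * (C * A) := mul_le_mul_of_nonneg_right h1 (by positivity)
  have h3 := mul_nonneg (mul_nonneg hQ0 hC.le) hB.1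
  linarith [hB.1]

/-- Subtracting its Taylor polynomial makes the integration of an `a`-homogeneous distribution
`(a + β)`-homogeneous. -/
theorem IsRegularisingKernel.exists_lift_const (hK : IsRegularisingKernel β m r ρ Ker Kn)
    {r' : ℕ} (hr : r' ≤ r) {K : Set (Euc d)} (hKc : IsCompact K) {S : ℝ} (hS : 1 ≤ S) {a : ℝ}
    (hm : a + β < m) :
    ∃ C, 0 ≤ C ∧ ∀ x ∈ K, ∀ (F : Distr d) (A B : ℝ), LocBdd r F →
      HomAt r' a (2 * ((1 + ρ) * S)) F x A → CritBd r Kn (a + β) F x B →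
      HomAt r' (a + β) S (kernelInt r Kn F -
        ∑ k ∈ poly d (a + β), taylorCoef r Kn F k x • monomial k x) x (C * (A + B)) := by
  obtain ⟨C, hC, h⟩ := hK.exists_potBd hr hKc hS a
  obtain ⟨C', hC', h'⟩ := hK.exists_critical_const hr hKc hS hm
  refine ⟨remConst d m (a + β) β * (C + C'), mul_nonneg (remConst_nonneg _ _ _ _) (by positivity),
    fun x hx F A B hF hA hB s hs hsS φ hφ => ?_⟩
  have hρ := hK.range_pos
  have hA0 := hA.nonneg (by positivity)
  have := (h x hx F A hF hA0 hA).abs_remainder_le hK.beta_pos (hasSum_kernelInt hK hF) hm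
    (mul_nonneg hC' (add_nonneg hA0 hB.1)) (h' x hx F A B hF hA hB) hs hsS zero_le_one
    (crBd_rescale hφ x hs)
  rw [sub_apply, sum_apply]
  simp only [smul_apply, monomial_apply, smul_eq_mul, taylorCoef]
  refine this.trans ?_
  rw [mul_one, mul_assoc _ (C + C'), mul_assoc (remConst d m (a + β) β)]
  refine mul_le_mul_of_nonneg_left (mul_le_mul_of_nonneg_right ?_ (by positivity))
    (remConst_nonneg _ _ _ _)
  nlinarith [mul_nonneg hC.le hB.1]

theorem abs_taylorCoef_le_of_potBd {a S A : ℝ} {x : Euc d} {F : Distr d} {r' : ℕ}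
    (h : PotBd m r' β a S A (fun n => pot r F (Kn n)) x) {k : Fin d → ℕ} (hk : deg k ≤ m)
    (hka : (deg k : ℝ) < a + β) : |taylorCoef r Kn F k x| ≤ epsSum (a + β - deg k) * A := by
  have h1 := sum_tail_le (f := fun n => pot r F (Kn n) k x) (N := 0) (t := a + β - deg k) (s := 1)
    (by linarith) one_pos (eps_le_one 0) h.nonneg
    fun n _ => h.small n k x hk (by rw [sub_self, norm_zero]; exact (eps_pos n).le)
  simpa [taylorCoef] using h1.2

/-! ### Measurability -/

/-- The extension is a pointwise limit, along a sequence of mollification scales, of pairings with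
smooth test functions. -/
theorem measurable_ext {F : Euc d → Distr d} (hF : IsGerm F) (hb : ∀ x, LocBdd r (F x))
    {g : Euc d → ℝ} (hg : ContDiff ℝ r g) (hgs : HasCompactSupport g) :
    Measurable fun x => ext r (F x) g :=
  measurable_of_tendsto_metrizable (fun j : ℕ => hF (averageTest (stdBump d) g ((j : ℝ) + 1)⁻¹))
    (tendsto_pi_nhds.2 fun x => ((hb x).tendsto_ext hg hgs).comp tendsto_inv_nat_nhdsGT)

theorem isGerm_kernelInt (hK : IsRegularisingKernel β m r ρ Ker Kn) {F : Euc d → Distr d}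
    (hF : IsGerm F) (hb : ∀ x, LocBdd r (F x)) : IsGerm fun x => kernelInt r Kn (F x) := by
  intro ψ
  refine measurable_of_tendsto_metrizable
    (f := fun N x => ∑ n ∈ Finset.range N, ext r (F x) (dualAct (Kn n) ψ)) (fun N =>
      Finset.measurable_sum _ fun n _ => measurable_ext hF hb ((hK.regular n).contDiff_dualAct ψ)
        (hasCompactSupport_dualAct (hK.support n) ψ)) (tendsto_pi_nhds.2 fun x => ?_)
  have h := (hasSum_kernelInt hK (hb x) ψ).tendsto_sum_nat
  simpa only [← (hK.regular _).ext_dualAct (hK.support _)] using h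

/-- The function is continuous in the evaluation point z and measurable in the base point x, hence
jointly measurable, and may be restricted to the diagonal. -/
theorem measurable_pot_self (hK : IsRegularisingKernel β m r ρ Ker Kn) {F : Euc d → Distr d}
    (hF : IsGerm F) (hb : ∀ x, LocBdd r (F x)) (n : ℕ) {k : Fin d → ℕ} (hk : deg k ≤ m) :
    Measurable fun x => pot r (F x) (Kn n) k x := by
  have h := measurable_uncurry_of_continuous_of_measurable
    (u := fun z x => pot r (F x) (Kn n) k z)
    (fun x => (hK.isJet_pot (F x) n).continuous k hk) fun z => by
      simp only [pot_eq]
      exact measurable_ext hF hb ((hK.regular n).contDiff_mixedDeriv hk z)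
        ((hK.regular n).hasCompactSupport_mixedDeriv (hK.support n) hk z)
  exact h.comp (measurable_id.prodMk measurable_id)

theorem measurable_taylorCoef (hK : IsRegularisingKernel β m r ρ Ker Kn) {F : Euc d → Distr d}
    (hF : IsGerm F) (hb : ∀ x, LocBdd r (F x)) {k : Fin d → ℕ} (hk : deg k ≤ m)
    (hs : ∀ x, Summable fun n => pot r (F x) (Kn n) k x) :
    Measurable fun x => taylorCoef r Kn (F x) k x :=
  measurable_of_tendsto_metrizable
    (f := fun N x => ∑ n ∈ Finset.range N, pot r (F x) (Kn n) k x)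
    (fun _ => Finset.measurable_sum _ fun n _ => measurable_pot_self hK hF hb n hk)
    (tendsto_pi_nhds.2 fun x => (hs x).hasSum.tendsto_sum_nat)

end


/-! ### The lifted model -/

theorem sum_poly_ite {d : ℕ} {V : Type*} [AddCommMonoid V] {t t' : ℝ} (h : t' ≤ t)
    (g : (Fin d → ℕ) → V) :
    ∑ k ∈ poly d t, (if (deg k : ℝ) < t' then g k else 0) = ∑ k ∈ poly d t', g k := by
  rw [← Finset.sum_filter]
  refine Finset.sum_congr (Finset.ext fun k => ?_) fun _ _ => rfl
  rw [Finset.mem_filter, mem_poly, mem_poly]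
  exact ⟨fun h => h.2, fun h' => ⟨h'.trans_le h, h'⟩⟩

section

variable {d m r rP : ℕ} {β γ ρ : ℝ} {Ker : Euc d → Euc d → ℝ} {Kn : ℕ → Euc d → Euc d → ℝ}
  {I : Type*} [Fintype I] {α : I → ℝ} {P : I → Euc d → Distr d}
  {Γ : Euc d → Euc d → I → I → ℝ}

theorem IsModel.locBdd {J : Type*} [Fintype J] {α : J → ℝ} {P : J → Euc d → Distr d}
    {Γ : Euc d → Euc d → J → J → ℝ} (hP : IsModel α rP P Γ) (hr : rP ≤ r) (i : J) (x : Euc d) :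
    LocBdd r (P i x) := ((hP.homogeneous i).locBdd x).mono hr

theorem IsModel.exists_homAt {J : Type*} [Fintype J] {α : J → ℝ} {P : J → Euc d → Distr d}
    {Γ : Euc d → Euc d → J → J → ℝ} (hP : IsModel α rP P Γ) {K : Set (Euc d)} (hK : IsCompact K)
    {S : ℝ} (hS : 1 ≤ S) :
    ∃ A, 0 ≤ A ∧ ∀ i, ∀ x ∈ K, HomAt rP (α i) S (P i x) x A := by
  choose A hA0 hA using fun i => (hP.homogeneous i).exists_homAt hK hS
  exact ⟨∑ i, A i, Finset.sum_nonneg fun i _ => hA0 i, fun i x hx => (hA i x hx).mono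
    (Finset.single_le_sum (fun j _ => hA0 j) (Finset.mem_univ i)) le_rfl le_rfl⟩

theorem IsCompatible.exists_critBd (hc : IsCompatible r Kn α β P) {K : Set (Euc d)}
    (hK : IsCompact K) : ∃ B, 0 ≤ B ∧ ∀ i, ∀ x ∈ K, CritBd r Kn (α i + β) (P i x) x B := by
  have h : ∀ (i : I) (k : Fin d → ℕ), ∃ B, 0 ≤ B ∧ ((deg k : ℝ) = α i + β → ∀ x ∈ K,
      ∀ s ∈ Ioc (0 : ℝ) 1,
        |multiDeriv k (kernelInt r Kn (P i x)) (rescale (stdBump d) x s)| ≤ B) := fun i k => by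
    by_cases hk : (deg k : ℝ) = α i + β
    · obtain ⟨r₀, h⟩ := hc i k hk
      obtain ⟨A, hA0, hA⟩ := h.exists_homAt hK le_rfl
      obtain ⟨c, hc0, hcb⟩ := exists_stdBump_const d r₀
      refine ⟨c * A, by positivity, fun _ x hx s hs => (hcb _ x s _ hs.1 (hA x hx s hs.1 hs.2)).trans ?_⟩
      rw [Real.rpow_zero, mul_one]
    · exact ⟨0, le_rfl, fun h => absurd h hk⟩
  choose B hB0 hB using h
  have hB0' : ∀ i, 0 ≤ ∑ k ∈ poly d (α i + β + 1), B i k :=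
    fun i => Finset.sum_nonneg fun k _ => hB0 i k
  have hnn : 0 ≤ ∑ i, ∑ k ∈ poly d (α i + β + 1), B i k := Finset.sum_nonneg fun i _ => hB0' i
  refine ⟨∑ i, ∑ k ∈ poly d (α i + β + 1), B i k, hnn, fun i x hx => ⟨hnn, fun k hk s hs =>
    (hB i k hk x hx s hs).trans ?_⟩⟩
  exact (Finset.single_le_sum (f := B i) (fun k _ => hB0 i k)
    (mem_poly.2 (by rw [hk]; linarith))).trans
    (Finset.single_le_sum (f := fun i => ∑ k ∈ poly d (α i + β + 1), B i k)
      (fun i _ => hB0' i) (Finset.mem_univ i))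

/-- The compatibility norm bounds the critical derivatives. -/
theorem IsCompatible.exists_critBd_le (d rP : ℕ) : ∃ c, 0 < c ∧
    ∀ {r : ℕ} {Kn : ℕ → Euc d → Euc d → ℝ} {I : Type*} [Fintype I] {α : I → ℝ} {β : ℝ}
      {P : I → Euc d → Distr d}, IsCompatible r Kn α β P → ∀ {K : Set (Euc d)}, IsCompact K →
      ∀ {S : ℝ}, 1 ≤ S → ∃ B, 0 ≤ B ∧ (∀ i, ∀ x ∈ K, CritBd r Kn (α i + β) (P i x) x B) ∧
        ENNReal.ofReal B ≤ ENNReal.ofReal c * compatNorm r Kn α β rP K S P := by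
  obtain ⟨c, hc0, hcb⟩ := exists_stdBump_const d rP
  refine ⟨c, hc0, fun {r Kn I _ α β P} hc K hK S hS => ?_⟩
  -- Compatibility holds for some order of test functions, possibly other than `rP`, so the norm of
  -- order `rP` can be infinite. In that case any finite bound will do.
  by_cases htop : compatNorm r Kn α β rP K S P = ⊤
  · obtain ⟨B, hB0, hB⟩ := hc.exists_critBd hK
    refine ⟨B, hB0, hB, ?_⟩
    rw [htop, ENNReal.mul_top (by simpa using hc0)]
    exact le_top
  · refine ⟨c * (compatNorm r Kn α β rP K S P).toReal, by positivity,
      fun i x hx => ⟨by positivity, fun k hk s hs => ?_⟩, ?_⟩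
    · have hle : homNorm 0 K S rP (fun x => multiDeriv k (kernelInt r Kn (P i x))) ≤
          compatNorm r Kn α β rP K S P := by
        refine (ENNReal.le_tsum (f := fun k : {k : Fin d → ℕ // (deg k : ℝ) = α i + β} =>
          homNorm 0 K S rP fun x => multiDeriv k.1 (kernelInt r Kn (P i x))) ⟨k, hk⟩).trans ?_
        exact Finset.single_le_sum (f := fun i => ∑' k : {k : Fin d → ℕ // (deg k : ℝ) = α i + β},
          homNorm 0 K S rP fun x => multiDeriv k.1 (kernelInt r Kn (P i x)))
          (fun _ _ => zero_le) (Finset.mem_univ i)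
      have hne := ne_top_of_le_ne_top htop hle
      refine (hcb _ x s _ hs.1 (homAt_toReal_homNorm hne hx s hs.1 (hs.2.trans hS))).trans ?_
      rw [Real.rpow_zero, mul_one]
      exact mul_le_mul_of_nonneg_left (ENNReal.toReal_mono htop hle) hc0.le
    · rw [ENNReal.ofReal_mul hc0.le, ENNReal.ofReal_toReal htop]

theorem IsModel.coefK_eq (hK : IsRegularisingKernel β m r ρ Ker Kn) (hP : IsModel α rP P Γ)
    (hr : rP ≤ r) (hm : ∀ i, α i + β < m) (i : I) {k : Fin d → ℕ} (hk : (deg k : ℝ) < α i + β)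
    (x : Euc d) :
    HasPointDeriv (α i + β) k (kernelInt r Kn (P i x)) x (taylorCoef r Kn (P i x) k x) ∧
      coefK r Kn α β P i k x = taylorCoef r Kn (P i x) k x := by
  have hρ := hK.range_pos
  obtain ⟨A, _, hA⟩ := hP.exists_homAt (isCompact_singleton (x := x))
    (S := 2 * ((1 + ρ) * 1)) (by linarith)
  have := (hA i x rfl).hasPointDeriv_kernelInt hK hr (hP.locBdd hr i x)
    (k := k) (by exact_mod_cast (hk.trans (hm i)).le) hk (α i + β)
  exact ⟨this, this.pointDeriv_eq⟩

theorem IsModel.summable_pot (hK : IsRegularisingKernel β m r ρ Ker Kn) (hP : IsModel α rP P Γ)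
    (hr : rP ≤ r) (hm : ∀ i, α i + β < m) (i : I) {k : Fin d → ℕ} (hk : (deg k : ℝ) < α i + β)
    (x : Euc d) : Summable fun n => pot r (P i x) (Kn n) k x := by
  have hρ := hK.range_pos
  obtain ⟨A, _, hA⟩ := hP.exists_homAt (isCompact_singleton (x := x))
    (S := 2 * ((1 + ρ) * 1)) (by linarith)
  exact (hA i x rfl).summable_pot hK hr (hP.locBdd hr i x)
    (k := k) (by exact_mod_cast (hk.trans (hm i)).le) hk

theorem IsModel.measurable_coefK (hK : IsRegularisingKernel β m r ρ Ker Kn)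
    (hP : IsModel α rP P Γ) (hr : rP ≤ r) (hm : ∀ i, α i + β < m) (i : I) {k : Fin d → ℕ}
    (hk : (deg k : ℝ) < α i + β) : Measurable (coefK r Kn α β P i k) := by
  have h := measurable_taylorCoef hK (hP.germ i) (hP.locBdd hr i) (k := k)
    (by exact_mod_cast (hk.trans (hm i)).le) (hP.summable_pot hK hr hm i hk)
  rwa [show coefK r Kn α β P i k = fun x => taylorCoef r Kn (P i x) k x from
    funext fun x => (hP.coefK_eq hK hr hm i hk x).2]

theorem IsRegularisingKernel.exists_hatP_const (hK : IsRegularisingKernel β m r ρ Ker Kn)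
    (hr : rP ≤ r) (hm : ∀ i, α i + β < m) {K : Set (Euc d)} (hKc : IsCompact K) {S : ℝ}
    (hS : 1 ≤ S) :
    ∃ C, 0 ≤ C ∧ ∀ (P : I → Euc d → Distr d) (Γ : Euc d → Euc d → I → I → ℝ) (A B : ℝ),
      IsModel α rP P Γ → 0 ≤ A → 0 ≤ B →
      (∀ i, ∀ x ∈ K, HomAt rP (α i) (2 * ((1 + ρ) * S)) (P i x) x A) →
      (∀ i, ∀ x ∈ K, CritBd r Kn (α i + β) (P i x) x B) →
      ∀ a, ∀ x ∈ K, HomAt rP (hatα d α β γ a) S (hatP r Kn α β γ P a x) x (C * (1 + A + B)) := by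
  choose C hC0 hC using fun i => hK.exists_lift_const hr hKc hS (hm i)
  have hV := ballVol_nonneg d
  have hCs : 0 ≤ ∑ i, C i := Finset.sum_nonneg fun i _ => hC0 i
  refine ⟨ballVol d + ∑ i, C i, by positivity, fun P Γ A B hP hA0 hB0 hA hB a x hx => ?_⟩
  match a with
  | .inl i =>
    have h := hC i x hx (P i x) A B (hP.locBdd hr i x) (hA i x hx) (hB i x hx)
    have e : hatP r Kn α β γ P (.inl i) x = kernelInt r Kn (P i x) -
        ∑ k ∈ poly d (α i + β), taylorCoef r Kn (P i x) k x • monomial k x := by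
      simp only [hatP]
      congr 1
      exact Finset.sum_congr rfl fun k hk => by rw [(hP.coefK_eq hK hr hm i (mem_poly.1 hk) x).2]
    rw [e]
    refine h.mono ?_ le_rfl le_rfl
    have h1 := Finset.single_le_sum (fun j _ => hC0 j) (Finset.mem_univ i)
    exact mul_le_mul (by linarith) (by linarith) (by positivity) (by positivity)
  | .inr k =>
    refine (homAt_monomial rP k.1 S x).mono ?_ le_rfl le_rfl
    nlinarith [mul_nonneg hV hA0, mul_nonneg hV hB0, mul_nonneg hCs hA0, mul_nonneg hCs hB0]

theorem sum_hatIndex {V : Type*} [AddCommMonoid V] {t : ℝ} (g : HatIndex I d t → V)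
    (h : (Fin d → ℕ) → V) (hg : ∀ k, g (.inr k) = h k.1) :
    ∑ a, g a = ∑ i, g (.inl i) + ∑ k ∈ poly d t, h k := by
  rw [Fintype.sum_sum_type, ← Finset.sum_coe_sort (poly d t) h]
  congr 1
  exact Finset.sum_congr rfl fun k _ => hg k

/-- Integration with the kernel is linear, so 𝖪Π^i_y re-expands with the same Γ. The two Taylor
corrections are then both written around x; the extra coefficients of the monomials are exactly the
entries of the new Γ between polynomials and I. -/
theorem IsModel.hatP_reexpansion (hK : IsRegularisingKernel β m r ρ Ker Kn)
    (hP : IsModel α rP P Γ) (hr : rP ≤ r) (hγ : ∀ i, α i < γ) (a : HatIndex I d (γ + β))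
    (x y : Euc d) :
    hatP r Kn α β γ P a y =
      ∑ b, hatΓ r Kn α β γ P Γ x y b a • hatP r Kn α β γ P b x := by
  match a with
  | .inr k =>
    rw [sum_hatIndex _ (fun l => polyΓ x y l k.1 • monomial l x) fun l => rfl]
    simp only [hatP, hatΓ, zero_smul, Finset.sum_const_zero, zero_add]
    exact monomial_eq_sum x y k.1 fun l hl => mem_poly_of_le k.2 hl
  | .inl i =>
    set c := coefK r Kn α β P with hc
    rw [sum_hatIndex _ (fun l => ((∑ j, if (deg l : ℝ) < α j + β then c j l x * Γ x y j i else 0) -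
        ∑ k ∈ poly d (α i + β), polyΓ x y l k * c i k y) • monomial l x) fun l => rfl]
    simp only [hatP, hatΓ, ← hc]
    have h1 : kernelInt r Kn (P i y) = ∑ j, Γ x y j i • kernelInt r Kn (P j x) := by
      rw [hP.reexpansion i x y, kernelInt_sum hK _ fun j _ => (hP.locBdd hr j x).smul _]
      exact Finset.sum_congr rfl fun j _ => kernelInt_smul hK (hP.locBdd hr j x) _
    have h2 : ∑ k ∈ poly d (α i + β), c i k y • monomial k y =
        ∑ l ∈ poly d (γ + β), (∑ k ∈ poly d (α i + β), polyΓ x y l k * c i k y) •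
          monomial l x := by
      simp only [Finset.sum_smul]
      rw [Finset.sum_comm]
      refine Finset.sum_congr rfl fun k hk => ?_
      have hk' : k ∈ poly d (γ + β) := mem_poly.2 ((mem_poly.1 hk).trans (by linarith [hγ i]))
      rw [monomial_eq_sum x y k (T := poly d (γ + β)) fun l hl => mem_poly_of_le hk' hl,
        Finset.smul_sum]
      exact Finset.sum_congr rfl fun l _ => by rw [smul_smul, mul_comm]
    have h3 : ∑ l ∈ poly d (γ + β), (∑ j, if (deg l : ℝ) < α j + β then c j l x * Γ x y j i else 0) •
        monomial l x =
        ∑ j, Γ x y j i • ∑ k ∈ poly d (α j + β), c j k x • monomial k x := by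
      simp only [Finset.sum_smul]
      rw [Finset.sum_comm]
      refine Finset.sum_congr rfl fun j _ => ?_
      rw [← sum_poly_ite (t := γ + β) (t' := α j + β) (by linarith [hγ j]), Finset.smul_sum]
      refine Finset.sum_congr rfl fun l _ => ?_
      split_ifs
      · rw [smul_smul, mul_comm]
      · rw [zero_smul, smul_zero]
    simp only [sub_smul, Finset.sum_sub_distrib, smul_sub]
    rw [h1, h2, h3]
    abel

theorem IsModel.isModel_hatP (hK : IsRegularisingKernel β m r ρ Ker Kn)
    (hP : IsModel α rP P Γ) (hc : IsCompatible r Kn α β P) (hr : rP ≤ r) (hγ : ∀ i, α i < γ)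
    (hm : γ + β < m) :
    IsModel (hatα d α β γ) rP (hatP r Kn α β γ P) (hatΓ r Kn α β γ P Γ) where
  germ a := by
    have hm' : ∀ i, α i + β < m := fun i => by linarith [hγ i]
    match a with
    | .inr k => exact isGerm_monomial k.1
    | .inl i =>
      intro ψ
      simp only [hatP, sub_apply, sum_apply, smul_apply, smul_eq_mul]
      exact (isGerm_kernelInt hK (hP.germ i) (hP.locBdd hr i) ψ).sub
        (Finset.measurable_sum _ fun k hk => (hP.measurable_coefK hK hr hm' i (mem_poly.1 hk)).mul
          (isGerm_monomial k ψ))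
  homogeneous a := isHomogeneous_of_homAt fun K hKc S hS => by
    have hρ := hK.range_pos
    have hm' : ∀ i, α i + β < m := fun i => by linarith [hγ i]
    obtain ⟨C, _, hC⟩ := hK.exists_hatP_const (γ := γ) hr hm' hKc hS
    obtain ⟨A, hA0, hA⟩ := hP.exists_homAt hKc (S := 2 * ((1 + ρ) * S)) (by nlinarith)
    obtain ⟨B, hB0, hB⟩ := hc.exists_critBd hKc
    exact ⟨_, hC P Γ A B hP hA0 hB0 hA hB a⟩
  reexpansion a := hP.hatP_reexpansion hK hr hγ a

end


/-! ### Germs of modelled distributions -/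

/-- The bounds in the definition of a modelled distribution, with the constant `M`. -/
def ModBd {d : ℕ} {J : Type*} [Fintype J] (α : J → ℝ) (Γ : Euc d → Euc d → J → J → ℝ) (γ : ℝ)
    (K : Set (Euc d)) (f : Euc d → J → ℝ) (M : ℝ) : Prop :=
  ∀ i, ∀ x ∈ K, ∀ y ∈ K, |f x i| ≤ M ∧ |increment Γ f x y i| ≤ M * ‖y - x‖ ^ (γ - α i)

section

variable {d r : ℕ} {γ : ℝ} {J : Type*} [Fintype J] {α : J → ℝ} {P : J → Euc d → Distr d}
  {Γ : Euc d → Euc d → J → J → ℝ} {f : Euc d → J → ℝ}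

theorem IsModelled.exists_modBd (hf : IsModelled α Γ γ f) {K : Set (Euc d)} (hK : IsCompact K) :
    ∃ M, 0 ≤ M ∧ ModBd α Γ γ K f M := by
  obtain ⟨C, hC⟩ := hf.bounds K hK
  refine ⟨max C 0, le_max_right _ _, fun i x hx y hy =>
    ⟨(hC i x hx y hy).1.trans (le_max_left _ _), (hC i x hx y hy).2.trans ?_⟩⟩
  gcongr
  exact le_max_left _ _

theorem modelledNorm_le {K : Set (Euc d)} {M : ℝ} (h : ModBd α Γ γ K f M) :
    modelledNorm α Γ γ K f ≤ 2 * ENNReal.ofReal M := by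
  rw [two_mul]
  refine add_le_add (iSup₂_le fun x hx => iSup_le fun i =>
    ENNReal.ofReal_le_ofReal (h i x hx x hx).1) (iSup₂_le fun x hx => iSup₂_le fun y hy =>
      iSup_le fun i => ENNReal.div_le_of_le_mul ?_)
  have hM : 0 ≤ M := (abs_nonneg _).trans (h i x hx x hx).1
  rw [← ENNReal.ofReal_mul hM]
  exact ENNReal.ofReal_le_ofReal (h i x hx y hy).2

theorem IsModelled.modelledNorm_ne_top (hf : IsModelled α Γ γ f) {K : Set (Euc d)}
    (hK : IsCompact K) : modelledNorm α Γ γ K f ≠ ⊤ :=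
  let ⟨_, _, h⟩ := hf.exists_modBd hK
  ne_top_of_le_ne_top (by finiteness) (modelledNorm_le h)

theorem IsModelled.modBd_toReal (hf : IsModelled α Γ γ f) {K : Set (Euc d)} (hK : IsCompact K) :
    ModBd α Γ γ K f (modelledNorm α Γ γ K f).toReal := by
  have htop := hf.modelledNorm_ne_top hK
  intro i x hx y hy
  constructor
  · rw [← ENNReal.ofReal_le_iff_le_toReal htop]
    exact ((le_iSup (fun i => ENNReal.ofReal |f x i|) i).trans
      (le_iSup₂ (f := fun x (_ : x ∈ K) => ⨆ i, ENNReal.ofReal |f x i|) x hx)).trans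
      le_self_add
  · obtain ⟨M, _, hM⟩ := hf.exists_modBd hK
    rcases (norm_nonneg (y - x)).eq_or_lt with h0 | h0
    · have h1 := (hM i x hx y hy).2
      have : (0 : ℝ) ^ (γ - α i) = 0 := Real.zero_rpow (by linarith [hf.lt i])
      rw [← h0, this, mul_zero] at h1 ⊢
      exact h1
    · have hp := Real.rpow_pos_of_pos h0 (γ - α i)
      have h2 : ENNReal.ofReal |increment Γ f x y i| / ENNReal.ofReal (‖y - x‖ ^ (γ - α i)) ≤
          modelledNorm α Γ γ K f :=
        ((le_iSup (fun i => ENNReal.ofReal |increment Γ f x y i| /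
          ENNReal.ofReal (‖y - x‖ ^ (γ - α i))) i).trans
        (le_iSup₂ (f := fun y (_ : y ∈ K) => ⨆ i, ENNReal.ofReal |increment Γ f x y i| /
          ENNReal.ofReal (‖y - x‖ ^ (γ - α i))) y hy)).trans
        ((le_iSup₂ (f := fun x (_ : x ∈ K) => ⨆ y ∈ K, ⨆ i,
          ENNReal.ofReal |increment Γ f x y i| / ENNReal.ofReal (‖y - x‖ ^ (γ - α i))) x hx).trans
          le_add_self)
      rw [← ENNReal.ofReal_div_of_pos hp, ENNReal.ofReal_le_iff_le_toReal htop,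
        div_le_iff₀ hp] at h2
      exact h2

/-- Expressing Π_y through Π_x turns the change of base point into the increments of f. Coherence,
and the comparison of the potentials at x and y, rest on this identity. -/
theorem IsModel.germOf_sub (hP : IsModel α r P Γ) (x y : Euc d) :
    germOf f P y - germOf f P x = ∑ j, increment Γ f x y j • P j x := by
  simp only [germOf, increment, sub_smul, Finset.sum_sub_distrib, Finset.sum_smul]
  congr 1
  rw [Finset.sum_comm]
  refine Finset.sum_congr rfl fun i _ => ?_
  rw [hP.reexpansion i x y, Finset.smul_sum]
  exact Finset.sum_congr rfl fun j _ => by rw [smul_smul, mul_comm]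

theorem IsModel.isGerm_germOf (hP : IsModel α r P Γ) (hf : Measurable f) :
    IsGerm (germOf f P) := fun φ => by
  simp only [germOf, sum_apply, smul_apply, smul_eq_mul]
  exact Finset.measurable_sum _ fun i _ => ((measurable_pi_apply i).comp hf).mul (hP.germ i φ)

/-- The factors t^{γ-b} and s^{b-a} are absorbed into powers of t + s; only s^a remains, as a may be
negative. -/
theorem rpow_mul_rpow_le {a b γ s t : ℝ} (hs : 0 < s) (ht : 0 ≤ t) (hab : a ≤ b) (hbγ : b ≤ γ) :
    t ^ (γ - b) * s ^ b ≤ s ^ a * (t + s) ^ (γ - a) := by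
  have h1 : s ^ b = s ^ a * s ^ (b - a) := by rw [← Real.rpow_add hs]; congr 1; ring
  have h2 : (t + s) ^ (γ - a) = (t + s) ^ (γ - b) * (t + s) ^ (b - a) := by
    rw [← Real.rpow_add (by linarith)]; congr 1; ring
  rw [h1, h2, mul_left_comm]
  refine mul_le_mul_of_nonneg_left (mul_le_mul ?_ ?_ (by positivity) (by positivity))
    (by positivity)
  · exact Real.rpow_le_rpow ht (by linarith) (by linarith)
  · exact Real.rpow_le_rpow hs.le (by linarith) (by linarith)

theorem IsModel.scaleBd_germOf_sub (hP : IsModel α r P Γ) {a : ℝ} (ha : ∀ j, a ≤ α j)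
    (hγ : ∀ j, α j ≤ γ) {x y : Euc d} {s S A M : ℝ} (hA0 : 0 ≤ A)
    (hA : ∀ j, HomAt r (α j) S (P j x) x A)
    (hM : ∀ j, |increment Γ f x y j| ≤ M * ‖y - x‖ ^ (γ - α j)) (hM0 : 0 ≤ M) (hs : 0 < s)
    (hsS : s ≤ S) :
    ScaleBd r (germOf f P y - germOf f P x) x s
      (Fintype.card J * (A * M) * (s ^ a * (‖y - x‖ + s) ^ (γ - a))) := by
  rw [hP.germOf_sub x y]
  refine (ScaleBd.sum Finset.univ fun j _ => (hA j s hs hsS).smul (increment Γ f x y j)).mono ?_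
    le_rfl
  refine (Finset.sum_le_card_nsmul _ _ (A * M * (s ^ a * (‖y - x‖ + s) ^ (γ - a)))
    fun j _ => ?_).trans_eq (by rw [nsmul_eq_mul, Finset.card_univ]; ring)
  calc _ ≤ M * ‖y - x‖ ^ (γ - α j) * (A * s ^ α j) :=
        mul_le_mul_of_nonneg_right (hM j) (by positivity)
    _ = A * M * (‖y - x‖ ^ (γ - α j) * s ^ α j) := by ring
    _ ≤ _ := mul_le_mul_of_nonneg_left (rpow_mul_rpow_le hs (norm_nonneg _) (ha j) (hγ j))
        (by positivity)

theorem IsModel.isCoherent_germOf (hP : IsModel α r P Γ) (hf : IsModelled α Γ γ f) {a : ℝ}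
    (ha : ∀ j, a ≤ α j) : IsCoherent a γ r (germOf f P) := fun K hK S hS => by
  obtain ⟨A, hA0, hA⟩ := hP.exists_homAt hK hS
  obtain ⟨M, hM0, hM⟩ := hf.exists_modBd hK
  exact ⟨_, fun x hx y hy s hs φ hφ => hP.scaleBd_germOf_sub ha (fun j => (hf.lt j).le) hA0
    (fun j => hA j x hx) (fun j => (hM j x hx y hy).2) hM0 hs.1 hs.2 φ hφ⟩

theorem IsModel.isHomogeneous_germOf (hP : IsModel α r P Γ) (hf : IsModelled α Γ γ f) {a : ℝ}
    (ha : ∀ j, a ≤ α j) : IsHomogeneous a r (germOf f P) :=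
  isHomogeneous_of_homAt fun K hK S hS => by
    obtain ⟨A, hA0, hA⟩ := hP.exists_homAt hK hS
    obtain ⟨M, hM0, hM⟩ := hf.exists_modBd hK
    refine ⟨∑ i, M * (S ^ (α i - a) * A), fun x hx => HomAt.sum _ fun i _ =>
      (((hA i x hx).exponent hS (ha i)).smul (f x i)).mono ?_ le_rfl le_rfl⟩
    exact mul_le_mul_of_nonneg_right (hM i x hx x hx).1 (by positivity)

/-! ### Reconstructions -/

theorem one_le_rpow_mul_rpow_abs {s S : ℝ} (hs : 1 ≤ s) (hS : s ≤ S) (γ : ℝ) :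
    1 ≤ S ^ |γ| * s ^ γ :=
  calc (1 : ℝ) ≤ s ^ (|γ| + γ) := Real.one_le_rpow hs (by linarith [neg_abs_le γ])
    _ = s ^ |γ| * s ^ γ := Real.rpow_add (by linarith) _ _
    _ ≤ _ := mul_le_mul_of_nonneg_right (Real.rpow_le_rpow (by linarith) hS (abs_nonneg _))
      (by positivity)

/-- A bound on small scales between a germ and a distribution extends to all scales. -/
theorem exists_homAt_sub {a : ℝ} {F : Euc d → Distr d} {R : Distr d} (hF : IsHomogeneous a r F)
    (hR : ∀ K : Set (Euc d), IsCompact K → ∃ C : ℝ, ∀ x ∈ K, ∀ s ∈ Ioc (0 : ℝ) 1,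
      ∀ φ ∈ unitTests d r, |(F x - R) (rescale φ x s)| ≤ C * s ^ γ) :
    LocBdd r R ∧ ∀ K : Set (Euc d), IsCompact K → ∀ S : ℝ, 1 ≤ S →
      ∃ N, 0 ≤ N ∧ ∀ x ∈ K, HomAt r γ S (F x - R) x N := by
  -- At scale one R is the difference of F_x and F_x - R, both bounded uniformly over compact sets.
  have hRb : LocBdd r R := locBdd_of_scaleBd_one fun K hK => by
    obtain ⟨A, _, hA⟩ := hF.exists_homAt hK le_rfl
    obtain ⟨C, hC⟩ := hR K hK
    refine ⟨A * 1 ^ a + C * 1 ^ γ, fun x hx => ?_⟩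
    have h := (hA x hx 1 one_pos le_rfl).sub (F := F x) (G := F x - R) (B' := C * 1 ^ γ)
      fun φ hφ => hC x hx 1 ⟨one_pos, le_rfl⟩ φ hφ
    rwa [sub_sub_cancel] at h
  refine ⟨hRb, fun K hK S hS => ?_⟩
  obtain ⟨A, hA0, hA⟩ := hF.exists_homAt hK hS
  obtain ⟨C, hC⟩ := hR K hK
  obtain ⟨B, hB0, hB⟩ := hRb.scaleBd hK S
  have hN : 0 ≤ (A * S ^ |a| + B) * S ^ |γ| := by positivity
  refine ⟨|C| + (A * S ^ |a| + B) * S ^ |γ|, by positivity, fun x hx s hs hsS => ?_⟩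
  have hsγ := Real.rpow_nonneg hs.le γ
  -- For s between 1 and S all powers of s are comparable, so F_x and R may be bounded separately.
  rcases le_total s 1 with h1 | h1
  · intro φ hφ
    refine (hC x hx s ⟨hs, h1⟩ φ hφ).trans (mul_le_mul_of_nonneg_right ?_ hsγ)
    linarith [le_abs_self C]
  · refine ((hA x hx s hs hsS).sub (hB x hx s h1 hsS)).mono ?_ le_rfl
    have h2 : s ^ a ≤ S ^ |a| := (Real.rpow_le_rpow_of_exponent_le h1 (le_abs_self a)).trans
      (Real.rpow_le_rpow hs.le hsS (abs_nonneg _))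
    have h3 := one_le_rpow_mul_rpow_abs h1 hsS γ
    have h4 : A * s ^ a + B ≤ A * S ^ |a| + B := by gcongr
    have h5 : 0 ≤ A * S ^ |a| + B := by positivity
    calc _ ≤ (A * S ^ |a| + B) * (S ^ |γ| * s ^ γ) := by
          nlinarith [mul_le_mul_of_nonneg_left h3 h5]
      _ ≤ _ := by nlinarith [mul_nonneg (abs_nonneg C) hsγ]

theorem IsHomogeneous.mono_order {a : ℝ} {F : Euc d → Distr d} (hF : IsHomogeneous a r F) {r' : ℕ}
    (hr : r ≤ r') : IsHomogeneous a r' F := fun K hK S hS =>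
  let ⟨C, hC⟩ := hF K hK S hS
  ⟨C, fun x hx s hs φ hφ => hC x hx s hs φ (unitTests_mono hr hφ)⟩

/-- For positive exponents, the reconstruction bound is governed by the coherence constants. -/
theorem exists_reconstruction_const (d r : ℕ) {a γ : ℝ} (hγ : 0 < γ) (ha : a ≤ γ) :
    ∃ C, 0 ≤ C ∧ ∀ (F : Euc d → Distr d) (R : Distr d), IsHomogeneous a r F →
      IsReconstruction a γ F R → ∀ (K K' : Set (Euc d)) (S D : ℝ), IsCompact K' → 1 ≤ S → 0 ≤ D →
      (∀ x ∈ K, Metric.closedBall x (4 * (d + 1) * S) ⊆ K') →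
      (∀ x ∈ K', ∀ y ∈ K', ∀ s, 0 < s → s ≤ S →
        ScaleBd r (F y - F x) x s (D * (s ^ a * (‖y - x‖ + s) ^ (γ - a)))) →
      ∀ x ∈ K, HomAt r γ S (F x - R) x (C * D) := by
  -- The definition of a reconstruction speaks of orders above -a only, and the order of the germ
  -- need not be one. The bound is taken at a larger order and brought down to r by sewing.
  obtain ⟨r₁, hr₁⟩ := exists_nat_gt (-a)
  set q := max r r₁ with hq
  obtain ⟨C, hC0, hC⟩ := exists_sewing_const d r q hγ ha
  refine ⟨C, hC0, fun F R hF hR K K' S D hK' hS hD hKK hcoh x hx s hs hsS => ?_⟩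
  obtain ⟨N, hN0, hN⟩ := (exists_homAt_sub (hF.mono_order (le_max_left r r₁))
    (hR q (hr₁.trans_le (by exact_mod_cast le_max_right r r₁)))).2 K' hK' S hS
  exact hC F R K' S D N hD hN0 hcoh (fun x hx s hs hsS => hN x hx s hs hsS) x s hs hsS
    ((Metric.closedBall_subset_closedBall (by gcongr)).trans (hKK x hx))

end

theorem iInf_le_of_finite {J : Type*} [Finite J] (α : J → ℝ) (j : J) : ⨅ i, α i ≤ α j :=
  ciInf_le (Set.finite_range α).bddBelow j

/-- The reconstruction bound for modelled distributions, at all scales. -/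
theorem IsModel.exists_homAt_sub_reconstruction {d r rP : ℕ} {γ : ℝ} {J : Type*} [Fintype J]
    [Nonempty J] {α : J → ℝ} {P : J → Euc d → Distr d} {Γ : Euc d → Euc d → J → J → ℝ}
    {f : Euc d → J → ℝ} {R : Distr d} (hP : IsModel α rP P Γ) (hf : IsModelled α Γ γ f)
    (hR : IsReconstruction (⨅ i, α i) γ (germOf f P) R) (hr : rP ≤ r)
    (hγ : γ ≤ 0 → ∀ i, -α i < r) :
    LocBdd r R ∧ ∀ K : Set (Euc d), IsCompact K → ∀ S : ℝ, 1 ≤ S →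
      ∃ N, 0 ≤ N ∧ ∀ x ∈ K, HomAt r γ S (germOf f P x - R) x N := by
  obtain ⟨i₀, hi₀⟩ := exists_eq_ciInf_of_finite (f := α)
  have hle := iInf_le_of_finite α
  have hhom := hP.isHomogeneous_germOf hf hle
  -- For γ ≤ 0 the order r is admissible by assumption and the reconstruction bound is used
  -- directly. For γ > 0 the sewing bound gives the order of the model, which is at most r.
  rcases le_or_gt γ 0 with h0 | h0
  · exact exists_homAt_sub (hhom.mono_order hr) (hR r (by rw [← hi₀]; exact hγ h0 i₀))
  · obtain ⟨C, hC0, hC⟩ := exists_reconstruction_const d rP h0 (a := ⨅ i, α i)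
      (by rw [← hi₀]; exact (hf.lt i₀).le)
    have key : ∀ K : Set (Euc d), IsCompact K → ∀ S : ℝ, 1 ≤ S →
        ∃ N, 0 ≤ N ∧ ∀ x ∈ K, HomAt rP γ S (germOf f P x - R) x N := fun K hK S hS => by
      have hK' : IsCompact (Metric.cthickening (4 * (d + 1) * S) K) := hK.cthickening
      obtain ⟨A, hA0, hA⟩ := hP.exists_homAt hK' hS
      obtain ⟨M, hM0, hM⟩ := hf.exists_modBd hK'
      refine ⟨C * (Fintype.card J * (A * M)), by positivity,
        hC (germOf f P) R hhom hR K _ S _ hK' hS (by positivity)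
        (fun x hx => Metric.closedBall_subset_cthickening hx _)
        fun x hx y hy s hs hsS => hP.scaleBd_germOf_sub hle (fun j => (hf.lt j).le) hA0
          (fun j => hA j x hx) (fun j => (hM j x hx y hy).2) hM0 hs hsS⟩
    refine ⟨?_, fun K hK S hS => let ⟨N, hN0, hN⟩ := key K hK S hS
      ⟨N, hN0, fun x hx => (hN x hx).mono le_rfl hr le_rfl⟩⟩
    have h1 : LocBdd rP (germOf f P 0 - R) := HomAt.locBdd fun S hS =>
      let ⟨N, _, hN⟩ := key {0} isCompact_singleton S hS
      ⟨N, hN 0 rfl⟩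
    have h2 := ((hhom.locBdd 0).sub h1).mono hr
    rwa [sub_sub_cancel] at h2


/-! ### The lifted modelled distribution -/

-- Only the indices l ≥ k contribute to the re-expanded derivative of index k, and l - k runs over
-- the degrees below t - |k|.
open Classical in
theorem sum_poly_shift {d : ℕ} {t θ : ℝ} {k : Fin d → ℕ} (hθ : θ = t - deg k) (x y : Euc d)
    (g : (Fin d → ℕ) → ℝ) :
    ∑ l ∈ poly d t, polyΓ x y k l * g l = ∑ l ∈ poly d θ, nmon l (x - y) * g (l + k) := by
  have h1 : ∀ l, polyΓ x y k l * g l = if k ≤ l then nmon (l - k) (x - y) * g l else 0 := fun l => by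
    rw [polyΓ_eq]; split_ifs <;> simp
  simp only [h1]
  rw [← Finset.sum_filter]
  refine (Finset.sum_nbij' (fun l => l + k) (fun l => l - k) (fun l hl => ?_) (fun l hl => ?_)
    (fun l _ => ?_) (fun l hl => ?_) (fun l _ => ?_)).symm
  · rw [Finset.mem_filter, mem_poly, deg_add]
    rw [mem_poly] at hl
    push_cast
    exact ⟨by linarith, le_add_self⟩
  · rw [Finset.mem_filter, mem_poly] at hl
    rw [mem_poly]
    have h2 : (deg (l - k) : ℝ) + deg k = deg l := by
      rw [← Nat.cast_add, ← deg_add, tsub_add_cancel_of_le hl.2]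
    linarith [hl.1]
  · exact add_tsub_cancel_right l k
  · exact tsub_add_cancel_of_le (Finset.mem_filter.1 hl).2
  · rw [add_tsub_cancel_right]

/-- The constant in the estimate for the increments of a lifted modelled distribution. -/
def incConst (d m : ℕ) {J : Type*} [Fintype J] (α : J → ℝ) (β γ : ℝ) (k : Fin d → ℕ) : ℝ :=
  seriesConst ((below d (m - deg k)).disjSum (Finset.univ : Finset J))
    (Sum.elim (fun l => (deg l : ℝ)) fun j => γ - α j) (γ + β - deg k) (γ + β - deg k)
    (m - (γ + β))

/-- Here v and w come from ⟨f, Π⟩ - R based at x and at y, and u from Π_x. At scales below ‖y - x‖,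
∂^k v(x) is summed directly. Above it, v = w - ∑_j c_j u_j: w is expanded at y, giving terms of
exponent |l|, and the c_j u_j(x) are kept, with exponent γ - α_j. The target exponent is γ + β -
|k|, so the series subtracted are the Taylor polynomial with |l| + |k| < γ + β and the coefficients
with |k| < α_j + β. -/
theorem PotBd.abs_increment_le {d m r rP : ℕ} {β γ : ℝ} {J : Type*} [Fintype J] {α : J → ℝ}
    {u : J → ℕ → (Fin d → ℕ) → Euc d → ℝ} {v w : ℕ → (Fin d → ℕ) → Euc d → ℝ} {x y : Euc d}
    {A N B M : ℝ} {c : J → ℝ} {k : Fin d → ℕ} (hγβ : ∀ n : ℕ, γ + β ≠ n) (hm : γ + β < m)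
    (hu : ∀ j, PotBd m rP β (α j) 1 A (u j) x) (hv : PotBd m r β γ 1 N v x)
    (hw : PotBd m r β γ 1 N w y)
    (hvw : ∀ n k z, deg k ≤ m → v n k z = w n k z - ∑ j, c j * u j n k z) (hxy : 0 < ‖y - x‖)
    (hc : ∀ j, |c j| ≤ M * ‖y - x‖ ^ (γ - α j)) (hA : 0 ≤ A) (hM : 0 ≤ M) (hB : 0 ≤ B)
    (hcrit : ∀ j, (deg k : ℝ) = α j + β → ∀ L, |∑ n ∈ Finset.range L, u j n k x| ≤ B)
    (hk : (deg k : ℝ) < γ + β) :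
    |∑' n, v n k x - ∑ l ∈ poly d (γ + β), polyΓ x y k l * ∑' n, w n l y +
        ∑ j, (if (deg k : ℝ) < α j + β then c j * ∑' n, u j n k x else 0)| ≤
      incConst d m α β γ k *
        (((1 + (d : ℝ) ^ (m - deg k)) * N + M * (A + B)) * ‖y - x‖ ^ (γ + β - deg k)) := by
  have hN := hv.nonneg
  have hkm : deg k ≤ m := by exact_mod_cast (hk.trans hm).le
  have hq : ((m - deg k : ℕ) : ℝ) = m - deg k := Nat.cast_sub hkm
  set s := ‖y - x‖ with hs
  obtain ⟨L, hL1, hL2⟩ := exists_cut hxy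
  set V : (Fin d → ℕ) ⊕ J → ℕ → ℝ := Sum.elim (fun l n => nmon l (x - y) * w n (l + k) y)
    (fun j n => -(c j * u j n k x)) with hV
  have hsx : ‖x - y‖ = s := by rw [hs, norm_sub_rev]
  have hD0 : 0 ≤ (1 + (d : ℝ) ^ (m - deg k)) * N + M * (A + B) := by positivity
  have hD1 : N ≤ (1 + (d : ℝ) ^ (m - deg k)) * N + M * (A + B) := by
    nlinarith [mul_nonneg hM (add_nonneg hA hB), mul_nonneg (pow_nonneg (Nat.cast_nonneg d :
      (0 : ℝ) ≤ d) (m - deg k)) hN]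
  have hD2 : (d : ℝ) ^ (m - deg k) * N ≤ (1 + (d : ℝ) ^ (m - deg k)) * N + M * (A + B) := by
    nlinarith [mul_nonneg hM (add_nonneg hA hB)]
  have hD3 : M * A ≤ (1 + (d : ℝ) ^ (m - deg k)) * N + M * (A + B) := by
    have h1 : 0 ≤ (1 + (d : ℝ) ^ (m - deg k)) * N := by positivity
    nlinarith [mul_nonneg hM hB]
  have hD4 : M * B ≤ (1 + (d : ℝ) ^ (m - deg k)) * N + M * (A + B) := by
    have h1 : 0 ≤ (1 + (d : ℝ) ^ (m - deg k)) * N := by positivity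
    nlinarith [mul_nonneg hM hA]
  generalize (1 + (d : ℝ) ^ (m - deg k)) * N + M * (A + B) = D at hD0 hD1 hD2 hD3 hD4 ⊢
  have hsmall : ∀ n, |v n k x| ≤ N * eps n ^ (γ + β - deg k) := fun n =>
    hv.small n k x hkm (by rw [sub_self, norm_zero]; exact (eps_pos n).le)
  have key := abs_series_sub_le (w := fun n => v n k x) (V := V)
    ((below d (m - deg k)).disjSum (Finset.univ : Finset J))
    (Sum.elim (fun l => (deg l : ℝ)) fun j => γ - α j) (θ := γ + β - deg k)
    (t := γ + β - deg k) (t' := m - (γ + β)) (by linarith) (by linarith) hxy hL1 hL2 hD0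
    (hv.summable hkm hk).hasSum ?_ ?_ ?_ ?_
  · refine le_of_eq_of_le (congrArg _ ?_) key
    rw [Finset.sum_filter, Finset.sum_disjSum]
    simp only [Sum.elim_inl, Sum.elim_inr, hV]
    rw [sum_poly_ite (by rw [hq]; linarith), sum_poly_shift rfl]
    simp only [tsum_mul_left, tsum_neg]
    rw [← sub_sub, sub_eq_add_neg _ (∑ j, _), ← Finset.sum_neg_distrib]
    congr 1
    refine Finset.sum_congr rfl fun j _ => ?_
    by_cases hj : (deg k : ℝ) < α j + β
    · rw [if_pos hj, if_pos (by linarith), neg_neg]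
    · rw [if_neg hj, if_neg (by linarith), neg_zero]
  · intro n _
    rw [sub_self, Real.rpow_zero, mul_one]
    exact (hsmall n).trans (mul_le_mul_of_nonneg_right hD1 (Real.rpow_nonneg (eps_pos n).le _))
  · intro n hn
    have h1 := hw.abs_taylor_le n (hL1 n hn).le hsx.le (q := m - deg k) (k := k) (by omega)
    rw [Finset.sum_disjSum]
    simp only [hV, Sum.elim_inl, Sum.elim_inr, Finset.sum_neg_distrib]
    rw [hvw n k x hkm]
    have e1 : γ + β - ((deg k + (m - deg k) : ℕ) : ℝ) = -(m - (γ + β)) := by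
      rw [Nat.add_sub_cancel' hkm]; ring
    have e2 : γ + β - deg k + (m - (γ + β)) = ((m - deg k : ℕ) : ℝ) := by rw [hq]; ring
    rw [e1] at h1
    rw [e2, Real.rpow_natCast]
    refine le_trans (le_of_eq_of_le (congrArg _ (by ring)) h1) ?_
    calc _ = (d : ℝ) ^ (m - deg k) * N * (eps n ^ (-(m - (γ + β))) * s ^ (m - deg k)) := by ring
      _ ≤ _ := mul_le_mul_of_nonneg_right hD2
        (mul_nonneg (Real.rpow_nonneg (eps_pos n).le _) (by positivity))
  · intro i hi n
    have hen := Real.rpow_pos_of_pos (eps_pos n)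
    match i with
    | .inl l =>
      have hl : deg l < m - deg k := mem_below.1 (Finset.inl_mem_disjSum.1 hi)
      simp only [hV, Sum.elim_inl]
      have h1 := hw.small n (l + k) y (by rw [deg_add]; omega)
        (by rw [sub_self, norm_zero]; exact (eps_pos n).le)
      rw [deg_add, Nat.cast_add, show γ + β - ((deg l : ℝ) + deg k) = γ + β - deg k - deg l by ring]
        at h1
      rw [abs_mul, Real.rpow_natCast]
      calc _ ≤ s ^ deg l * (N * eps n ^ (γ + β - deg k - deg l)) :=
            mul_le_mul (by rw [← hsx]; exact abs_nmon_le _ _) h1 (abs_nonneg _) (by positivity)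
        _ = N * (eps n ^ (γ + β - deg k - deg l) * s ^ deg l) := by ring
        _ ≤ _ := mul_le_mul_of_nonneg_right hD1 (mul_nonneg (hen _).le (by positivity))
    | .inr j =>
      simp only [hV, Sum.elim_inr]
      have h1 := (hu j).small n k x hkm (by rw [sub_self, norm_zero]; exact (eps_pos n).le)
      rw [abs_neg, abs_mul, show γ + β - (deg k : ℝ) - (γ - α j) = α j + β - deg k by ring]
      calc _ ≤ M * s ^ (γ - α j) * (A * eps n ^ (α j + β - deg k)) :=
            mul_le_mul (hc j) h1 (abs_nonneg _) (by positivity)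
        _ = M * A * (eps n ^ (α j + β - deg k) * s ^ (γ - α j)) := by ring
        _ ≤ _ := mul_le_mul_of_nonneg_right hD3 (mul_nonneg (hen _).le (by positivity))
  -- A critical monomial would make γ + β = |l| + |k| an integer. The term of index j is critical
  -- when |k| = α_j + β, and then the partial sums are bounded by assumption.
  · intro i hi hei
    match i with
    | .inl l =>
      simp only [Sum.elim_inl] at hei
      exact absurd (by push_cast; linarith) (hγβ (deg l + deg k))
    | .inr j =>
      simp only [Sum.elim_inr] at hei
      simp only [hV, Sum.elim_inr]
      rw [Finset.sum_neg_distrib, abs_neg, ← Finset.mul_sum, abs_mul, ← hei]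
      calc _ ≤ M * s ^ (γ - α j) * B :=
            mul_le_mul (hc j) (hcrit j (by linarith) L) (abs_nonneg _) (by positivity)
        _ = M * B * s ^ (γ - α j) := by ring
        _ ≤ _ := mul_le_mul_of_nonneg_right hD4 (by positivity)

section

variable {d m r rP : ℕ} {β γ ρ : ℝ} {Ker : Euc d → Euc d → ℝ} {Kn : ℕ → Euc d → Euc d → ℝ}
  {I : Type*} [Fintype I] {α : I → ℝ} {P : I → Euc d → Distr d}
  {Γ : Euc d → Euc d → I → I → ℝ} {f : Euc d → I → ℝ} {R : Distr d}

theorem increment_hatf_inl (i : I) (x y : Euc d) :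
    increment (hatΓ r Kn α β γ P Γ) (hatf r Kn α β γ P f R) x y (.inl i) =
      increment Γ f x y i := by
  simp only [increment]
  rw [Fintype.sum_sum_type]
  simp [hatΓ, hatf]

/-- The contributions of the coefficients of the model at y, coming from the new Γ and from the new
f, cancel. What remains is a Taylor remainder for 𝖪(⟨f, Π⟩ - R) and the increments of f against the
coefficients at x. -/
theorem increment_hatf_inr (hγ : ∀ i, α i < γ) (k : {k : Fin d → ℕ // k ∈ poly d (γ + β)})
    (x y : Euc d) :
    increment (hatΓ r Kn α β γ P Γ) (hatf r Kn α β γ P f R) x y (.inr k) =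
      pointDeriv (γ + β) k.1 (kernelInt r Kn (germOf f P x - R)) x -
        ∑ l ∈ poly d (γ + β), polyΓ x y k.1 l *
          pointDeriv (γ + β) l (kernelInt r Kn (germOf f P y - R)) y +
        ∑ j, (if (deg k.1 : ℝ) < α j + β then
          increment Γ f x y j * coefK r Kn α β P j k.1 x else 0) := by
  set c := coefK r Kn α β P with hc
  set V := fun l z => pointDeriv (γ + β) l (kernelInt r Kn (germOf f P z - R)) z with hV
  simp only [increment]
  rw [sum_hatIndex _ (fun l => polyΓ x y k.1 l *
    ((∑ j, if (deg l : ℝ) < α j + β then f y j * c j l y else 0) - V l y)) fun l => rfl]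
  simp only [hatΓ, hatf, ← hc]
  have e1 : ∑ i, (∑ j, if (deg k.1 : ℝ) < α j + β then c j k.1 x * Γ x y j i else 0) * f y i =
      ∑ j, if (deg k.1 : ℝ) < α j + β then (∑ i, Γ x y j i * f y i) * c j k.1 x else 0 := by
    simp only [Finset.sum_mul]
    rw [Finset.sum_comm]
    refine Finset.sum_congr rfl fun j _ => ?_
    split_ifs
    · exact Finset.sum_congr rfl fun i _ => by ring
    · simp
  have e2 : ∑ i, (∑ l ∈ poly d (α i + β), polyΓ x y k.1 l * c i l y) * f y i =
      ∑ l ∈ poly d (γ + β), polyΓ x y k.1 l *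
        ∑ j, if (deg l : ℝ) < α j + β then f y j * c j l y else 0 := by
    simp only [Finset.mul_sum, Finset.sum_mul]
    rw [Finset.sum_comm]
    refine Finset.sum_congr rfl fun i _ => ?_
    rw [← sum_poly_ite (t := γ + β) (t' := α i + β) (by linarith [hγ i])]
    refine Finset.sum_congr rfl fun l _ => ?_
    split_ifs
    · ring
    · simp
  have e3 : ∑ j, (if (deg k.1 : ℝ) < α j + β then
      (∑ i, Γ x y j i * f y i - f x j) * c j k.1 x else 0) =
      (∑ j, if (deg k.1 : ℝ) < α j + β then (∑ i, Γ x y j i * f y i) * c j k.1 x else 0) -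
        ∑ j, if (deg k.1 : ℝ) < α j + β then f x j * c j k.1 x else 0 := by
    rw [← Finset.sum_sub_distrib]
    refine Finset.sum_congr rfl fun j _ => ?_
    split_ifs <;> ring
  rw [e3]
  simp only [sub_mul, mul_sub, Finset.sum_sub_distrib]
  rw [e1, e2]
  ring

end


/-! ### Explicit bounds for the lifted modelled distribution, and the germ it defines. -/

theorem PotBd.mono {d m r : ℕ} {β a S A A' : ℝ} {u : ℕ → (Fin d → ℕ) → Euc d → ℝ} {x : Euc d}
    (hu : PotBd m r β a S A u x) (hA : A ≤ A') : PotBd m r β a S A' u x where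
  jet := hu.jet
  small n k z hk hz := (hu.small n k z hk hz).trans
    (mul_le_mul_of_nonneg_right hA (Real.rpow_nonneg (eps_pos n).le _))
  large n s ψ M hM hs hns hsS hψ := (hu.large n s ψ M hM hs hns hsS hψ).trans (by
    have := Real.rpow_nonneg (eps_pos n).le β
    gcongr)

section

variable {d m r rP : ℕ} {β γ ρ : ℝ} {Ker : Euc d → Euc d → ℝ} {Kn : ℕ → Euc d → Euc d → ℝ}
  {I : Type*} [Fintype I] {α : I → ℝ} {P : I → Euc d → Distr d}
  {Γ : Euc d → Euc d → I → I → ℝ} {f : Euc d → I → ℝ} {R : Distr d}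

theorem IsModel.locBdd_germOf (hP : IsModel α rP P Γ) (hr : rP ≤ r) (x : Euc d) :
    LocBdd r (germOf f P x) := LocBdd.sum _ fun i _ => (hP.locBdd hr i x).smul _

theorem IsModel.pot_germOf_sub (hK : IsRegularisingKernel β m r ρ Ker Kn)
    (hP : IsModel α rP P Γ) (hr : rP ≤ r) (hR : LocBdd r R) (x y : Euc d) (n : ℕ)
    {k : Fin d → ℕ} (hk : deg k ≤ m) (z : Euc d) :
    pot r (germOf f P x - R) (Kn n) k z = pot r (germOf f P y - R) (Kn n) k z -
      ∑ j, increment Γ f x y j * pot r (P j x) (Kn n) k z := by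
  have hc := (hK.regular n).contDiff_mixedDeriv hk z
  have hs := (hK.regular n).hasCompactSupport_mixedDeriv (hK.support n) hk z
  have e : germOf f P x - R = (germOf f P y - R) - ∑ j, increment Γ f x y j • P j x := by
    rw [← hP.germOf_sub x y]; abel
  have h1 : ∀ j ∈ Finset.univ, LocBdd r (increment Γ f x y j • P j x) :=
    fun j _ => (hP.locBdd hr j x).smul _
  simp only [pot_eq]
  rw [e, LocBdd.ext_sub_left ((hP.locBdd_germOf hr y).sub hR) (LocBdd.sum _ h1) hc hs,
    LocBdd.ext_sum_left _ h1 hc hs]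
  congr 1
  exact Finset.sum_congr rfl fun j _ => (hP.locBdd hr j x).ext_smul_left _ hc hs

theorem incConst_nonneg (d m : ℕ) (α : I → ℝ) (β γ : ℝ) (k : Fin d → ℕ) :
    0 ≤ incConst d m α β γ k := seriesConst_nonneg _ _ _ _ _

/-- In the constant, `U` collects the bounds on the values of the new coefficients, as convergent
series of potentials, and `W` the bounds on their increments. The constant is the same for all
models, f and R, because A, B, M and N carry all the dependence on them. -/
theorem IsRegularisingKernel.exists_hatf_const (hK : IsRegularisingKernel β m r ρ Ker Kn)
    (hr : rP ≤ r) (hγ : ∀ i, α i < γ) (hγβ : ∀ n : ℕ, γ + β ≠ n) (hm : γ + β < m)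
    {K : Set (Euc d)} (hKc : IsCompact K) :
    ∃ C, 0 ≤ C ∧ ∀ (P : I → Euc d → Distr d) (Γ : Euc d → Euc d → I → I → ℝ) (f : Euc d → I → ℝ)
      (R : Distr d) (A B M N : ℝ), IsModel α rP P Γ → LocBdd r R → 0 ≤ A → 0 ≤ B → 0 ≤ M → 0 ≤ N →
      (∀ i, ∀ x ∈ K, HomAt rP (α i) (2 * ((1 + ρ) * 1)) (P i x) x A) →
      (∀ i, ∀ x ∈ K, CritBd r Kn (α i + β) (P i x) x B) →
      (∀ x ∈ K, HomAt r γ (2 * ((1 + ρ) * 1)) (germOf f P x - R) x N) →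
      ModBd α Γ γ K f M →
      ModBd (hatα d α β γ) (hatΓ r Kn α β γ P Γ) (γ + β) K (hatf r Kn α β γ P f R)
        (C * ((1 + A + B) * M + N)) := by
  have hm' : ∀ i, α i + β < m := fun i => by linarith [hγ i]
  choose C₁ hC₁0 hC₁ using fun i => hK.exists_potBd hr hKc le_rfl (α i)
  obtain ⟨C₂, hC₂0, hC₂⟩ := hK.exists_potBd le_rfl hKc le_rfl γ
  choose C₃ hC₃0 hC₃ using fun i => hK.exists_critical_const hr hKc le_rfl (hm' i)
  set E₁ := ∑ i, C₁ i with hE₁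
  set E₃ := ∑ i, C₃ i with hE₃
  have hE₁0 : 0 ≤ E₁ := Finset.sum_nonneg fun i _ => (hC₁0 i).le
  have hE₃0 : 0 ≤ E₃ := Finset.sum_nonneg fun i _ => hC₃0 i
  set W : (Fin d → ℕ) → ℝ := fun k => incConst d m α β γ k *
    ((1 + (d : ℝ) ^ (m - deg k)) * C₂ + E₁ + E₃) with hW
  set U : (Fin d → ℕ) → ℝ := fun k => (∑ j, epsSum (α j + β - deg k)) * E₁ +
    epsSum (γ + β - deg k) * C₂ with hU
  have hW0 : ∀ k, 0 ≤ W k := fun k => mul_nonneg (incConst_nonneg _ _ _ _ _ _) (by positivity)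
  have hU0 : ∀ k, 0 ≤ U k := fun k => add_nonneg
    (mul_nonneg (Finset.sum_nonneg fun j _ => epsSum_nonneg _) hE₁0)
    (mul_nonneg (epsSum_nonneg _) hC₂0.le)
  have hWU : ∀ k ∈ poly d (γ + β), W k + U k ≤ ∑ k ∈ poly d (γ + β), (W k + U k) := fun k hk =>
    Finset.single_le_sum (f := fun k => W k + U k) (fun k _ => add_nonneg (hW0 k) (hU0 k)) hk
  have hWU0 : 0 ≤ ∑ k ∈ poly d (γ + β), (W k + U k) :=
    Finset.sum_nonneg fun k _ => add_nonneg (hW0 k) (hU0 k)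
  refine ⟨1 + ∑ k ∈ poly d (γ + β), (W k + U k), by positivity,
    fun P Γ f R A B M N hP hR hA0 hB0 hM0 hN0 hA hB hN hM => ?_⟩
  set Z := (1 + A + B) * M + N with hZ
  have hAM := mul_nonneg hA0 hM0
  have hBM := mul_nonneg hB0 hM0
  have hZM : M ≤ Z := by rw [hZ]; nlinarith
  have hZA : M * A ≤ Z := by rw [hZ]; nlinarith
  have hZB : M * (A + B) ≤ Z := by rw [hZ]; nlinarith
  have hZN : N ≤ Z := by rw [hZ]; nlinarith
  have hZ0 : 0 ≤ Z := hM0.trans hZM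
  have hG : ∀ x, LocBdd r (germOf f P x - R) := fun x => (hP.locBdd_germOf hr x).sub hR
  have hpot : ∀ j, ∀ x ∈ K, PotBd m rP β (α j) 1 (E₁ * A) (fun n => pot r (P j x) (Kn n)) x :=
    fun j x hx => (hC₁ j x hx (P j x) A (hP.locBdd hr j x) hA0 (hA j x hx)).mono
      (mul_le_mul_of_nonneg_right
        (Finset.single_le_sum (fun j _ => (hC₁0 j).le) (Finset.mem_univ j)) hA0)
  have hpotG : ∀ x ∈ K, PotBd m r β γ 1 (C₂ * N) (fun n => pot r (germOf f P x - R) (Kn n)) x :=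
    fun x hx => hC₂ x hx _ N (hG x) hN0 (hN x hx)
  have hV : ∀ x ∈ K, ∀ k : Fin d → ℕ, (deg k : ℝ) < γ + β →
      pointDeriv (γ + β) k (kernelInt r Kn (germOf f P x - R)) x =
        taylorCoef r Kn (germOf f P x - R) k x := fun x hx k hk =>
    ((hN x hx).hasPointDeriv_kernelInt hK le_rfl (hG x) (by exact_mod_cast (hk.trans hm).le) hk
      _).pointDeriv_eq
  intro a x hx y hy
  match a with
  | .inl i =>
    rw [increment_hatf_inl]
    have h1 : M ≤ (1 + ∑ k ∈ poly d (γ + β), (W k + U k)) * Z := by nlinarith [mul_nonneg hWU0 hZ0]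
    refine ⟨(hM i x hx y hy).1.trans h1, (hM i x hx y hy).2.trans ?_⟩
    simp only [hatα]
    rw [show γ + β - (α i + β) = γ - α i by ring]
    gcongr
  | .inr k =>
    have hk := mem_poly.1 k.2
    have hkm : deg k.1 ≤ m := by exact_mod_cast (hk.trans hm).le
    have hCk := hWU k.1 k.2
    constructor
    · simp only [hatf]
      rw [hV x hx k.1 hk]
      have h1 : |∑ j, if (deg k.1 : ℝ) < α j + β then f x j * coefK r Kn α β P j k.1 x else 0| ≤
          ∑ j, epsSum (α j + β - deg k.1) * (E₁ * Z) := by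
        refine (Finset.abs_sum_le_sum_abs _ _).trans (Finset.sum_le_sum fun j _ => ?_)
        split_ifs with hj
        · rw [(hP.coefK_eq hK hr hm' j hj x).2, abs_mul]
          have h2 := abs_taylorCoef_le_of_potBd (hpot j x hx) hkm hj
          calc _ ≤ M * (epsSum (α j + β - deg k.1) * (E₁ * A)) :=
                mul_le_mul (hM j x hx x hx).1 h2 (abs_nonneg _) hM0
            _ = epsSum (α j + β - deg k.1) * (E₁ * (M * A)) := by ring
            _ ≤ _ := mul_le_mul_of_nonneg_left (mul_le_mul_of_nonneg_left hZA hE₁0)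
                (epsSum_nonneg _)
        · rw [abs_zero]
          exact mul_nonneg (epsSum_nonneg _) (mul_nonneg hE₁0 hZ0)
      have h2 := abs_taylorCoef_le_of_potBd (hpotG x hx) hkm hk
      have h3 : epsSum (γ + β - deg k.1) * (C₂ * N) ≤ epsSum (γ + β - deg k.1) * (C₂ * Z) :=
        mul_le_mul_of_nonneg_left (mul_le_mul_of_nonneg_left hZN hC₂0.le) (epsSum_nonneg _)
      rw [← Finset.sum_mul] at h1
      refine (abs_sub _ _).trans ?_
      calc _ ≤ U k.1 * Z := by simp only [hU]; linarith
        _ ≤ _ := mul_le_mul_of_nonneg_right (by linarith [hW0 k.1]) hZ0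
    · rw [increment_hatf_inr hγ]
      simp only [hatα]
      -- The cut at scale ‖y - x‖ needs y ≠ x. On the diagonal the polynomial re-expansion is the
      -- identity and the increments of f vanish, so everything cancels exactly.
      rcases (norm_nonneg (y - x)).eq_or_lt with h0 | h0
      · have hyx : y = x := sub_eq_zero.1 (norm_eq_zero.1 h0.symm)
        subst hyx
        have hinc : ∀ j, increment Γ f y y j = 0 := fun j => by
          have := (hM j y hy y hy).2
          rw [← h0, Real.zero_rpow (by linarith [hγ j]), mul_zero] at this
          exact abs_nonpos_iff.1 this
        have e : ∑ l ∈ poly d (γ + β), polyΓ y y k.1 l *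
            pointDeriv (γ + β) l (kernelInt r Kn (germOf f P y - R)) y =
            pointDeriv (γ + β) k.1 (kernelInt r Kn (germOf f P y - R)) y := by
          rw [Finset.sum_eq_single_of_mem k.1 k.2 fun l _ hl => by
            rw [polyΓ_self_left, if_neg hl.symm, zero_mul]]
          rw [polyΓ_self_left, if_pos rfl, one_mul]
        simp only [hinc, zero_mul, ite_self, Finset.sum_const_zero, e, sub_self, add_zero, abs_zero]
        positivity
      · have h1 := PotBd.abs_increment_le (c := increment Γ f x y) (B := E₃ * (A + B)) (M := M)
          hγβ hm (fun j => hpot j x hx) (hpotG x hx) (hpotG y hy)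
          (fun n k z hk => hP.pot_germOf_sub hK hr hR x y n hk z) h0
          (fun j => (hM j x hx y hy).2) (mul_nonneg hE₁0 hA0) hM0 (by positivity)
          (fun j hj L => (hC₃ j x hx (P j x) A B (hP.locBdd hr j x) (hA j x hx) (hB j x hx) k.1 hj
            L).trans (mul_le_mul_of_nonneg_right
              (Finset.single_le_sum (fun j _ => hC₃0 j) (Finset.mem_univ j)) (by positivity))) hk
        have e1 : ∑ l ∈ poly d (γ + β), polyΓ x y k.1 l *
            pointDeriv (γ + β) l (kernelInt r Kn (germOf f P y - R)) y =
            ∑ l ∈ poly d (γ + β), polyΓ x y k.1 l * taylorCoef r Kn (germOf f P y - R) l y :=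
          Finset.sum_congr rfl fun l hl => by rw [hV y hy l (mem_poly.1 hl)]
        have e2 : ∑ j, (if (deg k.1 : ℝ) < α j + β then
            increment Γ f x y j * coefK r Kn α β P j k.1 x else 0) =
            ∑ j, (if (deg k.1 : ℝ) < α j + β then
              increment Γ f x y j * taylorCoef r Kn (P j x) k.1 x else 0) :=
          Finset.sum_congr rfl fun j _ => by
            split_ifs with hj
            · rw [(hP.coefK_eq hK hr hm' j hj x).2]
            · rfl
        rw [e1, e2, hV x hx k.1 hk]
        refine le_trans h1 ?_
        rw [← mul_assoc]
        refine mul_le_mul_of_nonneg_right ?_ (by positivity)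
        have h2 : (1 + (d : ℝ) ^ (m - deg k.1)) * (C₂ * N) + M * (E₁ * A + E₃ * (A + B)) ≤
            ((1 + (d : ℝ) ^ (m - deg k.1)) * C₂ + E₁ + E₃) * Z := by
          have h3 : 0 ≤ (1 + (d : ℝ) ^ (m - deg k.1)) * C₂ := by positivity
          have h4 := mul_le_mul_of_nonneg_left hZN h3
          have h5 := mul_le_mul_of_nonneg_left hZA hE₁0
          have h6 := mul_le_mul_of_nonneg_left hZB hE₃0
          linarith
        calc _ ≤ incConst d m α β γ k.1 * (((1 + (d : ℝ) ^ (m - deg k.1)) * C₂ + E₁ + E₃) * Z) :=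
              mul_le_mul_of_nonneg_left h2 (incConst_nonneg _ _ _ _ _ _)
          _ = W k.1 * Z := by simp only [hW]; ring
          _ ≤ _ := mul_le_mul_of_nonneg_right (by linarith [hU0 k.1]) hZ0

/-- The lift of a modelled distribution is the germ obtained by integration of its germ. -/
theorem IsModel.germOf_hatf (hK : IsRegularisingKernel β m r ρ Ker Kn) (hP : IsModel α rP P Γ)
    (hr : rP ≤ r) (hγ : ∀ i, α i < γ) :
    germOf (hatf r Kn α β γ P f R) (hatP r Kn α β γ P) = liftK r Kn β γ (germOf f P) R := by
  funext x
  set c := coefK r Kn α β P with hc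
  set V := fun l => pointDeriv (γ + β) l (kernelInt r Kn (germOf f P x - R)) x with hV
  simp only [germOf, liftK]
  rw [sum_hatIndex _ (fun k => ((∑ j, if (deg k : ℝ) < α j + β then f x j * c j k x else 0) -
    V k) • monomial k x) fun k => rfl]
  simp only [hatf, hatP, ← hc]
  have e1 : kernelInt r Kn (∑ i, f x i • P i x) = ∑ i, f x i • kernelInt r Kn (P i x) := by
    rw [kernelInt_sum hK _ fun i _ => (hP.locBdd hr i x).smul _]
    exact Finset.sum_congr rfl fun i _ => kernelInt_smul hK (hP.locBdd hr i x) _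
  have e2 : ∑ k ∈ poly d (γ + β), (∑ j, if (deg k : ℝ) < α j + β then f x j * c j k x else 0) •
      monomial k x = ∑ i, f x i • ∑ k ∈ poly d (α i + β), c i k x • monomial k x := by
    simp only [Finset.sum_smul]
    rw [Finset.sum_comm]
    refine Finset.sum_congr rfl fun j _ => ?_
    rw [← sum_poly_ite (t := γ + β) (t' := α j + β) (by linarith [hγ j]), Finset.smul_sum]
    refine Finset.sum_congr rfl fun l _ => ?_
    split_ifs
    · rw [smul_smul]
    · rw [zero_smul, smul_zero]
  simp only [sub_smul, smul_sub, Finset.sum_sub_distrib]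
  rw [e1, e2]
  simp only [hV, germOf]
  abel

end


/-! ### Reconstruction of lifted modelled distributions -/

theorem IsCoherent.mono_order {d r : ℕ} {a γ : ℝ} {F : Euc d → Distr d} (hF : IsCoherent a γ r F)
    {r' : ℕ} (hr : r ≤ r') : IsCoherent a γ r' F := fun K hK S hS =>
  let ⟨C, hC⟩ := hF K hK S hS
  ⟨C, fun x hx y hy s hs φ hφ => hC x hx y hy s hs φ (unitTests_mono hr hφ)⟩

/-- Reconstruction bounds of one order imply those of all admissible orders. -/
theorem isReconstruction_of_order {d r : ℕ} {a γ : ℝ} {F : Euc d → Distr d} {R : Distr d}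
    (ha : a ≤ γ) (hF : IsCoherent a γ r F)
    (hR : ∀ K : Set (Euc d), IsCompact K → ∀ S : ℝ, 1 ≤ S →
      ∃ N, 0 ≤ N ∧ ∀ x ∈ K, HomAt r γ S (F x - R) x N) : IsReconstruction a γ F R := by
  intro r' hr' K hK
  rcases le_or_gt r r' with hrr | hrr
  · obtain ⟨N, _, hN⟩ := hR K hK 1 le_rfl
    exact ⟨N, fun x hx s hs φ hφ => hN x hx s hs.1 hs.2 φ (unitTests_mono hrr hφ)⟩
  set σ : ℝ := 8 * (d + 1) with hσ
  have hσ0 : 0 ≤ σ := by positivity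
  have hga : 0 ≤ γ - a := by linarith
  -- Rebasing at scale κs costs at most κ^a, which may be large; the order reduction then needs r' +
  -- a > 0, which is precisely the range of admissible orders.
  obtain ⟨κ, C, hκ0, hκ1, hC0, hC⟩ := exists_orderReduction_const d hrr.le (e := a) (by linarith)
    (C₁ := 2 * (σ + 1) ^ (γ - a)) (by positivity)
  have hK' : IsCompact (Metric.cthickening σ K) := hK.cthickening
  -- The order reduction starts from bounds at twice the scale, so scales up to 2 are needed.
  obtain ⟨N, hN0, hN⟩ := hR _ hK' 2 one_le_two
  obtain ⟨B, hB⟩ := hF _ hK' 2 one_le_two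
  set D := 2 ^ γ * N + 2 * (2 ^ γ * |B|) with hD
  have h2γ : (0 : ℝ) < 2 ^ γ := by positivity
  have hD0 : 0 ≤ D := by positivity
  have hcoh : ∀ x ∈ Metric.cthickening σ K, ∀ y ∈ Metric.cthickening σ K, ∀ s, 0 < s → s ≤ 1 →
      ∀ t, ‖y - x‖ ≤ t →
      ScaleBd r (F y - F x) x (2 * s) (2 ^ γ * |B| * (s ^ a * (t + s) ^ (γ - a))) := by
    intro x hx y hy s hs hs1 t ht φ hφ
    refine (hB x hx y hy (2 * s) ⟨by positivity, by linarith⟩ φ hφ).trans ?_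
    have h1 : (‖y - x‖ + 2 * s) ^ (γ - a) ≤ 2 ^ (γ - a) * (t + s) ^ (γ - a) := by
      rw [← Real.mul_rpow zero_le_two (by linarith [norm_nonneg (y - x)])]
      exact Real.rpow_le_rpow (by positivity) (by linarith [norm_nonneg (y - x)]) hga
    have h2 : (2 * s) ^ a = 2 ^ a * s ^ a := Real.mul_rpow zero_le_two hs.le
    have h3 : (2 : ℝ) ^ γ = 2 ^ a * 2 ^ (γ - a) := by
      rw [← Real.rpow_add two_pos]; congr 1; ring
    calc B * ((2 * s) ^ a * (‖y - x‖ + 2 * s) ^ (γ - a))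
        ≤ |B| * ((2 * s) ^ a * (‖y - x‖ + 2 * s) ^ (γ - a)) :=
          mul_le_mul_of_nonneg_right (le_abs_self B) (by positivity)
      _ ≤ |B| * ((2 * s) ^ a * (2 ^ (γ - a) * (t + s) ^ (γ - a))) :=
          mul_le_mul_of_nonneg_left (mul_le_mul_of_nonneg_left h1 (by positivity)) (abs_nonneg B)
      _ = _ := by rw [h2, h3]; ring
  -- The family must be stable under rebasing. F_x - R splits into F_x - F_p and F_p - R; a
  -- difference F_y - F_z stays as it is, its weight recording the distances of y and z from the
  -- current centre. The condition on balls keeps all later centres in one compact set.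
  have main := hC (fun x s H w => 0 < s ∧ s ≤ 1 ∧
    Metric.closedBall x (σ * s) ⊆ Metric.cthickening σ K ∧
    ((H = F x - R ∧ w = D * s ^ γ) ∨ ∃ y ∈ Metric.cthickening σ K, ∃ z ∈ Metric.cthickening σ K,
      H = F y - F z ∧ w = D * (s ^ a * (‖y - x‖ + ‖z - x‖ + s) ^ (γ - a)))) ?_ ?_
  · refine ⟨C * D, fun x hx s hs φ hφ => ?_⟩
    have := main x s (F x - R) (D * s ^ γ) ⟨hs.1, hs.2,
      (Metric.closedBall_subset_closedBall (by nlinarith [hs.2])).trans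
        (Metric.closedBall_subset_cthickening hx σ), Or.inl ⟨rfl, rfl⟩⟩ φ hφ
    rwa [← mul_assoc] at this
  · rintro x s H w ⟨hs, hs1, hball, h⟩
    have hx : x ∈ Metric.cthickening σ K := hball (Metric.mem_closedBall_self (by positivity))
    rcases h with ⟨rfl, rfl⟩ | ⟨y, hy, z, hz, rfl, rfl⟩
    · refine ⟨hs, by positivity, (hN x hx (2 * s) (by positivity) (by linarith)).mono ?_ le_rfl⟩
      rw [Real.mul_rpow zero_le_two hs.le, ← mul_assoc]
      refine mul_le_mul_of_nonneg_right ?_ (by positivity)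
      have : 0 ≤ 2 * (2 ^ γ * |B|) := by positivity
      linarith
    · refine ⟨hs, by positivity, ?_⟩
      have h1 := hcoh x hx y hy s hs hs1 (‖y - x‖ + ‖z - x‖) (by linarith [norm_nonneg (z - x)])
      have h2 := hcoh x hx z hz s hs hs1 (‖y - x‖ + ‖z - x‖) (by linarith [norm_nonneg (y - x)])
      have h3 := h1.sub h2
      rw [sub_sub_sub_cancel_right] at h3
      refine h3.mono ?_ le_rfl
      rw [← two_mul, ← mul_assoc]
      refine mul_le_mul_of_nonneg_right ?_ (by positivity)
      have : 0 ≤ 2 ^ γ * N := by positivity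
      linarith
  · rintro x s H w ⟨hs, hs1, hball, h⟩ p hp
    have hκs : 0 < κ * s := by positivity
    have hκs1 : κ * s ≤ s / 2 := by nlinarith
    have hp' : ‖p - x‖ ≤ σ / 2 * s := by rw [hσ]; linarith
    have hx : x ∈ Metric.cthickening σ K := hball (Metric.mem_closedBall_self (by positivity))
    have hpball : Metric.closedBall p (σ * (κ * s)) ⊆ Metric.cthickening σ K := by
      refine (Metric.closedBall_subset_closedBall' ?_).trans hball
      rw [dist_eq_norm]
      nlinarith
    have hpK : p ∈ Metric.cthickening σ K := hpball (Metric.mem_closedBall_self (by positivity))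
    have hbase : κ * s ≤ s := by linarith
    have hpow : (κ * s) ^ a = κ ^ a * s ^ a := Real.mul_rpow hκ0.le hs.le
    have hone : ∀ t, 0 ≤ t → ∀ t', 0 ≤ t' → t' ≤ t + σ * s →
        D * ((κ * s) ^ a * (t' + κ * s) ^ (γ - a)) ≤
          (σ + 1) ^ (γ - a) * κ ^ a * (D * (s ^ a * (t + s) ^ (γ - a))) := by
      intro t ht t' ht' htt
      have h1 : (t' + κ * s) ^ (γ - a) ≤ (σ + 1) ^ (γ - a) * (t + s) ^ (γ - a) := by
        rw [← Real.mul_rpow (by positivity) (by positivity)]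
        refine Real.rpow_le_rpow (by positivity) ?_ hga
        nlinarith [mul_nonneg hσ0 ht]
      rw [hpow]
      calc _ ≤ D * (κ ^ a * s ^ a * ((σ + 1) ^ (γ - a) * (t + s) ^ (γ - a))) :=
            mul_le_mul_of_nonneg_left (mul_le_mul_of_nonneg_left h1 (by positivity)) hD0
        _ = _ := by ring
    have hsγ : s ^ γ = s ^ a * (0 + s) ^ (γ - a) := by
      rw [zero_add, ← Real.rpow_add hs]; congr 1; ring
    have hκγ : (κ * s) ^ γ = (κ * s) ^ a * (0 + κ * s) ^ (γ - a) := by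
      rw [zero_add, ← Real.rpow_add hκs]; congr 1; ring
    rcases h with ⟨rfl, rfl⟩ | ⟨y, hy, z, hz, rfl, rfl⟩
    · refine ⟨F x - F p, _, F p - R, _, by abel, ⟨hκs, by linarith, hpball,
        Or.inr ⟨x, hx, p, hpK, rfl, rfl⟩⟩, ⟨hκs, by linarith, hpball, Or.inl ⟨rfl, rfl⟩⟩, ?_⟩
      have h1 := hone 0 le_rfl (‖x - p‖ + ‖p - p‖) (by positivity) (by
        rw [sub_self, norm_zero, norm_sub_rev]; nlinarith)
      have h2 := hone 0 le_rfl 0 le_rfl (by positivity)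
      rw [hsγ, hκγ]
      linarith
    · refine ⟨F y - F z, _, F p - F p, _, by abel, ⟨hκs, by linarith, hpball,
        Or.inr ⟨y, hy, z, hz, rfl, rfl⟩⟩, ⟨hκs, by linarith, hpball,
        Or.inr ⟨p, hpK, p, hpK, rfl, rfl⟩⟩, ?_⟩
      have hny := norm_sub_le_norm_sub_add_norm_sub y x p
      have hnz := norm_sub_le_norm_sub_add_norm_sub z x p
      rw [norm_sub_rev x p] at hny hnz
      have h1 := hone (‖y - x‖ + ‖z - x‖) (by positivity) (‖y - p‖ + ‖z - p‖) (by positivity)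
        (by linarith)
      have h2 := hone (‖y - x‖ + ‖z - x‖) (by positivity) (‖p - p‖ + ‖p - p‖) (by positivity)
        (by rw [sub_self, norm_zero, add_zero]; positivity)
      linarith

/-- Reconstructions for positive exponents are unique. -/
theorem IsReconstruction.unique {d r : ℕ} {a γ : ℝ} {F : Euc d → Distr d} {R T : Distr d}
    (hγ : 0 < γ) (ha : a ≤ γ) (hF : IsHomogeneous a r F) (hR : IsReconstruction a γ F R)
    (hT : IsReconstruction a γ F T) : T = R := by
  obtain ⟨r₁, hr₁⟩ := exists_nat_gt (-a)
  set q := max r r₁ with hq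
  have hq1 : -a < q := hr₁.trans_le (by exact_mod_cast le_max_right r r₁)
  have hFq := hF.mono_order (le_max_left r r₁)
  -- The difference of two reconstructions reconstructs the zero germ, whose coherence constant is
  -- 0. The sewing bound, which does not see the reconstruction constants, then forces the
  -- difference to vanish at every point and scale.
  obtain ⟨C, hC0, hC⟩ := exists_sewing_const d 0 q hγ ha
  have hzero : ∀ x S, 1 ≤ S → ScaleBd 0 (R - T) x S 0 := fun x S hS => by
    have hK : IsCompact (Metric.closedBall x (4 * (d + 1) * S)) := isCompact_closedBall _ _
    obtain ⟨N, hN0, hN⟩ := (exists_homAt_sub hFq (hR q hq1)).2 _ hK S hS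
    obtain ⟨N', hN'0, hN'⟩ := (exists_homAt_sub hFq (hT q hq1)).2 _ hK S hS
    have h := hC (fun _ => 0) (T - R) _ S 0 (N + N') le_rfl (by positivity)
      (fun x _ y _ s _ _ φ _ => by simp) (fun y hy s hs hsS => by
        have h1 := (hN y hy s hs hsS).sub (hN' y hy s hs hsS)
        rw [sub_sub_sub_cancel_left] at h1
        rw [zero_sub, neg_sub]
        have e : R - T = -1 • (T - R) := by simp
        intro φ hφ
        have h2 := h1 φ hφ
        rw [sub_apply, abs_sub_comm, ← sub_apply] at h2
        linarith) x S (by linarith) le_rfl subset_rfl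
    simpa using h
  ext ψ
  obtain ⟨s, hs, hψ⟩ := exists_zero_of_hasCompactSupport ψ.hasCompactSupport (0 : Euc d)
  obtain ⟨M, hM0, hM⟩ := exists_bound_partialDeriv ψ 0
  have hcr : CrBd 0 ψ 0 (max s 1) (M * (max s 1) ^ (d + 0)) :=
    CrBd.of_bound (contDiff_nat_of_test ψ 0) (fun z hz => hψ z ((le_max_left _ _).trans_lt hz))
      (le_max_right _ _) hM0 hM
  have h := (hzero 0 (max s 1) (le_max_right _ _)).test_le (by positivity) (by positivity) hcr
  rw [mul_zero] at h
  have := abs_nonpos_iff.1 h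
  rw [sub_apply] at this
  linarith

section

variable {d m r rP : ℕ} {β γ ρ : ℝ} {Ker : Euc d → Euc d → ℝ} {Kn : ℕ → Euc d → Euc d → ℝ}
  {I : Type*} [Fintype I] {α : I → ℝ} {P : I → Euc d → Distr d}
  {Γ : Euc d → Euc d → I → I → ℝ} {f : Euc d → I → ℝ} {R : Distr d}

/-- The terms 𝖪F_x cancel: the lifted germ minus 𝖪R is 𝖪(F_x - R) minus its Taylor polynomial, to
which the Schauder estimate with exponent γ applies. -/
theorem exists_homAt_liftK_sub (hK : IsRegularisingKernel β m r ρ Ker Kn)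
    (hγβ : ∀ n : ℕ, γ + β ≠ n) (hm : γ + β < m) {F : Euc d → Distr d}
    (hF : ∀ x, LocBdd r (F x)) (hR : LocBdd r R)
    (hG : ∀ K : Set (Euc d), IsCompact K → ∀ S : ℝ, 1 ≤ S →
      ∃ N, 0 ≤ N ∧ ∀ x ∈ K, HomAt r γ S (F x - R) x N)
    {K : Set (Euc d)} (hKc : IsCompact K) {S : ℝ} (hS : 1 ≤ S) :
    ∃ N, 0 ≤ N ∧ ∀ x ∈ K, HomAt r (γ + β) S (liftK r Kn β γ F R x - kernelInt r Kn R) x N := by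
  have hρ := hK.range_pos
  obtain ⟨C, hC0, hC⟩ := hK.exists_lift_const le_rfl hKc hS hm
  obtain ⟨N, hN0, hN⟩ := hG K hKc (2 * ((1 + ρ) * S)) (by nlinarith)
  refine ⟨C * (N + 0), by positivity, fun x hx => ?_⟩
  have h := hC x hx _ N 0 ((hF x).sub hR) (hN x hx)
    -- There is no critical index, as γ + β is not an integer, so the critical bound is 0.
    ⟨le_rfl, fun k hk => absurd hk.symm (hγβ (deg k))⟩
  have e : liftK r Kn β γ F R x - kernelInt r Kn R = kernelInt r Kn (F x - R) -
      ∑ k ∈ poly d (γ + β), taylorCoef r Kn (F x - R) k x • monomial k x := by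
    have h1 : ∑ k ∈ poly d (γ + β), pointDeriv (γ + β) k (kernelInt r Kn (F x - R)) x •
        monomial k x = ∑ k ∈ poly d (γ + β), taylorCoef r Kn (F x - R) k x • monomial k x := by
      refine Finset.sum_congr rfl fun k hk => ?_
      have hk := mem_poly.1 hk
      rw [(((hN x hx).mono le_rfl le_rfl (by gcongr)).hasPointDeriv_kernelInt hK le_rfl
        ((hF x).sub hR) (by exact_mod_cast (hk.trans hm).le) hk (γ + β)).pointDeriv_eq]
    simp only [liftK]
    rw [h1, kernelInt_sub hK (hF x) hR]
    abel
  rwa [e]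

theorem IsModel.isModelled_hatf (hK : IsRegularisingKernel β m r ρ Ker Kn)
    (hP : IsModel α rP P Γ) (hc : IsCompatible r Kn α β P) (hf : IsModelled α Γ γ f)
    (hr : rP ≤ r) (hγβ : ∀ n : ℕ, γ + β ≠ n) (hm : γ + β < m) (hR : LocBdd r R)
    (hG : ∀ K : Set (Euc d), IsCompact K → ∀ S : ℝ, 1 ≤ S →
      ∃ N, 0 ≤ N ∧ ∀ x ∈ K, HomAt r γ S (germOf f P x - R) x N) :
    IsModelled (hatα d α β γ) (hatΓ r Kn α β γ P Γ) (γ + β) (hatf r Kn α β γ P f R) where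
  lt a := by
    match a with
    | .inl i => simp only [hatα]; linarith [hf.lt i]
    | .inr k => exact mem_poly.1 k.2
  measurable := by
    have hm' : ∀ i, α i + β < m := fun i => by linarith [hf.lt i]
    have hρ := hK.range_pos
    refine measurable_pi_iff.2 fun a => ?_
    match a with
    | .inl i => exact (measurable_pi_apply i).comp hf.measurable
    | .inr k =>
      have hk := mem_poly.1 k.2
      have hkm : deg k.1 ≤ m := by exact_mod_cast (hk.trans hm).le
      have hGb : ∀ x, LocBdd r (germOf f P x - R) := fun x => (hP.locBdd_germOf hr x).sub hR
      have hG1 : ∀ x, ∃ N, HomAt r γ (2 * ((1 + ρ) * 1)) (germOf f P x - R) x N := fun x =>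
        let ⟨N, _, hN⟩ := hG {x} isCompact_singleton _ (by linarith)
        ⟨N, hN x rfl⟩
      have hV : Measurable fun x =>
          pointDeriv (γ + β) k.1 (kernelInt r Kn (germOf f P x - R)) x := by
        have h := measurable_taylorCoef hK (F := fun x => germOf f P x - R) (fun φ => by
          simp only [sub_apply]
          exact (hP.isGerm_germOf hf.measurable φ).sub_const _) hGb hkm fun x =>
            let ⟨N, hN⟩ := hG1 x
            hN.summable_pot hK le_rfl (hGb x) hkm hk
        rwa [show (fun x => pointDeriv (γ + β) k.1 (kernelInt r Kn (germOf f P x - R)) x) =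
          fun x => taylorCoef r Kn (germOf f P x - R) k.1 x from funext fun x =>
            let ⟨N, hN⟩ := hG1 x
            (hN.hasPointDeriv_kernelInt hK le_rfl (hGb x) hkm hk (γ + β)).pointDeriv_eq]
      simp only [hatf]
      refine (Finset.measurable_sum _ fun j _ => ?_).sub hV
      split_ifs with hj
      · exact ((measurable_pi_apply j).comp hf.measurable).mul (hP.measurable_coefK hK hr hm' j hj)
      · exact measurable_const
  bounds K hKc := by
    have hρ := hK.range_pos
    have h1 : 1 ≤ 2 * ((1 + ρ) * 1) := by linarith
    obtain ⟨C, hC0, hC⟩ := hK.exists_hatf_const hr hf.lt hγβ hm hKc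
    obtain ⟨A, hA0, hA⟩ := hP.exists_homAt hKc h1
    obtain ⟨B, hB0, hB⟩ := hc.exists_critBd hKc
    obtain ⟨M, hM0, hM⟩ := hf.exists_modBd hKc
    obtain ⟨N, hN0, hN⟩ := hG K hKc _ h1
    exact ⟨_, hC P Γ f R A B M N hP hR hA0 hB0 hM0 hN0 hA hB hN hM⟩

end


/-! ### Continuity bounds -/

theorem IsModel.modelNorm_ne_top {d r : ℕ} {J : Type*} [Fintype J] {α : J → ℝ}
    {P : J → Euc d → Distr d} {Γ : Euc d → Euc d → J → J → ℝ} (hP : IsModel α r P Γ)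
    {K : Set (Euc d)} (hK : IsCompact K) {S : ℝ} (hS : 1 ≤ S) : modelNorm α r K S P ≠ ⊤ :=
  let ⟨_, _, hA⟩ := hP.exists_homAt hK hS
  ne_top_of_le_ne_top ENNReal.ofReal_ne_top (iSup_le fun i => homNorm_le (hA i))

theorem IsModel.homAt_toReal {d r : ℕ} {J : Type*} [Fintype J] {α : J → ℝ}
    {P : J → Euc d → Distr d} {Γ : Euc d → Euc d → J → J → ℝ} (hP : IsModel α r P Γ)
    {K : Set (Euc d)} (hK : IsCompact K) {S : ℝ} (hS : 1 ≤ S) (i : J) {x : Euc d} (hx : x ∈ K) :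
    HomAt r (α i) S (P i x) x (modelNorm α r K S P).toReal := by
  have h1 : homNorm (α i) K S r (P i) ≤ modelNorm α r K S P :=
    le_iSup (fun i => homNorm (α i) K S r (P i)) i
  have h2 := hP.modelNorm_ne_top hK hS
  exact (homAt_toReal_homNorm (ne_top_of_le_ne_top h2 h1) hx).mono (ENNReal.toReal_mono h2 h1)
    le_rfl le_rfl

/-- The real bounds `C ((1 + A + B) M + N)`, in terms of extended norms. -/
theorem ofReal_bound_le {C c A B M N : ℝ} (hC : 0 ≤ C) (hc : 0 ≤ c) (hA : 0 ≤ A) (hB : 0 ≤ B)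
    (hM : 0 ≤ M) (hN : 0 ≤ N) {A' B' M' N' : ℝ≥0∞} (hAA : ENNReal.ofReal A ≤ A')
    (hBB : ENNReal.ofReal B ≤ ENNReal.ofReal c * B') (hMM : ENNReal.ofReal M ≤ M')
    (hNN : ENNReal.ofReal N ≤ N') :
    ENNReal.ofReal (C * ((1 + A + B) * M + N)) ≤
      ((C * (1 + c)).toNNReal : ℝ≥0∞) * ((1 + A' + B') * M' + N') := by
  change _ ≤ ENNReal.ofReal (C * (1 + c)) * _
  have h1 : ENNReal.ofReal (C * ((1 + A + B) * M + N)) =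
      ENNReal.ofReal C * ((1 + ENNReal.ofReal A + ENNReal.ofReal B) * ENNReal.ofReal M +
        ENNReal.ofReal N) := by
    rw [ENNReal.ofReal_mul hC, ENNReal.ofReal_add (by positivity) hN,
      ENNReal.ofReal_mul (by positivity), ENNReal.ofReal_add (by positivity) hB,
      ENNReal.ofReal_add zero_le_one hA, ENNReal.ofReal_one]
  rw [h1, ENNReal.ofReal_mul hC, mul_assoc]
  refine mul_le_mul_right ?_ _
  have hc1 : (1 : ℝ≥0∞) ≤ ENNReal.ofReal (1 + c) := by
    rw [← ENNReal.ofReal_one]; exact ENNReal.ofReal_le_ofReal (by linarith)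
  have hc2 : ENNReal.ofReal c ≤ ENNReal.ofReal (1 + c) := ENNReal.ofReal_le_ofReal (by linarith)
  have h2 : 1 + ENNReal.ofReal A + ENNReal.ofReal B ≤ ENNReal.ofReal (1 + c) * (1 + A' + B') := by
    rw [mul_add]
    refine add_le_add ?_ (hBB.trans (mul_le_mul_left hc2 _))
    calc 1 + ENNReal.ofReal A ≤ 1 * (1 + A') := by rw [one_mul]; gcongr
      _ ≤ _ := mul_le_mul_left hc1 _
  rw [mul_add, ← mul_assoc]
  refine add_le_add (mul_le_mul' h2 hMM) (hNN.trans ?_)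
  calc N' = 1 * N' := (one_mul _).symm
    _ ≤ _ := mul_le_mul_left hc1 _

section

variable {d m r rP : ℕ} {β γ ρ : ℝ} {Ker : Euc d → Euc d → ℝ} {Kn : ℕ → Euc d → Euc d → ℝ}
  {I : Type*} [Fintype I] {α : I → ℝ}

theorem IsRegularisingKernel.exists_modelNorm_hatP_le (hK : IsRegularisingKernel β m r ρ Ker Kn)
    (hr : rP ≤ r) (hγ : ∀ i, α i < γ) (hm : γ + β < m) {K : Set (Euc d)} (hKc : IsCompact K)
    {S : ℝ} (hS : 1 ≤ S) :
    ∃ S' : ℝ, 1 ≤ S' ∧ ∃ C : ℝ≥0,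
      ∀ (P : I → Euc d → Distr d) (Γ : Euc d → Euc d → I → I → ℝ),
        IsModel α rP P Γ → IsCompatible r Kn α β P →
          modelNorm (hatα d α β γ) rP K S (hatP r Kn α β γ P) ≤
            C * (1 + modelNorm α rP K S' P + compatNorm r Kn α β rP K S' P) := by
  have hρ := hK.range_pos
  have hS' : 1 ≤ 2 * ((1 + ρ) * S) := by nlinarith
  obtain ⟨C, hC0, hC⟩ := hK.exists_hatP_const (γ := γ) (α := α) hr (fun i => by linarith [hγ i]) hKc hS
  obtain ⟨c, hc0, hc⟩ := IsCompatible.exists_critBd_le d rP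
  refine ⟨_, hS', (C * (1 + c)).toNNReal, fun P Γ hP hcomp => ?_⟩
  obtain ⟨B, hB0, hB, hBle⟩ := hc hcomp hKc hS'
  have h := hC P Γ _ B hP ENNReal.toReal_nonneg hB0 (fun i x hx => hP.homAt_toReal hKc hS' i hx) hB
  have h1 := ofReal_bound_le hC0 hc0.le ENNReal.toReal_nonneg hB0 zero_le_one le_rfl
    (ENNReal.ofReal_toReal (hP.modelNorm_ne_top hKc hS')).le hBle
    ENNReal.ofReal_one.le (ENNReal.ofReal_zero.le)
  rw [mul_one, add_zero, mul_one, add_zero] at h1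
  exact (iSup_le fun a => homNorm_le (h a)).trans h1

/-- The bound on a lifted modelled distribution, given a bound on `⟨f, P⟩ - R`. -/
theorem IsRegularisingKernel.exists_modelledNorm_hatf_le
    (hK : IsRegularisingKernel β m r ρ Ker Kn) (hr : rP ≤ r) (hγ : ∀ i, α i < γ)
    (hγβ : ∀ n : ℕ, γ + β ≠ n) (hm : γ + β < m) {K K' : Set (Euc d)} (hKc : IsCompact K)
    (hKc' : IsCompact K') (hKK : K ⊆ K') :
    ∃ C : ℝ≥0, ∀ (P : I → Euc d → Distr d) (Γ : Euc d → Euc d → I → I → ℝ) (f : Euc d → I → ℝ)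
      (R : Distr d) (N : ℝ) (N' : ℝ≥0∞), IsModel α rP P Γ → IsCompatible r Kn α β P →
      IsModelled α Γ γ f → LocBdd r R → 0 ≤ N → ENNReal.ofReal N ≤ N' →
      (∀ x ∈ K, HomAt r γ (2 * ((1 + ρ) * 1)) (germOf f P x - R) x N) →
      modelledNorm (hatα d α β γ) (hatΓ r Kn α β γ P Γ) (γ + β) K (hatf r Kn α β γ P f R) ≤
        C * ((1 + modelNorm α rP K' (2 * ((1 + ρ) * 1)) P +
          compatNorm r Kn α β rP K' (2 * ((1 + ρ) * 1)) P) * modelledNorm α Γ γ K' f + N') := by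
  have hρ := hK.range_pos
  have hS' : 1 ≤ 2 * ((1 + ρ) * 1) := by nlinarith
  obtain ⟨C, hC0, hC⟩ := hK.exists_hatf_const hr hγ hγβ hm hKc
  obtain ⟨c, hc0, hc⟩ := IsCompatible.exists_critBd_le d rP
  refine ⟨2 * (C * (1 + c)).toNNReal, fun P Γ f R N N' hP hcomp hf hR hN0 hNN hN => ?_⟩
  obtain ⟨B, hB0, hB, hBle⟩ := hc hcomp hKc' hS'
  have hM := hf.modBd_toReal hKc'
  have h := hC P Γ f R _ B _ N hP hR ENNReal.toReal_nonneg hB0 ENNReal.toReal_nonneg hN0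
    (fun i x hx => hP.homAt_toReal hKc' hS' i (hKK hx)) (fun i x hx => hB i x (hKK hx)) hN
    (fun i x hx y hy => hM i x (hKK hx) y (hKK hy))
  refine (modelledNorm_le h).trans ?_
  rw [ENNReal.coe_mul, mul_assoc]
  exact mul_le_mul_right (ofReal_bound_le hC0 hc0.le ENNReal.toReal_nonneg hB0
    ENNReal.toReal_nonneg hN0 (ENNReal.ofReal_toReal (hP.modelNorm_ne_top hKc' hS')).le hBle
    (ENNReal.ofReal_toReal (hf.modelledNorm_ne_top hKc')).le hNN) _

/-- For positive exponents, `⟨f, P⟩ - R` is bounded in terms of `f` and `P`. -/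
theorem exists_homAt_sub_le [Nonempty I] (d rP : ℕ) (hγ : ∀ i, α i < γ) (hγ0 : 0 < γ) {S : ℝ}
    (hS : 1 ≤ S) : ∃ C, 0 ≤ C ∧ ∀ (K K' : Set (Euc d)), IsCompact K' →
      (∀ x ∈ K, Metric.closedBall x (4 * (d + 1) * S) ⊆ K') →
      ∀ (P : I → Euc d → Distr d) (Γ : Euc d → Euc d → I → I → ℝ) (f : Euc d → I → ℝ)
        (R : Distr d), IsModel α rP P Γ → IsModelled α Γ γ f →
        IsReconstruction (⨅ i, α i) γ (germOf f P) R →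
        ∀ x ∈ K, HomAt rP γ S (germOf f P x - R) x
          (C * ((modelNorm α rP K' S P).toReal * (modelledNorm α Γ γ K' f).toReal)) := by
  obtain ⟨i₀, hi₀⟩ := exists_eq_ciInf_of_finite (f := α)
  have hle := iInf_le_of_finite α
  obtain ⟨C, hC0, hC⟩ := exists_reconstruction_const d rP hγ0 (a := ⨅ i, α i)
    (by rw [← hi₀]; exact (hγ i₀).le)
  refine ⟨C * Fintype.card I, by positivity, fun K K' hK' hKK P Γ f R hP hf hR => ?_⟩
  rw [mul_assoc]
  exact hC (germOf f P) R (hP.isHomogeneous_germOf hf hle) hR K K' S _ hK' hS (by positivity) hKK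
    fun x hx y hy s hs hsS => hP.scaleBd_germOf_sub hle (fun j => (hγ j).le)
      ENNReal.toReal_nonneg (fun j => hP.homAt_toReal hK' hS j hx)
      (fun j => (hf.modBd_toReal hK' j x hx y hy).2) ENNReal.toReal_nonneg hs hsS

end

end Schauder

end

/-! ### The multilevel Schauder estimates. -/

theorem theorem4p7 {d : ℕ} (hd : 0 < d) {I : Type*} [Fintype I] [Nonempty I]
    (α : I → ℝ) (β γ ρ : ℝ) (m r rP : ℕ)
    (Ker : Euc d → Euc d → ℝ) (Kn : ℕ → Euc d → Euc d → ℝ)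
    (hKer : IsRegularisingKernel β m r ρ Ker Kn)
    (hγ : ∀ i, α i < γ) (hγβ : ∀ n : ℕ, γ + β ≠ n) (hm : γ + β < m) (hr : rP ≤ r) :
    -- the new model is well defined and it is a model
    (∀ (P : I → Euc d → Distr d) (Γ : Euc d → Euc d → I → I → ℝ),
      IsModel α rP P Γ → IsCompatible r Kn α β P →
        (∀ i x, ∃ g, IsKernelInt r Kn (P i x) g) ∧
        (∀ i x, ∀ k : Fin d → ℕ, (deg k : ℝ) < α i + β →
          ∃ a, HasPointDeriv (α i + β) k (kernelInt r Kn (P i x)) x a) ∧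
        IsModel (hatα d α β γ) rP (hatP r Kn α β γ P) (hatΓ r Kn α β γ P Γ)) ∧
    -- the new modelled distribution is well defined, it is a modelled distribution, and it
    -- describes the integration of `⟨f, P⟩` and of its reconstruction
    (∀ (P : I → Euc d → Distr d) (Γ : Euc d → Euc d → I → I → ℝ) (f : Euc d → I → ℝ)
        (R : Distr d),
      IsModel α rP P Γ → IsCompatible r Kn α β P → IsModelled α Γ γ f →
      IsReconstruction (⨅ i, α i) γ (germOf f P) R → (γ ≤ 0 → ∀ i, -α i < r) →
        (∃ g, IsKernelInt r Kn R g) ∧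
        (∀ x, ∃ g, IsKernelInt r Kn (germOf f P x) g) ∧
        (∀ x, ∃ g, IsKernelInt r Kn (germOf f P x - R) g) ∧
        (∀ x, ∀ k : Fin d → ℕ, (deg k : ℝ) < γ + β →
          ∃ a, HasPointDeriv (γ + β) k (kernelInt r Kn (germOf f P x - R)) x a) ∧
        IsModelled (hatα d α β γ) (hatΓ r Kn α β γ P Γ) (γ + β) (hatf r Kn α β γ P f R) ∧
        IsGerm (germOf (hatf r Kn α β γ P f R) (hatP r Kn α β γ P)) ∧
        IsHomogeneous (⨅ a, hatα d α β γ a) rP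
          (germOf (hatf r Kn α β γ P f R) (hatP r Kn α β γ P)) ∧
        IsCoherent (⨅ a, hatα d α β γ a) (γ + β) rP
          (germOf (hatf r Kn α β γ P f R) (hatP r Kn α β γ P)) ∧
        germOf (hatf r Kn α β γ P f R) (hatP r Kn α β γ P) =
          liftK r Kn β γ (germOf f P) R ∧
        IsReconstruction (⨅ a, hatα d α β γ a) (γ + β)
          (germOf (hatf r Kn α β γ P f R) (hatP r Kn α β γ P)) (kernelInt r Kn R) ∧
        (0 < γ + β → ∀ T : Distr d,
          IsReconstruction (⨅ a, hatα d α β γ a) (γ + β)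
            (germOf (hatf r Kn α β γ P f R) (hatP r Kn α β γ P)) T → T = kernelInt r Kn R)) ∧
    -- continuity bound for the new model
    (∀ K : Set (Euc d), IsCompact K → ∀ S : ℝ, 1 ≤ S →
      ∃ K' : Set (Euc d), IsCompact K' ∧ K ⊆ K' ∧ ∃ S' : ℝ, 1 ≤ S' ∧ ∃ C : ℝ≥0,
        ∀ (P : I → Euc d → Distr d) (Γ : Euc d → Euc d → I → I → ℝ),
          IsModel α rP P Γ → IsCompatible r Kn α β P →
            modelNorm (hatα d α β γ) rP K S (hatP r Kn α β γ P) ≤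
              C * (1 + modelNorm α rP K' S' P + compatNorm r Kn α β rP K' S' P)) ∧
    -- continuity bound for the new modelled distribution, for an arbitrary reconstruction
    (∀ K : Set (Euc d), IsCompact K →
      ∃ K' : Set (Euc d), IsCompact K' ∧ K ⊆ K' ∧ ∃ S' : ℝ, 1 ≤ S' ∧ ∃ C : ℝ≥0,
        ∀ (P : I → Euc d → Distr d) (Γ : Euc d → Euc d → I → I → ℝ) (f : Euc d → I → ℝ)
            (R : Distr d),
          IsModel α rP P Γ → IsCompatible r Kn α β P → IsModelled α Γ γ f →
          IsReconstruction (⨅ i, α i) γ (germOf f P) R → (γ ≤ 0 → ∀ i, -α i < r) →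
            modelledNorm (hatα d α β γ) (hatΓ r Kn α β γ P Γ) (γ + β) K
                (hatf r Kn α β γ P f R) ≤
              C * ((1 + modelNorm α rP K' S' P + compatNorm r Kn α β rP K' S' P) *
                  modelledNorm α Γ γ K' f +
                homNorm γ K' S' r (fun x => germOf f P x - R))) ∧
    -- continuity bound for the new modelled distribution, for the unique reconstruction
    (0 < γ → ∀ K : Set (Euc d), IsCompact K →
      ∃ K' : Set (Euc d), IsCompact K' ∧ K ⊆ K' ∧ ∃ S' : ℝ, 1 ≤ S' ∧ ∃ C : ℝ≥0,
        ∀ (P : I → Euc d → Distr d) (Γ : Euc d → Euc d → I → I → ℝ) (f : Euc d → I → ℝ)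
            (R : Distr d),
          IsModel α rP P Γ → IsCompatible r Kn α β P → IsModelled α Γ γ f →
          IsReconstruction (⨅ i, α i) γ (germOf f P) R →
            modelledNorm (hatα d α β γ) (hatΓ r Kn α β γ P Γ) (γ + β) K
                (hatf r Kn α β γ P f R) ≤
              C * ((1 + modelNorm α rP K' S' P + compatNorm r Kn α β rP K' S' P) *
                  modelledNorm α Γ γ K' f)) := by
  have hm' : ∀ i, α i + β < m := fun i => by linarith [hγ i]
  have hρ := hKer.range_pos
  have hS₀ : 1 ≤ 2 * ((1 + ρ) * 1) := by linarith
  refine ⟨fun P Γ hP hc => ⟨fun i x => hKer.exists_isKernelInt (hP.locBdd hr i x),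
    fun i x k hk => ⟨_, (hP.coefK_eq hKer hr hm' i hk x).1⟩, hP.isModel_hatP hKer hc hr hγ hm⟩,
    fun P Γ f R hP hc hf hR hγr => ?_, fun K hK S hS => ?_, fun K hK => ?_, fun hγ0 K hK => ?_⟩
  · obtain ⟨hRb, hG⟩ := hP.exists_homAt_sub_reconstruction hf hR hr hγr
    have hGb : ∀ x, LocBdd r (germOf f P x - R) := fun x => (hP.locBdd_germOf hr x).sub hRb
    have hP' := hP.isModel_hatP hKer hc hr hγ hm
    have hf' := hP.isModelled_hatf hKer hc hf hr hγβ hm hRb hG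
    have hle : ∀ a, ⨅ a, hatα d α β γ a ≤ hatα d α β γ a := iInf_le_of_finite _
    have hle' : ⨅ a, hatα d α β γ a ≤ γ + β :=
      (hle (.inl (Classical.arbitrary I))).trans (hf'.lt _).le
    have hhom := hP'.isHomogeneous_germOf hf' hle
    have hcoh := hP'.isCoherent_germOf hf' hle
    have heq := hP.germOf_hatf (f := f) (R := R) hKer hr hγ
    have hrec : IsReconstruction (⨅ a, hatα d α β γ a) (γ + β)
        (germOf (hatf r Kn α β γ P f R) (hatP r Kn α β γ P)) (kernelInt r Kn R) :=
      isReconstruction_of_order hle' (hcoh.mono_order hr) fun K hK S hS => by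
        rw [heq]
        exact exists_homAt_liftK_sub hKer hγβ hm (hP.locBdd_germOf hr) hRb hG hK hS
    refine ⟨hKer.exists_isKernelInt hRb, fun x => hKer.exists_isKernelInt (hP.locBdd_germOf hr x),
      fun x => hKer.exists_isKernelInt (hGb x), fun x k hk => ?_, hf',
      hP'.isGerm_germOf hf'.measurable, hhom, hcoh, heq, hrec,
      fun h0 T hT => hrec.unique h0 hle' hhom hT⟩
    obtain ⟨N, _, hN⟩ := hG {x} isCompact_singleton _ hS₀
    exact ⟨_, (hN x rfl).hasPointDeriv_kernelInt hKer le_rfl (hGb x)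
      (by exact_mod_cast (hk.trans hm).le) hk (γ + β)⟩
  · obtain ⟨S', hS', C, hC⟩ := hKer.exists_modelNorm_hatP_le hr hγ hm hK hS
    exact ⟨K, hK, subset_rfl, S', hS', C, hC⟩
  · obtain ⟨C, hC⟩ := hKer.exists_modelledNorm_hatf_le hr hγ hγβ hm hK hK subset_rfl
    refine ⟨K, hK, subset_rfl, _, hS₀, C, fun P Γ f R hP hc hf hR hγr => ?_⟩
    obtain ⟨hRb, hG⟩ := hP.exists_homAt_sub_reconstruction hf hR hr hγr
    obtain ⟨N, _, hN⟩ := hG K hK _ hS₀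
    -- The bounds of the reconstruction at all scales make this norm finite, so its real value can
    -- serve as the constant N.
    have htop : homNorm γ K (2 * ((1 + ρ) * 1)) r (fun x => germOf f P x - R) ≠ ⊤ :=
      ne_top_of_le_ne_top ENNReal.ofReal_ne_top (homNorm_le hN)
    exact hC P Γ f R _ _ hP hc hf hRb ENNReal.toReal_nonneg (ENNReal.ofReal_toReal htop).le
      fun x hx => homAt_toReal_homNorm htop hx
  -- The sewing estimate for points of K, up to the scale 2(1 + ρ), uses the germ in balls of radius
  -- 4(d + 1) times that scale, hence the thickening.
  · have hK' : IsCompact (Metric.cthickening (4 * (d + 1) * (2 * ((1 + ρ) * 1))) K) :=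
      hK.cthickening
    have hKK : K ⊆ Metric.cthickening (4 * (d + 1) * (2 * ((1 + ρ) * 1))) K :=
      Metric.self_subset_cthickening K
    obtain ⟨C, hC⟩ := hKer.exists_modelledNorm_hatf_le hr hγ hγβ hm hK hK' hKK
    obtain ⟨C', hC'0, hC'⟩ := exists_homAt_sub_le d rP hγ hγ0 hS₀
    -- The term ⟨f, Π⟩ - R is now at most C' times the product of the norms of Π and f, which is
    -- absorbed in the first term of the bound; this is the origin of 1 + C'.
    refine ⟨_, hK', hKK, _, hS₀, C * (1 + C'.toNNReal), fun P Γ f R hP hc hf hR => ?_⟩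
    have hRb := (hP.exists_homAt_sub_reconstruction hf hR hr fun h => absurd hγ0 h.not_gt).1
    refine (hC P Γ f R _ _ hP hc hf hRb (by positivity) le_rfl fun x hx =>
      (hC' K _ hK' (fun x hx => Metric.closedBall_subset_cthickening hx _) P Γ f R hP hf hR x
        hx).mono le_rfl hr le_rfl).trans ?_
    rw [ENNReal.coe_mul, mul_assoc (C : ℝ≥0∞)]
    refine mul_le_mul' le_rfl ?_
    rw [ENNReal.ofReal_mul hC'0, ENNReal.ofReal_mul ENNReal.toReal_nonneg,
      ENNReal.ofReal_toReal (hP.modelNorm_ne_top hK' hS₀),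
      ENNReal.ofReal_toReal (hf.modelledNorm_ne_top hK'), ENNReal.coe_add, ENNReal.coe_one,
      one_add_mul (C'.toNNReal : ℝ≥0∞)]
    exact add_le_add le_rfl (mul_le_mul' le_rfl (mul_le_mul' (le_add_right le_add_self) le_rfl))
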